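/- Let $\mathcal V$ be a cartesian closed, complete and cocomplete category such that the category $\mathbf{Cat}(\mathcal V)$ of categories internal to $\mathcal V$ is cocomplete. "$\mathcal V$-category, -functor, -transformation" means internal to $\mathcal V$; formulas are written in generalized elements. **Operads.** Let $\mathcal O$ be a symmetric operad in $\mathbf{Cat}(\mathcal V)$ which is reduced, $\mathcal O(0)=*$, with structure maps $\gamma$ and unit $1\in\mathcal O(1)$. For $x\in\mathcal O(j)$, $y\in\mathcal O(k)$ put $x\circledast y=\gamma(x;y,\dots,y)\in\mathcal O(jk)$, with inputs ordered lexicographically. Let $\mathcal O$ be pseudo-commutative: it has invertible $\mathcal V$-transformations $\alpha_{j,k}(x,y)\colon (x\circledast y)\tau\to y\circledast x$ ($\tau$ interchanges the two lexicographic coordinates) such that (i) $\alpha_{1,n}(1,y)=\mathrm{id}$; (ii) $\alpha_{k,j}(y,x)\circ\alpha_{j,k}(x,y)\tau=\mathrm{id}$; (iii) $\alpha$ is equivariant in both variables; (iv) $\alpha(\gamma(x;y_1,\dots,y_k),z)$ is $\gamma(x;\alpha(y_i,z))$ followed by $\gamma(\alpha(x,z);y_i)$, up to the evident relabelling of inputs.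 **$\mathbf{Mult}(\mathcal O)$.** Objects are (strict) $\mathcal O$-algebras $(A,\theta)$, based at $0=\theta(*)$. A $k$-ary morphism $(A_1,\dots,A_k)\to B$, $k\ge 0$, is a $\mathcal V$-functor $F\colon A_1\times\cdots\times A_k\to B$ which takes the value $0$ (respectively $\mathrm{id}_0$) when one of its arguments is $0$ (respectively $\mathrm{id}_0$), with invertible $\mathcal V$-transformations $$\delta_i(c;y_1,\dots,y_n)\colon\theta(c;F(\dots,y_1,\dots),\dots,F(\dots,y_n,\dots))\to F(\dots,\theta(c;y_1,\dots,y_n),\dots)\qquad(c\in\mathcal O(n))$$ in the $i$th variable, such that $\delta_i=\mathrm{id}$ for $n=0$; $\delta_i(c\rho;y)=\delta_i(c;\rho y)$; $\delta_i(1;y)=\mathrm{id}$; $\delta_i(\gamma(c;d_1,\dots,d_n);y)$ is $\theta(c;\delta_i(d_1;y_1),\dots,\delta_i(d_n;y_n))$ followed by $\delta_i(c;\theta(d_1;y_1),\dots,\theta(d_n;y_n))$, where $y_r$ is the $r$th block of $y$; and for $i\ne j$ the two composites from $\theta(x;\theta(y;F(a_r,b_s))_s)_r$ to $F(\theta(x;a),\theta(y;b))$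 agree, namely $\delta_j$ followed by $\delta_i$, and $\alpha(x,y)$ followed by $\delta_i$ and then $\delta_j$. (So $0$-ary morphisms are objects of $B$, and $1$-ary ones are pseudomorphisms.) The composite of $F$ with $E_1,\dots,E_k$ has underlying functor $F\circ(E_1\times\cdots\times E_k)$, and its $\delta$ in the variable $(q,r)$ is $\delta_q^F$ followed by $F(\delta_r^{E_q})$; permutations act by permuting variables. The 2-cells between 1-ary morphisms are the $\mathcal V$-transformations compatible with the $\delta$'s. **The category of operators $\mathcal D$.** Let $\mathscr F$ be the category of finite based sets $\mathbf n=\{0,1,\dots,n\}$, and $\Pi\subset\mathscr F$ the maps $\phi$ with $|\phi^{-1}(j)|\le1$ for $j\ge 1$. Then $\mathcal D$ has objects $\mathbf n$ and $$\mathcal D(\mathbf m,\mathbf n)=\coprod_{\phi\colon\mathbf m\to\mathbf n}\ \prod_{1\le j\le n}\mathcal O(|\phi^{-1}(j)|),$$ with composition given by $\gamma$; it contains $\Pi$ by means of $1\in\mathcal O(1)$ and $*\in\mathcal O(0)$. The pairing $\circledast$ gives a pseudofunctor $\wedge\colon\mathcal D\wedge\mathcal D\to\mathcal D$ over the lexicographic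 smash product of $\mathscr F$; its functoriality constraints $\vartheta\colon(\bigwedge d_i)\circ(\bigwedge c_i)\to\bigwedge(d_i\circ c_i)$ and its symmetry constraints $\hat\tau$ are built from $\alpha$. **$\mathbf{Mult}(\mathcal D)$.** Objects are $\mathcal D$-algebras: based $\mathcal V$-categories $X(n)$ with strictly unital, associative and based actions $\theta\colon\mathcal D(\mathbf m,\mathbf n)\wedge X(m)\to X(n)$. A $k$-ary morphism $(X_1,\dots,X_k)\to Y$, $k\geq 0$, is a pseudotransformation from $X_1\wedge\cdots\wedge X_k$ to $Y\circ\wedge^k$ which is strict on $\Pi$: based $\mathcal V$-functors $F\colon X_1(m_1)\wedge\cdots\wedge X_k(m_k)\to Y(m_1\cdots m_k)$ and invertible based $\mathcal V$-transformations $$\delta(c;x)\colon\theta(c_1\wedge\cdots\wedge c_k;F(x_1,\dots,x_k))\to F(\theta(c_1;x_1),\dots,\theta(c_k;x_k))$$ which are the identity if all $c_i$ lie in $\Pi$, and such that $\theta(\bigwedge d_i;\delta(c;x))$ followed by $\delta(d;\theta(c;x))$ equals $\theta(\vartheta(d,c);F(x))$ followed by $\delta(d\circ c;x)$. Composition is by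 pasting; $\sigma\in\Sigma_k$ acts by permuting the $X_i$, relabelling $Y(m_1\cdots m_k)$ along the reordering of the factors, and pasting the cells $\delta$ with $\hat\tau$. The 2-cells between 1-ary morphisms are the based $\mathcal V$-transformations compatible with the $\delta$'s. **The 2-functor $\mathbb R$.** It sends an $\mathcal O$-algebra $A$ to $\mathbf n\mapsto A^n$, where the summand of $\mathcal D(\mathbf m,\mathbf n)$ indexed by $\phi$ acts by $\theta(c;x)_j=\theta_A(c_j;(x_i)_{i\in\phi^{-1}(j)})$; a pseudomorphism $(F,\partial)$ to the functors $F^n$ with the cells $\delta(c;x)_j=\partial(c_j;(x_i)_{i\in\phi^{-1}(j)})$; and a 2-cell $\omega$ to the family $\omega^n$. **Theorem.** Identities, composites and permutations of multimorphisms of $\mathbf{Mult}(\mathcal O)$, and of $\mathbf{Mult}(\mathcal D)$, are again multimorphisms; each $\mathbb RA$ is a $\mathcal D$-algebra; and the 2-functor $\mathbb R\colon\mathcal O\text{-}\mathbf{Alg_{ps}}\to\mathcal D\text{-}\mathbf{Alg_{ps}}$ extends to a symmetric multifunctor $\mathbf{Mult}(\mathcal O)\to\mathbf{Mult}(\mathcal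 D)$, that is, to a map on $k$-ary morphisms for all $k\ge0$ which preserves identities, composition and the actions of the symmetric groups, and which on objects, 1-ary morphisms and their 2-cells is $\mathbb R$. Moreover, it can be chosen so that the functors underlying the image of $F\colon(A_1,\dots,A_k)\to B$ are the composites $$A_1^{m_1}\times\cdots\times A_k^{m_k}\to(A_1\times\cdots\times A_k)^{m_1\cdots m_k}\xrightarrow{F^{m_1\cdots m_k}}B^{m_1\cdots m_k}$$ whose first map distributes coordinates lexicographically. -/

import Mathlib

open CategoryTheory CategoryTheory.Limits

universe w v u

namespace ORExt

/-! ### Internal categories -/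

/-- The two objects of `V` which make up an internal category: objects and arrows. -/
inductive Lvl
  | ob
  | mor

/-- A category internal to `V`. The object of composable pairs is the pullback of
`tgt` and `src`, and `comp` sends `(f, g)` to `f` followed by `g`. -/
structure VCat (V : Type u) [Category.{v} V] [HasFiniteLimits V] where
  car : Lvl → V
  src : car .mor ⟶ car .ob
  tgt : car .mor ⟶ car .ob
  idn : car .ob ⟶ car .mor
  comp : pullback tgt src ⟶ car .mor
  idn_src : idn ≫ src = 𝟙 _
  idn_tgt : idn ≫ tgt = 𝟙 _
  comp_src : comp ≫ src = pullback.fst _ _ ≫ src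
  comp_tgt : comp ≫ tgt = pullback.snd _ _ ≫ tgt
  id_comp : ∀ h, pullback.lift (src ≫ idn) (𝟙 _) h ≫ comp = 𝟙 _
  comp_id : ∀ h, pullback.lift (𝟙 _) (tgt ≫ idn) h ≫ comp = 𝟙 _
  assoc : ∀ (T : V) (f g k : T ⟶ car .mor) h₁ h₂ h₃ h₄,
    pullback.lift (pullback.lift f g h₁ ≫ comp) k h₂ ≫ comp =
      pullback.lift f (pullback.lift g k h₃ ≫ comp) h₄ ≫ comp

variable {V : Type u} [Category.{v} V] [HasFiniteLimits V]

namespace VCat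

/-- Generalized arrows: `f` followed by `g`. It is only used for composable arrows;
the value on other pairs is irrelevant. -/
noncomputable def seq (A : VCat V) {T : V} (f g : T ⟶ A.car .mor) : T ⟶ A.car .mor :=
  open Classical in
  if h : f ≫ A.tgt = g ≫ A.src then pullback.lift f g h ≫ A.comp else f

/-- A generalized object, regarded at level `l` (at the level of arrows: its identity). -/
def deg (A : VCat V) (l : Lvl) {T : V} (x : T ⟶ A.car .ob) : T ⟶ A.car l :=
  match l with
  | .ob => x
  | .mor => x ≫ A.idn

/-- The identity arrow of a generalized object. -/
def one (A : VCat V) {T : V} (x : T ⟶ A.car .ob) : T ⟶ A.car .mor := x ≫ A.idn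

/-- The generalized arrow `f` is invertible. -/
def Inv (A : VCat V) {T : V} (f : T ⟶ A.car .mor) : Prop :=
  ∃ g : T ⟶ A.car .mor, g ≫ A.src = f ≫ A.tgt ∧ g ≫ A.tgt = f ≫ A.src ∧
    A.seq f g = A.one (f ≫ A.src) ∧ A.seq g f = A.one (f ≫ A.tgt)

theorem seq_pos (A : VCat V) {T : V} {f g : T ⟶ A.car .mor} (h : f ≫ A.tgt = g ≫ A.src) :
    A.seq f g = pullback.lift f g h ≫ A.comp := dif_pos h

theorem lift_lift {T W X Y X' Y' W' : V} {p : X ⟶ W} {q : Y ⟶ W} {p' : X' ⟶ W'}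
    {q' : Y' ⟶ W'} (f : T ⟶ X) (g : T ⟶ Y) (h : f ≫ p = g ≫ q) (a : X ⟶ X') (b : Y ⟶ Y') (h')
    {Z : V} (c : pullback p' q' ⟶ Z) {f' : T ⟶ X'} {g' : T ⟶ Y'} (hf : f ≫ a = f')
    (hg : g ≫ b = g') :
    ∃ h'' : f' ≫ p' = g' ≫ q', pullback.lift f g h ≫
      pullback.lift (pullback.fst p q ≫ a) (pullback.snd p q ≫ b) h' ≫ c =
        pullback.lift f' g' h'' ≫ c := by
  subst hf hg
  have e := congrArg (pullback.lift f g h ≫ ·) h'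
  simp only [Category.assoc, pullback.lift_fst_assoc, pullback.lift_snd_assoc] at e
  refine ⟨by simpa using e, ?_⟩
  rw [← Category.assoc]
  congr 1
  ext <;> simp [pullback.lift_fst, pullback.lift_snd, pullback.lift_fst_assoc,
    pullback.lift_snd_assoc]

theorem id_comp' (A : VCat V) {T : V} (f : T ⟶ A.car .mor) (h) :
    pullback.lift (f ≫ A.src ≫ A.idn) f h ≫ A.comp = f := by
  have h₀ : (A.src ≫ A.idn) ≫ A.tgt = 𝟙 _ ≫ A.src := by simp [A.idn_tgt]
  have := congrArg (f ≫ ·) (A.id_comp h₀)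
  simp only [Category.comp_id] at this
  refine Eq.trans ?_ ((Category.assoc _ _ _).trans this)
  congr 1
  ext <;> simp [pullback.lift_fst, pullback.lift_snd]

theorem comp_id' (A : VCat V) {T : V} (f : T ⟶ A.car .mor) (h) :
    pullback.lift f (f ≫ A.tgt ≫ A.idn) h ≫ A.comp = f := by
  have h₀ : 𝟙 _ ≫ A.tgt = (A.tgt ≫ A.idn) ≫ A.src := by simp [A.idn_src]
  have := congrArg (f ≫ ·) (A.comp_id h₀)
  simp only [Category.comp_id] at this
  refine Eq.trans ?_ ((Category.assoc _ _ _).trans this)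
  congr 1
  ext <;> simp [pullback.lift_fst, pullback.lift_snd]

theorem pull_eq {X X' Y Y' W W' : V} {p : X ⟶ W} {q : Y ⟶ W} {p' : X' ⟶ W'}
    {q' : Y' ⟶ W'} (a : X ⟶ X') (b : Y ⟶ Y') (w : W ⟶ W') (hp : p ≫ w = a ≫ p')
    (hq : q ≫ w = b ≫ q') :
    (pullback.fst p q ≫ a) ≫ p' = (pullback.snd p q ≫ b) ≫ q' := by
  rw [Category.assoc, Category.assoc, ← hp, ← hq, ← Category.assoc, ← Category.assoc,
    pullback.condition]

/-- The product of two internal categories. -/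
noncomputable def times (A B : VCat V) : VCat V where
  car l := A.car l ⨯ B.car l
  src := prod.map A.src B.src
  tgt := prod.map A.tgt B.tgt
  idn := prod.map A.idn B.idn
  comp := prod.lift
    (pullback.lift (pullback.fst _ _ ≫ prod.fst) (pullback.snd _ _ ≫ prod.fst)
      (pull_eq _ _ prod.fst (by simp) (by simp)) ≫ A.comp)
    (pullback.lift (pullback.fst _ _ ≫ prod.snd) (pullback.snd _ _ ≫ prod.snd)
      (pull_eq _ _ prod.snd (by simp) (by simp)) ≫ B.comp)
  idn_src := by ext <;> simp [A.idn_src, B.idn_src]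
  idn_tgt := by ext <;> simp [A.idn_tgt, B.idn_tgt]
  comp_src := by
    ext <;> simp [A.comp_src, B.comp_src, pullback.lift_fst_assoc, prod.lift_fst, prod.lift_snd]
  comp_tgt := by
    ext <;> simp [A.comp_tgt, B.comp_tgt, pullback.lift_snd_assoc, prod.lift_fst, prod.lift_snd]
  id_comp h := by
    ext <;> simp only [Category.assoc, Category.id_comp, prod.lift_fst, prod.lift_snd]
    · obtain ⟨h', e⟩ := lift_lift _ _ h prod.fst prod.fst (pull_eq _ _ prod.fst (by simp) (by simp))
        A.comp (f' := prod.fst ≫ A.src ≫ A.idn) (g' := prod.fst) (by simp) (by simp)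
      rw [e, id_comp']
    · obtain ⟨h', e⟩ := lift_lift _ _ h prod.snd prod.snd (pull_eq _ _ prod.snd (by simp) (by simp))
        B.comp (f' := prod.snd ≫ B.src ≫ B.idn) (g' := prod.snd) (by simp) (by simp)
      rw [e, id_comp']
  comp_id h := by
    ext <;> simp only [Category.assoc, Category.id_comp, prod.lift_fst, prod.lift_snd]
    · obtain ⟨h', e⟩ := lift_lift _ _ h prod.fst prod.fst (pull_eq _ _ prod.fst (by simp) (by simp))
        A.comp (g' := prod.fst ≫ A.tgt ≫ A.idn) (f' := prod.fst) (by simp) (by simp)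
      rw [e, comp_id']
    · obtain ⟨h', e⟩ := lift_lift _ _ h prod.snd prod.snd (pull_eq _ _ prod.snd (by simp) (by simp))
        B.comp (g' := prod.snd ≫ B.tgt ≫ B.idn) (f' := prod.snd) (by simp) (by simp)
      rw [e, comp_id']
  assoc T f g k h₁ h₂ h₃ h₄ := by
    ext <;> simp only [Category.assoc, prod.lift_fst, prod.lift_snd]
    · obtain ⟨i₁, e₁⟩ := lift_lift _ _ h₁ prod.fst prod.fst
        (pull_eq _ _ prod.fst (by simp) (by simp)) A.comp rfl rfl
      obtain ⟨i₃, e₃⟩ := lift_lift _ _ h₃ prod.fst prod.fst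
        (pull_eq _ _ prod.fst (by simp) (by simp)) A.comp rfl rfl
      obtain ⟨i₂, e₂⟩ := lift_lift _ _ h₂ prod.fst prod.fst
        (pull_eq _ _ prod.fst (by simp) (by simp)) A.comp (by simpa [prod.lift_fst] using e₁) rfl
      obtain ⟨i₄, e₄⟩ := lift_lift _ _ h₄ prod.fst prod.fst
        (pull_eq _ _ prod.fst (by simp) (by simp)) A.comp rfl (by simpa [prod.lift_fst] using e₃)
      rw [e₂, e₄, A.assoc]
    · obtain ⟨i₁, e₁⟩ := lift_lift _ _ h₁ prod.snd prod.snd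
        (pull_eq _ _ prod.snd (by simp) (by simp)) B.comp rfl rfl
      obtain ⟨i₃, e₃⟩ := lift_lift _ _ h₃ prod.snd prod.snd
        (pull_eq _ _ prod.snd (by simp) (by simp)) B.comp rfl rfl
      obtain ⟨i₂, e₂⟩ := lift_lift _ _ h₂ prod.snd prod.snd
        (pull_eq _ _ prod.snd (by simp) (by simp)) B.comp (by simpa [prod.lift_snd] using e₁) rfl
      obtain ⟨i₄, e₄⟩ := lift_lift _ _ h₄ prod.snd prod.snd
        (pull_eq _ _ prod.snd (by simp) (by simp)) B.comp rfl (by simpa [prod.lift_snd] using e₃)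
      rw [e₂, e₄, B.assoc]

/-- The product of a finite family of internal categories. -/
noncomputable def pi {ι : Type} [Finite ι] (A : ι → VCat V) : VCat V where
  car l := ∏ᶜ fun i => (A i).car l
  src := Limits.Pi.map fun i => (A i).src
  tgt := Limits.Pi.map fun i => (A i).tgt
  idn := Limits.Pi.map fun i => (A i).idn
  comp := Limits.Pi.lift fun i =>
    pullback.lift (pullback.fst _ _ ≫ Limits.Pi.π _ i) (pullback.snd _ _ ≫ Limits.Pi.π _ i)
      (pull_eq _ _ (Limits.Pi.π _ i) (by simp) (by simp)) ≫ (A i).comp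
  idn_src := by ext; simp [(A _).idn_src]
  idn_tgt := by ext; simp [(A _).idn_tgt]
  comp_src := by ext; simp [(A _).comp_src, pullback.lift_fst_assoc]
  comp_tgt := by ext; simp [(A _).comp_tgt, pullback.lift_snd_assoc]
  id_comp h := by
    ext i; simp only [Category.assoc, Category.id_comp, Limits.Pi.lift_π]
    obtain ⟨h', e⟩ := lift_lift _ _ h (Limits.Pi.π _ i) (Limits.Pi.π _ i)
      (pull_eq _ _ (Limits.Pi.π _ i) (by simp) (by simp)) (A i).comp
      (f' := Limits.Pi.π _ i ≫ (A i).src ≫ (A i).idn) (g' := Limits.Pi.π _ i) (by simp) (by simp)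
    rw [e, id_comp']
  comp_id h := by
    ext i; simp only [Category.assoc, Category.id_comp, Limits.Pi.lift_π]
    obtain ⟨h', e⟩ := lift_lift _ _ h (Limits.Pi.π _ i) (Limits.Pi.π _ i)
      (pull_eq _ _ (Limits.Pi.π _ i) (by simp) (by simp)) (A i).comp
      (g' := Limits.Pi.π _ i ≫ (A i).tgt ≫ (A i).idn) (f' := Limits.Pi.π _ i) (by simp) (by simp)
    rw [e, comp_id']
  assoc T f g k h₁ h₂ h₃ h₄ := by
    ext i; simp only [Category.assoc, Limits.Pi.lift_π]
    obtain ⟨i₁, e₁⟩ := lift_lift _ _ h₁ (Limits.Pi.π _ i) (Limits.Pi.π _ i)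
      (pull_eq _ _ (Limits.Pi.π _ i) (by simp) (by simp)) (A i).comp rfl rfl
    obtain ⟨i₃, e₃⟩ := lift_lift _ _ h₃ (Limits.Pi.π _ i) (Limits.Pi.π _ i)
      (pull_eq _ _ (Limits.Pi.π _ i) (by simp) (by simp)) (A i).comp rfl rfl
    obtain ⟨i₂, e₂⟩ := lift_lift _ _ h₂ (Limits.Pi.π _ i) (Limits.Pi.π _ i)
      (pull_eq _ _ (Limits.Pi.π _ i) (by simp) (by simp)) (A i).comp
      (by simpa [Limits.Pi.lift_π] using e₁) rfl
    obtain ⟨i₄, e₄⟩ := lift_lift _ _ h₄ (Limits.Pi.π _ i) (Limits.Pi.π _ i)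
      (pull_eq _ _ (Limits.Pi.π _ i) (by simp) (by simp)) (A i).comp rfl
      (by simpa [Limits.Pi.lift_π] using e₃)
    rw [e₂, e₄, (A i).assoc]

/-- The projections of a product. -/
noncomputable def p₁ (A B : VCat V) (l : Lvl) : (A.times B).car l ⟶ A.car l := prod.fst

noncomputable def p₂ (A B : VCat V) (l : Lvl) : (A.times B).car l ⟶ B.car l := prod.snd

noncomputable def pk {ι : Type} [Finite ι] (A : ι → VCat V) (i : ι) (l : Lvl) :
    (pi A).car l ⟶ (A i).car l := Limits.Pi.π _ i

/-- The generalized object or arrow `(x, y)` of a product. -/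
noncomputable def pr {A B : VCat V} {l : Lvl} {T : V} (x : T ⟶ A.car l) (y : T ⟶ B.car l) :
    T ⟶ (A.times B).car l := prod.lift x y

/-- The generalized object or arrow `(x i)_i` of a product. -/
noncomputable def tup {ι : Type} [Finite ι] {A : ι → VCat V} {l : Lvl} {T : V}
    (x : ∀ i, T ⟶ (A i).car l) : T ⟶ (pi A).car l := Limits.Pi.lift x

/-- The `i`th coordinate of a generalized object or arrow of a product. -/
noncomputable def co {ι : Type} [Finite ι] {A : ι → VCat V} {l : Lvl} {T : V}
    (x : T ⟶ (pi A).car l) (i : ι) : T ⟶ (A i).car l := x ≫ pk A i l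

theorem pr_p₁ {A B : VCat V} {l : Lvl} {T : V} (x : T ⟶ A.car l) (y : T ⟶ B.car l) :
    pr x y ≫ p₁ A B l = x := prod.lift_fst _ _
theorem pr_p₂ {A B : VCat V} {l : Lvl} {T : V} (x : T ⟶ A.car l) (y : T ⟶ B.car l) :
    pr x y ≫ p₂ A B l = y := prod.lift_snd _ _
theorem tup_pr {ι : Type} [Finite ι] {A : ι → VCat V} {l : Lvl} {T : V}
    (x : ∀ i, T ⟶ (A i).car l) (i : ι) : tup x ≫ pk A i l = x i := Limits.Pi.lift_π _ _

theorem times_ext {A B : VCat V} {l : Lvl} {T : V} {x y : T ⟶ (A.times B).car l}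
    (h₁ : x ≫ p₁ A B l = y ≫ p₁ A B l) (h₂ : x ≫ p₂ A B l = y ≫ p₂ A B l) : x = y :=
  prod.hom_ext h₁ h₂
theorem pi_ext {ι : Type} [Finite ι] {A : ι → VCat V} {l : Lvl} {T : V} {x y : T ⟶ (pi A).car l}
    (h : ∀ i, x ≫ pk A i l = y ≫ pk A i l) : x = y := Limits.Pi.hom_ext _ _ h

theorem src_p₁ (A B : VCat V) : (A.times B).src ≫ p₁ A B .ob = p₁ A B .mor ≫ A.src := prod.map_fst _ _
theorem src_p₂ (A B : VCat V) : (A.times B).src ≫ p₂ A B .ob = p₂ A B .mor ≫ B.src := prod.map_snd _ _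
theorem tgt_p₁ (A B : VCat V) : (A.times B).tgt ≫ p₁ A B .ob = p₁ A B .mor ≫ A.tgt := prod.map_fst _ _
theorem tgt_p₂ (A B : VCat V) : (A.times B).tgt ≫ p₂ A B .ob = p₂ A B .mor ≫ B.tgt := prod.map_snd _ _
theorem idn_p₁ (A B : VCat V) : (A.times B).idn ≫ p₁ A B .mor = p₁ A B .ob ≫ A.idn := prod.map_fst _ _
theorem idn_p₂ (A B : VCat V) : (A.times B).idn ≫ p₂ A B .mor = p₂ A B .ob ≫ B.idn := prod.map_snd _ _
theorem src_pr {ι : Type} [Finite ι] (A : ι → VCat V) (i : ι) :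
    (pi A).src ≫ pk A i .ob = pk A i .mor ≫ (A i).src := Limits.Pi.map_π (fun i => (A i).src) i
theorem tgt_pr {ι : Type} [Finite ι] (A : ι → VCat V) (i : ι) :
    (pi A).tgt ≫ pk A i .ob = pk A i .mor ≫ (A i).tgt := Limits.Pi.map_π (fun i => (A i).tgt) i
theorem idn_pr {ι : Type} [Finite ι] (A : ι → VCat V) (i : ι) :
    (pi A).idn ≫ pk A i .mor = pk A i .ob ≫ (A i).idn := Limits.Pi.map_π (fun i => (A i).idn) i

theorem seq_p₁ (A B : VCat V) {T : V} {f g : T ⟶ (A.times B).car .mor}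
    (h : f ≫ (A.times B).tgt = g ≫ (A.times B).src) :
    (A.times B).seq f g ≫ p₁ A B .mor = A.seq (f ≫ p₁ A B .mor) (g ≫ p₁ A B .mor) := by
  obtain ⟨h', e⟩ := lift_lift f g h _ _
    (pull_eq _ _ (p₁ A B .ob) (tgt_p₁ A B) (src_p₁ A B)) A.comp rfl rfl
  rw [seq_pos _ h, seq_pos _ h', ← e, Category.assoc]
  exact congrArg (pullback.lift f g h ≫ ·) (prod.lift_fst _ _)

theorem seq_p₂ (A B : VCat V) {T : V} {f g : T ⟶ (A.times B).car .mor}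
    (h : f ≫ (A.times B).tgt = g ≫ (A.times B).src) :
    (A.times B).seq f g ≫ p₂ A B .mor = B.seq (f ≫ p₂ A B .mor) (g ≫ p₂ A B .mor) := by
  obtain ⟨h', e⟩ := lift_lift f g h _ _
    (pull_eq _ _ (p₂ A B .ob) (tgt_p₂ A B) (src_p₂ A B)) B.comp rfl rfl
  rw [seq_pos _ h, seq_pos _ h', ← e, Category.assoc]
  exact congrArg (pullback.lift f g h ≫ ·) (prod.lift_snd _ _)

theorem seq_pr {ι : Type} [Finite ι] (A : ι → VCat V) (i : ι) {T : V} {f g : T ⟶ (pi A).car .mor}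
    (h : f ≫ (pi A).tgt = g ≫ (pi A).src) :
    (pi A).seq f g ≫ pk A i .mor = (A i).seq (f ≫ pk A i .mor) (g ≫ pk A i .mor) := by
  obtain ⟨h', e⟩ := lift_lift f g h _ _
    (pull_eq _ _ (pk A i .ob) (tgt_pr A i) (src_pr A i)) (A i).comp rfl rfl
  rw [seq_pos _ h, seq_pos _ h', ← e, Category.assoc]
  exact congrArg (pullback.lift f g h ≫ ·) (Limits.Pi.lift_π _ _)

end VCat

open VCat

/-- A functor between internal categories. -/
@[ext]
structure VFun (A B : VCat V) where
  map : ∀ l, A.car l ⟶ B.car l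
  map_src : map .mor ≫ B.src = A.src ≫ map .ob
  map_tgt : map .mor ≫ B.tgt = A.tgt ≫ map .ob
  map_idn : A.idn ≫ map .mor = map .ob ≫ B.idn
  map_seq : ∀ (T : V) (f g : T ⟶ A.car .mor), f ≫ A.tgt = g ≫ A.src →
    A.seq f g ≫ map .mor = B.seq (f ≫ map .mor) (g ≫ map .mor)

namespace VFun

/-- The value of a functor on generalized objects and arrows. -/
def ap {A B : VCat V} (F : VFun A B) {l : Lvl} {T : V} (x : T ⟶ A.car l) : T ⟶ B.car l :=
  x ≫ F.map l

/-- The identity functor. -/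
def id (A : VCat V) : VFun A A where
  map l := 𝟙 _
  map_src := by simp
  map_tgt := by simp
  map_idn := by simp
  map_seq := by simp

/-- The functor `F` followed by `G`. -/
def comp {A B C : VCat V} (F : VFun A B) (G : VFun B C) : VFun A C where
  map l := F.map l ≫ G.map l
  map_src := by rw [Category.assoc, G.map_src, ← Category.assoc, F.map_src, Category.assoc]
  map_tgt := by rw [Category.assoc, G.map_tgt, ← Category.assoc, F.map_tgt, Category.assoc]
  map_idn := by rw [← Category.assoc, F.map_idn, Category.assoc, G.map_idn, Category.assoc]
  map_seq T f g h := by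
    rw [← Category.assoc, F.map_seq T f g h, G.map_seq]
    · simp
    · rw [Category.assoc, Category.assoc, F.map_src, F.map_tgt, ← Category.assoc, h, Category.assoc]

instance : Category (VCat V) where
  Hom := VFun
  id := VFun.id
  comp := VFun.comp
  id_comp F := by ext; simp [VFun.comp, VFun.id]
  comp_id F := by ext; simp [VFun.comp, VFun.id]
  assoc F G H := by ext; simp [VFun.comp]

/-- The projections of a product. -/
noncomputable def fst (A B : VCat V) : VFun (A.times B) A :=
  ⟨p₁ A B, (src_p₁ A B).symm, (tgt_p₁ A B).symm, idn_p₁ A B, fun _ _ _ => seq_p₁ A B⟩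

noncomputable def snd (A B : VCat V) : VFun (A.times B) B :=
  ⟨p₂ A B, (src_p₂ A B).symm, (tgt_p₂ A B).symm, idn_p₂ A B, fun _ _ _ => seq_p₂ A B⟩

noncomputable def proj {ι : Type} [Finite ι] (A : ι → VCat V) (i : ι) : VFun (VCat.pi A) (A i) :=
  ⟨pk A i, (src_pr A i).symm, (tgt_pr A i).symm, idn_pr A i, fun _ _ _ => seq_pr A i⟩

/-- The functor `(F, G)`. -/
noncomputable def pair {C A B : VCat V} (F : VFun C A) (G : VFun C B) : VFun C (A.times B) := by
  have hs : pr (F.map .mor) (G.map .mor) ≫ (A.times B).src = C.src ≫ pr (F.map .ob) (G.map .ob) :=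
    times_ext (by simp only [Category.assoc, src_p₁, pr_p₁, ← F.map_src]; rw [← Category.assoc, pr_p₁])
      (by simp only [Category.assoc, src_p₂, pr_p₂, ← G.map_src]; rw [← Category.assoc, pr_p₂])
  have ht : pr (F.map .mor) (G.map .mor) ≫ (A.times B).tgt = C.tgt ≫ pr (F.map .ob) (G.map .ob) :=
    times_ext (by simp only [Category.assoc, tgt_p₁, pr_p₁, ← F.map_tgt]; rw [← Category.assoc, pr_p₁])
      (by simp only [Category.assoc, tgt_p₂, pr_p₂, ← G.map_tgt]; rw [← Category.assoc, pr_p₂])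
  refine ⟨fun l => pr (F.map l) (G.map l), hs, ht, times_ext ?_ ?_, fun T f g h => ?_⟩
  · simp only [Category.assoc, idn_p₁, pr_p₁, F.map_idn]; rw [← Category.assoc, pr_p₁]
  · simp only [Category.assoc, idn_p₂, pr_p₂, G.map_idn]; rw [← Category.assoc, pr_p₂]
  · have h' : (f ≫ pr (F.map .mor) (G.map .mor)) ≫ (A.times B).tgt =
        (g ≫ pr (F.map .mor) (G.map .mor)) ≫ (A.times B).src := by
      rw [Category.assoc, Category.assoc, hs, ht, ← Category.assoc, h, Category.assoc]
    refine times_ext ?_ ?_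
    · rw [seq_p₁ _ _ h']; simp only [Category.assoc, pr_p₁]; exact F.map_seq T f g h
    · rw [seq_p₂ _ _ h']; simp only [Category.assoc, pr_p₂]; exact G.map_seq T f g h

/-- The functor `(F i)_i`. -/
noncomputable def tuple {ι : Type} [Finite ι] {C : VCat V} {A : ι → VCat V}
    (F : ∀ i, VFun C (A i)) : VFun C (VCat.pi A) := by
  have hs : tup (fun i => (F i).map .mor) ≫ (VCat.pi A).src = C.src ≫ tup (fun i => (F i).map .ob) :=
    pi_ext fun i => by
      simp only [Category.assoc, src_pr, tup_pr, ← (F i).map_src]; rw [← Category.assoc, tup_pr]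
  have ht : tup (fun i => (F i).map .mor) ≫ (VCat.pi A).tgt = C.tgt ≫ tup (fun i => (F i).map .ob) :=
    pi_ext fun i => by
      simp only [Category.assoc, tgt_pr, tup_pr, ← (F i).map_tgt]; rw [← Category.assoc, tup_pr]
  refine ⟨fun l => tup fun i => (F i).map l, hs, ht, pi_ext fun i => ?_,
    fun T f g h => pi_ext fun i => ?_⟩
  · simp only [Category.assoc, idn_pr, tup_pr, (F i).map_idn]; rw [← Category.assoc, tup_pr]
  · have h' : (f ≫ tup fun i => (F i).map .mor) ≫ (VCat.pi A).tgt =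
        (g ≫ tup fun i => (F i).map .mor) ≫ (VCat.pi A).src := by
      rw [Category.assoc, Category.assoc, hs, ht, ← Category.assoc, h, Category.assoc]
    rw [seq_pr _ _ h']; simp only [Category.assoc, tup_pr]; exact (F i).map_seq T f g h

end VFun

/-! ### Labels of inputs -/

/-- Lexicographic coordinates. -/
def dec {a b : ℕ} (i : Fin (a * b)) : Fin a × Fin b := finProdFinEquiv.symm i

/-- Interchange of the two lexicographic coordinates. -/
def flip (a b : ℕ) : Fin (a * b) ≃ Fin (b * a) :=
  finProdFinEquiv.symm.trans ((Equiv.prodComm _ _).trans finProdFinEquiv)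

/-- A bijection in each lexicographic coordinate. -/
def prodE {a b a' b' : ℕ} (e : Fin a ≃ Fin a') (f : Fin b ≃ Fin b') : Fin (a * b) ≃ Fin (a' * b') :=
  finProdFinEquiv.symm.trans ((e.prodCongr f).trans finProdFinEquiv)

/-- The label of `(s, (i, r))` is `(i, (s, r))`. -/
def lblL {n k : ℕ} {j : Fin k → ℕ} (e : Fin n ≃ Σ i, Fin (j i)) (q : ℕ) :
    Fin (q * n) ≃ Σ i, Fin (q * j i) :=
  finProdFinEquiv.symm.trans <| ((Equiv.refl (Fin q)).prodCongr e).trans <|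
    (Equiv.prodComm _ _).trans <| (Equiv.sigmaProdDistrib _ _).trans <|
      Equiv.sigmaCongrRight fun _ => (Equiv.prodComm _ _).trans finProdFinEquiv

/-- The label of `(s, (i, r))` is `((s, i), r)`. -/
def lblR {n k : ℕ} {j : Fin k → ℕ} (e : Fin n ≃ Σ i, Fin (j i)) (q : ℕ) :
    Fin (q * n) ≃ Σ p : Fin (q * k), Fin (j (dec p).2) :=
  finProdFinEquiv.symm.trans <| ((Equiv.refl (Fin q)).prodCongr e).trans <|
    Equiv.trans
      { toFun := fun x => ⟨(x.1, x.2.1), x.2.2⟩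
        invFun := fun y => (y.1.1, ⟨y.1.2, y.2⟩)
        left_inv := fun _ => rfl
        right_inv := fun _ => rfl } <|
    (Equiv.sigmaCongrLeft (β := fun y : Fin q × Fin k => Fin (j y.2)) finProdFinEquiv.symm).symm

/-! ### Operads -/

/-- The data of a reduced symmetric operad in internal categories. For `e : Fin m ≃ Fin n`
(so that `m = n`), `act e` is the right action of a permutation. -/
structure OperadData (V : Type u) [Category.{v} V] [HasFiniteLimits V] where
  O : ℕ → VCat V
  γ : ∀ {k : ℕ} (j : Fin k → ℕ), VFun ((O k).times (VCat.pi fun i => O (j i))) (O (∑ i, j i))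
  unit : ⊤_ V ⟶ (O 1).car .ob
  act : ∀ {m n : ℕ}, (Fin m ≃ Fin n) → VFun (O n) (O m)
  red : ∀ l, IsTerminal ((O 0).car l)

namespace OperadData

variable (P : OperadData V) {l : Lvl} {T : V}

/-- The unique nullary operation. -/
def star : T ⟶ (P.O 0).car l := (P.red l).from T

/-- The operadic unit. -/
noncomputable def unitP : T ⟶ (P.O 1).car l := (P.O 1).deg l (terminal.from T ≫ P.unit)

/-- The operadic composite `γ(d; c₁, …, c_k)` with inputs relabelled along `e`: its `p`th input is
the `t`th input of `c i` where `e p = (i, t)`. -/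
noncomputable def cmp {n k : ℕ} {j : Fin k → ℕ} (e : Fin n ≃ Σ i, Fin (j i))
    (d : T ⟶ (P.O k).car l) (c : ∀ i, T ⟶ (P.O (j i)).car l) : T ⟶ (P.O n).car l :=
  (P.act (e.trans finSigmaFinEquiv)).ap ((P.γ j).ap (pr d (tup c)))

/-- The pairing `x ⊛ y = γ(x; y, …, y)`, with inputs in lexicographic order. -/
noncomputable def pair {j k : ℕ} (x : T ⟶ (P.O j).car l) (y : T ⟶ (P.O k).car l) :
    T ⟶ (P.O (j * k)).car l :=
  P.cmp (finProdFinEquiv.symm.trans (Equiv.sigmaEquivProd _ _).symm) x fun _ => y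

end OperadData

/-- Reduced symmetric operads in internal categories. -/
structure Operad (V : Type u) [Category.{v} V] [HasFiniteLimits V] extends OperadData V where
  act_refl : ∀ {n : ℕ} {l : Lvl} {T : V} (c : T ⟶ (O n).car l), (act (Equiv.refl _)).ap c = c
  act_trans : ∀ {m n p : ℕ} {l : Lvl} {T : V} (f : Fin m ≃ Fin n) (e : Fin n ≃ Fin p)
    (c : T ⟶ (O p).car l), (act f).ap ((act e).ap c) = (act (f.trans e)).ap c
  cmp_act_left : ∀ {n k k' : ℕ} {j : Fin k → ℕ} {l : Lvl} {T : V} (e : Fin k' ≃ Fin k)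
    (E : Fin n ≃ Σ r, Fin (j (e r))) (d : T ⟶ (O k).car l) (c : ∀ i, T ⟶ (O (j i)).car l),
    toOperadData.cmp E ((act e).ap d) (fun r => c (e r)) =
      toOperadData.cmp (E.trans (Equiv.sigmaCongrLeft (β := fun i => Fin (j i)) e)) d c
  cmp_act_right : ∀ {n k : ℕ} {j j' : Fin k → ℕ} {l : Lvl} {T : V}
    (g : ∀ i, Fin (j' i) ≃ Fin (j i)) (E : Fin n ≃ Σ i, Fin (j' i)) (d : T ⟶ (O k).car l)
    (c : ∀ i, T ⟶ (O (j i)).car l),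
    toOperadData.cmp E d (fun i => (act (g i)).ap (c i)) =
      toOperadData.cmp (E.trans (Equiv.sigmaCongrRight g)) d c
  cmp_unit_left : ∀ {n : ℕ} {l : Lvl} {T : V} (c : T ⟶ (O n).car l),
    toOperadData.cmp (Equiv.uniqueSigma (fun _ : Fin 1 => Fin n)).symm toOperadData.unitP
      (fun _ => c) = c
  cmp_unit_right : ∀ {n : ℕ} {l : Lvl} {T : V} (c : T ⟶ (O n).car l),
    toOperadData.cmp (Equiv.sigmaUnique (Fin n) (fun _ => Fin 1)).symm c
      (fun _ => toOperadData.unitP) = c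
  cmp_assoc : ∀ {N K k : ℕ} {j n : Fin k → ℕ} {r : ∀ i, Fin (j i) → ℕ} {l : Lvl} {T : V}
    (E : Fin N ≃ Σ i, Fin (n i)) (G : ∀ i, Fin (n i) ≃ Σ t, Fin (r i t))
    (H : Fin K ≃ Σ i, Fin (j i)) (d : T ⟶ (O k).car l) (c : ∀ i, T ⟶ (O (j i)).car l)
    (b : ∀ i t, T ⟶ (O (r i t)).car l),
    toOperadData.cmp E d (fun i => toOperadData.cmp (G i) (c i) (b i)) =
      toOperadData.cmp
        (E.trans <| (Equiv.sigmaCongrRight G).trans <|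
          (Equiv.sigmaAssoc fun i t => Fin (r i t)).symm.trans
          (Equiv.sigmaCongrLeft (β := fun s : Σ i, Fin (j i) => Fin (r s.1 s.2)) H).symm)
        (toOperadData.cmp H d c) (fun p => b (H p).1 (H p).2)

/-- Pseudo-commutative structures: invertible transformations from `(x ⊛ y) τ` to `y ⊛ x`
which are unital, symmetric, equivariant and compatible with operadic composition. -/
structure PseudoComm (P : Operad V) where
  α : ∀ j k : ℕ, ((P.O j).times (P.O k)).car .ob ⟶ (P.O (k * j)).car .mor
  src : ∀ {j k : ℕ} {T : V} (x : T ⟶ (P.O j).car .ob) (y : T ⟶ (P.O k).car .ob),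
    (pr x y ≫ α j k) ≫ (P.O _).src = (P.act (flip k j)).ap (P.pair x y)
  tgt : ∀ {j k : ℕ} {T : V} (x : T ⟶ (P.O j).car .ob) (y : T ⟶ (P.O k).car .ob),
    (pr x y ≫ α j k) ≫ (P.O _).tgt = P.pair y x
  nat : ∀ {j k : ℕ} {T : V} (x : T ⟶ (P.O j).car .mor) (y : T ⟶ (P.O k).car .mor),
    (P.O (k * j)).seq ((P.act (flip k j)).ap (P.pair x y))
        (pr (x ≫ (P.O j).tgt) (y ≫ (P.O k).tgt) ≫ α j k) =
      (P.O (k * j)).seq (pr (x ≫ (P.O j).src) (y ≫ (P.O k).src) ≫ α j k) (P.pair y x)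
  inv : ∀ {j k : ℕ} {T : V} (x : T ⟶ (P.O j).car .ob) (y : T ⟶ (P.O k).car .ob),
    (P.O _).Inv (pr x y ≫ α j k)
  unit : ∀ {k : ℕ} {T : V} (y : T ⟶ (P.O k).car .ob),
    pr P.unitP y ≫ α 1 k = (P.O _).one (P.pair y P.unitP)
  symm : ∀ {j k : ℕ} {T : V} (x : T ⟶ (P.O j).car .ob) (y : T ⟶ (P.O k).car .ob),
    (P.O _).seq ((P.act (flip j k)).ap (pr x y ≫ α j k)) (pr y x ≫ α k j) =
      (P.O _).one (P.pair x y)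
  equivariant : ∀ {j k : ℕ} {T : V} (x : T ⟶ (P.O j).car .ob) (y : T ⟶ (P.O k).car .ob)
    (ρ : Fin j ≃ Fin j) (σ : Fin k ≃ Fin k),
    (P.act (prodE σ ρ)).ap (pr x y ≫ α j k) = pr ((P.act ρ).ap x) ((P.act σ).ap y) ≫ α j k
  cmp : ∀ {n k q : ℕ} {j : Fin k → ℕ} {T : V} (e : Fin n ≃ Σ i, Fin (j i))
    (x : T ⟶ (P.O k).car .ob) (y : ∀ i, T ⟶ (P.O (j i)).car .ob) (z : T ⟶ (P.O q).car .ob),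
    pr (P.cmp e x y) z ≫ α n q =
      (P.O (q * n)).seq
        (P.cmp (lblL e q) ((P.O k).one x) fun i => pr (y i) z ≫ α (j i) q)
        (P.cmp (lblR e q) (pr x z ≫ α k q) fun p => (P.O _).one (y (dec p).2))

/-- The transformation `α` on generalized objects. -/
noncomputable def PseudoComm.ap {P : Operad V} (α : PseudoComm P) {j k : ℕ} {T : V}
    (x : T ⟶ (P.O j).car .ob) (y : T ⟶ (P.O k).car .ob) : T ⟶ (P.O (k * j)).car .mor :=
  pr x y ≫ α.α j k

/-- Strict algebras over an operad. -/
structure OAlg (P : Operad V) where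
  C : VCat V
  θ : ∀ n : ℕ, VFun ((P.O n).times (VCat.pi fun _ : Fin n => C)) C
  θ_act : ∀ {m n : ℕ} {l : Lvl} {T : V} (e : Fin m ≃ Fin n) (c : T ⟶ (P.O n).car l)
    (y : Fin m → (T ⟶ C.car l)),
    (θ m).ap (pr ((P.act e).ap c) (tup y)) = (θ n).ap (pr c (tup fun i => y (e.symm i)))
  θ_unit : ∀ {l : Lvl} {T : V} (y : T ⟶ C.car l), (θ 1).ap (pr P.unitP (tup fun _ => y)) = y
  θ_cmp : ∀ {n k : ℕ} {j : Fin k → ℕ} {l : Lvl} {T : V} (e : Fin n ≃ Σ i, Fin (j i))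
    (d : T ⟶ (P.O k).car l) (c : ∀ i, T ⟶ (P.O (j i)).car l) (y : Fin n → (T ⟶ C.car l)),
    (θ n).ap (pr (P.cmp e d c) (tup y)) =
      (θ k).ap (pr d (tup fun i => (θ (j i)).ap (pr (c i) (tup fun t => y (e.symm ⟨i, t⟩)))))

namespace OAlg

variable {P : Operad V} (A : OAlg P) {l : Lvl} {T : V}

/-- The value of an operation. -/
noncomputable def op {n : ℕ} (c : T ⟶ (P.O n).car l) (y : Fin n → (T ⟶ A.C.car l)) :
    T ⟶ A.C.car l := (A.θ n).ap (pr c (tup y))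

/-- The basepoint: the value of the nullary operation. -/
noncomputable def zero : T ⟶ A.C.car l := A.op P.star Fin.elim0

end OAlg

/-! ### Multicategories and symmetric multifunctors -/

/-- Data for a symmetric multicategory: candidates `Pre` for multimorphisms `X → Y`, the condition
`IsHom` which singles out the multimorphisms, identities, composition and the right action of
permutations. In a composite, the source `X` is the concatenation of its `k` blocks
`r ↦ X (i, r)`, in lexicographic order. -/
structure PreMulti : Type (max (w + 1) (v + 1)) where
  Obj : Type w
  Pre : ∀ {k : ℕ}, (Fin k → Obj) → Obj → Type v
  IsHom : ∀ {k : ℕ} {X : Fin k → Obj} {Y : Obj}, Pre X Y → Prop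
  one : ∀ X : Obj, Pre (fun _ : Fin 1 => X) X
  comp : ∀ {k : ℕ} {j : Fin k → ℕ} {X : Fin (∑ i, j i) → Obj} {Y : Fin k → Obj} {Z : Obj},
    Pre Y Z → (∀ i, Pre (fun r => X (finSigmaFinEquiv ⟨i, r⟩)) (Y i)) → Pre X Z
  act : ∀ {k : ℕ} (σ : Equiv.Perm (Fin k)) {X : Fin k → Obj} {Y : Obj},
    Pre X Y → Pre (fun i => X (σ i)) Y

namespace PreMulti

/-- Identities, composites and permutations of multimorphisms are multimorphisms. -/
structure IsClosed (M : PreMulti) : Prop where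
  one : ∀ X, M.IsHom (M.one X)
  comp : ∀ {k : ℕ} {j : Fin k → ℕ} {X : Fin (∑ i, j i) → M.Obj} {Y : Fin k → M.Obj} {Z : M.Obj}
    (F : M.Pre Y Z) (E : ∀ i, M.Pre (fun r => X (finSigmaFinEquiv ⟨i, r⟩)) (Y i)),
    M.IsHom F → (∀ i, M.IsHom (E i)) → M.IsHom (M.comp F E)
  act : ∀ {k : ℕ} (σ : Equiv.Perm (Fin k)) {X : Fin k → M.Obj} {Y : M.Obj} (F : M.Pre X Y),
    M.IsHom F → M.IsHom (M.act σ F)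

/-- The multimorphisms from `X` to `Y`. -/
def Hom (M : PreMulti) {k : ℕ} (X : Fin k → M.Obj) (Y : M.Obj) :=
  {F : M.Pre X Y // M.IsHom F}

end PreMulti

/-- A symmetric multifunctor with prescribed values on objects. -/
structure SymmMultifunctor (M N : PreMulti) (hM : M.IsClosed) (hN : N.IsClosed)
    (obj : M.Obj → N.Obj) where
  map : ∀ {k : ℕ} {X : Fin k → M.Obj} {Y : M.Obj},
    M.Hom X Y → N.Hom (fun i => obj (X i)) (obj Y)
  map_one : ∀ X, map ⟨M.one X, hM.one X⟩ = ⟨N.one (obj X), hN.one _⟩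
  map_comp : ∀ {k : ℕ} {j : Fin k → ℕ} {X : Fin (∑ i, j i) → M.Obj} {Y : Fin k → M.Obj}
    {Z : M.Obj} (F : M.Hom Y Z) (E : ∀ i, M.Hom (fun r => X (finSigmaFinEquiv ⟨i, r⟩)) (Y i)),
    map ⟨M.comp F.1 fun i => (E i).1, hM.comp _ _ F.2 fun i => (E i).2⟩ =
      ⟨N.comp (map F).1 fun i => (map (E i)).1,
        hN.comp (X := fun p => obj (X p)) _ _ (map F).2 fun i => (map (E i)).2⟩
  map_act : ∀ {k : ℕ} (σ : Equiv.Perm (Fin k)) {X : Fin k → M.Obj} {Y : M.Obj} (F : M.Hom X Y),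
    map ⟨M.act σ F.1, hM.act σ _ F.2⟩ =
      ⟨N.act σ (X := fun i => obj (X i)) (map F).1, hN.act σ (X := fun i => obj (X i)) _ (map F).2⟩

/-! ### The multicategory of algebras over an operad -/

/-- The data of a `k`-ary morphism of algebras: a functor `F` of `k` variables, and for each `i`
and `n` a family `δ i n` of arrows of `B`, indexed by an object of `O(n)`, a list of `n` objects of
`A i`, and one object of each `A j` for `j ≠ i`. -/
@[ext]
structure PreO {P : Operad V} {k : ℕ} (A : Fin k → OAlg P) (B : OAlg P) where
  F : VFun (VCat.pi fun i => (A i).C) B.C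
  δ : ∀ (i : Fin k) (n : ℕ), ((P.O n).times ((VCat.pi fun _ : Fin n => (A i).C).times
    (VCat.pi fun j : {j // j ≠ i} => (A j.1).C))).car .ob ⟶ B.C.car .mor

namespace PreO

variable {P : Operad V} {k : ℕ} {A : Fin k → OAlg P} {B : OAlg P} {l : Lvl} {T : V}

/-- The functor `F` on generalized objects and arrows. -/
noncomputable def f (F : PreO A B) (w : ∀ i, T ⟶ (A i).C.car l) : T ⟶ B.C.car l := F.F.ap (tup w)

/-- The arrow `δ i n (c; y; w)`. The `i`th coordinate of `w` is not used. -/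
noncomputable def d (F : PreO A B) (i : Fin k) {n : ℕ} (c : T ⟶ (P.O n).car .ob)
    (y : Fin n → (T ⟶ (A i).C.car .ob)) (w : ∀ i, T ⟶ (A i).C.car .ob) : T ⟶ B.C.car .mor :=
  pr c (pr (tup y) (tup fun j : {j // j ≠ i} => w j.1)) ≫ F.δ i n

/-- A family `δ` from a formula `D` in terms of generalized objects; the `i`th coordinate of the
last argument of `D` is a dummy. -/
noncomputable def mkδ (i : Fin k) (n : ℕ)
    (D : ∀ {T : V}, (T ⟶ (P.O n).car .ob) → (Fin n → (T ⟶ (A i).C.car .ob)) →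
      (∀ i, T ⟶ (A i).C.car .ob) → (T ⟶ B.C.car .mor)) :
    ((P.O n).times ((VCat.pi fun _ : Fin n => (A i).C).times
      (VCat.pi fun j : {j // j ≠ i} => (A j.1).C))).car .ob ⟶ B.C.car .mor :=
  D (p₁ _ _ _) (co (p₂ _ _ _ ≫ p₁ _ _ _)) fun j =>
    if h : j = i then (A j).zero
    else co (A := fun j : {j // j ≠ i} => (A j.1).C) (p₂ _ _ _ ≫ p₂ _ _ _) ⟨j, h⟩

/-- The conditions on a `k`-ary morphism of algebras: `F` is based in each variable, each `δ i n` is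
an invertible transformation from `θ(c; F(…, y₁, …), …, F(…, y_n, …))` to `F(…, θ(c; y), …)`, and
the coherence axioms hold. For `k = 0` these are the objects of `B`. -/
structure IsHom (α : PseudoComm P) (F : PreO A B) : Prop where
  based : ∀ {l : Lvl} {T : V} (w : ∀ i, T ⟶ (A i).C.car l) (i : Fin k),
    w i = (A i).zero → F.f w = B.zero
  src : ∀ {T : V} (i : Fin k) {n : ℕ} (c : T ⟶ (P.O n).car .ob)
    (y : Fin n → (T ⟶ (A i).C.car .ob)) (w : ∀ i, T ⟶ (A i).C.car .ob),
    F.d i c y w ≫ B.C.src = B.op c fun r => F.f (Function.update w i (y r))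
  tgt : ∀ {T : V} (i : Fin k) {n : ℕ} (c : T ⟶ (P.O n).car .ob)
    (y : Fin n → (T ⟶ (A i).C.car .ob)) (w : ∀ i, T ⟶ (A i).C.car .ob),
    F.d i c y w ≫ B.C.tgt = F.f (Function.update w i ((A i).op c y))
  nat : ∀ {T : V} (i : Fin k) {n : ℕ} (c : T ⟶ (P.O n).car .mor)
    (y : Fin n → (T ⟶ (A i).C.car .mor)) (w : ∀ i, T ⟶ (A i).C.car .mor),
    B.C.seq (B.op c fun r => F.f (Function.update w i (y r)))
        (F.d i (c ≫ (P.O n).tgt) (fun r => y r ≫ (A i).C.tgt) fun j => w j ≫ (A j).C.tgt) =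
      B.C.seq (F.d i (c ≫ (P.O n).src) (fun r => y r ≫ (A i).C.src) fun j => w j ≫ (A j).C.src)
        (F.f (Function.update w i ((A i).op c y)))
  inv : ∀ {T : V} (i : Fin k) {n : ℕ} (c : T ⟶ (P.O n).car .ob)
    (y : Fin n → (T ⟶ (A i).C.car .ob)) (w : ∀ i, T ⟶ (A i).C.car .ob), B.C.Inv (F.d i c y w)
  -- unit object
  nullary : ∀ {T : V} (i : Fin k) (c : T ⟶ (P.O 0).car .ob)
    (y : Fin 0 → (T ⟶ (A i).C.car .ob)) (w : ∀ i, T ⟶ (A i).C.car .ob),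
    F.d i c y w = B.C.one B.zero
  -- equivariance
  equivariant : ∀ {T : V} (i : Fin k) {m n : ℕ} (e : Fin m ≃ Fin n) (c : T ⟶ (P.O n).car .ob)
    (y : Fin m → (T ⟶ (A i).C.car .ob)) (w : ∀ i, T ⟶ (A i).C.car .ob),
    F.d i ((P.act e).ap c) y w = F.d i c (fun r => y (e.symm r)) w
  -- operadic identity
  unit : ∀ {T : V} (i : Fin k) (w : ∀ i, T ⟶ (A i).C.car .ob),
    F.d i P.unitP (fun _ => w i) w = B.C.one (F.f w)
  -- operadic composition
  cmp : ∀ {T : V} (i : Fin k) {n m : ℕ} {j : Fin m → ℕ} (e : Fin n ≃ Σ r, Fin (j r))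
    (c : T ⟶ (P.O m).car .ob) (b : ∀ r, T ⟶ (P.O (j r)).car .ob)
    (y : Fin n → (T ⟶ (A i).C.car .ob)) (w : ∀ i, T ⟶ (A i).C.car .ob),
    B.C.seq
        (B.op ((P.O m).one c) fun r => F.d i (b r) (fun t => y (e.symm ⟨r, t⟩)) w)
        (F.d i c (fun r => (A i).op (b r) fun t => y (e.symm ⟨r, t⟩)) w) =
      F.d i (P.cmp e c b) y w
  -- commutation of `δ i` and `δ j`
  comm : ∀ {T : V} (i j : Fin k), i ≠ j → ∀ {m n : ℕ} (x : T ⟶ (P.O m).car .ob)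
    (y : T ⟶ (P.O n).car .ob) (a : Fin m → (T ⟶ (A i).C.car .ob))
    (b : Fin n → (T ⟶ (A j).C.car .ob)) (w : ∀ i, T ⟶ (A i).C.car .ob),
    B.C.seq
        (B.op ((P.O m).one x) fun r => F.d j y b (Function.update w i (a r)))
        (F.d i x a (Function.update w j ((A j).op y b))) =
      B.C.seq
        (B.op (α.ap x y) fun q => B.C.one
          (F.f (Function.update (Function.update w i (a (dec q).2)) j (b (dec q).1))))
        (B.C.seq
          (B.op ((P.O n).one y) fun s => F.d i x a (Function.update w j (b s)))
          (F.d j y b (Function.update w i ((A i).op x a))))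

/-- The identity of an algebra. -/
noncomputable def one (A : OAlg P) : PreO (fun _ : Fin 1 => A) A where
  F := VFun.proj _ 0
  δ i n := mkδ (A := fun _ : Fin 1 => A) i n fun c y _ => A.C.one (A.op c y)

/-- The composite of `F` with the multimorphisms `E i`. -/
noncomputable def comp {j : Fin k → ℕ} {X : Fin (∑ i, j i) → OAlg P} {Y : Fin k → OAlg P}
    {Z : OAlg P} (F : PreO Y Z) (E : ∀ i, PreO (fun r => X (finSigmaFinEquiv ⟨i, r⟩)) (Y i)) :
    PreO X Z where
  F := (VFun.tuple fun i => (VFun.tuple fun r => VFun.proj (fun p => (X p).C)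
    (finSigmaFinEquiv ⟨i, r⟩)).comp (E i).F).comp F.F
  δ p n := finSigmaFinEquiv.apply_symm_apply p ▸
    mkδ (A := X) (B := Z) (finSigmaFinEquiv (finSigmaFinEquiv.symm p)) n fun c y w =>
      let q := (finSigmaFinEquiv.symm p).1
      let r := (finSigmaFinEquiv.symm p).2
      Z.C.seq
        (F.d q c (fun s => (E q).f fun r' =>
            Function.update w (finSigmaFinEquiv ⟨q, r⟩) (y s) (finSigmaFinEquiv ⟨q, r'⟩))
          fun i => (E i).f fun r' => w (finSigmaFinEquiv ⟨i, r'⟩))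
        (F.f (Function.update (fun i => (Y i).C.one ((E i).f fun r' => w (finSigmaFinEquiv ⟨i, r'⟩)))
          q ((E q).d r c y fun r' => w (finSigmaFinEquiv ⟨q, r'⟩))))

/-- The right action of a permutation. -/
noncomputable def act (σ : Equiv.Perm (Fin k)) (F : PreO A B) : PreO (fun i => A (σ i)) B where
  F := (VFun.tuple (A := fun i => (A i).C) fun i =>
    (σ.apply_symm_apply i ▸ VFun.proj (fun i => (A (σ i)).C) (σ.symm i) :
      VFun (VCat.pi fun i => (A (σ i)).C) (A i).C)).comp F.F
  δ i n := mkδ (A := fun i => A (σ i)) i n fun {T} c y w =>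
    F.d (σ i) c y (Equiv.piCongrLeft (fun i => T ⟶ (A i).C.car .ob) σ w)

end PreO

/-- The symmetric multicategory of algebras over `P`. -/
noncomputable def MultO (P : Operad V) (α : PseudoComm P) : PreMulti where
  Obj := OAlg P
  Pre A B := PreO A B
  IsHom F := F.IsHom α
  one := PreO.one
  comp := PreO.comp
  act σ _ _ F := F.act σ

/-! ### Finite based sets -/

/-- Based maps `{0, 1, …, m} → {0, 1, …, n}`; `none` stands for the basepoint `0`. -/
abbrev FMap (m n : ℕ) := Fin m → Option (Fin n)

namespace FMap

/-- The composite `ψ ∘ φ`. -/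
def comp {m n p : ℕ} (ψ : FMap n p) (φ : FMap m n) : FMap m p := fun i => (φ i).bind ψ

/-- The number of elements of the fibre over `j`. -/
def c {m n : ℕ} (φ : FMap m n) (j : Fin n) : ℕ := Fintype.card {i // φ i = some j}

/-- The fibre over `j`, listed in increasing order. -/
def fib {m n : ℕ} (φ : FMap m n) (j : Fin n) : Fin (φ.c j) ≃ {i // φ i = some j} :=
  (Fintype.orderIsoFinOfCardEq _ rfl).toEquiv

/-- The isomorphism given by a bijection. -/
def ofEquiv {m n : ℕ} (e : Fin m ≃ Fin n) : FMap m n := fun i => some (e i)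

/-- The smash product of based maps, in lexicographic order. -/
def sm {m n p q : ℕ} (φ : FMap m n) (ψ : FMap p q) : FMap (m * p) (n * q) := fun i =>
  (φ (dec i).1).bind fun x => (ψ (dec i).2).map fun y => finProdFinEquiv (x, y)

/-- The based maps all of whose fibres, except possibly the one over the basepoint, have at most
one element. -/
def IsPi {m n : ℕ} (φ : FMap m n) : Prop := ∀ j, φ.c j ≤ 1

/-- The fibre of a composite is the union of the fibres. -/
noncomputable def compE {m n p : ℕ} (ψ : FMap n p) (φ : FMap m n) (j : Fin p) :
    Fin ((ψ.comp φ).c j) ≃ Σ r : Fin (ψ.c j), Fin (φ.c (ψ.fib j r).1) :=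
  ((ψ.comp φ).fib j).trans <|
    (Equiv.ofBijective
      (fun s : Σ x : {x // ψ x = some j}, {i // φ i = some x.1} =>
        (⟨s.2.1, by simp [comp, s.2.2, s.1.2]⟩ : {i // ψ.comp φ i = some j}))
      (by
        constructor
        · rintro ⟨⟨x, hx⟩, ⟨i, hi⟩⟩ ⟨⟨x', hx'⟩, ⟨i', hi'⟩⟩ h
          obtain rfl : i = i' := congrArg Subtype.val h
          obtain rfl : x = x' := Option.some.inj (hi.symm.trans hi')
          rfl
        · rintro ⟨i, hi⟩
          obtain ⟨x, hx, hx'⟩ := Option.bind_eq_some_iff.1 hi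
          exact ⟨⟨⟨x, hx'⟩, ⟨i, hx⟩⟩, rfl⟩)).symm.trans <|
      (Equiv.sigmaCongrLeft (β := fun x : {x // ψ x = some j} => {i // φ i = some x.1})
        (ψ.fib j)).symm.trans <|
        Equiv.sigmaCongrRight fun r => (φ.fib (ψ.fib j r).1).symm

theorem sm_eq_some {m n p q : ℕ} (φ : FMap m n) (ψ : FMap p q) (i : Fin (m * p))
    (l : Fin (n * q)) :
    sm φ ψ i = some l ↔ φ (dec i).1 = some (dec l).1 ∧ ψ (dec i).2 = some (dec l).2 := by
  obtain ⟨⟨x, y⟩, rfl⟩ := finProdFinEquiv.surjective l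
  simp only [sm, dec, Equiv.symm_apply_apply, Option.bind_eq_some_iff, Option.map_eq_some_iff,
    EmbeddingLike.apply_eq_iff_eq, Prod.mk.injEq]
  constructor
  · rintro ⟨a, h, b, h', rfl, rfl⟩
    exact ⟨h, h'⟩
  · rintro ⟨h, h'⟩
    exact ⟨x, h, y, h', rfl, rfl⟩

/-- The fibre of a smash product over `(j, k)` is the product of the fibres over `j` and `k`. -/
def smE {m n p q : ℕ} (φ : FMap m n) (ψ : FMap p q) (l : Fin (n * q)) :
    Fin ((sm φ ψ).c l) ≃ Fin (φ.c (dec l).1 * ψ.c (dec l).2) :=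
  ((sm φ ψ).fib l).trans <|
    ((finProdFinEquiv.symm.subtypeEquiv (q := fun z => φ z.1 = some (dec l).1 ∧
      ψ z.2 = some (dec l).2) fun i => sm_eq_some φ ψ i l).trans (Equiv.subtypeProdEquivProd
        (p := fun x => φ x = some (dec l).1) (q := fun y => ψ y = some (dec l).2))).trans <|
      ((φ.fib _).symm.prodCongr (ψ.fib _).symm).trans finProdFinEquiv

theorem sm_comp {m n p m' n' p' : ℕ} (ψ : FMap n p) (φ : FMap m n) (ν : FMap n' p')
    (μ : FMap m' n') : sm (ψ.comp φ) (ν.comp μ) = (sm ψ ν).comp (sm φ μ) := by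
  funext i
  rcases h : φ (dec i).1 with _ | x
  · simp [sm, comp, h]
  rcases h' : μ (dec i).2 with _ | y
  · simp [sm, comp, h, h']
  · have e : dec (finProdFinEquiv (x, y)) = (x, y) := finProdFinEquiv.symm_apply_apply _
    simp [sm, comp, h, h', e]

theorem isPi_of {m n : ℕ} {φ : FMap m n} (h : ∀ i i' j, φ i = some j → φ i' = some j → i = i') :
    φ.IsPi := fun j =>
  Fintype.card_le_one_iff_subsingleton.2 ⟨fun a b => Subtype.ext (h _ _ j a.2 b.2)⟩

theorem isPi_ofEquiv {m n : ℕ} (e : Fin m ≃ Fin n) : (ofEquiv e).IsPi :=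
  isPi_of fun _ _ _ h h' => e.injective (Option.some.inj (h.trans h'.symm))

theorem isPi_some {m : ℕ} : IsPi (some : FMap m m) := isPi_ofEquiv (Equiv.refl _)

/-- The product `m₁ ⋯ m_k`. -/
def ark : ∀ {k : ℕ}, (Fin k → ℕ) → ℕ
  | 0, _ => 1
  | _ + 1, m => m 0 * ark fun i => m i.succ

/-- The coordinates of an element of `m₁ ∧ ⋯ ∧ m_k`, in lexicographic order. -/
def crd : ∀ {k : ℕ} {m : Fin k → ℕ}, Fin (ark m) → ∀ i, Fin (m i)
  | 0, _, _ => fun i => i.elim0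
  | _ + 1, _, l => Fin.cases (dec l).1 (crd (dec l).2)

/-- The smash product of `k` based maps. -/
def smk : ∀ {k : ℕ} {m n : Fin k → ℕ}, (∀ i, FMap (m i) (n i)) → FMap (ark m) (ark n)
  | 0, _, _, _ => some
  | _ + 1, _, _, φ => sm (φ 0) (smk fun i => φ i.succ)

theorem smk_comp : ∀ {k : ℕ} {m n p : Fin k → ℕ} (ψ : ∀ i, FMap (n i) (p i))
    (φ : ∀ i, FMap (m i) (n i)), smk (fun i => (ψ i).comp (φ i)) = (smk ψ).comp (smk φ)
  | 0, _, _, _, _, _ => rfl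
  | _ + 1, _, _, _, ψ, φ =>
    (congrArg (sm _) (smk_comp (fun i => ψ i.succ) fun i => φ i.succ)).trans (sm_comp _ _ _ _)

theorem ark_eq_prod : ∀ {k : ℕ} (m : Fin k → ℕ), ark m = ∏ i, m i
  | 0, _ => rfl
  | _ + 1, m => by rw [Fin.prod_univ_succ, ark, ark_eq_prod]

/-- The product of a concatenated list is the product of the products of its blocks. -/
theorem ark_sigma {k : ℕ} {j : Fin k → ℕ} (m : Fin (∑ i, j i) → ℕ) :
    ark (fun i => ark fun r => m (finSigmaFinEquiv ⟨i, r⟩)) = ark m := by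
  simp only [ark_eq_prod]
  rw [← Equiv.prod_comp finSigmaFinEquiv, Fintype.prod_sigma]

theorem ark_one (m : Fin 1 → ℕ) : m 0 = ark m := (Nat.mul_one _).symm

/-! ### Reorderings of the factors -/

/-- The transposition of the first two of `k + 2` factors. -/
def swapF {k : ℕ} : Fin (k + 2) → Fin (k + 2) := Fin.cases 1 (Fin.cases 0 fun i => i.succ.succ)

/-- A reordering which fixes the first factor. -/
def tailF {k : ℕ} (f : Fin k → Fin k) : Fin (k + 1) → Fin (k + 1) :=
  Fin.cases 0 fun i => (f i).succ

/-- A presentation of a permutation as a composite of adjacent transpositions. -/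
inductive Braid : (k : ℕ) → (Fin k → Fin k) → Type
  | refl (k : ℕ) : Braid k _root_.id
  | swap (k : ℕ) : Braid (k + 2) swapF
  | cons {k : ℕ} {f : Fin k → Fin k} : Braid k f → Braid (k + 1) (tailF f)
  | trans {k : ℕ} {f g : Fin k → Fin k} : Braid k f → Braid k g → Braid k (f ∘ g)

/-- The coordinates `((y, x), z)` of an element of `p ∧ (m ∧ r)`. -/
def dec3 (p m r : ℕ) : Fin (p * (m * r)) ≃ (Fin p × Fin m) × Fin r :=
  finProdFinEquiv.symm.trans <|
    ((Equiv.refl _).prodCongr finProdFinEquiv.symm).trans (Equiv.prodAssoc _ _ _).symm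

/-- Interchange of the first two of three coordinates. -/
def swap3 (m p r : ℕ) : Fin (p * (m * r)) ≃ Fin (m * (p * r)) :=
  (dec3 p m r).trans <| ((Equiv.prodComm _ _).prodCongr (Equiv.refl _)).trans (dec3 m p r).symm

/-- The bijection `m_{f(1)} ∧ ⋯ ∧ m_{f(k)} → m₁ ∧ ⋯ ∧ m_k` which reorders the factors. -/
def Braid.bij : ∀ {k : ℕ} {f : Fin k → Fin k}, Braid k f → ∀ m : Fin k → ℕ,
    Fin (ark fun i => m (f i)) ≃ Fin (ark m)
  | _, _, .refl _, _ => Equiv.refl _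
  | _, _, .swap _, m => swap3 (m 0) (m 1) _
  | _, _, .cons b, m => prodE (Equiv.refl (Fin (m 0))) (b.bij fun i => m i.succ)
  | _, _, .trans (f := f) b b', m => (b'.bij fun i => m (f i)).trans (b.bij m)

theorem dec_mk {a b : ℕ} (x : Fin a × Fin b) : dec (finProdFinEquiv x) = x :=
  finProdFinEquiv.symm_apply_apply x

theorem sm_swap {m n p q r s : ℕ} (φ : FMap m n) (ψ : FMap p q) (χ : FMap r s) :
    (sm φ (sm ψ χ)).comp (ofEquiv (swap3 m p r)) =
      (ofEquiv (swap3 n q s)).comp (sm ψ (sm φ χ)) := by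
  funext i
  obtain ⟨⟨⟨y, x⟩, z⟩, rfl⟩ := (dec3 p m r).symm.surjective i
  rcases hx : φ x with _ | x' <;> rcases hy : ψ y with _ | y' <;> rcases hz : χ z with _ | z' <;>
    simp [comp, ofEquiv, sm, swap3, dec3, dec_mk, hx, hy, hz, -finProdFinEquiv_symm_apply]

theorem sm_ofEquiv {m n p q q' : ℕ} (φ : FMap m n) (ψ : FMap q p) (e : Fin q' ≃ Fin q) :
    sm φ (ψ.comp (ofEquiv e)) = (sm φ ψ).comp (ofEquiv (prodE (Equiv.refl _) e)) := by
  funext i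
  obtain ⟨⟨x, y⟩, rfl⟩ := finProdFinEquiv.surjective i
  simp [comp, ofEquiv, sm, prodE, dec_mk, -finProdFinEquiv_symm_apply]

theorem ofEquiv_sm {m n p q p' : ℕ} (φ : FMap m n) (ψ : FMap q p) (e : Fin p ≃ Fin p') :
    sm φ ((ofEquiv e).comp ψ) = (ofEquiv (prodE (Equiv.refl _) e)).comp (sm φ ψ) := by
  funext i
  rcases hx : φ (dec i).1 with _ | x <;> rcases hy : ψ (dec i).2 with _ | y <;>
    simp [comp, ofEquiv, sm, prodE, hx, hy, -finProdFinEquiv_symm_apply]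

theorem Braid.nat : ∀ {k : ℕ} {f : Fin k → Fin k} (b : Braid k f) {m n : Fin k → ℕ}
    (φ : ∀ i, FMap (m i) (n i)), (smk φ).comp (ofEquiv (b.bij m)) =
      (ofEquiv (b.bij n)).comp (smk fun i => φ (f i))
  | _, _, .refl _, _, _, φ => by
    funext i
    exact (Option.bind_fun_some (smk φ i)).symm
  | _, _, .swap _, _, _, φ => sm_swap (φ 0) (φ 1) (smk fun i => φ i.succ.succ)
  | _, _, .cons b, _, _, φ => by
    have := b.nat fun i => φ i.succ
    exact (sm_ofEquiv _ _ _).symm.trans ((congrArg (sm (φ 0)) this).trans (ofEquiv_sm _ _ _))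
  | _, _, .trans (f := f) b b', _, _, φ => by
    funext i
    have h := congrFun (b.nat φ) (b'.bij _ i)
    have h' := congrFun (b'.nat fun i => φ (f i)) i
    change smk φ (b.bij _ (b'.bij _ i)) = (smk (fun i => φ (f i)) (b'.bij _ i)).bind _ at h
    change smk (fun i => φ (f i)) (b'.bij _ i) = (smk _ i).bind _ at h'
    rw [h', Option.bind_assoc] at h
    exact h

/-- Every permutation is a composite of adjacent transpositions. -/
theorem exists_braid {k : ℕ} (σ : Equiv.Perm (Fin k)) : Nonempty (Braid k σ) := by
  cases k with
  | zero => exact ⟨(by rw [Subsingleton.elim (σ : Fin 0 → Fin 0) _root_.id]; exact .refl 0)⟩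
  | succ k =>
    have hs : ∀ {k : ℕ} (i : Fin k), Nonempty (Braid (k + 1) (Equiv.swap i.castSucc i.succ)) := by
      intro k
      induction k with
      | zero => exact fun i => i.elim0
      | succ k ih =>
        refine Fin.cases ⟨?_⟩ fun i => ⟨?_⟩
        · rw [show (Equiv.swap _ _ : Fin (k + 2) → Fin (k + 2)) = swapF from ?_]
          · exact .swap k
          · funext x
            refine Fin.cases ?_ (fun x => Fin.cases ?_ (fun x => ?_) x) x
            · simp [swapF]
            · exact Equiv.swap_apply_right _ _
            · exact Equiv.swap_apply_of_ne_of_ne (Fin.succ_ne_zero _)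
                ((Fin.succ_injective _).ne (Fin.succ_ne_zero _))
        · rw [show (Equiv.swap i.succ.castSucc i.succ.succ : Fin (k + 2) → Fin (k + 2)) =
            tailF (Equiv.swap i.castSucc i.succ) from ?_]
          · exact .cons (ih i).some
          · funext x
            refine Fin.cases ?_ (fun x => ?_) x
            · exact Equiv.swap_apply_of_ne_of_ne (fun h => Fin.succ_ne_zero i.castSucc h.symm)
                (Fin.succ_ne_zero _).symm
            · exact (Fin.succ_injective _).swap_apply i.castSucc i.succ x
    have : σ ∈ Submonoid.closure (Set.range fun i : Fin k => Equiv.swap i.castSucc i.succ) := by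
      rw [Equiv.Perm.mclosure_swap_castSucc_succ]; trivial
    induction this using Submonoid.closure_induction with
    | mem x hx => obtain ⟨i, rfl⟩ := hx; exact hs i
    | one => exact ⟨.refl _⟩
    | mul x y _ _ hx hy => exact ⟨hx.some.trans hy.some⟩

end FMap

open FMap

/-- The constant functor at an object. -/
noncomputable def VFun.const {C A : VCat V} (a : ⊤_ V ⟶ A.car .ob) : VFun C A where
  map l := A.deg l (terminal.from _ ≫ a)
  map_src := by
    simp only [VCat.deg, Category.assoc, A.idn_src, Category.comp_id]
    rw [← Category.assoc, Subsingleton.elim (C.src ≫ terminal.from _) (terminal.from _)]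
  map_tgt := by
    simp only [VCat.deg, Category.assoc, A.idn_tgt, Category.comp_id]
    rw [← Category.assoc, Subsingleton.elim (C.tgt ≫ terminal.from _) (terminal.from _)]
  map_idn := by
    simp only [VCat.deg, ← Category.assoc]
    rw [Subsingleton.elim (C.idn ≫ terminal.from _) (terminal.from _)]
  map_seq T f g h := by
    simp only [VCat.deg, ← Category.assoc]
    rw [Subsingleton.elim (C.seq f g ≫ terminal.from _) (terminal.from T),
      Subsingleton.elim (f ≫ terminal.from _) (terminal.from T),
      Subsingleton.elim (g ≫ terminal.from _) (terminal.from T)]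
    have e := A.comp_id' ((terminal.from T ≫ a) ≫ A.idn)
      (by simp [A.idn_src, A.idn_tgt])
    rw [seq_pos A (by simp [A.idn_src, A.idn_tgt])]
    refine e.symm.trans ?_
    congr 2
    simp [← Category.assoc A.idn A.tgt, A.idn_tgt]

/-! ### The category of operators associated with an operad

The `V`-category of morphisms `m → n` of the category of operators `D` of `P` is the coproduct, over
all based maps `φ : m → n`, of `∏ⱼ P(|φ⁻¹(j)|)`. Since products distribute over coproducts, functors
and transformations out of products of such coproducts are families indexed by based maps, and this
is how they are recorded below. -/

/-- The summand of `D(m, n)` indexed by `φ`. -/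
noncomputable def Operad.D (P : Operad V) {m n : ℕ} (φ : FMap m n) : VCat V :=
  VCat.pi fun j => P.O (φ.c j)

/-- Generalized objects and arrows of the summand of `D(m, n)` indexed by `φ`. -/
def DPt (P : Operad V) (l : Lvl) (T : V) {m n : ℕ} (φ : FMap m n) :=
  ∀ j, T ⟶ (P.O (φ.c j)).car l

/-- The nullary operation or the unit. -/
noncomputable def Operad.low (P : Operad V) : ∀ n : ℕ, n ≤ 1 → (⊤_ V ⟶ (P.O n).car .ob)
  | 0, _ => P.star
  | 1, _ => P.unit
  | _ + 2, h => absurd h (by omega)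

namespace DPt

variable {P : Operad V} {l : Lvl} {T : V} {m n p q r s : ℕ}

/-- Transport along an equality of indices. -/
def cast {φ φ' : FMap m n} (h : φ = φ') (c : DPt P l T φ) : DPt P l T φ' := h ▸ c

/-- The inclusion of `Π` into `D`. -/
noncomputable def iota (φ : FMap m n) (h : φ.IsPi) : DPt P l T φ :=
  fun j => (P.O _).deg l (terminal.from T ≫ P.low _ (h j))

/-- Identity arrows. -/
def one {φ : FMap m n} (c : DPt P .ob T φ) : DPt P .mor T φ := fun j => (P.O _).one (c j)

/-- Composition of arrows. -/
noncomputable def seq {φ : FMap m n} (f g : DPt P .mor T φ) : DPt P .mor T φ :=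
  fun j => (P.O _).seq (f j) (g j)

/-- Composition in `D`. -/
noncomputable def comp {ψ : FMap n p} {φ : FMap m n} (d : DPt P l T ψ) (c : DPt P l T φ) :
    DPt P l T (ψ.comp φ) :=
  fun j => P.cmp (compE ψ φ j) (d j) fun r => c (ψ.fib j r).1

/-- The smash product on `D`, given by the pairing of the operad. -/
noncomputable def sm {φ : FMap m n} {ψ : FMap p q} (c : DPt P l T φ) (d : DPt P l T ψ) :
    DPt P l T (φ.sm ψ) :=
  fun i => (P.act (smE φ ψ i)).ap (P.pair (c (dec i).1) (d (dec i).2))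

/-- The `k`-fold smash product on `D`. -/
noncomputable def smk : ∀ {k : ℕ} {m n : Fin k → ℕ} {φ : ∀ i, FMap (m i) (n i)},
    (∀ i, DPt P l T (φ i)) → DPt P l T (FMap.smk φ)
  | 0, _, _, _, _ => iota some isPi_some
  | _ + 1, _, _, _, c => (c 0).sm (smk fun i => c i.succ)

variable (α : PseudoComm P)

/-- The pseudofunctoriality constraint `(d ∧ a) ∘ (c ∧ b) → (d ∘ c) ∧ (a ∘ b)` of the smash
product. In each coordinate it interchanges `a` with the components of `c`. -/
noncomputable def theta {ψ : FMap n p} {φ : FMap m n} {ν : FMap r s} {μ : FMap q r}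
    (d : DPt P .ob T ψ) (a : DPt P .ob T ν) (c : DPt P .ob T φ) (b : DPt P .ob T μ) :
    DPt P .mor T ((ψ.comp φ).sm (ν.comp μ)) := fun i =>
  P.cmp
    ((smE _ _ i).trans <| finProdFinEquiv.symm.trans <|
      ((compE ψ φ (dec i).1).prodCongr (Equiv.refl _)).trans <|
        (Equiv.sigmaProdDistrib _ _).trans <| Equiv.sigmaCongrRight fun _ => finProdFinEquiv)
    ((P.O _).one (d (dec i).1)) fun x =>
      P.cmp (lblR (compE ν μ (dec i).2) _) (α.ap (a (dec i).2) (c (ψ.fib _ x).1))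
        fun y => (P.O _).one (b (ν.fib _ (dec y).2).1)

/-- The pseudofunctoriality constraint of the `k`-fold smash product, from
`(⋀ d i) ∘ (⋀ c i)` to `⋀ (d i ∘ c i)`. -/
noncomputable def thetak : ∀ {k : ℕ} {m n p : Fin k → ℕ} {ψ : ∀ i, FMap (n i) (p i)}
    {φ : ∀ i, FMap (m i) (n i)}, (∀ i, DPt P .ob T (ψ i)) → (∀ i, DPt P .ob T (φ i)) →
    DPt P .mor T (FMap.smk fun i => (ψ i).comp (φ i))
  | 0, _, _, _, _, _, _, _ => iota some isPi_some
  | _ + 1, _, _, _, ψ, φ, d, c =>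
    seq (φ := FMap.sm ((ψ 0).comp (φ 0)) (FMap.smk fun i => (ψ i.succ).comp (φ i.succ)))
      (cast (congrArg (FMap.sm ((ψ 0).comp (φ 0)))
          (smk_comp (fun i => ψ i.succ) fun i => φ i.succ).symm)
        (theta α (d 0) (smk fun i => d i.succ) (c 0) (smk fun i => c i.succ)))
      (((d 0).comp (c 0)).one.sm (thetak (fun i => d i.succ) fun i => c i.succ))

/-- The coordinates of the fibre of a reordered triple smash product. -/
def swapE (φ : FMap m n) (ψ : FMap p q) (χ : FMap r s) (i : Fin (n * (q * s))) :
    Fin (((φ.sm (ψ.sm χ)).comp (ofEquiv (swap3 m p r))).c i) ≃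
      Fin (ψ.c (dec (dec i).2).1 * φ.c (dec i).1 * χ.c (dec (dec i).2).2) :=
  (fib _ i).trans <|
    (((dec3 p m r).subtypeEquiv (q := fun z => (ψ z.1.1 = some (dec (dec i).2).1 ∧
        φ z.1.2 = some (dec i).1) ∧ χ z.2 = some (dec (dec i).2).2) fun z => by
      obtain ⟨⟨⟨y, x⟩, z⟩, rfl⟩ := (dec3 p m r).symm.surjective z
      rw [Equiv.apply_symm_apply]
      change φ.sm (ψ.sm χ) (swap3 m p r _) = _ ↔ _
      simp only [sm_eq_some, swap3, Equiv.trans_apply, Equiv.apply_symm_apply]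
      simp only [dec3, dec_mk, Equiv.symm_trans_apply, Equiv.symm_symm, Equiv.prodCongr_symm,
        Equiv.prodCongr_apply, Equiv.refl_symm, Equiv.prodAssoc_apply, Prod.map, Equiv.refl_apply,
        Equiv.prodComm_apply, Prod.swap]
      tauto).trans <|
      (Equiv.subtypeProdEquivProd (p := fun z : Fin p × Fin m => ψ z.1 = some (dec (dec i).2).1 ∧
        φ z.2 = some (dec i).1) (q := fun z => χ z = some (dec (dec i).2).2)).trans <|
      (Equiv.subtypeProdEquivProd (p := fun z => ψ z = some (dec (dec i).2).1)
        (q := fun z => φ z = some (dec i).1)).prodCongr (Equiv.refl _)).trans <|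
    ((((ψ.fib _).symm.prodCongr (φ.fib _).symm).trans finProdFinEquiv).prodCongr
      (χ.fib _).symm).trans finProdFinEquiv

/-- The pseudonaturality constraint of a reordering `κ` of the factors of the `k`-fold smash
product, from `(⋀ c i) ∘ κ` to `κ ∘ ⋀ c (f i)`. -/
noncomputable def cell : ∀ {k : ℕ} {f : Fin k → Fin k} (b : Braid k f) {m n : Fin k → ℕ}
    {φ : ∀ i, FMap (m i) (n i)}, (∀ i, DPt P .ob T (φ i)) →
    DPt P .mor T ((FMap.smk φ).comp (ofEquiv (b.bij m)))
  | _, _, .refl _, _, _, _, c => (smk c).one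
  | _, _, .swap _, _, _, φ, c => fun i =>
    (P.act (swapE (φ 0) (φ 1) (FMap.smk fun i => φ i.succ.succ) i)).ap
      (P.pair (α.ap (c 0 (dec i).1) (c 1 (dec (dec i).2).1))
        ((smk fun i => c i.succ.succ).one (dec (dec i).2).2))
  | _, _, .cons b, _, _, _, c =>
    cast (sm_ofEquiv _ _ _) ((c 0).one.sm (cell b fun i => c i.succ))
  | _, _, .trans (f := f) b b', m, n, φ, c =>
    seq (φ := (FMap.smk φ).comp (ofEquiv ((b.trans b').bij m)))
      ((cell b c).comp (iota (ofEquiv (b'.bij fun i => m (f i))) (isPi_ofEquiv _)))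
      (cast (congrArg (fun χ => χ.comp (ofEquiv (b'.bij fun i => m (f i)))) (b.nat φ)).symm
        ((iota (ofEquiv (b.bij n)) (isPi_ofEquiv _)).comp (cell b' fun i => c (f i))))

end DPt

/-! ### The multicategory of algebras over the category of operators -/

/-- The data of an algebra over `D`: based internal categories `X n` and action functors
`D(m, n) × X m → X n`, given on each summand of `D(m, n)`. -/
structure DAlgData (P : Operad V) where
  X : ℕ → VCat V
  base : ∀ n, ⊤_ V ⟶ (X n).car .ob
  θ : ∀ {m n : ℕ} (φ : FMap m n), VFun ((P.D φ).times (X m)) (X n)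

namespace DAlgData

variable {P : Operad V} (X : DAlgData P) {l : Lvl} {T : V}

/-- The action on generalized objects and arrows. -/
noncomputable def op {m n : ℕ} (φ : FMap m n) (c : DPt P l T φ) (x : T ⟶ (X.X m).car l) :
    T ⟶ (X.X n).car l := (X.θ φ).ap (pr (A := P.D φ) (tup c) x)

/-- The basepoint of `X n`. -/
noncomputable def zero {n : ℕ} : T ⟶ (X.X n).car l := (X.X n).deg l (terminal.from T ≫ X.base n)

/-- The isomorphism `X m ≅ X n` given by a bijection. -/
noncomputable def rel {m n : ℕ} (e : Fin m ≃ Fin n) : VFun (X.X m) (X.X n) :=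
  (VFun.pair (B := X.X m)
    (VFun.tuple fun j => VFun.const (P.low _ (isPi_ofEquiv e j)) : VFun _ (P.D (ofEquiv e)))
    (VFun.id _)).comp (X.θ (ofEquiv e))

/-- The laws of a strict algebra over `D`: the action passes to smash products, and it is unital and
associative. -/
structure IsAlgebra : Prop where
  base_right : ∀ {l : Lvl} {T : V} {m n : ℕ} (φ : FMap m n) (c : DPt P l T φ),
    X.op φ c X.zero = X.zero
  base_left : ∀ {l : Lvl} {T : V} {m n : ℕ} (c : DPt P l T (fun _ : Fin m => (none : Option (Fin n))))
    (x : T ⟶ (X.X m).car l), X.op _ c x = X.zero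
  id : ∀ {l : Lvl} {T : V} {m : ℕ} (x : T ⟶ (X.X m).car l),
    X.op some (DPt.iota some isPi_some) x = x
  comp : ∀ {l : Lvl} {T : V} {m n p : ℕ} (ψ : FMap n p) (φ : FMap m n) (d : DPt P l T ψ)
    (c : DPt P l T φ) (x : T ⟶ (X.X m).car l),
    X.op (ψ.comp φ) (d.comp c) x = X.op ψ d (X.op φ c x)

end DAlgData

/-- Strict algebras over the category of operators of `P`. -/
structure DAlg (P : Operad V) extends DAlgData P where
  isAlgebra : toDAlgData.IsAlgebra

/-- The data of a `k`-ary morphism of `D`-algebras: functors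
`X₁(m₁) × ⋯ × X_k(m_k) → Y(m₁ ⋯ m_k)`, and families of arrows of `Y(n₁ ⋯ n_k)` indexed by objects of
the `D(mᵢ, nᵢ)` and of the `Xᵢ(mᵢ)`. -/
@[ext]
structure PreD {P : Operad V} {k : ℕ} (X : Fin k → DAlg P) (Y : DAlg P) where
  F : ∀ m : Fin k → ℕ, VFun (VCat.pi fun i => (X i).X (m i)) (Y.X (ark m))
  δ : ∀ {m n : Fin k → ℕ} (φ : ∀ i, FMap (m i) (n i)),
    ((VCat.pi fun i => P.D (φ i)).times (VCat.pi fun i => (X i).X (m i))).car .ob ⟶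
      (Y.X (ark n)).car .mor

namespace PreD

variable {P : Operad V} {k : ℕ} {X : Fin k → DAlg P} {Y : DAlg P} {l : Lvl} {T : V}

/-- The functors `F` on generalized objects and arrows. -/
noncomputable def f (F : PreD X Y) {m : Fin k → ℕ} (x : ∀ i, T ⟶ ((X i).X (m i)).car l) :
    T ⟶ (Y.X (ark m)).car l := (F.F m).ap (tup x)

/-- The arrow `δ (c; x)`. -/
noncomputable def d (F : PreD X Y) {m n : Fin k → ℕ} (φ : ∀ i, FMap (m i) (n i))
    (c : ∀ i, DPt P .ob T (φ i)) (x : ∀ i, T ⟶ ((X i).X (m i)).car .ob) :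
    T ⟶ (Y.X (ark n)).car .mor :=
  pr (A := VCat.pi fun i => P.D (φ i)) (tup fun i => (tup (c i) : T ⟶ (P.D (φ i)).car .ob)) (tup x) ≫
    F.δ φ

/-- A family `δ` from a formula in terms of generalized objects. -/
noncomputable def mkδ {m n : Fin k → ℕ} (φ : ∀ i, FMap (m i) (n i))
    (D : ∀ {T : V}, (∀ i, DPt P .ob T (φ i)) → (∀ i, T ⟶ ((X i).X (m i)).car .ob) →
      (T ⟶ (Y.X (ark n)).car .mor)) :
    ((VCat.pi fun i => P.D (φ i)).times (VCat.pi fun i => (X i).X (m i))).car .ob ⟶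
      (Y.X (ark n)).car .mor :=
  D (fun i j => co (A := fun j => P.O ((φ i).c j)) (co (A := fun i => P.D (φ i)) (p₁ _ _ _) i) j)
    (co (A := fun i => (X i).X (m i)) (p₂ _ _ _))

/-- The conditions on a `k`-ary morphism of `D`-algebras, that is, on a pseudotransformation from
`X₁ ∧ ⋯ ∧ X_k` to `Y ∘ ⋀` which is strict on `Π`. The functors `F` and the transformations `δ` pass
to smash products, and `δ` is an invertible transformation from `θ(⋀ c; F x)` to `F(θ(c₁; x₁), …)`
which is the identity on `Π` and compatible with composition. -/
structure IsHom (α : PseudoComm P) (F : PreD X Y) : Prop where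
  based : ∀ {l : Lvl} {T : V} {m : Fin k → ℕ} (x : ∀ i, T ⟶ ((X i).X (m i)).car l) (i : Fin k),
    x i = (X i).zero → F.f x = Y.zero
  src : ∀ {T : V} {m n : Fin k → ℕ} (φ : ∀ i, FMap (m i) (n i)) (c : ∀ i, DPt P .ob T (φ i))
    (x : ∀ i, T ⟶ ((X i).X (m i)).car .ob),
    F.d φ c x ≫ (Y.X _).src = Y.op (FMap.smk φ) (DPt.smk c) (F.f x)
  tgt : ∀ {T : V} {m n : Fin k → ℕ} (φ : ∀ i, FMap (m i) (n i)) (c : ∀ i, DPt P .ob T (φ i))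
    (x : ∀ i, T ⟶ ((X i).X (m i)).car .ob),
    F.d φ c x ≫ (Y.X _).tgt = F.f fun i => (X i).op (φ i) (c i) (x i)
  nat : ∀ {T : V} {m n : Fin k → ℕ} (φ : ∀ i, FMap (m i) (n i)) (c : ∀ i, DPt P .mor T (φ i))
    (x : ∀ i, T ⟶ ((X i).X (m i)).car .mor),
    (Y.X _).seq (Y.op (FMap.smk φ) (DPt.smk c) (F.f x))
        (F.d φ (fun i j => c i j ≫ (P.O _).tgt) fun i => x i ≫ ((X i).X (m i)).tgt) =
      (Y.X _).seq (F.d φ (fun i j => c i j ≫ (P.O _).src) fun i => x i ≫ ((X i).X (m i)).src)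
        (F.f fun i => (X i).op (φ i) (c i) (x i))
  inv : ∀ {T : V} {m n : Fin k → ℕ} (φ : ∀ i, FMap (m i) (n i)) (c : ∀ i, DPt P .ob T (φ i))
    (x : ∀ i, T ⟶ ((X i).X (m i)).car .ob), (Y.X _).Inv (F.d φ c x)
  base_right : ∀ {T : V} {m n : Fin k → ℕ} (φ : ∀ i, FMap (m i) (n i)) (c : ∀ i, DPt P .ob T (φ i))
    (x : ∀ i, T ⟶ ((X i).X (m i)).car .ob) (i : Fin k),
    x i = (X i).zero → F.d φ c x = (Y.X _).one Y.zero
  base_left : ∀ {T : V} {m n : Fin k → ℕ} (φ : ∀ i, FMap (m i) (n i)) (c : ∀ i, DPt P .ob T (φ i))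
    (x : ∀ i, T ⟶ ((X i).X (m i)).car .ob) (i : Fin k),
    φ i = (fun _ => none) → F.d φ c x = (Y.X _).one Y.zero
  strict : ∀ {T : V} {m n : Fin k → ℕ} (φ : ∀ i, FMap (m i) (n i)) (h : ∀ i, (φ i).IsPi)
    (x : ∀ i, T ⟶ ((X i).X (m i)).car .ob),
    F.d φ (fun i => DPt.iota (φ i) (h i)) x =
      (Y.X _).one (F.f fun i => (X i).op (φ i) (DPt.iota (φ i) (h i)) (x i))
  comp : ∀ {T : V} {m n p : Fin k → ℕ} (ψ : ∀ i, FMap (n i) (p i)) (φ : ∀ i, FMap (m i) (n i))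
    (d : ∀ i, DPt P .ob T (ψ i)) (c : ∀ i, DPt P .ob T (φ i))
    (x : ∀ i, T ⟶ ((X i).X (m i)).car .ob),
    (Y.X _).seq
        (Y.op (FMap.smk ψ) (DPt.smk d).one (F.d φ c x))
        (F.d ψ d fun i => (X i).op (φ i) (c i) (x i)) =
      (Y.X _).seq
        (Y.op (FMap.smk fun i => (ψ i).comp (φ i)) (DPt.thetak α d c) ((Y.X _).one (F.f x)))
        (F.d (fun i => (ψ i).comp (φ i)) (fun i => (d i).comp (c i)) x)

/-- The identity of a `D`-algebra. -/
noncomputable def one (X : DAlg P) : PreD (fun _ : Fin 1 => X) X where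
  F m := (VFun.proj _ 0).comp (X.rel (finCongr (ark_one m)))
  δ {_ n} φ := mkδ (X := fun _ : Fin 1 => X) φ fun c x =>
    (X.X _).one ((X.rel (finCongr (ark_one n))).ap (X.op (φ 0) (c 0) (x 0)))

/-- The composite of `F` with the multimorphisms `E i`. -/
noncomputable def comp {j : Fin k → ℕ} {X : Fin (∑ i, j i) → DAlg P} {Y : Fin k → DAlg P}
    {Z : DAlg P} (F : PreD Y Z) (E : ∀ i, PreD (fun r => X (finSigmaFinEquiv ⟨i, r⟩)) (Y i)) :
    PreD X Z where
  F m := ((VFun.tuple fun i => (VFun.tuple fun r => VFun.proj (fun p => (X p).X (m p))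
    (finSigmaFinEquiv ⟨i, r⟩)).comp ((E i).F fun r => m (finSigmaFinEquiv ⟨i, r⟩))).comp
      (F.F fun i => ark fun r => m (finSigmaFinEquiv ⟨i, r⟩))).comp (Z.rel (finCongr (ark_sigma m)))
  δ {_ n} φ := mkδ (Y := Z) φ fun c x =>
    (Z.rel (finCongr (ark_sigma n))).ap <| (Z.X _).seq
      (F.d (fun i => FMap.smk fun r => φ (finSigmaFinEquiv ⟨i, r⟩))
        (fun i => DPt.smk fun r => c (finSigmaFinEquiv ⟨i, r⟩))
        fun i => (E i).f fun r => x (finSigmaFinEquiv ⟨i, r⟩))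
      (F.f fun i => (E i).d (fun r => φ (finSigmaFinEquiv ⟨i, r⟩))
        (fun r => c (finSigmaFinEquiv ⟨i, r⟩)) fun r => x (finSigmaFinEquiv ⟨i, r⟩))

/-- A presentation of `σ⁻¹` by adjacent transpositions. -/
noncomputable def braid (σ : Equiv.Perm (Fin k)) : Braid k σ.symm := (exists_braid σ.symm).some

/-- The right action of a permutation. -/
noncomputable def act (α : PseudoComm P) (σ : Equiv.Perm (Fin k)) (F : PreD X Y) :
    PreD (fun i => X (σ i)) Y where
  F m := ((VFun.tuple (A := fun i => (X i).X (m (σ.symm i))) fun i =>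
    (Eq.rec (motive := fun i' _ => VFun (VCat.pi fun i => (X (σ i)).X (m i))
        ((X i').X (m (σ.symm i))))
      (VFun.proj (fun i => (X (σ i)).X (m i)) (σ.symm i)) (σ.apply_symm_apply i))).comp
    (F.F fun i => m (σ.symm i))).comp (Y.rel ((braid σ).bij m))
  δ {m n} φ := mkδ (X := fun i => X (σ i)) (Y := Y) φ fun {T} c x =>
    let x' : ∀ i, T ⟶ ((X i).X (m (σ.symm i))).car .ob := fun i =>
      Eq.rec (motive := fun i' _ => T ⟶ ((X i').X (m (σ.symm i))).car .ob) (x (σ.symm i))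
        (σ.apply_symm_apply i)
    (Y.X _).seq
      (Y.op ((FMap.smk φ).comp (ofEquiv ((braid σ).bij m))) (DPt.cell α (braid σ) c)
        ((Y.X _).one (F.f x')))
      ((Y.rel ((braid σ).bij n)).ap
        (F.d (fun i => φ (σ.symm i)) (fun i => c (σ.symm i)) x'))

end PreD

/-- The symmetric multicategory of algebras over the category of operators of `P`. -/
noncomputable def MultD (P : Operad V) (α : PseudoComm P) : PreMulti where
  Obj := DAlg P
  Pre X Y := PreD X Y
  IsHom F := F.IsHom α
  one := PreD.one
  comp := PreD.comp
  act σ _ _ F := F.act α σ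

/-! ### The 2-functor from `P`-algebras to `D`-algebras -/

/-- The `D`-algebra `n ↦ Aⁿ`. The summand of `D(m, n)` indexed by `φ` acts by the product of the
actions of the `P(|φ⁻¹(j)|)` on the coordinates in `φ⁻¹(j)`, in increasing order. -/
noncomputable def RData {P : Operad V} (A : OAlg P) : DAlgData P where
  X n := VCat.pi fun _ : Fin n => A.C
  base n := tup (A := fun _ : Fin n => A.C) (l := .ob) fun _ => A.zero
  θ {m _} φ := VFun.tuple fun j =>
    (VFun.pair ((VFun.fst _ _).comp (VFun.proj (fun j => P.O (φ.c j)) j))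
      (VFun.tuple fun r =>
        (VFun.snd (P.D φ) _).comp (VFun.proj (fun _ : Fin m => A.C) (φ.fib j r).1))).comp
    (A.θ (φ.c j))

/-- `P`-transformations `ω : F ⇒ G` between (multi)morphisms of `P`-algebras. -/
structure IsOTrans {P : Operad V} {k : ℕ} {A : Fin k → OAlg P} {B : OAlg P} (F G : PreO A B)
    (ω : (VCat.pi fun i => (A i).C).car .ob ⟶ B.C.car .mor) : Prop where
  src : ∀ {T : V} (w : ∀ i, T ⟶ (A i).C.car .ob), (tup w ≫ ω) ≫ B.C.src = F.f w
  tgt : ∀ {T : V} (w : ∀ i, T ⟶ (A i).C.car .ob), (tup w ≫ ω) ≫ B.C.tgt = G.f w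
  nat : ∀ {T : V} (w : ∀ i, T ⟶ (A i).C.car .mor),
    B.C.seq (F.f w) (tup (fun i => w i ≫ (A i).C.tgt) ≫ ω) =
      B.C.seq (tup (fun i => w i ≫ (A i).C.src) ≫ ω) (G.f w)
  compat : ∀ {T : V} (i : Fin k) {n : ℕ} (c : T ⟶ (P.O n).car .ob)
    (y : Fin n → (T ⟶ (A i).C.car .ob)) (w : ∀ i, T ⟶ (A i).C.car .ob),
    B.C.seq (F.d i c y w) (tup (Function.update w i ((A i).op c y)) ≫ ω) =
      B.C.seq (B.op ((P.O n).one c) fun r => tup (Function.update w i (y r)) ≫ ω) (G.d i c y w)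

/-- `D`-transformations `ω : F ⇒ G` between (multi)morphisms of `D`-algebras. -/
structure IsDTrans {P : Operad V} {k : ℕ} {X : Fin k → DAlg P} {Y : DAlg P} (F G : PreD X Y)
    (ω : ∀ m : Fin k → ℕ, (VCat.pi fun i => (X i).X (m i)).car .ob ⟶ (Y.X (ark m)).car .mor) :
    Prop where
  src : ∀ {T : V} {m : Fin k → ℕ} (x : ∀ i, T ⟶ ((X i).X (m i)).car .ob),
    (tup x ≫ ω m) ≫ (Y.X _).src = F.f x
  tgt : ∀ {T : V} {m : Fin k → ℕ} (x : ∀ i, T ⟶ ((X i).X (m i)).car .ob),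
    (tup x ≫ ω m) ≫ (Y.X _).tgt = G.f x
  nat : ∀ {T : V} {m : Fin k → ℕ} (x : ∀ i, T ⟶ ((X i).X (m i)).car .mor),
    (Y.X _).seq (F.f x) (tup (fun i => x i ≫ ((X i).X (m i)).tgt) ≫ ω m) =
      (Y.X _).seq (tup (fun i => x i ≫ ((X i).X (m i)).src) ≫ ω m) (G.f x)
  based : ∀ {T : V} {m : Fin k → ℕ} (x : ∀ i, T ⟶ ((X i).X (m i)).car .ob) (i : Fin k),
    x i = (X i).zero → tup x ≫ ω m = (Y.X _).one Y.zero
  compat : ∀ {T : V} {m n : Fin k → ℕ} (φ : ∀ i, FMap (m i) (n i)) (c : ∀ i, DPt P .ob T (φ i))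
    (x : ∀ i, T ⟶ ((X i).X (m i)).car .ob),
    (Y.X _).seq (F.d φ c x) (tup (fun i => (X i).op (φ i) (c i) (x i)) ≫ ω n) =
      (Y.X _).seq (Y.op (FMap.smk φ) (DPt.smk c).one (tup x ≫ ω m)) (G.d φ c x)

/-- The symmetric multifunctor `R` extends the 2-functor which sends an algebra `A` to `n ↦ Aⁿ`, a
pseudomorphism `(F, δ)` to the functors `Fⁿ` and the products of the `δ(|φ⁻¹(j)|)`, and a
transformation `ω` to `ωⁿ`; and the functors underlying the image of a `k`-ary morphism `F` are
`A₁^{m₁} × ⋯ × A_k^{m_k} → (A₁ × ⋯ × A_k)^{m₁⋯m_k} → B^{m₁⋯m_k}`, the powers of `F` preceded by the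
lexicographic distribution of the coordinates. -/
structure ExtendsR {P : Operad V} {α : PseudoComm P} {hO : (MultO P α).IsClosed}
    {hD : (MultD P α).IsClosed} {hR : ∀ A : OAlg P, (RData A).IsAlgebra}
    (R : SymmMultifunctor (MultO P α) (MultD P α) hO hD fun A : OAlg P =>
      (⟨RData A, hR A⟩ : DAlg P)) : Prop where
  functor : ∀ {k : ℕ} {A : Fin k → OAlg P} {B : OAlg P} (F : PreO A B) (hF : F.IsHom α)
    {l : Lvl} {T : V} {m : Fin k → ℕ} (x : ∀ i, T ⟶ (VCat.pi fun _ : Fin (m i) => (A i).C).car l)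
    (j : Fin (ark m)),
    co (A := fun _ : Fin (ark m) => B.C) (PreD.f (R.map ⟨F, hF⟩).1 x) j =
      F.f fun i => co (A := fun _ : Fin (m i) => (A i).C) (x i) (crd j i)
  cells : ∀ {A B : OAlg P} (F : PreO (fun _ : Fin 1 => A) B) (hF : F.IsHom α) {T : V}
    {m n : Fin 1 → ℕ} (φ : ∀ i, FMap (m i) (n i)) (c : ∀ i, DPt P .ob T (φ i))
    (x : ∀ i, T ⟶ (VCat.pi fun _ : Fin (m i) => A.C).car .ob) (j : Fin (ark n)),
    co (A := fun _ : Fin (ark n) => B.C) (PreD.d (R.map ⟨F, hF⟩).1 φ c x) j =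
      F.d 0 (c 0 (crd j 0))
        (fun r => co (A := fun _ : Fin (m 0) => A.C) (x 0) ((φ 0).fib (crd j 0) r).1)
        fun _ => A.zero
  transformations : ∀ {A B : OAlg P} (F G : PreO (fun _ : Fin 1 => A) B) (hF : F.IsHom α)
    (hG : G.IsHom α) (ω : (VCat.pi fun _ : Fin 1 => A.C).car .ob ⟶ B.C.car .mor),
    IsOTrans F G ω →
      IsDTrans (R.map ⟨F, hF⟩).1 (R.map ⟨G, hG⟩).1 fun m =>
        tup (A := fun _ : Fin (ark m) => B.C) (l := .mor) fun j =>
          tup (A := fun _ : Fin 1 => A.C) (l := .ob) (fun i => co (A := fun _ : Fin (m i) => A.C)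
            (pk (fun i => VCat.pi fun _ : Fin (m i) => A.C) i .ob) (crd j i)) ≫ ω

end ORExt

/-!
The image of a multimorphism `F : (A₁, …, A_k) → B` has as functors the powers of `F`, and its
constraint `PtMor.Δ` moves the operations `c₁, …, c_k` past `F` one variable after the other, each
time by a constraint `δᵢ` of `F`. Since `δᵢ` and `δⱼ` only commute up to `α`, the order matters: the
last variable comes first, so that the sources are the iterated actions by which `c₁ ∧ ⋯ ∧ c_k` acts
on a lexicographic array. The pseudofunctoriality constraint of `∧` is then exactly what is needed
to compare moving two layers `d`, `c` of operations one after the other with moving `d ∘ c`. The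
inductive step is `PtMor.Δ_comm`: the constraint of the remaining variables commutes, up to an
interchange `α`, with an operation in a variable which has been fixed. It gives naturality
(`PtMor.Δ_nat`) and compatibility with composition (`PtMor.Δ_comp`), hence `PreO.isHom_toD`.

All calculations take place at generalized points. For an object `T` of `V`, an operad in internal
categories has as its points at `T` an operad in sets on objects and one on arrows. An operation is
determined by its action on all algebras in sets, and even by the action on distinct variables in
the algebra `Lin.alg` of linear terms (`ext_of_R`, `ext_of_R_one`). So identities between operations
or arrows of operations, in which bijections between the sets of inputs abound, follow from
identities between their values `LAlg.R` on arrays, where inputs are named instead of numbered, and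
the axiom on `α` at a composite operation becomes a rule for the values `PtAlg.al` and `PtAlg.Al` of
the interchange arrows.

In this way the smash product of `D` is seen to be coherent: its constraints are associative
(`R_thetaSeq_assoc`), so that objects, arrows and composable pairs of `D` form monoids `DMor` and
`DPair`, and the iterated smash product of a concatenated list is that of the products of its
blocks. This proves that composites in `Mult(D)` are multimorphisms. For permutations, a
presentation of a permutation by adjacent interchanges gives a reordering constraint, which is
compatible with the pseudofunctoriality constraint (`R_cell_theta`, resting on the Yang-Baxter
equation `al_braid`). That composites and permutations in `Mult(O)` are multimorphisms follows from
the axioms by pasting.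

Compatibility with identities, composition and permutations rests on the principle
`PreD.eq_of_single`: since the pseudofunctoriality constraints are invertible, the axiom for
composites expresses the constraint at `c` by constraints at families in which all operations but
one merely select coordinates. At such a family `Δ` is a single constraint of `F` (`Δ_single`), and
the reordering constraint is an identity (`R_cell_eq_one`), because `α` is an identity as soon as
one argument is the operadic unit. What remains, for a composite, is that the blocks of a smash
product which contains a single operation may be replaced by that operation (`R_smk_single`). The
block and the operation have different numbers of inputs, but represent the same formal combination
of objects; and a constraint of `F` depends only on this combination, as it is a component of the
structure of the comma algebra `PtMor.comma` (`PtMor.d_congr`).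
-/

namespace ORExt

open VCat FMap

variable {V : Type u} [Category.{v} V] [HasFiniteLimits V]

/-! ### Generalized points of internal categories -/

namespace VCat

variable (A : VCat V) {T : V}

theorem one_src (x : T ⟶ A.car .ob) : A.one x ≫ A.src = x := by simp [one, A.idn_src]

theorem one_tgt (x : T ⟶ A.car .ob) : A.one x ≫ A.tgt = x := by simp [one, A.idn_tgt]

theorem comp_one {S : V} (t : S ⟶ T) (x : T ⟶ A.car .ob) : t ≫ A.one x = A.one (t ≫ x) := by
  simp [one]

theorem seq_src (f g : T ⟶ A.car .mor) : A.seq f g ≫ A.src = f ≫ A.src := by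
  by_cases h : f ≫ A.tgt = g ≫ A.src
  · rw [seq_pos A h, Category.assoc, A.comp_src, pullback.lift_fst_assoc]
  · rw [seq, dif_neg h]

theorem seq_tgt {f g : T ⟶ A.car .mor} (h : f ≫ A.tgt = g ≫ A.src) :
    A.seq f g ≫ A.tgt = g ≫ A.tgt := by
  rw [seq_pos A h, Category.assoc, A.comp_tgt, pullback.lift_snd_assoc]

theorem one_seq (f : T ⟶ A.car .mor) : A.seq (A.one (f ≫ A.src)) f = f := by
  rw [seq_pos A (by rw [one_tgt])]
  simpa only [one, Category.assoc] using A.id_comp' f (by simp [A.idn_tgt])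

theorem seq_one (f : T ⟶ A.car .mor) : A.seq f (A.one (f ≫ A.tgt)) = f := by
  rw [seq_pos A (by rw [one_src])]
  simpa only [one, Category.assoc] using A.comp_id' f (by simp [A.idn_src])

theorem seq_assoc {f g k : T ⟶ A.car .mor} (h : f ≫ A.tgt = g ≫ A.src)
    (h' : g ≫ A.tgt = k ≫ A.src) : A.seq (A.seq f g) k = A.seq f (A.seq g k) := by
  have e₁ : A.seq f g ≫ A.tgt = k ≫ A.src := by rw [seq_tgt A h, h']
  have e₂ : f ≫ A.tgt = A.seq g k ≫ A.src := by rw [seq_src, h]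
  rw [seq_pos A e₁, seq_pos A e₂]
  simp only [seq_pos A h, seq_pos A h']
  exact A.assoc T f g k _ _ _ _

theorem comp_seq {S : V} (t : S ⟶ T) {f g : T ⟶ A.car .mor} (h : f ≫ A.tgt = g ≫ A.src) :
    t ≫ A.seq f g = A.seq (t ≫ f) (t ≫ g) := by
  have h' : (t ≫ f) ≫ A.tgt = (t ≫ g) ≫ A.src := by rw [Category.assoc, h, Category.assoc]
  rw [seq_pos A h, seq_pos A h', ← Category.assoc]
  congr 1
  ext <;> simp [pullback.lift_fst, pullback.lift_snd]

theorem one_deg (l : Lvl) {S : V} (t : S ⟶ T) (x : T ⟶ A.car .ob) :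
    t ≫ A.deg l x = A.deg l (t ≫ x) := by
  cases l <;> simp [deg]

section Products

variable {ι : Type} [Finite ι] {B : ι → VCat V} {C : VCat V} {l : Lvl}

theorem co_tup (x : ∀ i, T ⟶ (B i).car l) (i : ι) : co (tup x) i = x i := tup_pr x i

theorem tup_co (x : T ⟶ (pi B).car l) : tup (co x) = x :=
  pi_ext fun i => by rw [tup_pr]; rfl

theorem co_ext {x y : T ⟶ (pi B).car l} (h : ∀ i, co x i = co y i) : x = y := pi_ext h

theorem comp_tup {S : V} (t : S ⟶ T) (x : ∀ i, T ⟶ (B i).car l) :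
    t ≫ tup x = tup fun i => t ≫ x i :=
  pi_ext fun i => by rw [Category.assoc, tup_pr, tup_pr]

theorem comp_co {S : V} (t : S ⟶ T) (x : T ⟶ (pi B).car l) (i : ι) :
    co (t ≫ x) i = t ≫ co x i := Category.assoc _ _ _

theorem co_src (f : T ⟶ (pi B).car .mor) (i : ι) : co (f ≫ (pi B).src) i = co f i ≫ (B i).src := by
  rw [co, Category.assoc, src_pr, ← Category.assoc]; rfl

theorem co_tgt (f : T ⟶ (pi B).car .mor) (i : ι) : co (f ≫ (pi B).tgt) i = co f i ≫ (B i).tgt := by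
  rw [co, Category.assoc, tgt_pr, ← Category.assoc]; rfl

theorem co_one (x : T ⟶ (pi B).car .ob) (i : ι) : co ((pi B).one x) i = (B i).one (co x i) := by
  rw [co, one, Category.assoc, idn_pr, ← Category.assoc]; rfl

theorem co_seq {f g : T ⟶ (pi B).car .mor} (h : f ≫ (pi B).tgt = g ≫ (pi B).src) (i : ι) :
    co ((pi B).seq f g) i = (B i).seq (co f i) (co g i) := seq_pr B i h

theorem co_deg (x : T ⟶ (pi B).car .ob) (i : ι) : co ((pi B).deg l x) i = (B i).deg l (co x i) := by
  cases l
  · rfl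
  · exact co_one x i

theorem tup_src (f : ∀ i, T ⟶ (B i).car .mor) :
    tup f ≫ (pi B).src = tup fun i => f i ≫ (B i).src :=
  co_ext fun i => by rw [co_src, co_tup, co_tup]

theorem tup_tgt (f : ∀ i, T ⟶ (B i).car .mor) :
    tup f ≫ (pi B).tgt = tup fun i => f i ≫ (B i).tgt :=
  co_ext fun i => by rw [co_tgt, co_tup, co_tup]

theorem one_tup (x : ∀ i, T ⟶ (B i).car .ob) :
    (pi B).one (tup x) = tup fun i => (B i).one (x i) :=
  co_ext fun i => by rw [co_one, co_tup, co_tup]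

theorem seq_tup {f g : ∀ i, T ⟶ (B i).car .mor} (h : ∀ i, f i ≫ (B i).tgt = g i ≫ (B i).src) :
    (pi B).seq (tup f) (tup g) = tup fun i => (B i).seq (f i) (g i) :=
  co_ext fun i => by
    rw [co_seq (by rw [tup_src, tup_tgt]; simp only [h]), co_tup, co_tup, co_tup]

variable {D : VCat V}

theorem comp_pr {S : V} (t : S ⟶ T) (x : T ⟶ C.car l) (y : T ⟶ D.car l) :
    t ≫ pr x y = pr (t ≫ x) (t ≫ y) :=
  times_ext (by rw [Category.assoc, pr_p₁, pr_p₁]) (by rw [Category.assoc, pr_p₂, pr_p₂])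

theorem pr_src (f : T ⟶ C.car .mor) (g : T ⟶ D.car .mor) :
    pr f g ≫ (C.times D).src = pr (f ≫ C.src) (g ≫ D.src) :=
  times_ext (by rw [Category.assoc, src_p₁, ← Category.assoc, pr_p₁, pr_p₁])
    (by rw [Category.assoc, src_p₂, ← Category.assoc, pr_p₂, pr_p₂])

theorem pr_tgt (f : T ⟶ C.car .mor) (g : T ⟶ D.car .mor) :
    pr f g ≫ (C.times D).tgt = pr (f ≫ C.tgt) (g ≫ D.tgt) :=
  times_ext (by rw [Category.assoc, tgt_p₁, ← Category.assoc, pr_p₁, pr_p₁])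
    (by rw [Category.assoc, tgt_p₂, ← Category.assoc, pr_p₂, pr_p₂])

theorem one_pr (x : T ⟶ C.car .ob) (y : T ⟶ D.car .ob) :
    (C.times D).one (pr x y) = pr (C.one x) (D.one y) :=
  times_ext (by rw [one, Category.assoc, idn_p₁, ← Category.assoc, pr_p₁, pr_p₁]; rfl)
    (by rw [one, Category.assoc, idn_p₂, ← Category.assoc, pr_p₂, pr_p₂]; rfl)

theorem seq_pr' {f f' : T ⟶ C.car .mor} {g g' : T ⟶ D.car .mor} (h : f ≫ C.tgt = f' ≫ C.src)
    (h' : g ≫ D.tgt = g' ≫ D.src) :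
    (C.times D).seq (pr f g) (pr f' g') = pr (C.seq f f') (D.seq g g') := by
  have e : pr f g ≫ (C.times D).tgt = pr f' g' ≫ (C.times D).src := by rw [pr_src, pr_tgt, h, h']
  exact times_ext (by rw [seq_p₁ _ _ e, pr_p₁, pr_p₁, pr_p₁])
    (by rw [seq_p₂ _ _ e, pr_p₂, pr_p₂, pr_p₂])

end Products

end VCat

namespace VFun

variable {A B : VCat V} (F : VFun A B) {T : V}

theorem comp_ap {S : V} {l : Lvl} (t : S ⟶ T) (x : T ⟶ A.car l) : t ≫ F.ap x = F.ap (t ≫ x) :=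
  (Category.assoc _ _ _).symm

theorem ap_src (f : T ⟶ A.car .mor) : F.ap f ≫ B.src = F.ap (f ≫ A.src) := by
  simp [ap, F.map_src]

theorem ap_tgt (f : T ⟶ A.car .mor) : F.ap f ≫ B.tgt = F.ap (f ≫ A.tgt) := by
  simp [ap, F.map_tgt]

theorem ap_one (x : T ⟶ A.car .ob) : F.ap (A.one x) = B.one (F.ap x) := by
  simp [ap, VCat.one, F.map_idn]

theorem ap_seq {f g : T ⟶ A.car .mor} (h : f ≫ A.tgt = g ≫ A.src) :
    F.ap (A.seq f g) = B.seq (F.ap f) (F.ap g) := F.map_seq T f g h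

theorem ap_inv {f : T ⟶ A.car .mor} (h : A.Inv f) : B.Inv (F.ap f) := by
  obtain ⟨g, h₁, h₂, h₃, h₄⟩ := h
  refine ⟨F.ap g, ?_, ?_, ?_, ?_⟩
  · rw [ap_src, h₁, ap_tgt]
  · rw [ap_src, ← h₂, ap_tgt]
  · rw [ap_src, ← ap_seq F h₁.symm, h₃, ap_one]
  · rw [ap_tgt, ← ap_seq F h₂, h₄, ap_one]

theorem comp_ap' {C : VCat V} (G : VFun B C) {l : Lvl} (x : T ⟶ A.car l) :
    (F.comp G).ap x = G.ap (F.ap x) := (Category.assoc _ _ _).symm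

/-- A functor is determined by its values on generalized points. -/
theorem ext_ap {F G : VFun A B} (h : ∀ (l : Lvl) (T : V) (x : T ⟶ A.car l), F.ap x = G.ap x) :
    F = G := by
  ext l
  simpa [ap] using h l _ (𝟙 _)

theorem tuple_ap {ι : Type} [Finite ι] {C : VCat V} {A : ι → VCat V} (F : ∀ i, VFun C (A i))
    {l : Lvl} (x : T ⟶ C.car l) : (tuple F).ap x = tup fun i => (F i).ap x :=
  comp_tup x _

theorem pair_ap {C A B : VCat V} (F : VFun C A) (G : VFun C B) {l : Lvl} (x : T ⟶ C.car l) :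
    (pair F G).ap x = pr (F.ap x) (G.ap x) :=
  comp_pr x _ _

theorem proj_ap {ι : Type} [Finite ι] (A : ι → VCat V) (i : ι) {l : Lvl}
    (x : T ⟶ (VCat.pi A).car l) : (proj A i).ap x = co x i := rfl

theorem fst_ap (A B : VCat V) {l : Lvl} (x : T ⟶ A.car l) (y : T ⟶ B.car l) :
    (fst A B).ap (pr x y) = x := pr_p₁ _ _

theorem snd_ap (A B : VCat V) {l : Lvl} (x : T ⟶ A.car l) (y : T ⟶ B.car l) :
    (snd A B).ap (pr x y) = y := pr_p₂ _ _

theorem id_ap (A : VCat V) {l : Lvl} (x : T ⟶ A.car l) : (VFun.id A).ap x = x :=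
  Category.comp_id _

theorem const_ap {C A : VCat V} (a : ⊤_ V ⟶ A.car .ob) {l : Lvl} (x : T ⟶ C.car l) :
    (const a : VFun C A).ap x = A.deg l (terminal.from T ≫ a) := by
  change x ≫ A.deg l _ = _
  rw [one_deg, ← Category.assoc, Subsingleton.elim (x ≫ terminal.from _) (terminal.from T)]

end VFun

namespace VCat

variable (A : VCat V) {T : V}

theorem inv_one (x : T ⟶ A.car .ob) : A.Inv (A.one x) := by
  have h := A.one_seq (A.one x)
  rw [one_src] at h
  exact ⟨A.one x, by rw [one_src, one_tgt], by rw [one_src, one_tgt], by rw [one_src, h],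
    by rw [one_tgt, h]⟩

theorem inv_seq {f g : T ⟶ A.car .mor} (h : f ≫ A.tgt = g ≫ A.src) (hf : A.Inv f)
    (hg : A.Inv g) : A.Inv (A.seq f g) := by
  obtain ⟨f', a₁, a₂, a₃, a₄⟩ := hf
  obtain ⟨g', b₁, b₂, b₃, b₄⟩ := hg
  have h' : g' ≫ A.tgt = f' ≫ A.src := by rw [b₂, a₁, h]
  refine ⟨A.seq g' f', ?_, ?_, ?_, ?_⟩
  · rw [seq_src, seq_tgt A h, b₁]
  · rw [seq_src, seq_tgt A h', a₂]
  · rw [seq_src, seq_assoc A h (by rw [seq_src, b₁]), ← seq_assoc A b₁.symm h', b₃, ← h, ← a₁,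
      one_seq, a₃]
  · rw [seq_tgt A h, seq_assoc A h' (by rw [seq_src, a₂]), ← seq_assoc A a₂ h, a₄, h, one_seq, b₄]

theorem inv_tup {ι : Type} [Finite ι] {B : ι → VCat V} {f : ∀ i, T ⟶ (B i).car .mor}
    (h : ∀ i, (B i).Inv (f i)) : (pi B).Inv (tup f) := by
  choose g h₁ h₂ h₃ h₄ using h
  refine ⟨tup g, ?_, ?_, ?_, ?_⟩
  · rw [tup_src, tup_tgt]; simp only [h₁]
  · rw [tup_src, tup_tgt]; simp only [h₂]
  · rw [seq_tup fun i => (h₁ i).symm, tup_src, one_tup]; simp only [h₃]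
  · rw [seq_tup h₂, tup_tgt, one_tup]; simp only [h₄]

theorem inv_pr {C D : VCat V} {f : T ⟶ C.car .mor} {g : T ⟶ D.car .mor} (hf : C.Inv f)
    (hg : D.Inv g) : (C.times D).Inv (pr f g) := by
  obtain ⟨f', a₁, a₂, a₃, a₄⟩ := hf
  obtain ⟨g', b₁, b₂, b₃, b₄⟩ := hg
  refine ⟨pr f' g', ?_, ?_, ?_, ?_⟩
  · rw [pr_src, pr_tgt, a₁, b₁]
  · rw [pr_src, pr_tgt, a₂, b₂]
  · rw [seq_pr' a₁.symm b₁.symm, pr_src, one_pr, a₃, b₃]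
  · rw [seq_pr' a₂ b₂, pr_tgt, one_pr, a₄, b₄]

end VCat

/-! ### Generalized points of operads -/

namespace Operad

variable (P : Operad V) {T : V}

section

variable {n k : ℕ} {j : Fin k → ℕ} (e : Fin n ≃ Σ i, Fin (j i))

theorem cmp_src (d : T ⟶ (P.O k).car .mor) (c : ∀ i, T ⟶ (P.O (j i)).car .mor) :
    P.cmp e d c ≫ (P.O n).src = P.cmp e (d ≫ (P.O k).src) fun i => c i ≫ (P.O (j i)).src := by
  rw [OperadData.cmp, VFun.ap_src, VFun.ap_src, pr_src, tup_src]; rfl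

theorem cmp_tgt (d : T ⟶ (P.O k).car .mor) (c : ∀ i, T ⟶ (P.O (j i)).car .mor) :
    P.cmp e d c ≫ (P.O n).tgt = P.cmp e (d ≫ (P.O k).tgt) fun i => c i ≫ (P.O (j i)).tgt := by
  rw [OperadData.cmp, VFun.ap_tgt, VFun.ap_tgt, pr_tgt, tup_tgt]; rfl

theorem one_cmp (d : T ⟶ (P.O k).car .ob) (c : ∀ i, T ⟶ (P.O (j i)).car .ob) :
    (P.O n).one (P.cmp e d c) = P.cmp e ((P.O k).one d) fun i => (P.O (j i)).one (c i) := by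
  rw [OperadData.cmp, ← VFun.ap_one, ← VFun.ap_one, one_pr, one_tup]; rfl

theorem seq_cmp {d d' : T ⟶ (P.O k).car .mor} {c c' : ∀ i, T ⟶ (P.O (j i)).car .mor}
    (h : d ≫ (P.O k).tgt = d' ≫ (P.O k).src)
    (h' : ∀ i, c i ≫ (P.O (j i)).tgt = c' i ≫ (P.O (j i)).src) :
    P.cmp e ((P.O k).seq d d') (fun i => (P.O (j i)).seq (c i) (c' i)) =
      (P.O n).seq (P.cmp e d c) (P.cmp e d' c') := by
  have h₁ : tup c ≫ (VCat.pi fun i => P.O (j i)).tgt = tup c' ≫ (VCat.pi fun i => P.O (j i)).src := by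
    rw [tup_src, tup_tgt]; simp only [h']
  have h₂ : pr d (tup c) ≫ ((P.O k).times (VCat.pi fun i => P.O (j i))).tgt =
      pr d' (tup c') ≫ ((P.O k).times (VCat.pi fun i => P.O (j i))).src := by
    rw [pr_src, pr_tgt, h, h₁]
  rw [OperadData.cmp, ← seq_tup h', ← seq_pr' h h₁, VFun.ap_seq _ h₂, VFun.ap_seq _ ?_]
  · rfl
  · rw [VFun.ap_src, VFun.ap_tgt, h₂]

theorem comp_cmp {S : V} (t : S ⟶ T) {l : Lvl} (d : T ⟶ (P.O k).car l)
    (c : ∀ i, T ⟶ (P.O (j i)).car l) :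
    t ≫ P.cmp e d c = P.cmp e (t ≫ d) fun i => t ≫ c i := by
  rw [OperadData.cmp, VFun.comp_ap, VFun.comp_ap, comp_pr, comp_tup]; rfl

end

theorem eq_star {l : Lvl} (c : T ⟶ (P.O 0).car l) : c = P.star := (P.red l).hom_ext _ _

theorem unitP_mor : (P.unitP : T ⟶ (P.O 1).car .mor) = (P.O 1).one P.unitP := rfl

end Operad

namespace PseudoComm

variable {P : Operad V} (α : PseudoComm P) {T : V}

theorem ap_src {j k : ℕ} (x : T ⟶ (P.O j).car .ob) (y : T ⟶ (P.O k).car .ob) :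
    α.ap x y ≫ (P.O _).src = (P.act (flip k j)).ap (P.pair x y) := α.src x y

theorem ap_tgt {j k : ℕ} (x : T ⟶ (P.O j).car .ob) (y : T ⟶ (P.O k).car .ob) :
    α.ap x y ≫ (P.O _).tgt = P.pair y x := α.tgt x y

theorem comp_ap {S : V} (t : S ⟶ T) {j k : ℕ} (x : T ⟶ (P.O j).car .ob)
    (y : T ⟶ (P.O k).car .ob) : t ≫ α.ap x y = α.ap (t ≫ x) (t ≫ y) := by
  rw [ap, ← Category.assoc, comp_pr]; rfl

end PseudoComm

/-! ### Algebras in sets and in ordinary categories -/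

/-- A strict algebra in sets over the generalized points at `T` and at level `l` of an operad. -/
structure LAlg (P : Operad V) (T : V) (l : Lvl) where
  car : Type w
  op : ∀ {n : ℕ}, (T ⟶ (P.O n).car l) → (Fin n → car) → car
  op_act : ∀ {m n : ℕ} (e : Fin m ≃ Fin n) (c : T ⟶ (P.O n).car l) (y : Fin m → car),
    op ((P.act e).ap c) y = op c fun i => y (e.symm i)
  op_unit : ∀ (y : Fin 1 → car), op P.unitP y = y 0
  op_cmp : ∀ {n k : ℕ} {j : Fin k → ℕ} (e : Fin n ≃ Σ i, Fin (j i)) (d : T ⟶ (P.O k).car l)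
    (c : ∀ i, T ⟶ (P.O (j i)).car l) (y : Fin n → car),
    op (P.cmp e d c) y = op d fun i => op (c i) fun t => y (e.symm ⟨i, t⟩)

/-- A strict algebra in ordinary categories over the generalized points at `T` of an operad.
The composite `seq f g` is only meaningful for composable arrows. -/
structure PtAlg (P : Operad V) (T : V) where
  L : ∀ l, LAlg.{w} P T l
  src : (L .mor).car → (L .ob).car
  tgt : (L .mor).car → (L .ob).car
  one : (L .ob).car → (L .mor).car
  seq : (L .mor).car → (L .mor).car → (L .mor).car
  src_one : ∀ x, src (one x) = x
  tgt_one : ∀ x, tgt (one x) = x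
  src_seq : ∀ f g, src (seq f g) = src f
  tgt_seq : ∀ {f g}, tgt f = src g → tgt (seq f g) = tgt g
  one_seq : ∀ f, seq (one (src f)) f = f
  seq_one : ∀ f, seq f (one (tgt f)) = f
  seq_assoc : ∀ {f g k}, tgt f = src g → tgt g = src k → seq (seq f g) k = seq f (seq g k)
  op_src : ∀ {n : ℕ} (f : T ⟶ (P.O n).car .mor) y,
    src ((L .mor).op f y) = (L .ob).op (f ≫ (P.O n).src) fun i => src (y i)
  op_tgt : ∀ {n : ℕ} (f : T ⟶ (P.O n).car .mor) y,
    tgt ((L .mor).op f y) = (L .ob).op (f ≫ (P.O n).tgt) fun i => tgt (y i)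
  op_one : ∀ {n : ℕ} (c : T ⟶ (P.O n).car .ob) y,
    (L .mor).op ((P.O n).one c) (fun i => one (y i)) = one ((L .ob).op c y)
  op_seq : ∀ {n : ℕ} {f g : T ⟶ (P.O n).car .mor} {y y'}, f ≫ (P.O n).tgt = g ≫ (P.O n).src →
    (∀ i, tgt (y i) = src (y' i)) →
    (L .mor).op ((P.O n).seq f g) (fun i => seq (y i) (y' i)) = seq ((L .mor).op f y) ((L .mor).op g y')

/-- The generalized points at `T` of an algebra in internal categories. -/
noncomputable def OAlg.pt {P : Operad V} (A : OAlg P) (T : V) : PtAlg.{v} P T where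
  L l :=
    { car := T ⟶ A.C.car l
      op := fun c y => A.op c y
      op_act := fun e c y => A.θ_act e c y
      op_unit := fun y => by
        have : y = fun _ => y 0 := funext fun i => by rw [Subsingleton.elim i 0]
        rw [this]; exact A.θ_unit (y 0)
      op_cmp := fun e d c y => A.θ_cmp e d c y }
  src f := f ≫ A.C.src
  tgt f := f ≫ A.C.tgt
  one x := A.C.one x
  seq f g := A.C.seq f g
  src_one := A.C.one_src
  tgt_one := A.C.one_tgt
  src_seq := A.C.seq_src
  tgt_seq := A.C.seq_tgt
  one_seq := A.C.one_seq
  seq_one := A.C.seq_one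
  seq_assoc := A.C.seq_assoc
  op_src f y := by change A.op f y ≫ _ = _; rw [OAlg.op, VFun.ap_src, pr_src, tup_src]; rfl
  op_tgt f y := by change A.op f y ≫ _ = _; rw [OAlg.op, VFun.ap_tgt, pr_tgt, tup_tgt]; rfl
  op_one c y := by
    change A.op _ _ = A.C.one (A.op c y); rw [OAlg.op, OAlg.op, ← VFun.ap_one, one_pr, one_tup]
  op_seq {n f g y y'} h h' := by
    have h₁ : tup y ≫ (VCat.pi fun _ : Fin n => A.C).tgt =
        tup y' ≫ (VCat.pi fun _ : Fin n => A.C).src := by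
      rw [tup_src, tup_tgt]; exact congrArg tup (funext h')
    change A.op _ _ = A.C.seq (A.op f y) (A.op g y')
    rw [OAlg.op, ← seq_tup h', ← seq_pr' h h₁, VFun.ap_seq _ (by rw [pr_src, pr_tgt, h, h₁])]; rfl

/-! ### The linear algebra of an operad -/

theorem Operad.act_cmp (P : Operad V) {T : V} {l : Lvl} {m n k : ℕ} {j : Fin k → ℕ}
    (f : Fin m ≃ Fin n) (e : Fin n ≃ Σ i, Fin (j i)) (d : T ⟶ (P.O k).car l)
    (c : ∀ i, T ⟶ (P.O (j i)).car l) :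
    (P.act f).ap (P.cmp e d c) = P.cmp (f.trans e) d c :=
  P.act_trans _ _ _

namespace Lin

variable (P : Operad V) (T : V)

/-- A linear term: an operation all of whose inputs carry distinct labels. -/
structure Rep (l : Lvl) where
  n : ℕ
  lab : Fin n ↪ ℕ
  x : T ⟶ (P.O n).car l

variable {P T}

/-- Terms which differ by a renumbering of the inputs are equivalent. -/
def rel {l : Lvl} (r s : Rep P T l) : Prop :=
  ∃ f : Fin r.n ≃ Fin s.n, (∀ i, s.lab (f i) = r.lab i) ∧ r.x = (P.act f).ap s.x

theorem rel_equivalence {l : Lvl} : Equivalence (rel (P := P) (T := T) (l := l)) where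
  refl r := ⟨Equiv.refl _, fun _ => rfl, (P.act_refl _).symm⟩
  symm := by
    rintro r s ⟨f, h, h'⟩
    refine ⟨f.symm, fun i => by rw [← h]; simp, ?_⟩
    rw [h', P.act_trans, Equiv.symm_trans_self, P.act_refl]
  trans := by
    rintro r s t ⟨f, h, h'⟩ ⟨g, k, k'⟩
    exact ⟨f.trans g, fun i => (k _).trans (h i), by rw [h', k', P.act_trans]⟩

variable (P T) in
/-- The carrier of the linear algebra: the linear terms up to renumbering of the inputs, together
with one more element `bad`, the value of all operations which would repeat a label. -/
inductive Car (l : Lvl)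
  | bad : Car l
  | ok : Quot (rel (P := P) (T := T) (l := l)) → Car l

open Car

variable {l l' : Lvl}

/-- The class of a linear term. -/
def mk {n : ℕ} (lab : Fin n ↪ ℕ) (x : T ⟶ (P.O n).car l) : Car P T l :=
  ok (Quot.mk _ ⟨n, lab, x⟩)

theorem cases (q : Car P T l) :
    q = bad ∨ ∃ (n : ℕ) (lab : Fin n ↪ ℕ) (x : T ⟶ (P.O n).car l), q = mk lab x := by
  rcases q with _ | q
  · exact Or.inl rfl
  · induction q using Quot.ind with
    | mk r => exact Or.inr ⟨r.n, r.lab, r.x, rfl⟩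

theorem mk_ne {n : ℕ} (lab : Fin n ↪ ℕ) (x : T ⟶ (P.O n).car l) : mk lab x ≠ bad :=
  fun h => by cases h

theorem mk_eq_iff {n n' : ℕ} {lab : Fin n ↪ ℕ} {x : T ⟶ (P.O n).car l} {lab' : Fin n' ↪ ℕ}
    {x' : T ⟶ (P.O n').car l} : mk lab x = mk lab' x' ↔
      ∃ f : Fin n ≃ Fin n', (∀ i, lab' (f i) = lab i) ∧ x = (P.act f).ap x' := by
  rw [mk, mk, ok.injEq, Quot.eq, rel_equivalence.eqvGen_iff]; rfl

theorem mk_inj {n : ℕ} {lab : Fin n ↪ ℕ} {x x' : T ⟶ (P.O n).car l} (h : mk lab x = mk lab x') :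
    x = x' := by
  obtain ⟨f, h, h'⟩ := mk_eq_iff.1 h
  obtain rfl : f = Equiv.refl _ := Equiv.ext fun i => lab.injective (h i)
  rw [h', P.act_refl]

/-- An equivariant family of maps on operations induces a map on terms. -/
def map (F : ∀ n, (T ⟶ (P.O n).car l) → (T ⟶ (P.O n).car l'))
    (hF : ∀ {m n} (e : Fin m ≃ Fin n) x, F m ((P.act e).ap x) = (P.act e).ap (F n x)) :
    Car P T l → Car P T l'
  | bad => bad
  | ok q => ok (Quot.map (fun r => ⟨r.n, r.lab, F r.n r.x⟩) (by
      rintro r s ⟨f, h, h'⟩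
      exact ⟨f, h, by rw [h', hF]⟩) q)

section map

variable (F : ∀ n, (T ⟶ (P.O n).car l) → (T ⟶ (P.O n).car l'))
  (hF : ∀ {m n} (e : Fin m ≃ Fin n) x, F m ((P.act e).ap x) = (P.act e).ap (F n x))

theorem map_mk {n : ℕ} (lab : Fin n ↪ ℕ) (x : T ⟶ (P.O n).car l) :
    map F hF (mk lab x) = mk lab (F n x) := rfl

theorem map_bad : map F hF bad = bad := rfl

theorem map_eq_bad {q : Car P T l} (h : map F hF q = bad) : q = bad := by
  rcases cases q with rfl | ⟨n, lab, x, rfl⟩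
  · rfl
  · exact absurd h (mk_ne _ _)

/-- Terms lift along a map induced by operations, with the same labels. -/
theorem map_eq_mk {q : Car P T l} {n : ℕ} {lab : Fin n ↪ ℕ} {z : T ⟶ (P.O n).car l'}
    (h : map F hF q = mk lab z) : ∃ x, q = mk lab x ∧ F n x = z := by
  rcases cases q with rfl | ⟨n, lab, x, rfl⟩
  · exact absurd h.symm (mk_ne _ _)
  · obtain ⟨f, h₁, h₂⟩ := mk_eq_iff.1 h
    refine ⟨(P.act f.symm).ap x, ?_, ?_⟩
    · refine mk_eq_iff.2 ⟨f, h₁, ?_⟩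
      rw [P.act_trans, Equiv.self_trans_symm, P.act_refl]
    · rw [hF, h₂, P.act_trans, Equiv.symm_trans_self, P.act_refl]

end map

/-- The labels of the `i`th term of a family. -/
def emb {ι : Type} {k : ι → ℕ} (L : (Σ i, Fin (k i)) ↪ ℕ) (i : ι) : Fin (k i) ↪ ℕ :=
  (Function.Embedding.sigmaMk i).trans L

/-- A presentation of a family of terms without repeated labels. -/
structure Pres {ι : Type} (y : ι → Car P T l) where
  k : ι → ℕ
  L : (Σ i, Fin (k i)) ↪ ℕ
  x : ∀ i, T ⟶ (P.O (k i)).car l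
  eq : ∀ i, y i = mk (emb L i) (x i)

/-- A family of terms without repeated labels. -/
def Good {ι : Type} (y : ι → Car P T l) : Prop := Nonempty (Pres y)

theorem Good.comp {ι ι' : Type} {y : ι → Car P T l} (h : Good y) (e : ι' ≃ ι) :
    Good fun i => y (e i) := by
  obtain ⟨⟨k, L, x, h⟩⟩ := h
  exact ⟨⟨fun i => k (e i),
    (Equiv.sigmaCongrLeft (β := fun i => Fin (k i)) e).toEmbedding.trans L, fun i => x (e i),
    fun i => h (e i)⟩⟩

open Classical in
/-- The operations of the linear algebra. -/
noncomputable def op {n : ℕ} (c : T ⟶ (P.O n).car l) (y : Fin n → Car P T l) : Car P T l :=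
  if h : Good y then
    mk (finSigmaFinEquiv.symm.toEmbedding.trans h.some.L)
      (P.cmp finSigmaFinEquiv.symm c h.some.x)
  else bad

theorem op_of_not {n : ℕ} (c : T ⟶ (P.O n).car l) {y : Fin n → Car P T l} (h : ¬ Good y) :
    op c y = bad := dif_neg h

theorem op_eq {n m : ℕ} (c : T ⟶ (P.O n).car l) {y : Fin n → Car P T l} {k : Fin n → ℕ}
    (L : (Σ i, Fin (k i)) ↪ ℕ) (x : ∀ i, T ⟶ (P.O (k i)).car l)
    (h : ∀ i, y i = mk (emb L i) (x i)) (E : Fin m ≃ Σ i, Fin (k i)) :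
    op c y = mk (E.toEmbedding.trans L) (P.cmp E c x) := by
  have hy : Good y := ⟨⟨k, L, x, h⟩⟩
  rw [op, dif_pos hy]
  generalize hy.some = z
  obtain ⟨k', L', x', h'⟩ := z
  have H : ∀ i, ∃ f : Fin (k' i) ≃ Fin (k i), (∀ t, L ⟨i, f t⟩ = L' ⟨i, t⟩) ∧
      x' i = (P.act f).ap (x i) := fun i => mk_eq_iff.1 ((h' i).symm.trans (h i))
  choose f hf hx using H
  obtain rfl : x' = fun i => (P.act (f i)).ap (x i) := funext hx
  refine mk_eq_iff.2
    ⟨(finSigmaFinEquiv.symm.trans (Equiv.sigmaCongrRight f)).trans E.symm, fun t => ?_, ?_⟩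
  · simpa using hf _ _
  · rw [P.cmp_act_right, P.act_cmp]
    congr 1
    ext1 t
    simp

theorem op_ne_bad {n : ℕ} {c : T ⟶ (P.O n).car l} {y : Fin n → Car P T l} (h : op c y ≠ bad) :
    Good y := by
  by_contra hy
  exact h (op_of_not c hy)

theorem op_act {m n : ℕ} (e : Fin m ≃ Fin n) (c : T ⟶ (P.O n).car l) (y : Fin m → Car P T l) :
    op ((P.act e).ap c) y = op c fun i => y (e.symm i) := by
  by_cases hy : Good fun i => y (e.symm i)
  · obtain ⟨⟨k, L, x, h⟩⟩ := hy
    rw [op_eq c L x h (finSigmaFinEquiv.symm.trans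
      (Equiv.sigmaCongrLeft (β := fun i => Fin (k i)) e)), ← P.cmp_act_left]
    refine op_eq _ ((Equiv.sigmaCongrLeft (β := fun i => Fin (k i)) e).toEmbedding.trans L)
      (fun i => x (e i)) (fun i => ?_) finSigmaFinEquiv.symm
    exact (congrArg y (e.symm_apply_apply i).symm).trans (h (e i))
  · rw [op_of_not c hy, op_of_not]
    exact fun h => hy (h.comp e.symm)

theorem op_unit (y : Fin 1 → Car P T l) : op P.unitP y = y 0 := by
  rcases cases (y 0) with h | ⟨n, lab, x, h⟩
  · rw [h]
    refine op_of_not _ ?_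
    rintro ⟨⟨k, L, x, h'⟩⟩
    exact mk_ne _ _ ((h' 0).symm.trans h)
  · rw [h, op_eq _ ((Equiv.uniqueSigma (fun _ : Fin 1 => Fin n)).toEmbedding.trans lab)
      (fun _ => x) (fun i => ?_) (Equiv.uniqueSigma (fun _ : Fin 1 => Fin n)).symm]
    · rw [P.cmp_unit_left]; rfl
    · rw [Subsingleton.elim i 0, h]; rfl

theorem op_cmp {n k : ℕ} {j : Fin k → ℕ} (e : Fin n ≃ Σ i, Fin (j i)) (d : T ⟶ (P.O k).car l)
    (c : ∀ i, T ⟶ (P.O (j i)).car l) (y : Fin n → Car P T l) :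
    op (P.cmp e d c) y = op d fun i => op (c i) fun t => y (e.symm ⟨i, t⟩) := by
  by_cases hy : Good fun s => y (e.symm s)
  · obtain ⟨⟨κ, L, x, h⟩⟩ := hy
    let F : ∀ i, Fin (∑ t, κ ⟨i, t⟩) ≃ Σ t, Fin (κ ⟨i, t⟩) := fun i => finSigmaFinEquiv.symm
    let A := Equiv.sigmaAssoc fun i t => Fin (κ ⟨i, t⟩)
    have h₁ : ∀ i, op (c i) (fun t => y (e.symm ⟨i, t⟩)) =
        mk (emb ((Equiv.sigmaCongrRight F).toEmbedding.trans
          (A.symm.toEmbedding.trans L)) i) (P.cmp (F i) (c i) fun t => x ⟨i, t⟩) := fun i =>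
      op_eq (c i) ((Function.Embedding.sigmaMk i).trans (A.symm.toEmbedding.trans L)) _
        (fun t => h ⟨i, t⟩) (F i)
    have h₂ : ∀ p, y p = mk (emb ((Equiv.sigmaCongrLeft (β := fun s => Fin (κ s)) e).toEmbedding.trans
        L) p) (x (e p)) := fun p => (congrArg y (e.symm_apply_apply p).symm).trans (h (e p))
    rw [op_eq d _ _ h₁ finSigmaFinEquiv.symm, op_eq _ _ _ h₂
      (((finSigmaFinEquiv.symm.trans (Equiv.sigmaCongrRight F)).trans A.symm).trans
        (Equiv.sigmaCongrLeft (β := fun s => Fin (κ s)) e).symm)]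
    congr 1
    · ext1 t
      simp [A]
    · exact (P.cmp_assoc (r := fun i t => κ ⟨i, t⟩) finSigmaFinEquiv.symm F e d c
        (fun i t => x ⟨i, t⟩)).symm
  · rw [op_of_not _ fun h => hy (h.comp e.symm), op_of_not]
    rintro ⟨⟨κ, L, x, h⟩⟩
    refine hy ?_
    have hg : ∀ i, Good fun t => y (e.symm ⟨i, t⟩) := fun i =>
      op_ne_bad (c := c i) (by rw [show op (c i) _ = _ from h i]; exact mk_ne _ _)
    choose κ' L' x' h' using fun i => ((hg i).elim fun z => ⟨z.k, z.L, z.x, z.eq⟩ :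
      ∃ (k : Fin (j i) → ℕ) (L : (Σ t, Fin (k t)) ↪ ℕ) (x : ∀ t, T ⟶ (P.O (k t)).car l),
        ∀ t, y (e.symm ⟨i, t⟩) = mk (emb L t) (x t))
    have H : ∀ i, ∃ f : (Σ t, Fin (κ' i t)) ≃ Fin (κ i), ∀ s, L ⟨i, f s⟩ = L' i s := fun i => by
      have := h i
      rw [op_eq (c i) _ _ (h' i) finSigmaFinEquiv.symm] at this
      obtain ⟨f, hf, -⟩ := mk_eq_iff.1 this
      exact ⟨finSigmaFinEquiv.trans f, fun s => (hf _).trans (by simp)⟩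
    choose f hf using H
    refine ⟨⟨fun s => κ' s.1 s.2, ((Equiv.sigmaAssoc fun i t => Fin (κ' i t)).trans
      (Equiv.sigmaCongrRight f)).toEmbedding.trans L, fun s => x' s.1 s.2, ?_⟩⟩
    rintro ⟨i, t⟩
    refine (h' i t).trans (congrArg (mk · _) ?_)
    ext s
    exact (hf i ⟨t, s⟩).symm

theorem op_map (F : ∀ n, (T ⟶ (P.O n).car l) → (T ⟶ (P.O n).car l'))
    (hF : ∀ {m n} (e : Fin m ≃ Fin n) x, F m ((P.act e).ap x) = (P.act e).ap (F n x))
    (hc : ∀ {n k : ℕ} {j : Fin k → ℕ} (e : Fin n ≃ Σ i, Fin (j i)) d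
      (c : ∀ i, T ⟶ (P.O (j i)).car l), F n (P.cmp e d c) = P.cmp e (F k d) fun i => F _ (c i))
    {n : ℕ} (f : T ⟶ (P.O n).car l) (y : Fin n → Car P T l) :
    map F hF (op f y) = op (F n f) fun i => map F hF (y i) := by
  by_cases hy : Good y
  · obtain ⟨⟨k, L, x, h⟩⟩ := hy
    rw [op_eq _ L x h finSigmaFinEquiv.symm, map_mk, op_eq _ L (fun i => F _ (x i)) (fun i => ?_)
      finSigmaFinEquiv.symm, hc]
    rw [h, map_mk]
  · rw [op_of_not _ hy, op_of_not, map_bad]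
    rintro ⟨⟨k, L, x, h⟩⟩
    choose x' hx using fun i => map_eq_mk F hF (h i)
    exact hy ⟨⟨k, L, x', fun i => (hx i).1⟩⟩

variable (P T) in
/-- The linear terms as an algebra in sets. -/
noncomputable def lalg (l : Lvl) : LAlg.{v} P T l where
  car := Car P T l
  op := op
  op_act := op_act
  op_unit := op_unit
  op_cmp := op_cmp

/-- The source of a term of arrows. -/
def src : Car P T .mor → Car P T .ob :=
  map (fun n x => x ≫ (P.O n).src) fun _ _ => VFun.ap_src _ _

/-- The target of a term of arrows. -/
def tgt : Car P T .mor → Car P T .ob :=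
  map (fun n x => x ≫ (P.O n).tgt) fun _ _ => VFun.ap_tgt _ _

/-- The identity arrow of a term of objects. -/
def one : Car P T .ob → Car P T .mor :=
  map (fun n x => (P.O n).one x) fun _ _ => (VFun.ap_one _ _).symm

/-- A presentation of two terms with the same labels and composable arrows. -/
structure Pair (q q' : Car P T .mor) where
  n : ℕ
  lab : Fin n ↪ ℕ
  f : T ⟶ (P.O n).car .mor
  g : T ⟶ (P.O n).car .mor
  left : q = mk lab f
  right : q' = mk lab g
  comp : f ≫ (P.O n).tgt = g ≫ (P.O n).src

open Classical in
/-- The composite of terms with the same labels. -/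
noncomputable def seq (q q' : Car P T .mor) : Car P T .mor :=
  if h : Nonempty (Pair q q') then mk h.some.lab ((P.O _).seq h.some.f h.some.g)
  else q

theorem seq_mk {n : ℕ} (lab : Fin n ↪ ℕ) {f g : T ⟶ (P.O n).car .mor}
    (h : f ≫ (P.O n).tgt = g ≫ (P.O n).src) :
    seq (mk lab f) (mk lab g) = mk lab ((P.O n).seq f g) := by
  have H : Nonempty (Pair (mk lab f) (mk lab g)) := ⟨⟨n, lab, f, g, rfl, rfl, h⟩⟩
  rw [seq, dif_pos H]
  generalize H.some = z
  obtain ⟨m, lab', f', g', a₁, a₂, a₃⟩ := z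
  obtain ⟨σ, s₁, s₂⟩ := mk_eq_iff.1 a₁
  obtain ⟨ρ, r₁, r₂⟩ := mk_eq_iff.1 a₂
  obtain rfl : σ = ρ := Equiv.ext fun i =>
    lab'.injective ((s₁ i).trans (r₁ i).symm)
  subst s₂ r₂
  rw [← VFun.ap_seq _ a₃]
  refine mk_eq_iff.2 ⟨σ.symm, fun i => by rw [← s₁]; simp, ?_⟩
  rw [P.act_trans, Equiv.symm_trans_self, P.act_refl]

theorem seq_bad (q : Car P T .mor) : seq bad q = bad := by
  refine dif_neg ?_
  rintro ⟨⟨n, lab, f, g, h, -, -⟩⟩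
  exact mk_ne _ _ h.symm

theorem exists_pair {q q' : Car P T .mor} (h : tgt q = src q') :
    (q = bad ∧ q' = bad) ∨
      Nonempty (Pair q q') := by
  rcases cases q with rfl | ⟨n, lab, x, rfl⟩
  · exact Or.inl ⟨rfl, map_eq_bad _ (fun _ _ => VFun.ap_src _ _) h.symm⟩
  · obtain ⟨x', h₁, h₂⟩ := map_eq_mk _ (fun _ _ => VFun.ap_src _ _) h.symm
    exact Or.inr ⟨⟨n, lab, x, x', rfl, h₁, h₂.symm⟩⟩

theorem tgt_seq {f g : Car P T .mor} (h : tgt f = src g) : tgt (seq f g) = tgt g := by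
  rcases exists_pair h with ⟨rfl, rfl⟩ | ⟨⟨n, lab, a, b, rfl, rfl, h₀⟩⟩
  · rw [seq_bad]
  · rw [seq_mk lab h₀]
    exact congrArg (mk lab) ((P.O n).seq_tgt h₀)

theorem seq_assoc {f g k : Car P T .mor} (h : tgt f = src g) (h' : tgt g = src k) :
    seq (seq f g) k = seq f (seq g k) := by
  rcases exists_pair h with ⟨rfl, rfl⟩ | ⟨⟨n, lab, a, b, rfl, rfl, h₀⟩⟩
  · rw [seq_bad, seq_bad, seq_bad]
  · obtain ⟨c, rfl, hc⟩ := map_eq_mk _ (fun _ _ => VFun.ap_src _ _) h'.symm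
    rw [seq_mk lab h₀, seq_mk lab (by rw [VCat.seq_tgt _ h₀, hc]), seq_mk lab hc.symm,
      seq_mk lab (by rw [VCat.seq_src, h₀]), VCat.seq_assoc _ h₀ hc.symm]

variable (P T) in
/-- The linear terms as an algebra in categories. It separates operations: an operation is
determined by its value on distinct variables. -/
noncomputable def alg : PtAlg.{v} P T where
  L := lalg P T
  src := src
  tgt := tgt
  one := one
  seq := seq
  src_one x := by
    rcases cases x with rfl | ⟨n, lab, x, rfl⟩
    · rfl
    · exact congrArg (mk lab) ((P.O n).one_src x)
  tgt_one x := by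
    rcases cases x with rfl | ⟨n, lab, x, rfl⟩
    · rfl
    · exact congrArg (mk lab) ((P.O n).one_tgt x)
  src_seq f g := by
    by_cases h : Nonempty (Pair f g)
    · obtain ⟨⟨n, lab, a, b, rfl, rfl, h⟩⟩ := h
      rw [seq_mk lab h]
      exact congrArg (mk lab) ((P.O n).seq_src a b)
    · exact congrArg src (dif_neg h)
  tgt_seq := tgt_seq
  one_seq f := by
    rcases cases f with rfl | ⟨n, lab, x, rfl⟩
    · exact seq_bad _
    · exact (seq_mk lab (by rw [one_tgt])).trans (congrArg (mk lab) ((P.O n).one_seq x))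
  seq_one f := by
    rcases cases f with rfl | ⟨n, lab, x, rfl⟩
    · exact seq_bad _
    · exact (seq_mk lab (by rw [one_src])).trans (congrArg (mk lab) ((P.O n).seq_one x))
  seq_assoc := seq_assoc
  op_src f y := op_map _ (fun _ _ => VFun.ap_src _ _) (fun e d c => P.cmp_src e d c) f y
  op_tgt f y := op_map _ (fun _ _ => VFun.ap_tgt _ _) (fun e d c => P.cmp_tgt e d c) f y
  op_one c y := (op_map _ (fun _ _ => (VFun.ap_one _ _).symm) (fun e d c => P.one_cmp e d c) c y).symm
  op_seq {n f g y y'} h h' := by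
    change op _ (fun i => seq (y i) (y' i)) = seq (op f y) (op g y')
    by_cases hy : Good y
    · obtain ⟨⟨k, L, x, hx⟩⟩ := hy
      have H : ∀ i, ∃ z, y' i = mk (emb L i) z ∧
          x i ≫ (P.O (k i)).tgt = z ≫ (P.O (k i)).src := fun i => by
        have h'' := h' i
        rw [hx i] at h''
        obtain ⟨z, h₁, h₂⟩ := map_eq_mk _ (fun _ _ => VFun.ap_src _ _) h''.symm
        exact ⟨z, h₁, h₂.symm⟩
      choose z hz hz' using H
      rw [op_eq f L x hx finSigmaFinEquiv.symm, op_eq g L z hz finSigmaFinEquiv.symm, seq_mk,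
        ← P.seq_cmp _ h hz']
      · exact op_eq _ L _ (fun i => by rw [hx, hz, seq_mk _ (hz' i)]) _
      · rw [P.cmp_src, P.cmp_tgt, h]; simp only [hz']
    · have hy' : ¬ Good fun i => seq (y i) (y' i) := by
        rintro ⟨⟨k, L, x, hx⟩⟩
        have H : ∀ i, ∃ z, y i = mk (emb L i) z := fun i => by
          rcases exists_pair (h' i) with ⟨a, b⟩ | ⟨⟨n, lab, a, b, h₁, h₂, h₃⟩⟩
          · have : seq (y i) (y' i) = _ := hx i
            rw [a] at this
            exact absurd (this.symm.trans (seq_bad _)) (mk_ne _ _)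
          · have : seq (y i) (y' i) = _ := hx i
            rw [h₁, h₂, seq_mk _ h₃] at this
            obtain ⟨f, hf, -⟩ := mk_eq_iff.1 this
            refine ⟨(P.act f.symm).ap a, h₁.trans (mk_eq_iff.2 ⟨f, hf, ?_⟩)⟩
            rw [P.act_trans, Equiv.self_trans_symm, P.act_refl]
        choose z hz using H
        exact hy ⟨⟨k, L, z, hz⟩⟩
      rw [op_of_not _ hy, op_of_not _ hy', seq_bad]

/-- The variable with label `i`. -/
noncomputable def var (i : ℕ) : Car P T l :=
  mk ⟨fun _ : Fin 1 => i, fun _ _ _ => Subsingleton.elim _ _⟩ P.unitP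

theorem op_var {n : ℕ} (c : T ⟶ (P.O n).car l) (lab : Fin n ↪ ℕ) :
    op c (fun i => var (lab i)) = mk lab c := by
  refine (op_eq c ((Equiv.sigmaUnique (Fin n) (fun _ => Fin 1)).toEmbedding.trans lab)
    (fun _ => P.unitP) (fun i => rfl) (Equiv.sigmaUnique (Fin n) (fun _ => Fin 1)).symm).trans ?_
  rw [P.cmp_unit_right]
  rfl

end Lin

/-! ### Powers of an algebra as algebras over the category of operators -/

theorem FMap.fib_spec {m n : ℕ} (φ : FMap m n) (j : Fin n) (r : Fin (φ.c j)) :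
    φ (φ.fib j r).1 = some j := (φ.fib j r).2

theorem FMap.c_pos {m n : ℕ} {φ : FMap m n} {i : Fin m} {j : Fin n} (h : φ i = some j) :
    0 < φ.c j := Fintype.card_pos_iff.2 ⟨⟨i, h⟩⟩

theorem FMap.c_eq_zero {m n : ℕ} {φ : FMap m n} {j : Fin n} (h : ∀ i, φ i ≠ some j) :
    φ.c j = 0 := Fintype.card_eq_zero_iff.2 ⟨fun i => h i.1 i.2⟩

theorem FMap.compE_symm {m n p : ℕ} (ψ : FMap n p) (φ : FMap m n) (j : Fin p) (r : Fin (ψ.c j))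
    (s : Fin (φ.c (ψ.fib j r).1)) :
    ((ψ.comp φ).fib j ((compE ψ φ j).symm ⟨r, s⟩)).1 = (φ.fib _ s).1 := by
  simp [compE, Equiv.sigmaCongrLeft]
  rfl

theorem FMap.smE_symm {m n p q : ℕ} (φ : FMap m n) (ψ : FMap p q) (l : Fin (n * q))
    (r : Fin (φ.c (dec l).1)) (s : Fin (ψ.c (dec l).2)) :
    ((sm φ ψ).fib l ((smE φ ψ l).symm (finProdFinEquiv (r, s)))).1 =
      finProdFinEquiv ((φ.fib _ r).1, (ψ.fib _ s).1) := by
  simp [smE, Equiv.subtypeProdEquivProd]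
  rfl

theorem lblL_symm {n k : ℕ} {j : Fin k → ℕ} (e : Fin n ≃ Σ i, Fin (j i)) (q : ℕ) (i : Fin k)
    (t : Fin (q * j i)) :
    (lblL e q).symm ⟨i, t⟩ = finProdFinEquiv ((dec t).1, e.symm ⟨i, (dec t).2⟩) := rfl

theorem lblR_symm {n k : ℕ} {j : Fin k → ℕ} (e : Fin n ≃ Σ i, Fin (j i)) (q : ℕ) (p : Fin (q * k))
    (t : Fin (j (dec p).2)) :
    (lblR e q).symm ⟨p, t⟩ = finProdFinEquiv ((dec p).1, e.symm ⟨(dec p).2, t⟩) := rfl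

namespace LAlg

variable {P : Operad V} {T : V} {l : Lvl} (B : LAlg.{w} P T l)

/-- The value of the nullary operation. -/
def zero : B.car := B.op P.star Fin.elim0

theorem op_zero {n : ℕ} (hn : n = 0) (c : T ⟶ (P.O n).car l) (y : Fin n → B.car) :
    B.op c y = B.zero := by
  subst hn
  rw [P.eq_star c, zero, Subsingleton.elim y Fin.elim0]

theorem op_const_zero {n : ℕ} (c : T ⟶ (P.O n).car l) : B.op c (fun _ => B.zero) = B.zero := by
  have e : Fin 0 ≃ Σ _ : Fin n, Fin 0 := ⟨Fin.elim0, fun x => x.2, fun x => x.elim0, fun x => x.2.elim0⟩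
  refine Eq.trans ?_ ((B.op_cmp e c (fun _ => P.star) Fin.elim0).symm.trans (B.op_zero rfl _ _))
  exact congrArg (B.op c) (funext fun i => (B.op_zero (n := 0) rfl _ _).symm)

theorem op_pair {j k : ℕ} (x : T ⟶ (P.O j).car l) (y : T ⟶ (P.O k).car l)
    (z : Fin (j * k) → B.car) :
    B.op (P.pair x y) z = B.op x fun i => B.op y fun s => z (finProdFinEquiv (i, s)) :=
  B.op_cmp _ _ _ _

variable {m n p q : ℕ}

/-- The action of `D` on the powers of an algebra. -/
def R {φ : FMap m n} (c : DPt P l T φ) (X : Fin m → B.car) : Fin n → B.car :=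
  fun j => B.op (c j) fun r => X (φ.fib j r).1

theorem R_cast {φ φ' : FMap m n} (h : φ = φ') (c : DPt P l T φ) : B.R (c.cast h) = B.R c := by
  subst h; rfl

theorem R_comp {ψ : FMap n p} {φ : FMap m n} (d : DPt P l T ψ) (c : DPt P l T φ)
    (X : Fin m → B.car) : B.R (d.comp c) X = B.R d (B.R c X) := by
  funext j
  refine (B.op_cmp _ _ _ _).trans ?_
  simp only [compE_symm]
  rfl

theorem R_sm {φ : FMap m n} {ψ : FMap p q} (c : DPt P l T φ) (d : DPt P l T ψ)
    (X : Fin (m * p) → B.car) (j : Fin (n * q)) :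
    B.R (c.sm d) X j =
      B.R c (fun i => B.R d (fun i' => X (finProdFinEquiv (i, i'))) (dec j).2) (dec j).1 := by
  refine (B.op_act _ _ _).trans ((B.op_pair _ _ _).trans ?_)
  simp only [smE_symm]
  rfl

theorem op_pair_flip {j k : ℕ} (x : T ⟶ (P.O j).car l) (y : T ⟶ (P.O k).car l)
    (G : Fin j → Fin k → B.car) :
    B.op ((P.act (flip k j)).ap (P.pair x y)) (fun q => G (dec q).2 (dec q).1) =
      B.op x fun i => B.op y (G i) := by
  rw [op_act, op_pair]
  simp [flip, dec]

theorem op_pair_dec {j k : ℕ} (x : T ⟶ (P.O j).car l) (y : T ⟶ (P.O k).car l)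
    (G : Fin j → Fin k → B.car) :
    B.op (P.pair y x) (fun q => G (dec q).2 (dec q).1) = B.op y fun s => B.op x fun i => G i s := by
  rw [op_pair]
  simp [dec]

theorem op_low {n : ℕ} (h : n ≤ 1) (hn : 0 < n) (y : Fin n → B.car) :
    B.op ((P.O n).deg l (terminal.from T ≫ P.low n h)) y = y ⟨0, hn⟩ := by
  obtain rfl : n = 1 := by omega
  exact B.op_unit y

theorem R_iota {φ : FMap m n} (h : φ.IsPi) (X : Fin m → B.car) {i : Fin m} {j : Fin n}
    (hij : φ i = some j) : B.R (DPt.iota φ h) X j = X i := by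
  refine (B.op_low (h j) (c_pos hij) _).trans (congrArg X ?_)
  have := Fintype.card_le_one_iff.1 (h j) (φ.fib j ⟨0, c_pos hij⟩) ⟨i, hij⟩
  rw [this]

theorem R_iota_zero {φ : FMap m n} (h : φ.IsPi) (X : Fin m → B.car) {j : Fin n}
    (hj : ∀ i, φ i ≠ some j) : B.R (DPt.iota φ h) X j = B.zero :=
  B.op_zero (c_eq_zero hj) _ _

theorem R_iota_some (h : IsPi (some : FMap m m)) (X : Fin m → B.car) :
    B.R (DPt.iota some h) X = X := funext fun _ => B.R_iota h X rfl

theorem R_iota_ofEquiv (e : Fin m ≃ Fin n) (h : IsPi (ofEquiv e)) (X : Fin m → B.car) (j : Fin n) :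
    B.R (DPt.iota (ofEquiv e) h) X j = X (e.symm j) :=
  B.R_iota h X (congrArg some (e.apply_symm_apply j))

theorem R_zero {φ : FMap m n} (c : DPt P l T φ) :
    B.R c (fun _ => B.zero) = fun _ => B.zero := funext fun _ => B.op_const_zero _

end LAlg

/-- Operations which act in the same way on all algebras in sets are equal. -/
theorem Lin.ext_of_op {P : Operad V} {T : V} {l : Lvl} {n : ℕ} {c c' : T ⟶ (P.O n).car l}
    (h : ∀ (B : LAlg.{v} P T l) (X : Fin n → B.car), B.op c X = B.op c' X) : c = c' :=
  Lin.mk_inj (n := n) (lab := Fin.valEmbedding) ((Lin.op_var c Fin.valEmbedding).symm.trans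
    ((h (Lin.lalg P T l) fun i => Lin.var i).trans (Lin.op_var c' Fin.valEmbedding)))

namespace DPt

variable {P : Operad V} {T : V} {l : Lvl} {m n p q : ℕ}

/-- Operations which act in the same way on all algebras in sets are equal. -/
theorem ext_of_R {φ : FMap m n} {c c' : DPt P l T φ}
    (h : ∀ (B : LAlg.{v} P T l) (X : Fin m → B.car), B.R c X = B.R c' X) : c = c' := by
  funext j
  have := congrFun (h (Lin.lalg P T l) fun i => Lin.var i) j
  let lab : Fin (φ.c j) ↪ ℕ :=
    (φ.fib j).toEmbedding.trans ((Function.Embedding.subtype _).trans Fin.valEmbedding)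
  exact Lin.mk_inj ((Lin.op_var (c j) lab).symm.trans (this.trans (Lin.op_var (c' j) lab)))

/-- Arrows of operations which act in the same way on the identity arrows of all algebras in
categories are equal. -/
theorem ext_of_R_one {φ : FMap m n} {c c' : DPt P .mor T φ}
    (h : ∀ (B : PtAlg.{v} P T) (X : Fin m → (B.L .ob).car),
      (B.L .mor).R c (fun i => B.one (X i)) = (B.L .mor).R c' fun i => B.one (X i)) : c = c' := by
  funext j
  have := congrFun (h (Lin.alg P T) fun i => Lin.var i) j
  let lab : Fin (φ.c j) ↪ ℕ :=
    (φ.fib j).toEmbedding.trans ((Function.Embedding.subtype _).trans Fin.valEmbedding)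
  exact Lin.mk_inj ((Lin.op_var (c j) lab).symm.trans (this.trans (Lin.op_var (c' j) lab)))

/-- The source of an arrow of `D`. -/
def src {φ : FMap m n} (c : DPt P .mor T φ) : DPt P .ob T φ := fun j => c j ≫ (P.O _).src

/-- The target of an arrow of `D`. -/
def tgt {φ : FMap m n} (c : DPt P .mor T φ) : DPt P .ob T φ := fun j => c j ≫ (P.O _).tgt

/-- The restriction of a generalized point of `D`. -/
def res {S : V} (t : S ⟶ T) {φ : FMap m n} (c : DPt P l T φ) : DPt P l S φ := fun j => t ≫ c j

theorem one_src {φ : FMap m n} (c : DPt P .ob T φ) : c.one.src = c := funext fun _ => VCat.one_src _ _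

theorem one_tgt {φ : FMap m n} (c : DPt P .ob T φ) : c.one.tgt = c := funext fun _ => VCat.one_tgt _ _

theorem seq_src {φ : FMap m n} (f g : DPt P .mor T φ) : (f.seq g).src = f.src :=
  funext fun _ => VCat.seq_src _ _ _

theorem seq_tgt {φ : FMap m n} {f g : DPt P .mor T φ} (h : f.tgt = g.src) : (f.seq g).tgt = g.tgt :=
  funext fun j => VCat.seq_tgt _ (congrFun h j)

theorem one_seq {φ : FMap m n} (f : DPt P .mor T φ) : f.src.one.seq f = f :=
  funext fun _ => VCat.one_seq _ _

theorem seq_one {φ : FMap m n} (f : DPt P .mor T φ) : f.seq f.tgt.one = f :=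
  funext fun _ => VCat.seq_one _ _

theorem cast_src {φ φ' : FMap m n} (h : φ = φ') (c : DPt P .mor T φ) :
    (c.cast h).src = c.src.cast h := by subst h; rfl

theorem cast_tgt {φ φ' : FMap m n} (h : φ = φ') (c : DPt P .mor T φ) :
    (c.cast h).tgt = c.tgt.cast h := by subst h; rfl

theorem cast_one {φ φ' : FMap m n} (h : φ = φ') (c : DPt P .ob T φ) :
    (c.cast h).one = c.one.cast h := by subst h; rfl

theorem comp_src {ψ : FMap n p} {φ : FMap m n} (d : DPt P .mor T ψ) (c : DPt P .mor T φ) :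
    (d.comp c).src = d.src.comp c.src := funext fun _ => P.cmp_src _ _ _

theorem comp_tgt {ψ : FMap n p} {φ : FMap m n} (d : DPt P .mor T ψ) (c : DPt P .mor T φ) :
    (d.comp c).tgt = d.tgt.comp c.tgt := funext fun _ => P.cmp_tgt _ _ _

theorem comp_one {ψ : FMap n p} {φ : FMap m n} (d : DPt P .ob T ψ) (c : DPt P .ob T φ) :
    (d.comp c).one = d.one.comp c.one := funext fun _ => P.one_cmp _ _ _

theorem sm_src {φ : FMap m n} {ψ : FMap p q} (c : DPt P .mor T φ) (d : DPt P .mor T ψ) :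
    (c.sm d).src = c.src.sm d.src :=
  funext fun _ => (VFun.ap_src _ _).trans (congrArg _ (P.cmp_src _ _ _))

theorem sm_tgt {φ : FMap m n} {ψ : FMap p q} (c : DPt P .mor T φ) (d : DPt P .mor T ψ) :
    (c.sm d).tgt = c.tgt.sm d.tgt :=
  funext fun _ => (VFun.ap_tgt _ _).trans (congrArg _ (P.cmp_tgt _ _ _))

theorem sm_one {φ : FMap m n} {ψ : FMap p q} (c : DPt P .ob T φ) (d : DPt P .ob T ψ) :
    (c.sm d).one = c.one.sm d.one :=
  funext fun _ => (VFun.ap_one _ _).symm.trans (congrArg _ (P.one_cmp _ _ _))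

theorem iota_one {φ : FMap m n} (h : φ.IsPi) :
    (iota φ h : DPt P .ob T φ).one = iota φ h := rfl

theorem iota_src {φ : FMap m n} (h : φ.IsPi) : (iota φ h : DPt P .mor T φ).src = iota φ h :=
  one_src _

theorem iota_tgt {φ : FMap m n} (h : φ.IsPi) : (iota φ h : DPt P .mor T φ).tgt = iota φ h :=
  one_tgt _

theorem cast_cast {φ φ' φ'' : FMap m n} (h : φ = φ') (h' : φ' = φ'') (c : DPt P l T φ) :
    (c.cast h).cast h' = c.cast (h.trans h') := by subst h h'; rfl

theorem cast_self {φ : FMap m n} (h : φ = φ) (c : DPt P l T φ) : c.cast h = c := rfl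

section res

variable {S : V} (t : S ⟶ T)

theorem res_cast {φ φ' : FMap m n} (h : φ = φ') (c : DPt P l T φ) :
    (c.cast h).res t = (c.res t).cast h := by subst h; rfl

theorem res_one {φ : FMap m n} (c : DPt P .ob T φ) : c.one.res t = (c.res t).one :=
  funext fun _ => VCat.comp_one _ _ _

theorem res_seq {φ : FMap m n} {f g : DPt P .mor T φ} (h : f.tgt = g.src) :
    (f.seq g).res t = (f.res t).seq (g.res t) :=
  funext fun j => VCat.comp_seq _ _ (congrFun h j)

theorem res_iota {φ : FMap m n} (h : φ.IsPi) : (iota φ h : DPt P l T φ).res t = iota φ h :=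
  funext fun j => by
    rw [res, iota, one_deg, ← Category.assoc, Subsingleton.elim (t ≫ terminal.from _) (terminal.from S)]
    rfl

theorem res_comp {ψ : FMap n p} {φ : FMap m n} (d : DPt P l T ψ) (c : DPt P l T φ) :
    (d.comp c).res t = (d.res t).comp (c.res t) := funext fun _ => P.comp_cmp _ _ _ _

theorem res_sm {φ : FMap m n} {ψ : FMap p q} (c : DPt P l T φ) (d : DPt P l T ψ) :
    (c.sm d).res t = (c.res t).sm (d.res t) :=
  funext fun _ => (VFun.comp_ap _ _ _).trans (congrArg _ (P.comp_cmp _ _ _ _))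

theorem res_smk : ∀ {k : ℕ} {m n : Fin k → ℕ} {φ : ∀ i, FMap (m i) (n i)}
    (c : ∀ i, DPt P l T (φ i)), (smk c).res t = smk fun i => (c i).res t
  | 0, _, _, _, _ => res_iota t _
  | _ + 1, _, _, _, c => (res_sm t _ _).trans (congrArg _ (res_smk fun i => c i.succ))

end res

section smk

variable {k : ℕ} {m n p : Fin k → ℕ}

theorem smk_src : ∀ {k : ℕ} {m n : Fin k → ℕ} {φ : ∀ i, FMap (m i) (n i)}
    (c : ∀ i, DPt P .mor T (φ i)), (smk c).src = smk fun i => (c i).src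
  | 0, _, _, _, _ => iota_src _
  | _ + 1, _, _, _, c => (sm_src _ _).trans (congrArg _ (smk_src fun i => c i.succ))

theorem smk_tgt : ∀ {k : ℕ} {m n : Fin k → ℕ} {φ : ∀ i, FMap (m i) (n i)}
    (c : ∀ i, DPt P .mor T (φ i)), (smk c).tgt = smk fun i => (c i).tgt
  | 0, _, _, _, _ => iota_tgt _
  | _ + 1, _, _, _, c => (sm_tgt _ _).trans (congrArg _ (smk_tgt fun i => c i.succ))

theorem smk_one : ∀ {k : ℕ} {m n : Fin k → ℕ} {φ : ∀ i, FMap (m i) (n i)}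
    (c : ∀ i, DPt P .ob T (φ i)), (smk c).one = smk fun i => (c i).one
  | 0, _, _, _, _ => iota_one _
  | _ + 1, _, _, _, c => (sm_one _ _).trans (congrArg _ (smk_one fun i => c i.succ))

end smk

end DPt

namespace PtAlg

variable {P : Operad V} {T : V} (B : PtAlg.{w} P T) {n : ℕ}

theorem one_seq' {f : (B.L .mor).car} {x : (B.L .ob).car} (h : B.src f = x) :
    B.seq (B.one x) f = f := by rw [← h, B.one_seq]

theorem seq_one' {f : (B.L .mor).car} {x : (B.L .ob).car} (h : B.tgt f = x) :
    B.seq f (B.one x) = f := by rw [← h, B.seq_one]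

theorem op_one_src (c : T ⟶ (P.O n).car .ob) (y : Fin n → (B.L .mor).car) :
    B.src ((B.L .mor).op ((P.O n).one c) y) = (B.L .ob).op c fun i => B.src (y i) := by
  rw [B.op_src, VCat.one_src]

theorem op_one_tgt (c : T ⟶ (P.O n).car .ob) (y : Fin n → (B.L .mor).car) :
    B.tgt ((B.L .mor).op ((P.O n).one c) y) = (B.L .ob).op c fun i => B.tgt (y i) := by
  rw [B.op_tgt, VCat.one_tgt]

theorem op_one_seq (c : T ⟶ (P.O n).car .ob) {y y' : Fin n → (B.L .mor).car}
    (h : ∀ i, B.tgt (y i) = B.src (y' i)) :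
    (B.L .mor).op ((P.O n).one c) (fun i => B.seq (y i) (y' i)) =
      B.seq ((B.L .mor).op ((P.O n).one c) y) ((B.L .mor).op ((P.O n).one c) y') := by
  rw [← B.op_seq (by rw [VCat.one_src, VCat.one_tgt]) h]
  have := (P.O n).one_seq ((P.O n).one c)
  rw [VCat.one_src] at this
  rw [this]

theorem op_seq_one {f g : T ⟶ (P.O n).car .mor} (h : f ≫ (P.O n).tgt = g ≫ (P.O n).src)
    (y : Fin n → (B.L .ob).car) :
    (B.L .mor).op ((P.O n).seq f g) (fun i => B.one (y i)) =
      B.seq ((B.L .mor).op f fun i => B.one (y i)) ((B.L .mor).op g fun i => B.one (y i)) := by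
  rw [← B.op_seq h fun i => by rw [B.src_one, B.tgt_one]]
  simp only [B.one_seq' (B.src_one _)]

section R

variable {m n p q : ℕ} {φ : FMap m n}

theorem R_src (c : DPt P .mor T φ) (X : Fin m → (B.L .mor).car) (j : Fin n) :
    B.src ((B.L .mor).R c X j) = (B.L .ob).R c.src (fun i => B.src (X i)) j := B.op_src _ _

theorem R_tgt (c : DPt P .mor T φ) (X : Fin m → (B.L .mor).car) (j : Fin n) :
    B.tgt ((B.L .mor).R c X j) = (B.L .ob).R c.tgt (fun i => B.tgt (X i)) j := B.op_tgt _ _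

theorem R_one (c : DPt P .ob T φ) (X : Fin m → (B.L .ob).car) (j : Fin n) :
    (B.L .mor).R c.one (fun i => B.one (X i)) j = B.one ((B.L .ob).R c X j) := B.op_one _ _

theorem R_seq {f g : DPt P .mor T φ} (h : f.tgt = g.src) {X Y : Fin m → (B.L .mor).car}
    (h' : ∀ i, B.tgt (X i) = B.src (Y i)) (j : Fin n) :
    (B.L .mor).R (f.seq g) (fun i => B.seq (X i) (Y i)) j =
      B.seq ((B.L .mor).R f X j) ((B.L .mor).R g Y j) :=
  B.op_seq (congrFun h j) fun _ => h' _

theorem R_one_seq (c : DPt P .ob T φ) {X Y : Fin m → (B.L .mor).car}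
    (h' : ∀ i, B.tgt (X i) = B.src (Y i)) (j : Fin n) :
    (B.L .mor).R c.one (fun i => B.seq (X i) (Y i)) j =
      B.seq ((B.L .mor).R c.one X j) ((B.L .mor).R c.one Y j) :=
  B.op_one_seq _ fun _ => h' _

theorem R_seq_one {f g : DPt P .mor T φ} (h : f.tgt = g.src) (X : Fin m → (B.L .ob).car)
    (j : Fin n) :
    (B.L .mor).R (f.seq g) (fun i => B.one (X i)) j =
      B.seq ((B.L .mor).R f (fun i => B.one (X i)) j) ((B.L .mor).R g (fun i => B.one (X i)) j) :=
  B.op_seq_one (congrFun h j) _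

theorem R_one_src (c : DPt P .ob T φ) (X : Fin m → (B.L .mor).car) (j : Fin n) :
    B.src ((B.L .mor).R c.one X j) = (B.L .ob).R c (fun i => B.src (X i)) j := by
  rw [R_src, DPt.one_src]

theorem R_one_tgt (c : DPt P .ob T φ) (X : Fin m → (B.L .mor).car) (j : Fin n) :
    B.tgt ((B.L .mor).R c.one X j) = (B.L .ob).R c (fun i => B.tgt (X i)) j := by
  rw [R_tgt, DPt.one_tgt]

end R

/-! ### The interchange arrows in an algebra -/

variable (α : PseudoComm P) {j k : ℕ}

/-- The value of `α(x, y)` on an array of objects: an arrow from `x(y(W))` to `y(x(W))`, where `x`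
acts on the first and `y` on the second coordinate of `W`. -/
noncomputable def al (x : T ⟶ (P.O j).car .ob) (y : T ⟶ (P.O k).car .ob)
    (W : Fin j → Fin k → (B.L .ob).car) : (B.L .mor).car :=
  (B.L .mor).op (α.ap x y) fun q => B.one (W (dec q).2 (dec q).1)

theorem al_src (x : T ⟶ (P.O j).car .ob) (y : T ⟶ (P.O k).car .ob)
    (W : Fin j → Fin k → (B.L .ob).car) :
    B.src (B.al α x y W) = (B.L .ob).op x fun i => (B.L .ob).op y (W i) := by
  rw [al, B.op_src, α.ap_src]
  simp only [B.src_one]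
  exact (B.L .ob).op_pair_flip x y W

theorem al_tgt (x : T ⟶ (P.O j).car .ob) (y : T ⟶ (P.O k).car .ob)
    (W : Fin j → Fin k → (B.L .ob).car) :
    B.tgt (B.al α x y W) = (B.L .ob).op y fun s => (B.L .ob).op x fun i => W i s := by
  rw [al, B.op_tgt, α.ap_tgt]
  simp only [B.tgt_one]
  exact (B.L .ob).op_pair_dec x y W

theorem al_nat (x : T ⟶ (P.O j).car .mor) (y : T ⟶ (P.O k).car .mor)
    (G : Fin j → Fin k → (B.L .mor).car) :
    B.seq ((B.L .mor).op x fun i => (B.L .mor).op y (G i))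
        (B.al α (x ≫ (P.O j).tgt) (y ≫ (P.O k).tgt) fun i s => B.tgt (G i s)) =
      B.seq (B.al α (x ≫ (P.O j).src) (y ≫ (P.O k).src) fun i s => B.src (G i s))
        ((B.L .mor).op y fun s => (B.L .mor).op x fun i => G i s) := by
  have h := α.nat x y
  rw [← (B.L .mor).op_pair_flip x y G, al, al, ← B.op_seq, ← (B.L .mor).op_pair_dec x y G, ← B.op_seq]
  · simp only [B.one_seq, B.seq_one]
    exact congrArg (fun f => (B.L .mor).op f fun q => G (dec q).2 (dec q).1) h
  · rw [α.ap_tgt]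
    exact (P.cmp_src _ _ _).symm
  · intro i
    rw [B.tgt_one]
  · rw [α.ap_src, VFun.ap_tgt]
    exact congrArg _ (P.cmp_tgt _ _ _)
  · intro i
    rw [B.src_one]

theorem al_nat' (x : T ⟶ (P.O j).car .ob) (y : T ⟶ (P.O k).car .ob)
    (G : Fin j → Fin k → (B.L .mor).car) :
    B.seq ((B.L .mor).op ((P.O j).one x) fun i => (B.L .mor).op ((P.O k).one y) (G i))
        (B.al α x y fun i s => B.tgt (G i s)) =
      B.seq (B.al α x y fun i s => B.src (G i s))
        ((B.L .mor).op ((P.O k).one y) fun s => (B.L .mor).op ((P.O j).one x) fun i => G i s) := by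
  simpa only [VCat.one_src, VCat.one_tgt] using B.al_nat α ((P.O j).one x) ((P.O k).one y) G

theorem al_symm (x : T ⟶ (P.O j).car .ob) (y : T ⟶ (P.O k).car .ob)
    (W : Fin j → Fin k → (B.L .ob).car) :
    B.seq (B.al α x y W) (B.al α y x fun s i => W i s) =
      B.one ((B.L .ob).op x fun i => (B.L .ob).op y (W i)) := by
  have h := congrArg (fun f => (B.L .mor).op f fun q => B.one (W (dec q).1 (dec q).2)) (α.symm x y)
  change (B.L .mor).op ((P.O _).seq ((P.act (flip j k)).ap (α.ap x y)) (α.ap y x)) _ = _ at h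
  rw [B.op_seq_one] at h
  · refine Eq.trans (congrArg (B.seq · _) ?_) (h.trans ?_)
    · rw [LAlg.op_act, al]
      simp [flip, dec]
    · rw [B.op_one, LAlg.op_pair]
      simp [dec]
  · rw [VFun.ap_tgt]
    change (P.act (flip j k)).ap (α.ap x y ≫ _) = α.ap y x ≫ _
    rw [α.ap_src, α.ap_tgt]

theorem al_cmp_left {n : ℕ} {r : Fin k → ℕ} {q : ℕ} (e : Fin n ≃ Σ i, Fin (r i))
    (x : T ⟶ (P.O k).car .ob) (y : ∀ i, T ⟶ (P.O (r i)).car .ob) (z : T ⟶ (P.O q).car .ob)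
    (W : Fin n → Fin q → (B.L .ob).car) :
    B.al α (P.cmp e x y) z W =
      B.seq ((B.L .mor).op ((P.O k).one x) fun i => B.al α (y i) z fun t => W (e.symm ⟨i, t⟩))
        (B.al α x z fun i s => (B.L .ob).op (y i) fun t => W (e.symm ⟨i, t⟩) s) := by
  have h : α.ap (P.cmp e x y) z = _ := α.cmp e x y z
  rw [al, h, B.op_seq_one, LAlg.op_cmp, LAlg.op_cmp, al]
  · congr 2
    · funext i
      rw [al]
      congr 1
      funext t
      rw [lblL_symm, dec_mk]
    · funext p
      rw [← B.op_one]
      congr 1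
      funext t
      rw [lblR_symm, dec_mk]
  · have e₁ : ∀ i, (pr (y i) z ≫ α.α (r i) q) ≫ (P.O _).tgt = _ := fun i => α.tgt (y i) z
    have e₂ : (pr x z ≫ α.α k q) ≫ (P.O _).src = _ := α.src x z
    rw [P.cmp_src, P.cmp_tgt, VCat.one_tgt, e₂]
    simp only [VCat.one_src, e₁]
    refine Lin.ext_of_op fun C X => ?_
    rw [LAlg.op_cmp, LAlg.op_cmp]
    refine Eq.trans ?_ (C.op_pair_flip x z fun i s => C.op (y i) fun t =>
      X (finProdFinEquiv (s, e.symm ⟨i, t⟩))).symm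
    refine congrArg (C.op x) (funext fun i => ?_)
    rw [LAlg.op_pair]
    refine congrArg (C.op z) (funext fun s => congrArg (C.op _) (funext fun t => ?_))
    rw [lblL_symm, dec_mk]

end PtAlg

namespace PtAlg

variable {P : Operad V} {T : V} (B : PtAlg.{w} P T) (α : PseudoComm P)

/-- Inverse arrows are unique. -/
theorem eq_of_inv {f f' g : (B.L .mor).car} (h : B.tgt f' = B.src g) (h₁ : B.tgt g = B.src f)
    (h₂ : B.seq f' g = B.one (B.src f)) (h₃ : B.seq g f = B.one (B.tgt f')) : f' = f := by
  rw [← B.seq_one f', ← h₃, ← B.seq_assoc h h₁, h₂, B.one_seq]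

section al

variable {j k : ℕ}

theorem one_zero : B.one (B.L .ob).zero = (B.L .mor).zero := by
  have := B.op_one (P.star : T ⟶ (P.O 0).car .ob) Fin.elim0
  rw [LAlg.zero, ← this]
  exact (B.L .mor).op_zero rfl _ _

theorem al_inv (x : T ⟶ (P.O j).car .ob) (y : T ⟶ (P.O k).car .ob)
    (W : Fin j → Fin k → (B.L .ob).car) {f : (B.L .mor).car}
    (hf : B.tgt f = (B.L .ob).op y fun s => (B.L .ob).op x fun i => W i s)
    (h : B.seq f (B.al α y x fun s i => W i s) =
      B.one ((B.L .ob).op x fun i => (B.L .ob).op y (W i))) : f = B.al α x y W :=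
  B.eq_of_inv (g := B.al α y x fun s i => W i s) (by rw [hf, al_src]) (by rw [al_src, al_tgt])
    (by rw [h, al_src]) (by rw [al_symm, hf])

theorem al_act_left {j' : ℕ} (e : Fin j' ≃ Fin j) (x : T ⟶ (P.O j).car .ob)
    (y : T ⟶ (P.O k).car .ob) (W : Fin j' → Fin k → (B.L .ob).car) :
    B.al α ((P.act e).ap x) y W = B.al α x y fun i => W (e.symm i) := by
  obtain rfl : j' = j := by simpa using Fintype.card_congr e
  have h := α.equivariant x y e (Equiv.refl _)
  rw [P.act_refl] at h
  rw [al, PseudoComm.ap, ← h, LAlg.op_act, al]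
  simp [prodE, dec, PseudoComm.ap]

theorem al_act_right {k' : ℕ} (e : Fin k' ≃ Fin k) (x : T ⟶ (P.O j).car .ob)
    (y : T ⟶ (P.O k).car .ob) (W : Fin j → Fin k' → (B.L .ob).car) :
    B.al α x ((P.act e).ap y) W = B.al α x y fun i s => W i (e.symm s) := by
  obtain rfl : k' = k := by simpa using Fintype.card_congr e
  have h := α.equivariant x y (Equiv.refl _) e
  rw [P.act_refl] at h
  rw [al, PseudoComm.ap, ← h, LAlg.op_act, al]
  simp [prodE, dec, PseudoComm.ap]

theorem al_cmp_right {n : ℕ} {r : Fin k → ℕ} {q : ℕ} (e : Fin n ≃ Σ i, Fin (r i))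
    (x : T ⟶ (P.O k).car .ob) (y : ∀ i, T ⟶ (P.O (r i)).car .ob) (z : T ⟶ (P.O q).car .ob)
    (W : Fin q → Fin n → (B.L .ob).car) :
    B.al α z (P.cmp e x y) W =
      B.seq (B.al α z x fun s i => (B.L .ob).op (y i) fun t => W s (e.symm ⟨i, t⟩))
        ((B.L .mor).op ((P.O k).one x) fun i => B.al α z (y i) fun s t => W s (e.symm ⟨i, t⟩)) := by
  refine (B.al_inv α _ _ _ ?_ ?_).symm
  · rw [B.tgt_seq]
    · rw [op_one_tgt, LAlg.op_cmp]
      simp only [al_tgt]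
    · rw [op_one_src, al_tgt]
      simp only [al_src]
  · have h := B.op_one_seq x (y := fun i => B.al α z (y i) fun s t => W s (e.symm ⟨i, t⟩))
      (y' := fun i => B.al α (y i) z fun t s => W s (e.symm ⟨i, t⟩)) fun i => by
        rw [al_tgt, al_src]
    rw [al_cmp_left, B.seq_assoc, ← B.seq_assoc (f := (B.L .mor).op _ _), ← h]
    · simp only [al_symm]
      rw [B.op_one, B.one_seq', al_symm]
      · simp only [LAlg.op_cmp]
      · rw [al_src]
    · rw [op_one_tgt, op_one_src]
      simp only [al_src, al_tgt]
    · rw [op_one_tgt, al_src]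
      simp only [al_tgt]
    · rw [op_one_src, al_tgt]
      simp only [al_src]
    · rw [op_one_tgt, B.src_seq, op_one_src]
      simp only [al_src, al_tgt]

theorem al_pair_left {q : ℕ} (x : T ⟶ (P.O j).car .ob) (y : T ⟶ (P.O k).car .ob)
    (z : T ⟶ (P.O q).car .ob) (W : Fin (j * k) → Fin q → (B.L .ob).car) :
    B.al α (P.pair x y) z W =
      B.seq ((B.L .mor).op ((P.O j).one x) fun i => B.al α y z fun t => W (finProdFinEquiv (i, t)))
        (B.al α x z fun i s => (B.L .ob).op y fun t => W (finProdFinEquiv (i, t)) s) :=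
  B.al_cmp_left α _ _ _ _ _

theorem al_pair_right {q : ℕ} (x : T ⟶ (P.O j).car .ob) (y : T ⟶ (P.O k).car .ob)
    (z : T ⟶ (P.O q).car .ob) (W : Fin q → Fin (j * k) → (B.L .ob).car) :
    B.al α z (P.pair x y) W =
      B.seq (B.al α z x fun s i => (B.L .ob).op y fun t => W s (finProdFinEquiv (i, t)))
        ((B.L .mor).op ((P.O j).one x) fun i =>
          B.al α z y fun s t => W s (finProdFinEquiv (i, t))) :=
  B.al_cmp_right α _ _ _ _ _

theorem al_unit_left (y : T ⟶ (P.O k).car .ob) (W : Fin 1 → Fin k → (B.L .ob).car) :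
    B.al α P.unitP y W = B.one ((B.L .ob).op y (W 0)) := by
  rw [al, PseudoComm.ap, α.unit, B.op_one, LAlg.op_pair_dec]
  simp only [LAlg.op_unit]

theorem al_low_left (h : j ≤ 1) (y : T ⟶ (P.O k).car .ob) (W : Fin j → Fin k → (B.L .ob).car) :
    B.al α (terminal.from T ≫ P.low j h) y W =
      B.one ((B.L .ob).op (terminal.from T ≫ P.low j h) fun i => (B.L .ob).op y (W i)) := by
  match j, h with
  | 0, h => rw [al, (B.L .mor).op_zero (Nat.mul_zero _), (B.L .ob).op_zero rfl, one_zero]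
  | 1, h =>
    exact (B.al_unit_left α y W).trans
      (congrArg B.one ((B.L .ob).op_unit fun i => (B.L .ob).op y (W i)).symm)
  | _ + 2, h => exact absurd h (by omega)

theorem al_low_right (h : k ≤ 1) (x : T ⟶ (P.O j).car .ob) (W : Fin j → Fin k → (B.L .ob).car) :
    B.al α x (terminal.from T ≫ P.low k h) W =
      B.one ((B.L .ob).op (terminal.from T ≫ P.low k h) fun s => (B.L .ob).op x fun i => W i s) := by
  have e := B.al_low_left α h x fun s i => W i s
  have h₁ := congrArg B.src e
  have h₂ := congrArg B.tgt e
  rw [al_src, B.src_one] at h₁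
  rw [al_tgt, B.tgt_one] at h₂
  refine (B.al_inv α _ _ _ (by rw [B.tgt_one]) ?_).symm
  rw [e, B.one_seq' (by rw [B.src_one]), h₂]

end al

section R

variable {m n p : ℕ} {φ : FMap m n}

theorem R_seq_src {f g : DPt P .mor T φ} (h : f.tgt = g.src) (X : Fin m → (B.L .mor).car)
    (j : Fin n) :
    (B.L .mor).R (f.seq g) X j =
      B.seq ((B.L .mor).R f (fun i => B.one (B.src (X i))) j) ((B.L .mor).R g X j) := by
  rw [← B.R_seq h fun i => B.tgt_one _]
  simp only [B.one_seq]

theorem R_src_seq (f : DPt P .mor T φ) {X Y : Fin m → (B.L .mor).car}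
    (h' : ∀ i, B.tgt (X i) = B.src (Y i)) (j : Fin n) :
    (B.L .mor).R f (fun i => B.seq (X i) (Y i)) j =
      B.seq ((B.L .mor).R f.src.one X j) ((B.L .mor).R f Y j) := by
  rw [← B.R_seq (DPt.one_tgt _) h', DPt.one_seq]

end R

section Al

variable {m n p q r s : ℕ} {φ : FMap m n} {ν : FMap r s}

/-- The interchange arrow for the `i`th component of `a` and the `k`th component of `c`, on an array
indexed by the sources of `a` and `c`. -/
noncomputable def Al (a : DPt P .ob T ν) (c : DPt P .ob T φ) (i : Fin s) (k : Fin n)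
    (W : Fin r → Fin m → (B.L .ob).car) : (B.L .mor).car :=
  B.al α (a i) (c k) fun y x => W (ν.fib i y).1 (φ.fib k x).1

theorem Al_src (a : DPt P .ob T ν) (c : DPt P .ob T φ) (i : Fin s) (k : Fin n)
    (W : Fin r → Fin m → (B.L .ob).car) :
    B.src (B.Al α a c i k W) = (B.L .ob).R a (fun y => (B.L .ob).R c (W y) k) i := B.al_src α _ _ _

theorem Al_tgt (a : DPt P .ob T ν) (c : DPt P .ob T φ) (i : Fin s) (k : Fin n)
    (W : Fin r → Fin m → (B.L .ob).car) :
    B.tgt (B.Al α a c i k W) = (B.L .ob).R c (fun x => (B.L .ob).R a (fun y => W y x) i) k :=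
  B.al_tgt α _ _ _

theorem Al_symm (a : DPt P .ob T ν) (c : DPt P .ob T φ) (i : Fin s) (k : Fin n)
    (W : Fin r → Fin m → (B.L .ob).car) :
    B.seq (B.Al α a c i k W) (B.Al α c a k i fun x y => W y x) =
      B.one ((B.L .ob).R a (fun y => (B.L .ob).R c (W y) k) i) := B.al_symm α _ _ _

theorem Al_nat (a : DPt P .ob T ν) (c : DPt P .ob T φ) (i : Fin s) (k : Fin n)
    (G : Fin r → Fin m → (B.L .mor).car) :
    B.seq ((B.L .mor).R a.one (fun y => (B.L .mor).R c.one (G y) k) i)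
        (B.Al α a c i k fun y x => B.tgt (G y x)) =
      B.seq (B.Al α a c i k fun y x => B.src (G y x))
        ((B.L .mor).R c.one (fun x => (B.L .mor).R a.one (fun y => G y x) i) k) :=
  B.al_nat' α _ _ _

theorem Al_nat_mor (a : DPt P .mor T ν) (c : DPt P .mor T φ) (i : Fin s) (k : Fin n)
    (G : Fin r → Fin m → (B.L .mor).car) :
    B.seq ((B.L .mor).R a (fun y => (B.L .mor).R c (G y) k) i)
        (B.Al α a.tgt c.tgt i k fun y x => B.tgt (G y x)) =
      B.seq (B.Al α a.src c.src i k fun y x => B.src (G y x))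
        ((B.L .mor).R c (fun x => (B.L .mor).R a (fun y => G y x) i) k) :=
  B.al_nat α _ _ _

theorem Al_comp_left {μ : FMap q r} (a : DPt P .ob T ν) (b : DPt P .ob T μ) (c : DPt P .ob T φ)
    (i : Fin s) (k : Fin n) (W : Fin q → Fin m → (B.L .ob).car) :
    B.Al α (a.comp b) c i k W =
      B.seq ((B.L .mor).R a.one (fun y => B.Al α b c y k W) i)
        (B.Al α a c i k fun y x => (B.L .ob).R b (fun z => W z x) y) := by
  refine (B.al_cmp_left α _ _ _ _ _).trans ?_
  simp only [compE_symm]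
  rfl

theorem Al_comp_right {μ : FMap q m} (a : DPt P .ob T ν) (c : DPt P .ob T φ) (b : DPt P .ob T μ)
    (i : Fin s) (k : Fin n) (W : Fin r → Fin q → (B.L .ob).car) :
    B.Al α a (c.comp b) i k W =
      B.seq (B.Al α a c i k fun y x => (B.L .ob).R b (W y) x)
        ((B.L .mor).R c.one (fun x => B.Al α a b i x W) k) := by
  refine (B.al_cmp_right α _ _ _ _ _).trans ?_
  simp only [compE_symm]
  rfl

theorem Al_sm_left {μ : FMap p q} (a : DPt P .ob T ν) (b : DPt P .ob T μ) (c : DPt P .ob T φ)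
    (i : Fin (s * q)) (k : Fin n) (W : Fin (r * p) → Fin m → (B.L .ob).car) :
    B.Al α (a.sm b) c i k W =
      B.seq ((B.L .mor).R a.one (fun y => B.Al α b c (dec i).2 k fun z =>
          W (finProdFinEquiv (y, z))) (dec i).1)
        (B.Al α a c (dec i).1 k fun y x =>
          (B.L .ob).R b (fun z => W (finProdFinEquiv (y, z)) x) (dec i).2) := by
  refine (B.al_act_left α _ _ _ _).trans ((B.al_pair_left α _ _ _ _).trans ?_)
  simp only [smE_symm]
  rfl

theorem Al_sm_right {μ : FMap p q} (a : DPt P .ob T ν) (c : DPt P .ob T φ) (b : DPt P .ob T μ)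
    (i : Fin s) (k : Fin (n * q)) (W : Fin r → Fin (m * p) → (B.L .ob).car) :
    B.Al α a (c.sm b) i k W =
      B.seq (B.Al α a c i (dec k).1 fun y x =>
          (B.L .ob).R b (fun z => W y (finProdFinEquiv (x, z))) (dec k).2)
        ((B.L .mor).R c.one (fun x => B.Al α a b i (dec k).2 fun y z =>
          W y (finProdFinEquiv (x, z))) (dec k).1) := by
  refine (B.al_act_right α _ _ _ _).trans ((B.al_pair_right α _ _ _ _).trans ?_)
  simp only [smE_symm]
  rfl

theorem Al_iota_left (h : ν.IsPi) (c : DPt P .ob T φ) (i : Fin s) (k : Fin n)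
    (W : Fin r → Fin m → (B.L .ob).car) :
    B.Al α (DPt.iota ν h) c i k W =
      B.one ((B.L .ob).R (DPt.iota ν h) (fun y => (B.L .ob).R c (W y) k) i) :=
  B.al_low_left α (h i) _ _

theorem Al_iota_right (h : φ.IsPi) (a : DPt P .ob T ν) (i : Fin s) (k : Fin n)
    (W : Fin r → Fin m → (B.L .ob).car) :
    B.Al α a (DPt.iota φ h) i k W =
      B.one ((B.L .ob).R (DPt.iota φ h) (fun x => (B.L .ob).R a (fun y => W y x) i) k) :=
  B.al_low_right α (h k) _ _

end Al

section theta

variable {m n p q r s : ℕ} {ψ : FMap n p} {φ : FMap m n} {ν : FMap r s} {μ : FMap q r}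

theorem R_theta (d : DPt P .ob T ψ) (a : DPt P .ob T ν) (c : DPt P .ob T φ) (b : DPt P .ob T μ)
    (X : Fin (m * q) → (B.L .ob).car) (i : Fin (p * s)) :
    (B.L .mor).R (DPt.theta α d a c b) (fun z => B.one (X z)) i =
      (B.L .mor).R d.one (fun k => B.Al α a c (dec i).2 k fun y x =>
        (B.L .ob).R b (fun z => X (finProdFinEquiv (x, z))) y) (dec i).1 := by
  refine ((B.L .mor).op_cmp _ _ _ _).trans (congrArg ((B.L .mor).op _) (funext fun x => ?_))
  refine ((B.L .mor).op_cmp _ _ _ _).trans (congrArg ((B.L .mor).op _) (funext fun y => ?_))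
  refine (B.op_one _ _).trans (congrArg (fun Y => B.one ((B.L .ob).op _ Y)) (funext fun z => ?_))
  refine congrArg X ?_
  have h : ∀ (t : Fin (φ.c (ψ.fib (dec i).1 x).1)) (u : Fin ((ν.comp μ).c (dec i).2)),
      ((sm (ψ.comp φ) (ν.comp μ)).fib i (((smE _ _ i).trans <| finProdFinEquiv.symm.trans <|
      ((compE ψ φ (dec i).1).prodCongr (Equiv.refl _)).trans <|
        (Equiv.sigmaProdDistrib _ _).trans <| Equiv.sigmaCongrRight fun _ => finProdFinEquiv).symm
        ⟨x, finProdFinEquiv (t, u)⟩)).1 =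
        finProdFinEquiv ((φ.fib _ t).1, ((ν.comp μ).fib _ u).1) := fun t u => by
    rw [← compE_symm ψ φ, ← smE_symm]
    refine congrArg (fun v => (fib _ i v).1) ((Equiv.symm_apply_eq _).2 ?_)
    simp
  rw [lblR_symm, h, compE_symm]

end theta

end PtAlg

namespace DPt

variable {P : Operad V} {T : V} {l : Lvl} {m n p q r s : ℕ} (α : PseudoComm P)
  {ψ : FMap n p} {φ : FMap m n} {ν : FMap r s} {μ : FMap q r}

/-- Operations which act in the same way on the objects of all algebras in categories are equal. -/
theorem ext_of_pt {c c' : DPt P .ob T φ} (h : ∀ (B : PtAlg.{v} P T) (X : Fin m → (B.L .ob).car) j,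
    (B.L .ob).R c X j = (B.L .ob).R c' X j) : c = c' := by
  funext j
  have := h (Lin.alg P T) (fun i => Lin.var i) j
  let lab : Fin (φ.c j) ↪ ℕ :=
    (φ.fib j).toEmbedding.trans ((Function.Embedding.subtype _).trans Fin.valEmbedding)
  exact Lin.mk_inj ((Lin.op_var (c j) lab).symm.trans (this.trans (Lin.op_var (c' j) lab)))

theorem theta_src (d : DPt P .ob T ψ) (a : DPt P .ob T ν) (c : DPt P .ob T φ) (b : DPt P .ob T μ) :
    (theta α d a c b).src = ((d.sm a).comp (c.sm b)).cast (sm_comp _ _ _ _).symm := by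
  refine ext_of_pt fun B X j => ?_
  have h := B.R_src (theta α d a c b) (fun z => B.one (X z)) j
  simp only [B.src_one] at h
  rw [← h, B.R_theta, B.R_one_src, LAlg.R_cast, LAlg.R_comp, LAlg.R_sm]
  simp only [B.Al_src, LAlg.R_sm, dec_mk]

theorem theta_tgt (d : DPt P .ob T ψ) (a : DPt P .ob T ν) (c : DPt P .ob T φ) (b : DPt P .ob T μ) :
    (theta α d a c b).tgt = (d.comp c).sm (a.comp b) := by
  refine ext_of_pt fun B X j => ?_
  have h := B.R_tgt (theta α d a c b) (fun z => B.one (X z)) j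
  simp only [B.tgt_one] at h
  rw [← h, B.R_theta, B.R_one_tgt]
  simp only [B.Al_tgt, LAlg.R_sm, LAlg.R_comp]

theorem sm_seq {f g : DPt P .mor T φ} (h : f.tgt = g.src) {f' g' : DPt P .mor T μ}
    (h' : f'.tgt = g'.src) : (f.seq g).sm (f'.seq g') = (f.sm f').seq (g.sm g') := by
  refine ext_of_R_one fun B X => funext fun j => ?_
  rw [B.R_seq_one (by rw [sm_src, sm_tgt, h, h'])]
  simp only [LAlg.R_sm, B.R_seq_one h']
  refine B.R_seq h (fun i => ?_) _
  rw [B.R_tgt, B.R_src, h']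
  simp only [B.src_one, B.tgt_one]

/-- The pseudofunctoriality constraint followed by the smash product of two arrows out of
composites. -/
noncomputable def thetaSeq (d : DPt P .ob T ψ) (a : DPt P .ob T ν) (c : DPt P .ob T φ)
    (b : DPt P .ob T μ) {χ : FMap m p} {χ' : FMap q s} (h : ψ.comp φ = χ) (h' : ν.comp μ = χ')
    (t : DPt P .mor T χ) (t' : DPt P .mor T χ') : DPt P .mor T (χ.sm χ') :=
  seq (cast (congrArg₂ FMap.sm h h') (theta α d a c b)) (t.sm t')

theorem thetaSeq_comp (d : DPt P .ob T ψ) (a : DPt P .ob T ν) (c : DPt P .ob T φ)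
    (b : DPt P .ob T μ) {χ : FMap m p} {χ' : FMap q s} (h : ψ.comp φ = χ) (h' : ν.comp μ = χ')
    {t : DPt P .mor T χ} {t' : DPt P .mor T χ'} (ht : t.src = (d.comp c).cast h)
    (ht' : t'.src = (a.comp b).cast h') :
    (cast (congrArg₂ FMap.sm h h') (theta α d a c b)).tgt = (t.sm t').src := by
  subst h h'
  rw [cast_tgt, theta_tgt, sm_src, ht, ht']
  rfl

theorem thetaSeq_src (d : DPt P .ob T ψ) (a : DPt P .ob T ν) (c : DPt P .ob T φ)
    (b : DPt P .ob T μ) {χ : FMap m p} {χ' : FMap q s} (h : ψ.comp φ = χ) (h' : ν.comp μ = χ')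
    (t : DPt P .mor T χ) (t' : DPt P .mor T χ') (h'' : (ψ.sm ν).comp (φ.sm μ) = χ.sm χ') :
    (thetaSeq α d a c b h h' t t').src = ((d.sm a).comp (c.sm b)).cast h'' := by
  rw [thetaSeq, seq_src, cast_src, theta_src, cast_cast]

theorem thetaSeq_tgt (d : DPt P .ob T ψ) (a : DPt P .ob T ν) (c : DPt P .ob T φ)
    (b : DPt P .ob T μ) {χ : FMap m p} {χ' : FMap q s} (h : ψ.comp φ = χ) (h' : ν.comp μ = χ')
    {t : DPt P .mor T χ} {t' : DPt P .mor T χ'} (ht : t.src = (d.comp c).cast h)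
    (ht' : t'.src = (a.comp b).cast h') :
    (thetaSeq α d a c b h h' t t').tgt = t.tgt.sm t'.tgt := by
  rw [thetaSeq, seq_tgt (thetaSeq_comp α d a c b h h' ht ht'), sm_tgt]

theorem R_thetaSeq (d : DPt P .ob T ψ) (a : DPt P .ob T ν) (c : DPt P .ob T φ)
    (b : DPt P .ob T μ) {χ : FMap m p} {χ' : FMap q s} (h : ψ.comp φ = χ) (h' : ν.comp μ = χ')
    {t : DPt P .mor T χ} {t' : DPt P .mor T χ'} (ht : t.src = (d.comp c).cast h)
    (ht' : t'.src = (a.comp b).cast h') (B : PtAlg.{w} P T) (X : Fin (m * q) → (B.L .mor).car)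
    (j : Fin (p * s)) :
    (B.L .mor).R (thetaSeq α d a c b h h' t t') X j =
      B.seq ((B.L .mor).R d.one (fun k => B.Al α a c (dec j).2 k fun y x =>
          (B.L .ob).R b (fun z => B.src (X (finProdFinEquiv (x, z)))) y) (dec j).1)
        ((B.L .mor).R t (fun x => (B.L .mor).R t' (fun z => X (finProdFinEquiv (x, z)))
          (dec j).2) (dec j).1) := by
  rw [thetaSeq, B.R_seq_src (thetaSeq_comp α d a c b h h' ht ht'), LAlg.R_cast, B.R_theta,
    LAlg.R_sm]

theorem thetak_src : ∀ {k : ℕ} {m n p : Fin k → ℕ} {ψ : ∀ i, FMap (n i) (p i)}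
    {φ : ∀ i, FMap (m i) (n i)} (d : ∀ i, DPt P .ob T (ψ i)) (c : ∀ i, DPt P .ob T (φ i)),
    (thetak α d c).src = ((smk d).comp (smk c)).cast (FMap.smk_comp _ _).symm
  | 0, _, _, _, _, _, _, _ => by
    refine ext_of_pt fun B X j => ?_
    rw [LAlg.R_cast, LAlg.R_comp]
    change (B.L .ob).R (iota some isPi_some : DPt P .mor T some).src X j = _
    rw [iota_src]
    exact congrFun (((B.L .ob).R_iota_some _ X).trans (((B.L .ob).R_iota_some _ _).trans
      ((B.L .ob).R_iota_some _ X)).symm) j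
  | _ + 1, _, _, _, ψ, φ, d, c =>
    thetaSeq_src α (d 0) (smk fun i => d i.succ) (c 0) (smk fun i => c i.succ) rfl
      (FMap.smk_comp _ _).symm _ (thetak α (fun i => d i.succ) fun i => c i.succ)
      (FMap.smk_comp ψ φ).symm

theorem thetak_tgt : ∀ {k : ℕ} {m n p : Fin k → ℕ} {ψ : ∀ i, FMap (n i) (p i)}
    {φ : ∀ i, FMap (m i) (n i)} (d : ∀ i, DPt P .ob T (ψ i)) (c : ∀ i, DPt P .ob T (φ i)),
    (thetak α d c).tgt = smk fun i => (d i).comp (c i)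
  | 0, _, _, _, _, _, _, _ => iota_tgt _
  | _ + 1, _, _, _, _, _, d, c =>
    (thetaSeq_tgt α (d 0) (smk fun i => d i.succ) (c 0) (smk fun i => c i.succ) rfl
      (FMap.smk_comp _ _).symm (one_src _)
      (thetak_src α (fun i => d i.succ) fun i => c i.succ)).trans
      (congrArg₂ sm (one_tgt _) (thetak_tgt (fun i => d i.succ) fun i => c i.succ))

end DPt

/-! ### The iterated smash product of a concatenated list -/

theorem fin_assoc {a b c : ℕ} (h : a * b * c = a * (b * c)) (x : Fin a) (y : Fin b) (z : Fin c) :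
    Fin.cast h (finProdFinEquiv (finProdFinEquiv (x, y), z)) =
      finProdFinEquiv (x, finProdFinEquiv (y, z)) :=
  Fin.ext <| by simp [finProdFinEquiv]; ring

theorem fin_one_mul {n : ℕ} (h : 1 * n = n) (y : Fin n) (x : Fin 1) :
    Fin.cast h (finProdFinEquiv (x, y)) = y :=
  Fin.ext <| by simp [finProdFinEquiv]

theorem fin_mul_one {n : ℕ} (h : n * 1 = n) (y : Fin n) (x : Fin 1) :
    Fin.cast h (finProdFinEquiv (y, x)) = y :=
  Fin.ext <| by simp [finProdFinEquiv]

theorem sm_assoc {m n p q r s : ℕ} (φ : FMap m n) (ψ : FMap p q) (χ : FMap r s)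
    (h : m * p * r = m * (p * r)) (h' : n * q * s = n * (q * s)) (i : Fin (m * p * r)) :
    φ.sm (ψ.sm χ) (Fin.cast h i) = ((φ.sm ψ).sm χ i).map (Fin.cast h') := by
  obtain ⟨⟨x, z⟩, rfl⟩ := finProdFinEquiv.surjective i
  obtain ⟨⟨x, y⟩, rfl⟩ := finProdFinEquiv.surjective x
  rw [fin_assoc]
  rcases hx : φ x with _ | x' <;> rcases hy : ψ y with _ | y' <;> rcases hz : χ z with _ | z' <;>
    simp [sm, dec_mk, hx, hy, hz, fin_assoc]

theorem one_sm {m n : ℕ} (φ : FMap m n) (h : 1 * m = m) (h' : 1 * n = n) (i : Fin (1 * m)) :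
    φ (Fin.cast h i) = (FMap.sm (some : FMap 1 1) φ i).map (Fin.cast h') := by
  obtain ⟨⟨x, y⟩, rfl⟩ := finProdFinEquiv.surjective i
  rw [fin_one_mul]
  rcases hy : φ y with _ | y' <;> simp [sm, dec_mk, hy, fin_one_mul]

theorem sm_one {m n : ℕ} (φ : FMap m n) (h : m * 1 = m) (h' : n * 1 = n) (i : Fin (m * 1)) :
    φ (Fin.cast h i) = (FMap.sm φ (some : FMap 1 1) i).map (Fin.cast h') := by
  obtain ⟨⟨x, y⟩, rfl⟩ := finProdFinEquiv.surjective i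
  rw [fin_mul_one]
  rcases hy : φ x with _ | y' <;> simp [sm, dec_mk, hy, fin_mul_one]

namespace DPt

variable {P : Operad V} {T : V} {l : Lvl} {m n p q r s : ℕ} (α : PseudoComm P)

theorem R_sm_assoc {φ : FMap m n} {ψ : FMap p q} {χ : FMap r s} (a : DPt P l T φ) (b : DPt P l T ψ)
    (c : DPt P l T χ) (h : m * p * r = m * (p * r)) (h' : n * q * s = n * (q * s))
    (B : LAlg.{w} P T l) (X : Fin (m * (p * r)) → B.car) (j : Fin (n * q * s)) :
    B.R ((a.sm b).sm c) (fun i => X (Fin.cast h i)) j = B.R (a.sm (b.sm c)) X (Fin.cast h' j) := by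
  obtain ⟨⟨x, z⟩, rfl⟩ := finProdFinEquiv.surjective j
  obtain ⟨⟨x, y⟩, rfl⟩ := finProdFinEquiv.surjective x
  simp only [fin_assoc, B.R_sm, dec_mk]

theorem R_one_sm {φ : FMap m n} (c : DPt P l T φ) (h : 1 * m = m) (h' : 1 * n = n)
    (B : LAlg.{w} P T l) (X : Fin m → B.car) (j : Fin (1 * n)) :
    B.R ((iota some isPi_some : DPt P l T (some : FMap 1 1)).sm c) (fun i => X (Fin.cast h i)) j =
      B.R c X (Fin.cast h' j) := by
  obtain ⟨⟨x, z⟩, rfl⟩ := finProdFinEquiv.surjective j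
  simp only [fin_one_mul, B.R_sm, dec_mk, B.R_iota_some]

theorem R_sm_one {φ : FMap m n} (c : DPt P l T φ) (h : m * 1 = m) (h' : n * 1 = n)
    (B : LAlg.{w} P T l) (X : Fin m → B.car) (j : Fin (n * 1)) :
    B.R (c.sm (iota some isPi_some : DPt P l T (some : FMap 1 1))) (fun i => X (Fin.cast h i)) j =
      B.R c X (Fin.cast h' j) := by
  obtain ⟨⟨x, z⟩, rfl⟩ := finProdFinEquiv.surjective j
  simp only [fin_mul_one, B.R_sm, dec_mk, B.R_iota_some]

section assoc

variable {m n p q r s m' n' p' : ℕ} {ψ₁ : FMap n p} {φ₁ : FMap m n} {ψ₂ : FMap r s} {φ₂ : FMap q r}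
  {ψ₃ : FMap n' p'} {φ₃ : FMap m' n'} {χ₁ : FMap m p} {χ₂ : FMap q s} {χ₃ : FMap m' p'}
  (h₁ : ψ₁.comp φ₁ = χ₁) (h₂ : ψ₂.comp φ₂ = χ₂) (h₃ : ψ₃.comp φ₃ = χ₃)
  (d₁ : DPt P .ob T ψ₁) (d₂ : DPt P .ob T ψ₂) (d₃ : DPt P .ob T ψ₃)
  (c₁ : DPt P .ob T φ₁) (c₂ : DPt P .ob T φ₂) (c₃ : DPt P .ob T φ₃)
  {t₁ : DPt P .mor T χ₁} {t₂ : DPt P .mor T χ₂} {t₃ : DPt P .mor T χ₃}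

/-- The pseudofunctoriality constraint is associative. -/
theorem R_thetaSeq_assoc (ht₁ : t₁.src = (d₁.comp c₁).cast h₁) (ht₂ : t₂.src = (d₂.comp c₂).cast h₂)
    (ht₃ : t₃.src = (d₃.comp c₃).cast h₃) (h₁₂ : (ψ₁.sm ψ₂).comp (φ₁.sm φ₂) = χ₁.sm χ₂)
    (h₂₃ : (ψ₂.sm ψ₃).comp (φ₂.sm φ₃) = χ₂.sm χ₃) (B : PtAlg.{w} P T)
    (X : Fin (m * (q * m')) → (B.L .ob).car) (h : m * q * m' = m * (q * m'))
    (h' : p * s * p' = p * (s * p')) (j : Fin (p * s * p')) :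
    (B.L .mor).R (thetaSeq α (d₁.sm d₂) d₃ (c₁.sm c₂) c₃ h₁₂ h₃
        (thetaSeq α d₁ d₂ c₁ c₂ h₁ h₂ t₁ t₂) t₃) (fun i => B.one (X (Fin.cast h i))) j =
      (B.L .mor).R (thetaSeq α d₁ (d₂.sm d₃) c₁ (c₂.sm c₃) h₁ h₂₃ t₁
        (thetaSeq α d₂ d₃ c₂ c₃ h₂ h₃ t₂ t₃)) (fun i => B.one (X i)) (Fin.cast h' j) := by
  obtain ⟨⟨x, z⟩, rfl⟩ := finProdFinEquiv.surjective j
  obtain ⟨⟨x, y⟩, rfl⟩ := finProdFinEquiv.surjective x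
  rw [R_thetaSeq α _ _ _ _ _ _ (thetaSeq_src α d₁ d₂ c₁ c₂ h₁ h₂ t₁ t₂ h₁₂) ht₃, fin_assoc,
    R_thetaSeq α _ _ _ _ _ _ ht₁ (thetaSeq_src α d₂ d₃ c₂ c₃ h₂ h₃ t₂ t₃ h₂₃)]
  simp only [dec_mk]
  rw [R_thetaSeq α _ _ _ _ _ _ ht₁ ht₂]
  simp only [R_thetaSeq α _ _ _ _ _ _ ht₂ ht₃, dec_mk, fin_assoc, B.src_one]
  rw [B.R_src_seq, ht₁]
  · rw [← B.seq_assoc, ← B.seq_assoc]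
    · congr 1
      rw [cast_one, LAlg.R_cast, comp_one, LAlg.R_comp, sm_one, LAlg.R_sm]
      simp only [dec_mk, B.Al_sm_right, B.Al_sm_left, LAlg.R_sm, fin_assoc]
      rw [← B.R_one_seq, ← B.R_one_seq]
      · refine congrArg (fun Y => (B.L .mor).R d₁.one Y x) (funext fun k => ?_)
        rw [B.R_one_seq, B.seq_assoc, B.seq_assoc]
        · congr 1
          have := B.Al_nat α d₂ c₁ y k fun i x =>
            B.Al α d₃ c₂ z i fun y w =>
              (B.L .ob).R c₃ (fun v => X (finProdFinEquiv (x, finProdFinEquiv (w, v)))) y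
          simp only [B.Al_src, B.Al_tgt] at this
          simp only [B.R_src, ht₃, LAlg.R_cast, LAlg.R_comp, B.src_one]
          exact this
        all_goals
          simp only [B.R_one_src, B.R_one_tgt, B.Al_src, B.Al_tgt, B.R_src, LAlg.R_comp, LAlg.R_cast, ht₃, B.src_one,
          implies_true]
      all_goals
        simp only [B.tgt_seq, B.R_one_src, B.R_one_tgt, B.Al_src, B.Al_tgt, B.R_src, LAlg.R_comp, LAlg.R_cast, ht₃, B.src_one,
          implies_true]
    all_goals
      simp only [B.R_one_src, B.R_one_tgt, B.Al_src, B.Al_tgt, B.R_src, dec_mk,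
          LAlg.R_sm, LAlg.R_comp, cast_one, LAlg.R_cast, comp_one, ht₁, ht₂, ht₃, B.src_one,
          fin_assoc]
  all_goals
    simp only [B.R_one_tgt, B.Al_tgt, B.R_src, LAlg.R_comp, LAlg.R_cast, ht₂, ht₃, B.src_one,
          implies_true]

theorem R_thetaSeq_one_left (ht : t₁.src = (d₁.comp c₁).cast h₁)
    (hu : (iota some isPi_some : DPt P .mor T (some : FMap 1 1)).src =
      ((iota some isPi_some : DPt P .ob T (some : FMap 1 1)).comp
        (iota some isPi_some : DPt P .ob T (some : FMap 1 1))).cast rfl)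
    (B : PtAlg.{w} P T) (X : Fin m → (B.L .ob).car) (h : 1 * m = m) (h' : 1 * p = p)
    (j : Fin (1 * p)) :
    (B.L .mor).R (thetaSeq α (χ := (some : FMap 1 1)) (iota (some : FMap 1 1) isPi_some) d₁
        (iota (some : FMap 1 1) isPi_some) c₁ rfl h₁ (iota (some : FMap 1 1) isPi_some) t₁)
        (fun i => B.one (X (Fin.cast h i))) j =
      (B.L .mor).R t₁ (fun i => B.one (X i)) (Fin.cast h' j) := by
  obtain ⟨⟨x, z⟩, rfl⟩ := finProdFinEquiv.surjective j
  refine (R_thetaSeq α _ _ _ _ (χ := (some : FMap 1 1)) rfl h₁ hu ht B _ _).trans ?_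
  simp only [dec_mk, fin_one_mul, iota_one, LAlg.R_iota_some, B.Al_iota_right]
  refine B.one_seq' ?_
  rw [B.R_src, ht, LAlg.R_cast, LAlg.R_comp]

theorem R_thetaSeq_one_right (ht : t₁.src = (d₁.comp c₁).cast h₁)
    (hu : (iota some isPi_some : DPt P .mor T (some : FMap 1 1)).src =
      ((iota some isPi_some : DPt P .ob T (some : FMap 1 1)).comp
        (iota some isPi_some : DPt P .ob T (some : FMap 1 1))).cast rfl)
    (B : PtAlg.{w} P T) (X : Fin m → (B.L .ob).car) (h : m * 1 = m) (h' : p * 1 = p)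
    (j : Fin (p * 1)) :
    (B.L .mor).R (thetaSeq α (χ' := (some : FMap 1 1)) d₁ (iota (some : FMap 1 1) isPi_some) c₁
        (iota (some : FMap 1 1) isPi_some) h₁ rfl t₁ (iota (some : FMap 1 1) isPi_some))
        (fun i => B.one (X (Fin.cast h i))) j =
      (B.L .mor).R t₁ (fun i => B.one (X i)) (Fin.cast h' j) := by
  obtain ⟨⟨x, z⟩, rfl⟩ := finProdFinEquiv.surjective j
  refine (R_thetaSeq α _ _ _ _ (χ' := (some : FMap 1 1)) h₁ rfl ht hu B _ _).trans ?_
  simp only [dec_mk, fin_mul_one, LAlg.R_iota_some, B.Al_iota_left, B.src_one, B.R_one]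
  refine B.one_seq' ?_
  rw [B.R_src, ht, LAlg.R_cast, LAlg.R_comp]
  simp only [B.src_one]

end assoc

theorem seq_assoc {φ : FMap m n} {f g k : DPt P .mor T φ} (h : f.tgt = g.src) (h' : g.tgt = k.src) :
    (f.seq g).seq k = f.seq (g.seq k) :=
  funext fun j => VCat.seq_assoc _ (congrFun h j) (congrFun h' j)

end DPt

/-- A generalized object or arrow of the category of operators, with its source and target. The
smash product makes these into a monoid. -/
structure DMor (P : Operad V) (l : Lvl) (T : V) where
  {m n : ℕ}
  φ : FMap m n
  c : DPt P l T φ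

namespace DMor

variable {P : Operad V} {l : Lvl} {T : V}

theorem ext_R {a b : DMor P l T} (hm : a.m = b.m) (hn : a.n = b.n)
    (hφ : ∀ i, b.φ (Fin.cast hm i) = (a.φ i).map (Fin.cast hn))
    (hR : ∀ (B : LAlg.{v} P T l) (X : Fin b.m → B.car) j,
      B.R a.c (fun i => X (Fin.cast hm i)) j = B.R b.c X (Fin.cast hn j)) : a = b := by
  obtain ⟨φ, c⟩ := a
  obtain ⟨φ', c'⟩ := b
  cases hm
  cases hn
  obtain rfl : φ = φ' := funext fun i => by simpa using (hφ i).symm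
  obtain rfl : c = c' := DPt.ext_of_R fun B X => funext fun j => hR B X j
  rfl

/-- Morphisms of the category of operators under the smash product; strictly associative, since
lexicographic orders are. -/
noncomputable instance : Monoid (DMor P l T) where
  one := ⟨(some : FMap 1 1), DPt.iota some isPi_some⟩
  mul a b := ⟨a.φ.sm b.φ, a.c.sm b.c⟩
  mul_assoc a b c := ext_R (Nat.mul_assoc _ _ _) (Nat.mul_assoc _ _ _) (sm_assoc _ _ _ _ _)
    (DPt.R_sm_assoc _ _ _ _ _)
  one_mul a := ext_R (Nat.one_mul _) (Nat.one_mul _) (one_sm _ _ _) (DPt.R_one_sm _ _ _)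
  mul_one a := ext_R (Nat.mul_one _) (Nat.mul_one _) (sm_one _ _ _) (DPt.R_sm_one _ _ _)

theorem prod_ofFn : ∀ {k : ℕ} {m n : Fin k → ℕ} {φ : ∀ i, FMap (m i) (n i)}
    (c : ∀ i, DPt P l T (φ i)), (List.ofFn fun i => (⟨φ i, c i⟩ : DMor P l T)).prod =
      ⟨smk φ, DPt.smk c⟩
  | 0, _, _, _, _ => rfl
  | k + 1, m, n, φ, c => by
    rw [List.ofFn_succ, List.prod_cons, prod_ofFn fun i => c i.succ]
    rfl

end DMor

/-- A composable pair of objects of the category of operators, together with an arrow out of the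
composite. -/
structure DPair (P : Operad V) (T : V) where
  {m n p : ℕ}
  ψ : FMap n p
  φ : FMap m n
  χ : FMap m p
  h : ψ.comp φ = χ
  d : DPt P .ob T ψ
  c : DPt P .ob T φ
  t : DPt P .mor T χ
  src : t.src = (d.comp c).cast h

namespace DPair

variable {P : Operad V} {T : V} (α : PseudoComm P)

theorem ext_R {a b : DPair P T} (hm : a.m = b.m) (hn : a.n = b.n) (hp : a.p = b.p)
    (hψ : ∀ i, b.ψ (Fin.cast hn i) = (a.ψ i).map (Fin.cast hp))
    (hφ : ∀ i, b.φ (Fin.cast hm i) = (a.φ i).map (Fin.cast hn))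
    (hd : ∀ (B : LAlg.{v} P T .ob) (X : Fin b.n → B.car) j,
      B.R a.d (fun i => X (Fin.cast hn i)) j = B.R b.d X (Fin.cast hp j))
    (hc : ∀ (B : LAlg.{v} P T .ob) (X : Fin b.m → B.car) j,
      B.R a.c (fun i => X (Fin.cast hm i)) j = B.R b.c X (Fin.cast hn j))
    (ht : ∀ (B : PtAlg.{v} P T) (X : Fin b.m → (B.L .ob).car) j,
      (B.L .mor).R a.t (fun i => B.one (X (Fin.cast hm i))) j =
        (B.L .mor).R b.t (fun i => B.one (X i)) (Fin.cast hp j)) : a = b := by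
  obtain ⟨ψ, φ, χ, h, d, c, t, src⟩ := a
  obtain ⟨ψ', φ', χ', h', d', c', t', src'⟩ := b
  cases hm
  cases hn
  cases hp
  obtain rfl : φ = φ' := funext fun i => by simpa using (hφ i).symm
  obtain rfl : ψ = ψ' := funext fun i => by simpa using (hψ i).symm
  obtain rfl := h
  obtain rfl := h'
  obtain rfl : c = c' := DPt.ext_of_R fun B X => funext fun j => hc B X j
  obtain rfl : d = d' := DPt.ext_of_R fun B X => funext fun j => hd B X j
  obtain rfl : t = t' := DPt.ext_of_R_one fun B X => funext fun j => ht B X j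
  rfl

/-- The smash product of pairs, with the arrow preceded by the pseudofunctoriality constraint. -/
noncomputable def mul (a b : DPair P T) : DPair P T where
  ψ := a.ψ.sm b.ψ
  φ := a.φ.sm b.φ
  χ := a.χ.sm b.χ
  h := by rw [← a.h, ← b.h, sm_comp]
  d := a.d.sm b.d
  c := a.c.sm b.c
  t := DPt.thetaSeq α a.d b.d a.c b.c a.h b.h a.t b.t
  src := DPt.thetaSeq_src α a.d b.d a.c b.c a.h b.h a.t b.t _

/-- The unit of the smash product. -/
noncomputable def unit : DPair P T where
  ψ := (some : FMap 1 1)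
  φ := (some : FMap 1 1)
  χ := (some : FMap 1 1)
  h := rfl
  d := DPt.iota some isPi_some
  c := DPt.iota some isPi_some
  t := DPt.iota some isPi_some
  src := by
    refine (DPt.iota_src _).trans (DPt.ext_of_R fun B X => ?_)
    exact (B.R_iota_some _ X).trans (((B.R_comp _ _ X).trans (B.R_iota_some _ _)).trans
      (B.R_iota_some _ X)).symm


theorem unit_mul (b : DPair P T) : mul α unit b = b :=
  ext_R (Nat.one_mul _) (Nat.one_mul _) (Nat.one_mul _) (one_sm _ _ _) (one_sm _ _ _)
    (DPt.R_one_sm _ _ _) (DPt.R_one_sm _ _ _)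
    (DPt.R_thetaSeq_one_left α b.h b.d b.c b.src unit.src · · _ _ ·)

theorem mul_unit (b : DPair P T) : mul α b unit = b :=
  ext_R (Nat.mul_one _) (Nat.mul_one _) (Nat.mul_one _) (sm_one _ _ _) (sm_one _ _ _)
    (DPt.R_sm_one _ _ _) (DPt.R_sm_one _ _ _)
    (DPt.R_thetaSeq_one_right α b.h b.d b.c b.src unit.src · · _ _ ·)

/-- The smash product makes composable pairs into a monoid. -/
noncomputable abbrev monoid : Monoid (DPair P T) where
  one := unit
  mul := mul α
  mul_assoc a b c := ext_R (Nat.mul_assoc _ _ _) (Nat.mul_assoc _ _ _) (Nat.mul_assoc _ _ _)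
    (sm_assoc _ _ _ _ _) (sm_assoc _ _ _ _ _) (DPt.R_sm_assoc _ _ _ _ _)
    (DPt.R_sm_assoc _ _ _ _ _)
    (DPt.R_thetaSeq_assoc α a.h b.h c.h a.d b.d c.d a.c b.c c.c a.src b.src c.src
      (mul α a b).h (mul α b c).h · · _ _ ·)
  one_mul := unit_mul α
  mul_one := mul_unit α

theorem seq_thetaSeq {m n p q r s : ℕ} {ψ : FMap n p} {φ : FMap m n} {ν : FMap r s} {μ : FMap q r}
    {χ : FMap m p} {χ' : FMap q s} (d : DPt P .ob T ψ) (a : DPt P .ob T ν) (c : DPt P .ob T φ)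
    (b : DPt P .ob T μ) (h : ψ.comp φ = χ) (h' : ν.comp μ = χ') {t : DPt P .mor T χ}
    {t' u : DPt P .mor T χ'} (ht : t.src = (d.comp c).cast h)
    (ht' : t'.src = (a.comp b).cast h') (hu : t'.tgt = u.src) :
    (DPt.thetaSeq α d a c b h h' t.src.one t').seq (t.sm u) =
      DPt.thetaSeq α d a c b h h' t (t'.seq u) := by
  rw [DPt.thetaSeq, DPt.seq_assoc, ← DPt.sm_seq, DPt.one_seq, DPt.thetaSeq]
  · rw [DPt.one_tgt]
  · exact hu
  · exact DPt.thetaSeq_comp α d a c b h h' (by rw [DPt.one_src, ht]) ht'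
  · rw [DPt.sm_tgt, DPt.sm_src, hu, DPt.one_tgt]

/-- The pair of smash products, with the pseudofunctoriality constraint followed by a smash product
of arrows. -/
noncomputable def smk {k : ℕ} {m n p : Fin k → ℕ} {ψ : ∀ i, FMap (n i) (p i)}
    {φ : ∀ i, FMap (m i) (n i)} {χ : ∀ i, FMap (m i) (p i)} (h : ∀ i, (ψ i).comp (φ i) = χ i)
    (d : ∀ i, DPt P .ob T (ψ i)) (c : ∀ i, DPt P .ob T (φ i)) (t : ∀ i, DPt P .mor T (χ i)) :
    DPair P T where
  ψ := FMap.smk ψ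
  φ := FMap.smk φ
  χ := FMap.smk χ
  h := by rw [← FMap.smk_comp]; simp only [h]
  d := DPt.smk d
  c := DPt.smk c
  t := ((DPt.thetak α d c).cast (by simp only [h])).seq (DPt.smk t)
  src := by rw [DPt.seq_src, DPt.cast_src, DPt.thetak_src, DPt.cast_cast]

theorem mk_congr {m n p : ℕ} {ψ : FMap n p} {φ : FMap m n} {χ : FMap m p} {h : ψ.comp φ = χ}
    {d : DPt P .ob T ψ} {c : DPt P .ob T φ} {t t' : DPt P .mor T χ} {s s'} (e : t = t') :
    (⟨ψ, φ, χ, h, d, c, t, s⟩ : DPair P T) = ⟨ψ, φ, χ, h, d, c, t', s'⟩ := by subst e; rfl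

theorem prod_ofFn : ∀ {k : ℕ} {m n p : Fin k → ℕ} {ψ : ∀ i, FMap (n i) (p i)}
    {φ : ∀ i, FMap (m i) (n i)} {χ : ∀ i, FMap (m i) (p i)} (h : ∀ i, (ψ i).comp (φ i) = χ i)
    (d : ∀ i, DPt P .ob T (ψ i)) (c : ∀ i, DPt P .ob T (φ i)) (t : ∀ i, DPt P .mor T (χ i))
    (ht : ∀ i, (t i).src = ((d i).comp (c i)).cast (h i)),
    let := monoid (T := T) α
    (List.ofFn fun i => (⟨ψ i, φ i, χ i, h i, d i, c i, t i, ht i⟩ : DPair P T)).prod =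
      smk α h d c t
  | 0, _, _, _, _, _, _, _, _, _, _, _ => mk_congr
    ((DPt.seq_one (DPt.iota some isPi_some : DPt P .mor T (some : FMap 1 1))).symm.trans
      (congrArg (fun c => DPt.seq _ (DPt.one c)) (DPt.iota_tgt isPi_some)))
  | k + 1, m, n, p, ψ, φ, χ, h, d, c, t, ht => by
    intro
    obtain rfl : (fun i => (ψ i).comp (φ i)) = χ := funext h
    rw [List.ofFn_succ, List.prod_cons]
    rw [prod_ofFn (fun i => h i.succ) (fun i => d i.succ) (fun i => c i.succ) (fun i => t i.succ)
      fun i => ht i.succ]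
    have := seq_thetaSeq α (d 0) (DPt.smk fun i => d i.succ) (c 0) (DPt.smk fun i => c i.succ) rfl
      (FMap.smk_comp _ _).symm (ht 0)
      (DPt.thetak_src α (fun i => d i.succ) fun i => c i.succ) (u := DPt.smk fun i => t i.succ) 
      (by rw [DPt.thetak_tgt, DPt.smk_src]; exact congrArg DPt.smk (funext fun i => (ht i.succ).symm))
    rw [ht 0] at this
    exact mk_congr this.symm

end DPair

/-- The product of a concatenated list is the product of the products of its blocks. -/
theorem prod_ofFn_sigma {M : Type*} [Monoid M] : ∀ {k : ℕ} {j : Fin k → ℕ} (f : Fin (∑ i, j i) → M),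
    (List.ofFn fun i => (List.ofFn fun r => f (finSigmaFinEquiv ⟨i, r⟩)).prod).prod =
      (List.ofFn f).prod
  | 0, _, _ => rfl
  | k + 1, j, f => by
    rw [List.ofFn_succ', List.concat_eq_append, List.prod_append, List.prod_singleton,
      List.ofFn_congr (Fin.sum_univ_castSucc j), List.ofFn_add, List.prod_append,
      ← prod_ofFn_sigma]
    congr 5
    · funext i
      congr 2
      funext r
      congr 1
      ext
      simp
    · funext r
      congr 1
      ext
      simp
      rfl

/-! ### The reordering constraints -/

theorem swap3_mk {m p r : ℕ} (y : Fin p) (x : Fin m) (z : Fin r) :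
    swap3 m p r (finProdFinEquiv (y, finProdFinEquiv (x, z))) =
      finProdFinEquiv (x, finProdFinEquiv (y, z)) := by
  simp [swap3, dec3, -finProdFinEquiv_symm_apply]

theorem swap3_symm_mk {m p r : ℕ} (y : Fin p) (x : Fin m) (z : Fin r) :
    (swap3 m p r).symm (finProdFinEquiv (x, finProdFinEquiv (y, z))) =
      finProdFinEquiv (y, finProdFinEquiv (x, z)) := by
  rw [Equiv.symm_apply_eq, swap3_mk]

theorem prodE_symm_mk {m m' n n' : ℕ} (e : Fin m ≃ Fin m') (f : Fin n ≃ Fin n') (x : Fin m')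
    (y : Fin n') :
    (prodE e f).symm (finProdFinEquiv (x, y)) = finProdFinEquiv (e.symm x, f.symm y) := by
  simp [prodE, -finProdFinEquiv_symm_apply]

namespace PtAlg

variable {P : Operad V} {T : V} (B : PtAlg.{w} P T) (α : PseudoComm P)

section

variable {m n : ℕ} {φ : FMap m n}

theorem R_eq_seq_tgt (f : DPt P .mor T φ) (X : Fin m → (B.L .mor).car) (j : Fin n) :
    (B.L .mor).R f X j = B.seq ((B.L .mor).R f (fun i => B.one (B.src (X i))) j)
      ((B.L .mor).R f.tgt.one X j) := by
  rw [← B.R_seq_src (by rw [DPt.one_src]), DPt.seq_one]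

theorem R_eq_seq_src (f : DPt P .mor T φ) (X : Fin m → (B.L .mor).car) (j : Fin n) :
    (B.L .mor).R f X j = B.seq ((B.L .mor).R f.src.one X j)
      ((B.L .mor).R f (fun i => B.one (B.tgt (X i))) j) := by
  rw [← B.R_src_seq _ (by simp only [B.src_one, implies_true])]
  simp only [B.seq_one]

end

/-- The interchange arrows satisfy the Yang-Baxter equation. -/
theorem al_braid {i j k : ℕ} (x : T ⟶ (P.O i).car .ob) (y : T ⟶ (P.O j).car .ob)
    (z : T ⟶ (P.O k).car .ob) (W : Fin k → Fin i → Fin j → (B.L .ob).car) :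
    B.seq ((B.L .mor).op ((P.O k).one z) fun c => B.al α x y (W c))
        (B.seq (B.al α z y fun c b => (B.L .ob).op x fun a => W c a b)
          ((B.L .mor).op ((P.O j).one y) fun b => B.al α z x fun c a => W c a b)) =
      B.seq (B.al α z x fun c a => (B.L .ob).op y (W c a))
        (B.seq ((B.L .mor).op ((P.O i).one x) fun a => B.al α z y fun c b => W c a b)
          (B.al α x y fun a b => (B.L .ob).op z fun c => W c a b)) := by
  have h := B.al_nat α ((P.O k).one z) (α.ap x y) fun c q => B.one (W c (dec q).2 (dec q).1)
  simp only [VCat.one_src, VCat.one_tgt, B.src_one, B.tgt_one, α.ap_src, α.ap_tgt,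
    B.al_act_right, B.al_pair_right, B.op_one] at h
  simp only [flip, dec, Equiv.symm_trans_apply, Equiv.symm_symm, Equiv.prodComm_symm,
    Equiv.prodComm_apply, Equiv.symm_apply_apply, Prod.swap] at h
  rw [B.seq_assoc] at h
  · exact h
  · rw [B.al_tgt, B.op_one_src]
    simp only [B.al_src]
  · rw [B.op_one_tgt, B.op_src, α.ap_src]
    simp only [B.al_tgt, B.src_one]
    exact ((B.L .ob).op_pair_flip x y fun a b => (B.L .ob).op z fun c => W c a b).symm

section

variable {m n p q r s : ℕ} {φ : FMap m n} {ν : FMap r s} {μ : FMap p q}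

theorem Al_braid (a : DPt P .ob T φ) (b : DPt P .ob T ν) (c : DPt P .ob T μ) (i : Fin n)
    (j : Fin s) (k : Fin q) (W : Fin p → Fin m → Fin r → (B.L .ob).car) :
    B.seq ((B.L .mor).R c.one (fun z => B.Al α a b i j (W z)) k)
        (B.seq (B.Al α c b k j fun z y => (B.L .ob).R a (fun x => W z x y) i)
          ((B.L .mor).R b.one (fun y => B.Al α c a k i fun z x => W z x y) j)) =
      B.seq (B.Al α c a k i fun z x => (B.L .ob).R b (W z x) j)
        (B.seq ((B.L .mor).R a.one (fun x => B.Al α c b k j fun z y => W z x y) i)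
          (B.Al α a b i j fun x y => (B.L .ob).R c (fun z => W z x y) k)) :=
  B.al_braid α _ _ _ _

theorem Al_comp_iota_left (e : Fin p ≃ Fin r) (a : DPt P .ob T ν) (c : DPt P .ob T φ)
    (i : Fin s) (k : Fin n) (h) (W : Fin p → Fin m → (B.L .ob).car) :
    B.Al α (a.comp (DPt.iota (ofEquiv e) h)) c i k W =
      B.Al α a c i k fun y => W (e.symm y) := by
  rw [B.Al_comp_left]
  simp only [B.Al_iota_left, LAlg.R_iota_ofEquiv, B.R_one]
  exact B.one_seq' (B.Al_src _ _ _ _ _ _)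

theorem Al_iota_comp_left (e : Fin s ≃ Fin q) (a : DPt P .ob T ν) (c : DPt P .ob T φ)
    (i : Fin q) (k : Fin n) (h) (W : Fin r → Fin m → (B.L .ob).car) :
    B.Al α ((DPt.iota (ofEquiv e) h : DPt P .ob T (ofEquiv e)).comp a) c i k W =
      B.Al α a c (e.symm i) k W := by
  rw [B.Al_comp_left, B.Al_iota_left]
  refine (B.seq_one' ?_).trans ((B.L .mor).R_iota_ofEquiv e h _ i)
  rw [DPt.iota_one, LAlg.R_iota_ofEquiv, LAlg.R_iota_ofEquiv, B.Al_tgt]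

theorem Al_cast_left {ν' : FMap r s} (h : ν = ν') (a : DPt P .ob T ν) (c : DPt P .ob T φ) :
    B.Al α (a.cast h) c = B.Al α a c := by subst h; rfl

end

end PtAlg

namespace DPt

variable {P : Operad V} {T : V} {l : Lvl} {m n p q r s : ℕ} (α : PseudoComm P)
  {φ : FMap m n} {ψ : FMap p q} {χ : FMap r s}

/-- The constraint of the interchange of the first two factors. -/
noncomputable def swapCell (a : DPt P .ob T φ) (b : DPt P .ob T ψ) (c : DPt P .ob T χ) :
    DPt P .mor T ((φ.sm (ψ.sm χ)).comp (ofEquiv (swap3 m p r))) := fun i =>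
  (P.act (swapE φ ψ χ i)).ap
    (P.pair (α.ap (a (dec i).1) (b (dec (dec i).2).1)) (c.one (dec (dec i).2).2))

theorem fib_swapE (i : Fin (n * (q * s))) (y : Fin (ψ.c (dec (dec i).2).1))
    (x : Fin (φ.c (dec i).1)) (z : Fin (χ.c (dec (dec i).2).2)) :
    (fib _ i ((swapE φ ψ χ i).symm (finProdFinEquiv (finProdFinEquiv (y, x), z)))).1 =
      finProdFinEquiv ((ψ.fib _ y).1, finProdFinEquiv ((φ.fib _ x).1, (χ.fib _ z).1)) := by
  simp [swapE, Equiv.subtypeProdEquivProd, -finProdFinEquiv_symm_apply]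
  rfl

theorem R_swapCell (a : DPt P .ob T φ) (b : DPt P .ob T ψ) (c : DPt P .ob T χ)
    (B : PtAlg.{w} P T) (X : Fin (p * (m * r)) → (B.L .ob).car) (i : Fin (n * (q * s))) :
    (B.L .mor).R (swapCell α a b c) (fun x => B.one (X x)) i =
      B.Al α a b (dec i).1 (dec (dec i).2).1 fun x y =>
        (B.L .ob).R c (fun z => X (finProdFinEquiv (y, finProdFinEquiv (x, z)))) (dec (dec i).2).2 := by
  refine ((B.L .mor).op_act _ _ _).trans (((B.L .mor).op_pair _ _ _).trans
    (congrArg ((B.L .mor).op _) (funext fun w => ?_)))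
  obtain ⟨⟨y, x⟩, rfl⟩ := finProdFinEquiv.surjective w
  simp only [fib_swapE, dec_mk]
  exact B.op_one _ _

theorem swapCell_src (a : DPt P .ob T φ) (b : DPt P .ob T ψ) (c : DPt P .ob T χ) :
    (swapCell α a b c).src =
      (a.sm (b.sm c)).comp (iota (ofEquiv (swap3 m p r)) (isPi_ofEquiv _)) := by
  refine ext_of_pt fun B X j => ?_
  have h := B.R_src (swapCell α a b c) (fun z => B.one (X z)) j
  simp only [B.src_one] at h
  rw [← h, R_swapCell, B.Al_src, LAlg.R_comp]
  simp only [LAlg.R_sm, LAlg.R_iota_ofEquiv, swap3_symm_mk]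

theorem swapCell_tgt (a : DPt P .ob T φ) (b : DPt P .ob T ψ) (c : DPt P .ob T χ) :
    (swapCell α a b c).tgt =
      ((iota (ofEquiv (swap3 n q s)) (isPi_ofEquiv _)).comp (b.sm (a.sm c))).cast
        (sm_swap φ ψ χ).symm := by
  refine ext_of_pt fun B X j => ?_
  have h := B.R_tgt (swapCell α a b c) (fun z => B.one (X z)) j
  simp only [B.tgt_one] at h
  rw [← h, R_swapCell, B.Al_tgt, LAlg.R_cast, LAlg.R_comp, LAlg.R_iota_ofEquiv]
  obtain ⟨⟨x, z⟩, rfl⟩ := finProdFinEquiv.surjective j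
  obtain ⟨⟨y, z⟩, rfl⟩ := finProdFinEquiv.surjective z
  simp only [LAlg.R_sm, dec_mk, swap3_symm_mk]

/-- The constraint of a reordering which fixes the first factor. -/
noncomputable def consCell (a : DPt P .ob T φ) {r' : ℕ} (e : Fin r' ≃ Fin r)
    (t : DPt P .mor T (χ.comp (ofEquiv e))) :
    DPt P .mor T ((φ.sm χ).comp (ofEquiv (prodE (Equiv.refl _) e))) :=
  cast (sm_ofEquiv _ _ _) (a.one.sm t)

theorem R_consCell (a : DPt P .ob T φ) {r' : ℕ} (e : Fin r' ≃ Fin r)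
    (t : DPt P .mor T (χ.comp (ofEquiv e))) (B : LAlg.{w} P T .mor) (X : Fin (m * r') → B.car)
    (j : Fin (n * s)) :
    B.R (consCell a e t) X j = B.R a.one
      (fun x => B.R t (fun z => X (finProdFinEquiv (x, z))) (dec j).2) (dec j).1 := by
  rw [consCell, LAlg.R_cast, LAlg.R_sm]

theorem consCell_src (a : DPt P .ob T φ) {r' : ℕ} (e : Fin r' ≃ Fin r) (c : DPt P .ob T χ)
    {t : DPt P .mor T (χ.comp (ofEquiv e))}
    (ht : t.src = c.comp (iota (ofEquiv e) (isPi_ofEquiv _))) :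
    (consCell a e t).src = (a.sm c).comp (iota (ofEquiv (prodE (Equiv.refl _) e)) (isPi_ofEquiv _)) := by
  refine ext_of_R fun B X => funext fun j => ?_
  rw [consCell, cast_src, sm_src, ht, one_src, LAlg.R_cast, LAlg.R_sm, LAlg.R_comp, LAlg.R_sm]
  simp only [LAlg.R_comp, LAlg.R_iota_ofEquiv, prodE_symm_mk, Equiv.refl_symm, Equiv.refl_apply]
  congr 1; funext x; congr 1; funext y
  rw [LAlg.R_iota_ofEquiv]

end DPt

namespace DPt

variable {P : Operad V} {T : V} {l : Lvl} {m n p q r s : ℕ} (α : PseudoComm P)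
  {φ : FMap m n} {ψ : FMap p q} {χ : FMap r s}

theorem consCell_tgt (a : DPt P .ob T φ) {r' s' : ℕ} (e : Fin r' ≃ Fin r) (e' : Fin s' ≃ Fin s)
    {χ' : FMap r' s'} (c : DPt P .ob T χ') (h : χ.comp (ofEquiv e) = (ofEquiv e').comp χ')
    {t : DPt P .mor T (χ.comp (ofEquiv e))}
    (ht : t.tgt = ((iota (ofEquiv e') (isPi_ofEquiv _)).comp c).cast h.symm) (h') :
    (consCell a e t).tgt =
      ((iota (ofEquiv (prodE (Equiv.refl _) e')) (isPi_ofEquiv _)).comp (a.sm c)).cast h' := by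
  refine ext_of_R fun B X => funext fun j => ?_
  obtain ⟨⟨x, z⟩, rfl⟩ := finProdFinEquiv.surjective j
  rw [consCell, cast_tgt, sm_tgt, ht, one_tgt, LAlg.R_cast, LAlg.R_cast, LAlg.R_comp,
    LAlg.R_iota_ofEquiv, prodE_symm_mk, LAlg.R_sm, LAlg.R_sm]
  simp only [LAlg.R_cast, LAlg.R_comp, LAlg.R_iota_ofEquiv, dec_mk]
  rfl

/-- The constraint of a composite of reorderings. -/
noncomputable def transCell {m' m'' n' : ℕ} (e : Fin m' ≃ Fin m) (e' : Fin m'' ≃ Fin m')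
    (e₁ : Fin n' ≃ Fin n) {φ' : FMap m' n'} (h : φ.comp (ofEquiv e) = (ofEquiv e₁).comp φ')
    (t : DPt P .mor T (φ.comp (ofEquiv e))) (t' : DPt P .mor T (φ'.comp (ofEquiv e'))) :
    DPt P .mor T (φ.comp (ofEquiv (e'.trans e))) :=
  seq (φ := φ.comp (ofEquiv (e'.trans e))) (t.comp (iota (ofEquiv e') (isPi_ofEquiv _)))
    (cast (congrArg (fun χ => χ.comp (ofEquiv e')) h).symm
      ((iota (ofEquiv e₁) (isPi_ofEquiv _)).comp t'))

section transCell

variable {m' m'' n' : ℕ} (e : Fin m' ≃ Fin m) (e' : Fin m'' ≃ Fin m')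
    (e₁ : Fin n' ≃ Fin n) {φ' : FMap m' n'} (h : φ.comp (ofEquiv e) = (ofEquiv e₁).comp φ')
    {t : DPt P .mor T (φ.comp (ofEquiv e))} {t' : DPt P .mor T (φ'.comp (ofEquiv e'))}
    (c : DPt P .ob T φ) (c' : DPt P .ob T φ')

theorem transCell_comp (ht : t.tgt = ((iota (ofEquiv e₁) (isPi_ofEquiv _)).comp c').cast h.symm)
    (ht' : t'.src = c'.comp (iota (ofEquiv e') (isPi_ofEquiv _))) :
    (t.comp (iota (ofEquiv e') (isPi_ofEquiv _))).tgt =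
    (cast (congrArg (fun χ => χ.comp (ofEquiv e')) h).symm
      ((iota (ofEquiv e₁) (isPi_ofEquiv _)).comp t')).src := by
  refine ext_of_R fun B X => ?_
  refine (congrArg (B.R · X) (comp_tgt _ _)).trans (Eq.trans ?_ (congrArg (B.R · X)
    (cast_src _ _)).symm)
  refine (B.R_comp _ _ X).trans (Eq.trans ?_ (congrFun (B.R_cast _ _) X).symm)
  refine Eq.trans ?_ ((congrArg (B.R · X) (comp_src _ _)).trans (B.R_comp _ _ X)).symm
  rw [ht, ht', iota_src, iota_tgt, B.R_cast, B.R_comp, B.R_comp]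

theorem R_transCell
    (ht : t.tgt = ((iota (ofEquiv e₁) (isPi_ofEquiv _)).comp c').cast h.symm)
    (ht' : t'.src = c'.comp (iota (ofEquiv e') (isPi_ofEquiv _))) (B : PtAlg.{w} P T)
    (X : Fin m'' → (B.L .ob).car) (j : Fin n) :
    (B.L .mor).R (transCell e e' e₁ h t t') (fun i => B.one (X i)) j =
      B.seq ((B.L .mor).R t (fun i => B.one (X (e'.symm i))) j)
        ((B.L .mor).R t' (fun i => B.one (X i)) (e₁.symm j)) := by
  refine (B.R_seq_one (transCell_comp e e' e₁ h c' ht ht') X j).trans ?_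
  refine congrArg₂ B.seq ((congrFun ((B.L .mor).R_comp t _ _) j).trans
    (congrFun (congrArg _ (funext fun i => (B.L .mor).R_iota_ofEquiv _ _ _ _)) j)) ?_
  exact (congrFun (congrFun ((B.L .mor).R_cast _ _) _) j).trans
    ((congrFun ((B.L .mor).R_comp _ t' _) j).trans ((B.L .mor).R_iota_ofEquiv _ _ _ _))

theorem transCell_src (ht : t.src = c.comp (iota (ofEquiv e) (isPi_ofEquiv _))) :
    (transCell e e' e₁ h t t').src = c.comp (iota (ofEquiv (e'.trans e)) (isPi_ofEquiv _)) := by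
  refine ext_of_R fun B X => ?_
  refine (congrArg (B.R · X) ((seq_src _ _).trans (comp_src _ _))).trans ?_
  rw [ht, B.R_comp c]
  refine (B.R_comp _ _ _).trans ((B.R_comp _ _ _).trans (congrArg _ (funext fun i => ?_)))
  rw [B.R_iota_ofEquiv, B.R_iota_ofEquiv, iota_src, B.R_iota_ofEquiv]
  rfl

theorem transCell_tgt {p' : ℕ} (e₁' : Fin p' ≃ Fin n') {φ'' : FMap m'' p'} (c'' : DPt P .ob T φ'')
    (ht : t.tgt = ((iota (ofEquiv e₁) (isPi_ofEquiv _)).comp c').cast h.symm)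
    (ht' : t'.src = c'.comp (iota (ofEquiv e') (isPi_ofEquiv _)))
    (h₁ : φ'.comp (ofEquiv e') = (ofEquiv e₁').comp φ'')
    (ht₁ : t'.tgt = ((iota (ofEquiv e₁') (isPi_ofEquiv _)).comp c'').cast h₁.symm) (h₂) :
    (transCell e e' e₁ h t t').tgt =
      ((iota (ofEquiv (e₁'.trans e₁)) (isPi_ofEquiv _)).comp c'').cast h₂ := by
  refine ext_of_R fun B X => funext fun j => ?_
  refine (congrFun (congrArg (B.R · X) ((seq_tgt (transCell_comp e e' e₁ h c' ht ht')).trans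
    (cast_tgt _ _))) j).trans ?_
  refine (congrFun (congrFun (B.R_cast _ _) X) j).trans ?_
  refine (congrFun (congrArg (B.R · X) (comp_tgt _ _)) j).trans ?_
  refine (congrFun (B.R_comp _ _ X) j).trans ?_
  rw [iota_tgt, B.R_iota_ofEquiv, ht₁, B.R_cast, B.R_comp, B.R_iota_ofEquiv]
  refine Eq.symm ((congrFun (congrFun (B.R_cast _ _) X) j).trans
    ((congrFun (B.R_comp _ _ X) j).trans ((B.R_iota_ofEquiv _ _ _ _).trans rfl)))

end transCell

theorem cell_src_tgt : ∀ {k : ℕ} {f : Fin k → Fin k} (b : Braid k f) {m n : Fin k → ℕ}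
    {φ : ∀ i, FMap (m i) (n i)} (c : ∀ i, DPt P .ob T (φ i)),
    (cell α b c).src = (smk c).comp (iota (ofEquiv (b.bij m)) (isPi_ofEquiv _)) ∧
    (cell α b c).tgt = ((iota (ofEquiv (b.bij n)) (isPi_ofEquiv _)).comp
      (smk fun i => c (f i))).cast (b.nat φ).symm
  | _, _, .refl _, m, n, φ, c => by
    constructor
    · refine (one_src _).trans (ext_of_R fun B X => ?_)
      exact ((B.R_comp _ _ X).trans (congrArg _ (B.R_iota_some _ X))).symm
    · refine (one_tgt _).trans (ext_of_R fun B X => ?_)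
      exact ((congrFun (B.R_cast _ _) X).trans ((B.R_comp _ _ X).trans (B.R_iota_some _ _))).symm
  | _, _, .swap _, m, n, φ, c =>
    ⟨swapCell_src α (c 0) (c 1) (smk fun i => c i.succ.succ),
      swapCell_tgt α (c 0) (c 1) (smk fun i => c i.succ.succ)⟩
  | _, _, .cons b, m, n, φ, c => by
    obtain ⟨h₁, h₂⟩ := cell_src_tgt b fun i => c i.succ
    constructor
    · exact consCell_src (c 0) _ (smk fun i => c i.succ) h₁
    · exact consCell_tgt (c 0) _ _ _ (b.nat fun i => φ i.succ) h₂ _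
  | _, _, .trans (f := f) b b', m, n, φ, c => by
    obtain ⟨h₁, h₂⟩ := cell_src_tgt b c
    obtain ⟨h₃, h₄⟩ := cell_src_tgt b' fun i => c (f i)
    constructor
    · exact transCell_src _ _ _ (b.nat φ) _ h₁
    · exact transCell_tgt _ _ _ (b.nat φ) _ _ _ h₂ h₃ (b'.nat _) h₄ _

theorem cell_src {k : ℕ} {f : Fin k → Fin k} (b : Braid k f) {m n : Fin k → ℕ}
    {φ : ∀ i, FMap (m i) (n i)} (c : ∀ i, DPt P .ob T (φ i)) :
    (cell α b c).src = (smk c).comp (iota (ofEquiv (b.bij m)) (isPi_ofEquiv _)) :=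
  (cell_src_tgt α b c).1

theorem cell_tgt {k : ℕ} {f : Fin k → Fin k} (b : Braid k f) {m n : Fin k → ℕ}
    {φ : ∀ i, FMap (m i) (n i)} (c : ∀ i, DPt P .ob T (φ i)) :
    (cell α b c).tgt = ((iota (ofEquiv (b.bij n)) (isPi_ofEquiv _)).comp
      (smk fun i => c (f i))).cast (b.nat φ).symm :=
  (cell_src_tgt α b c).2

/-! #### Values of the reordering constraints -/

section R_cell

variable {k : ℕ} (B : PtAlg.{w} P T)

theorem R_cell_refl {m n : Fin k → ℕ} {φ : ∀ i, FMap (m i) (n i)} (c : ∀ i, DPt P .ob T (φ i))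
    (X : Fin (ark m) → (B.L .ob).car) (j : Fin (ark n)) :
    (B.L .mor).R (cell α (.refl k) c) (fun i => B.one (X i)) j = B.one ((B.L .ob).R (smk c) X j) :=
  B.R_one _ _ _

theorem R_cell_swap {m n : Fin (k + 2) → ℕ} {φ : ∀ i, FMap (m i) (n i)}
    (c : ∀ i, DPt P .ob T (φ i)) (X : Fin (ark fun i => m (swapF i)) → (B.L .ob).car)
    (j : Fin (n 0 * (n 1 * ark fun i : Fin k => n i.succ.succ))) :
    (B.L .mor).R (cell α (.swap k) c) (fun i => B.one (X i)) j =
      B.Al α (c 0) (c 1) (dec j).1 (dec (dec j).2).1 fun x y =>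
        (B.L .ob).R (smk fun i => c i.succ.succ)
          (fun z => X (finProdFinEquiv (y, finProdFinEquiv (x, z)))) (dec (dec j).2).2 :=
  R_swapCell α _ _ _ B X j

theorem R_cell_cons {f : Fin k → Fin k} (b : Braid k f) {m n : Fin (k + 1) → ℕ}
    {φ : ∀ i, FMap (m i) (n i)} (c : ∀ i, DPt P .ob T (φ i))
    (X : Fin (ark fun i => m (tailF f i)) → (B.L .mor).car)
    (j : Fin (n 0 * (ark fun i : Fin k => n i.succ))) :
    (B.L .mor).R (cell α (.cons b) c) X j = (B.L .mor).R (c 0).one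
      (fun x => (B.L .mor).R (cell α b fun i => c i.succ) (fun z => X (finProdFinEquiv (x, z)))
        (dec j).2) (dec j).1 :=
  R_consCell _ _ _ _ X j

theorem R_cell_trans {f g : Fin k → Fin k} (b : Braid k f) (b' : Braid k g) {m n : Fin k → ℕ}
    {φ : ∀ i, FMap (m i) (n i)} (c : ∀ i, DPt P .ob T (φ i))
    (X : Fin (ark fun i => m (f (g i))) → (B.L .ob).car) (j : Fin (ark n)) :
    (B.L .mor).R (cell α (b.trans b') c) (fun i => B.one (X i)) j =
      B.seq ((B.L .mor).R (cell α b c) (fun i => B.one (X ((b'.bij fun i => m (f i)).symm i))) j)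
        ((B.L .mor).R (cell α b' fun i => c (f i)) (fun i => B.one (X i)) ((b.bij n).symm j)) :=
  R_transCell _ _ _ (b.nat φ) _ (cell_tgt α b c) (cell_src α b' _) B X j

theorem R_cell_src {f : Fin k → Fin k} (b : Braid k f) {m n : Fin k → ℕ}
    {φ : ∀ i, FMap (m i) (n i)} (c : ∀ i, DPt P .ob T (φ i))
    (X : Fin (ark fun i => m (f i)) → (B.L .mor).car) (j : Fin (ark n)) :
    B.src ((B.L .mor).R (cell α b c) X j) =
      (B.L .ob).R (smk c) (fun i => B.src (X ((b.bij m).symm i))) j := by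
  rw [B.R_src, cell_src, LAlg.R_comp]
  exact congrFun (congrArg _ (funext fun i => (B.L .ob).R_iota_ofEquiv _ _ _ _)) _

theorem R_cell_tgt {f : Fin k → Fin k} (b : Braid k f) {m n : Fin k → ℕ}
    {φ : ∀ i, FMap (m i) (n i)} (c : ∀ i, DPt P .ob T (φ i))
    (X : Fin (ark fun i => m (f i)) → (B.L .mor).car) (j : Fin (ark n)) :
    B.tgt ((B.L .mor).R (cell α b c) X j) =
      (B.L .ob).R (smk fun i => c (f i)) (fun i => B.tgt (X i)) ((b.bij n).symm j) := by
  rw [B.R_tgt, cell_tgt, LAlg.R_cast, LAlg.R_comp, LAlg.R_iota_ofEquiv]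

theorem R_smk_succ {m n : Fin (k + 1) → ℕ} {φ : ∀ i, FMap (m i) (n i)}
    (c : ∀ i, DPt P l T (φ i)) (A : LAlg.{w} P T l) (X : Fin (ark m) → A.car)
    (j : Fin (n 0 * (ark fun i : Fin k => n i.succ))) :
    A.R (smk c) X j = A.R (c 0) (fun x => A.R (smk fun i => c i.succ)
      (fun z => X (finProdFinEquiv (x, z))) (dec j).2) (dec j).1 :=
  A.R_sm _ _ X j

end R_cell

end DPt

/-! ### Compatibility of the two kinds of constraints -/

namespace PtAlg

variable {P : Operad V} {T : V} (B : PtAlg.{w} P T) (α : PseudoComm P)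

theorem seq_cancel {a n c s d c' n' : (B.L .mor).car} (h : B.seq n c = B.seq c' n')
    (h' : B.seq n' s = B.one (B.src n')) (h₁ : B.tgt n = B.src c) (h₂ : B.tgt c = B.src s)
    (h₃ : B.tgt s = B.src d) (h₄ : B.tgt c' = B.src n') (h₅ : B.tgt n' = B.src s) :
    B.seq a (B.seq n (B.seq c (B.seq s d))) = B.seq a (B.seq c' d) := by
  have h₆ : B.src n' = B.src d := by
    rw [← h₃, ← B.tgt_seq h₅, h', B.tgt_one]
  rw [← B.seq_assoc h₁ (by rw [B.src_seq, h₂]), h, B.seq_assoc h₄ (by rw [B.src_seq, h₅]),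
    ← B.seq_assoc h₅ h₃, h', h₆, B.one_seq]

theorem seq_assoc₄ {f g h k : (B.L .mor).car} (h₁ : B.tgt f = B.src g) (h₂ : B.tgt g = B.src h)
    (h₃ : B.tgt h = B.src k) :
    B.seq f (B.seq g (B.seq h k)) = B.seq (B.seq f (B.seq g h)) k := by
  rw [B.seq_assoc (by rw [B.src_seq, h₁]) (by rw [B.tgt_seq h₂, h₃]), B.seq_assoc h₂ h₃]

theorem seq_paste {a₁ a₂ e₁ e₁' e₂ g t t₁ θ k₁ k₂ : (B.L .mor).car}
    (hi : B.seq a₂ e₁ = B.seq e₁' g) (ih : B.seq (B.seq a₁ e₁') t₁ = B.seq θ k₁)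
    (ih' : B.seq (B.seq g e₂) t = B.seq t₁ k₂) (h₁ : B.tgt a₁ = B.src a₂)
    (h₂ : B.tgt a₂ = B.src e₁) (h₃ : B.tgt e₁ = B.src e₂) (h₄ : B.tgt e₂ = B.src t)
    (h₅ : B.tgt e₁' = B.src g) (h₆ : B.tgt g = B.src e₂) (h₇ : B.src g = B.src t₁)
    (h₈ : B.tgt t₁ = B.src k₂) (h₉ : B.tgt θ = B.src k₁) (h₁₀ : B.tgt k₁ = B.src k₂) :
    B.seq (B.seq (B.seq a₁ a₂) (B.seq e₁ e₂)) t = B.seq θ (B.seq k₁ k₂) := by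
  have h₁₁ : B.tgt a₁ = B.src e₁' := by
    rw [h₁, ← B.src_seq a₂ e₁, hi, B.src_seq]
  rw [B.seq_assoc h₁ (by rw [B.src_seq, h₂]), ← B.seq_assoc h₂ h₃, hi, B.seq_assoc h₅ h₆,
    ← B.seq_assoc h₁₁ (by rw [B.src_seq, h₅]), B.seq_assoc (by rw [B.tgt_seq h₁₁, B.src_seq, h₅])
      (by rw [B.tgt_seq h₆, h₄]), ih', ← B.seq_assoc (by rw [B.tgt_seq h₁₁, h₅, h₇]) h₈, ih,
    B.seq_assoc h₉ h₁₀]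

theorem R_comp_paste {m n p : ℕ} {ψ : FMap n p} {φ : FMap m n} (d : DPt P .ob T ψ)
    (c : DPt P .ob T φ) {a₁ a₂ a₃ a₄ : Fin n → (B.L .mor).car} {g e t t' k : Fin m → (B.L .mor).car}
    (h : ∀ x, B.seq (B.seq (a₁ x) (a₂ x)) (a₃ x) =
      B.seq (a₄ x) (B.seq ((B.L .mor).R c.one g x) ((B.L .mor).R c.one e x)))
    (ih : ∀ x, B.seq (B.seq (g x) (e x)) (t' x) = B.seq (t x) (k x))
    (h₁ : ∀ x, B.tgt (a₁ x) = B.src (a₂ x)) (h₂ : ∀ x, B.tgt (a₂ x) = B.src (a₃ x))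
    (h₃ : ∀ x, B.tgt (g x) = B.src (e x)) (h₄ : ∀ x, B.tgt (e x) = B.src (t' x))
    (h₅ : ∀ x, B.tgt (t x) = B.src (k x))
    (h₆ : ∀ x, B.tgt (a₃ x) = (B.L .ob).R c (fun y => B.src (t' y)) x)
    (h₇ : ∀ x, B.tgt (a₄ x) = (B.L .ob).R c (fun y => B.src (g y)) x) (j : Fin p) :
    B.seq (B.seq ((B.L .mor).R d.one a₁ j) ((B.L .mor).R d.one a₂ j))
        (B.seq ((B.L .mor).R d.one a₃ j) ((B.L .mor).R (d.comp c).one t' j)) =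
      B.seq (B.seq ((B.L .mor).R d.one a₄ j) ((B.L .mor).R (d.comp c).one t j))
        ((B.L .mor).R (d.comp c).one k j) := by
  have h₈ : ∀ x, B.src (t x) = B.src (g x) := fun x => by
    rw [← B.src_seq (t x) (k x), ← ih, B.src_seq, B.src_seq]
  have h₉ : ∀ x, B.tgt (B.seq (g x) (e x)) = B.src (t' x) := fun x => by
    rw [B.tgt_seq (h₃ x), h₄]
  have e₁ : B.seq ((B.L .mor).R d.one a₄ j) ((B.L .mor).R (d.comp c).one (fun x =>
      B.seq (B.seq (g x) (e x)) (t' x)) j) =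
      B.seq ((B.L .mor).R d.one (fun x => B.seq (a₄ x)
        (B.seq ((B.L .mor).R c.one g x) ((B.L .mor).R c.one e x))) j)
        ((B.L .mor).R (d.comp c).one t' j) := by
    rw [B.R_one_seq _ h₉, ← B.seq_assoc]
    · refine congrArg (B.seq · _) ?_
      rw [DPt.comp_one, LAlg.R_comp, ← B.R_one_seq d]
      · refine congrArg (fun F => (B.L .mor).R d.one F j) (funext fun x => ?_)
        rw [B.R_one_seq _ h₃]
      · intro x
        rw [B.R_one_src, h₇]
        simp only [B.src_seq]
    all_goals
      simp only [B.src_seq, B.R_one_src, B.R_one_tgt, h₇, h₉, LAlg.R_comp]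
  rw [B.seq_assoc (f := (B.L .mor).R d.one a₄ j), ← B.R_one_seq _ h₅, ← funext ih, e₁, ← funext h,
    ← B.seq_assoc, ← B.R_one_seq _ h₁, ← B.R_one_seq]
  all_goals
    try intro
    simp only [B.tgt_seq, B.R_one_src, B.R_one_tgt, h₁, h₂, h₅, h₆, h₇, h₈, LAlg.R_comp]

variable {m₀ n₀ p₀ m₁ n₁ p₁ n₂ p₂ : ℕ}
  {ψ₀ : FMap n₀ p₀} {ψ₁ : FMap n₁ p₁} {ψ₂ : FMap n₂ p₂} {φ₀ : FMap m₀ n₀} {φ₁ : FMap m₁ n₁}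
  (d₀ : DPt P .ob T ψ₀) (d₁ : DPt P .ob T ψ₁) (d₂ : DPt P .ob T ψ₂)
  (c₀ : DPt P .ob T φ₀) (c₁ : DPt P .ob T φ₁)
  (i₀ : Fin p₀) (i₁ : Fin p₁) (i₂ : Fin p₂) (x' : Fin n₀)
  (U : Fin m₁ → Fin m₀ → Fin n₂ → (B.L .ob).car)

theorem Al_swap_inner :
    B.seq ((B.L .mor).R d₁.one (fun y' => B.Al α d₂ c₀ i₂ x' fun z x =>
          (B.L .ob).R c₁ (fun y => U y x z) y') i₁)
        (B.seq (B.Al α d₁ c₀ i₁ x' fun y' x =>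
            (B.L .ob).R d₂ (fun z => (B.L .ob).R c₁ (fun y => U y x z) y') i₂)
          (B.seq ((B.L .mor).R c₀.one (fun x => (B.L .mor).R d₁.one (fun y' =>
              B.Al α d₂ c₁ i₂ y' fun z y => U y x z) i₁) x')
            (B.seq (B.Al α c₀ d₁ x' i₁ fun x y' =>
                (B.L .ob).R c₁ (fun y => (B.L .ob).R d₂ (U y x) i₂) y')
              ((B.L .mor).R d₁.one (fun y' => B.Al α c₀ c₁ x' y' fun x y =>
                (B.L .ob).R d₂ (U y x) i₂) i₁)))) =
      (B.L .mor).R d₁.one (fun y' =>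
        B.seq ((B.L .mor).R d₂.one (fun z => B.Al α c₀ c₁ x' y' fun x y => U y x z) i₂)
          (B.seq (B.Al α d₂ c₁ i₂ y' fun z y => (B.L .ob).R c₀ (fun x => U y x z) x')
            ((B.L .mor).R c₁.one (fun y => B.Al α d₂ c₀ i₂ x' fun z x => U y x z) y'))) i₁ := by
  have h := B.Al_nat α d₁ c₀ i₁ x' fun y' x => B.Al α d₂ c₁ i₂ y' fun z y => U y x z
  have h' := B.Al_symm α d₁ c₀ i₁ x' fun y' x =>
    (B.L .ob).R c₁ (fun y => (B.L .ob).R d₂ (U y x) i₂) y'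
  simp only [B.Al_src, B.Al_tgt] at h
  refine (B.seq_cancel h.symm (h'.trans ?_) ?_ ?_ ?_ ?_ ?_).trans ?_
  iterate 6
    simp only [B.R_one_src, B.R_one_tgt, B.Al_src, B.Al_tgt]
  simp only [fun y' => B.Al_braid α c₀ c₁ d₂ x' y' i₂ fun z x y => U y x z]
  rw [B.R_one_seq, B.R_one_seq]
  all_goals
    intros
    simp only [B.src_seq, B.R_one_src, B.R_one_tgt, B.Al_src, B.Al_tgt]

theorem Al_comp_comp (W : Fin m₀ → Fin m₁ → (B.L .ob).car) :
    B.Al α (d₀.comp c₀) (d₁.comp c₁) i₀ i₁ W =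
      B.seq ((B.L .mor).R d₀.one (fun x' => B.seq
          (B.Al α c₀ d₁ x' i₁ fun x y' => (B.L .ob).R c₁ (fun y => W x y) y')
          ((B.L .mor).R d₁.one (fun y' => B.Al α c₀ c₁ x' y' W) i₁)) i₀)
        (B.seq (B.Al α d₀ d₁ i₀ i₁ fun x' y' =>
            (B.L .ob).R c₁ (fun y => (B.L .ob).R c₀ (fun x => W x y) x') y')
          ((B.L .mor).R d₁.one (fun y' => B.Al α d₀ c₁ i₀ y' fun x' y =>
            (B.L .ob).R c₀ (fun x => W x y) x') i₁)) := by
  rw [B.Al_comp_left, B.Al_comp_right]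
  simp only [B.Al_comp_right]

theorem Al_swap :
    B.seq ((B.L .mor).R d₀.one (fun x' =>
          B.seq ((B.L .mor).R d₁.one (fun y' => B.Al α d₂ c₀ i₂ x' fun z x =>
            (B.L .ob).R c₁ (fun y => U y x z) y') i₁)
          (B.Al α d₁ c₀ i₁ x' fun y' x =>
            (B.L .ob).R d₂ (fun z => (B.L .ob).R c₁ (fun y => U y x z) y') i₂)) i₀)
        (B.seq ((B.L .mor).R (d₀.comp c₀).one (fun x => (B.L .mor).R d₁.one (fun y' =>
              B.Al α d₂ c₁ i₂ y' fun z y => U y x z) i₁) i₀)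
          (B.Al α (d₀.comp c₀) (d₁.comp c₁) i₀ i₁ fun x y => (B.L .ob).R d₂ (U y x) i₂)) =
      B.seq ((B.L .mor).R d₀.one (fun x' => (B.L .mor).R d₁.one (fun y' =>
          (B.L .mor).R d₂.one (fun z => B.Al α c₀ c₁ x' y' fun x y => U y x z) i₂) i₁) i₀)
        (B.seq (B.Al α d₀ d₁ i₀ i₁ fun x' y' => (B.L .ob).R d₂ (fun z =>
            (B.L .ob).R c₁ (fun y => (B.L .ob).R c₀ (fun x => U y x z) x') y') i₂)
          (B.seq ((B.L .mor).R d₁.one (fun y' => B.seq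
              ((B.L .mor).R d₀.one (fun x' => B.Al α d₂ c₁ i₂ y' fun z y =>
                (B.L .ob).R c₀ (fun x => U y x z) x') i₀)
              (B.Al α d₀ c₁ i₀ y' fun x' y => (B.L .ob).R d₂ (fun z =>
                (B.L .ob).R c₀ (fun x => U y x z) x') i₂)) i₁)
            ((B.L .mor).R (d₁.comp c₁).one (fun y => (B.L .mor).R d₀.one (fun x' =>
              B.Al α d₂ c₀ i₂ x' fun z x => U y x z) i₀) i₁))) := by
  rw [B.Al_comp_comp, DPt.comp_one, DPt.comp_one, LAlg.R_comp, LAlg.R_comp]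
  -- the left hand side, up to the constraints of `d₀` and `d₁`
  have hl : ∀ a b c k : Fin n₀ → (B.L .mor).car, (∀ x, B.tgt (a x) = B.src (b x)) → (∀ x, B.tgt (b x) = B.src (c x)) →
      (∀ x, B.tgt (c x) = B.src (k x)) → ∀ g, (B.L .ob).R d₀ (fun x => B.tgt (k x)) i₀ = B.src g →
      B.seq ((B.L .mor).R d₀.one (fun x => B.seq (a x) (b x)) i₀)
        (B.seq ((B.L .mor).R d₀.one c i₀) (B.seq ((B.L .mor).R d₀.one k i₀) g)) =
      B.seq ((B.L .mor).R d₀.one (fun x => B.seq (a x) (B.seq (b x) (B.seq (c x) (k x)))) i₀) g := by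
    intro a b c k h₁ h₂ h₃ g hg
    have h₄ : ∀ x, B.tgt (b x) = B.src (B.seq (c x) (k x)) := fun x => by rw [B.src_seq, h₂]
    have h₅ : ∀ x, B.tgt (a x) = B.src (B.seq (b x) (B.seq (c x) (k x))) := fun x => by
      rw [B.src_seq, h₁]
    rw [B.R_one_seq d₀ h₁, B.R_one_seq d₀ h₅, B.R_one_seq d₀ h₄, B.R_one_seq d₀ h₃]
    rw [B.seq_assoc, B.seq_assoc, B.seq_assoc, B.seq_assoc]
    all_goals simp only [B.src_seq, B.tgt_seq, B.R_one_src, B.R_one_tgt, h₁, h₂, h₃, hg]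
  rw [hl]
  rotate_left
  iterate 4
    intros
    simp only [B.src_seq, B.tgt_seq, B.R_one_src, B.R_one_tgt, B.Al_src, B.Al_tgt]
  simp only [B.Al_swap_inner]
  -- the right hand side, past the constraint of `c₁` with `d₀`
  have hr : ∀ y', B.seq (B.seq ((B.L .mor).R d₀.one (fun x' => B.Al α d₂ c₁ i₂ y' fun z y =>
        (B.L .ob).R c₀ (fun x => U y x z) x') i₀)
      (B.Al α d₀ c₁ i₀ y' fun x' y => (B.L .ob).R d₂ (fun z =>
        (B.L .ob).R c₀ (fun x => U y x z) x') i₂))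
      ((B.L .mor).R c₁.one (fun y => (B.L .mor).R d₀.one (fun x' =>
        B.Al α d₂ c₀ i₂ x' fun z x => U y x z) i₀) y') =
      B.seq ((B.L .mor).R d₀.one (fun x' => B.seq
          (B.Al α d₂ c₁ i₂ y' fun z y => (B.L .ob).R c₀ (fun x => U y x z) x')
          ((B.L .mor).R c₁.one (fun y => B.Al α d₂ c₀ i₂ x' fun z x => U y x z) y')) i₀)
        (B.Al α d₀ c₁ i₀ y' fun x' y =>
            (B.L .ob).R c₀ (fun x => (B.L .ob).R d₂ (U y x) i₂) x') := by
    intro y'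
    have h := B.Al_nat α d₀ c₁ i₀ y' fun x' y => B.Al α d₂ c₀ i₂ x' fun z x => U y x z
    simp only [B.Al_src, B.Al_tgt] at h
    rw [B.R_one_seq, B.seq_assoc, ← h, B.seq_assoc]
    all_goals
      intros
      simp only [B.R_one_src, B.R_one_tgt, B.Al_src, B.Al_tgt]
  have hr' := (B.R_one_seq d₁ (fun y' => by
      simp only [B.tgt_seq, B.R_one_src, B.R_one_tgt, B.Al_src, B.Al_tgt]) i₁).symm.trans
    ((congrArg (fun f => (B.L .mor).R d₁.one f i₁) (funext hr)).trans (B.R_one_seq d₁ (fun y' => by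
      simp only [B.tgt_seq, B.R_one_src, B.R_one_tgt, B.Al_src, B.Al_tgt]) i₁))
  rw [hr']
  -- past the constraint of `d₀` with `d₁`
  have h := B.Al_nat α d₀ d₁ i₀ i₁ fun x' y' => B.seq
    (B.Al α d₂ c₁ i₂ y' fun z y => (B.L .ob).R c₀ (fun x => U y x z) x')
    ((B.L .mor).R c₁.one (fun y => B.Al α d₂ c₀ i₂ x' fun z x => U y x z) y')
  simp only [B.src_seq, B.tgt_seq, B.R_one_src, B.R_one_tgt, B.Al_src, B.Al_tgt] at h
  rw [← B.seq_assoc (f := B.Al α d₀ d₁ i₀ i₁ _), ← h]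
  rotate_left
  iterate 2
    simp only [B.src_seq, B.tgt_seq, B.R_one_src, B.R_one_tgt, B.Al_src, B.Al_tgt]
  have hm : (B.L .mor).R d₀.one (fun x' => (B.L .mor).R d₁.one (fun y' =>
        B.seq ((B.L .mor).R d₂.one (fun z => B.Al α c₀ c₁ x' y' fun x y => U y x z) i₂)
          (B.seq (B.Al α d₂ c₁ i₂ y' fun z y => (B.L .ob).R c₀ (fun x => U y x z) x')
            ((B.L .mor).R c₁.one (fun y => B.Al α d₂ c₀ i₂ x' fun z x => U y x z) y'))) i₁) i₀ =
      B.seq ((B.L .mor).R d₀.one (fun x' => (B.L .mor).R d₁.one (fun y' =>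
          (B.L .mor).R d₂.one (fun z => B.Al α c₀ c₁ x' y' fun x y => U y x z) i₂) i₁) i₀)
        ((B.L .mor).R d₀.one (fun x' => (B.L .mor).R d₁.one (fun y' =>
          (B.seq (B.Al α d₂ c₁ i₂ y' fun z y => (B.L .ob).R c₀ (fun x => U y x z) x')
            ((B.L .mor).R c₁.one (fun y => B.Al α d₂ c₀ i₂ x' fun z x => U y x z) y'))) i₁) i₀) := by
    rw [← B.R_one_seq]
    · refine congrArg (fun f => (B.L .mor).R d₀.one f i₀) (funext fun x' => B.R_one_seq _ ?_ _)
      intros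
      simp only [B.src_seq, B.R_one_tgt, B.Al_src, B.Al_tgt]
    · intros
      simp only [B.src_seq, B.R_one_src, B.R_one_tgt, B.Al_src, B.Al_tgt]
  rw [hm, B.seq_assoc, B.seq_assoc]
  all_goals
    simp only [B.src_seq, B.tgt_seq, B.R_one_src, B.R_one_tgt, B.Al_src, B.Al_tgt]

theorem Al_swap_tail {χ₀ : FMap m₀ p₀} {χ₁ : FMap m₁ p₁} {e₀ : DPt P .ob T χ₀}
    {e₁ : DPt P .ob T χ₁} (h₀ : ψ₀.comp φ₀ = χ₀) (h₁ : ψ₁.comp φ₁ = χ₁)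
    (he₀ : e₀ = (d₀.comp c₀).cast h₀) (he₁ : e₁ = (d₁.comp c₁).cast h₁)
    (t : Fin m₁ → Fin m₀ → (B.L .mor).car)
    (ht : ∀ y x, B.src (t y x) = (B.L .ob).R d₂ (U y x) i₂) :
    B.seq (B.seq ((B.L .mor).R d₀.one (fun x' => (B.L .mor).R d₁.one (fun y' =>
          (B.L .mor).R d₂.one (fun z => B.Al α c₀ c₁ x' y' fun x y => U y x z) i₂) i₁) i₀)
        (B.Al α d₀ d₁ i₀ i₁ fun x' y' => (B.L .ob).R d₂ (fun z =>
            (B.L .ob).R c₁ (fun y => (B.L .ob).R c₀ (fun x => U y x z) x') y') i₂))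
      (B.seq ((B.L .mor).R d₁.one (fun y' => B.Al α (d₀.sm d₂) c₁ (finProdFinEquiv (i₀, i₂)) y'
          fun w y => (B.L .ob).R c₀ (fun x => U y x (dec w).2) (dec w).1) i₁)
        ((B.L .mor).R e₁.one (fun y => B.seq ((B.L .mor).R d₀.one (fun x' =>
              B.Al α d₂ c₀ i₂ x' fun z x => U y x z) i₀)
            ((B.L .mor).R e₀.one (t y) i₀)) i₁)) =
    B.seq (B.seq ((B.L .mor).R d₀.one (fun x' => B.Al α (d₁.sm d₂) c₀ (finProdFinEquiv (i₁, i₂)) x'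
          fun w x => (B.L .ob).R c₁ (fun y => U y x (dec w).2) (dec w).1) i₀)
        ((B.L .mor).R e₀.one (fun x => B.seq ((B.L .mor).R d₁.one (fun y' =>
              B.Al α d₂ c₁ i₂ y' fun z y => U y x z) i₁)
            ((B.L .mor).R e₁.one (fun y => t y x) i₁)) i₀))
      (B.Al α e₀ e₁ i₀ i₁ fun x y => B.tgt (t y x)) := by
  subst h₀ h₁
  rw [DPt.cast_self] at he₀ he₁
  subst he₀ he₁
  have h := B.Al_swap α d₀ d₁ d₂ c₀ c₁ i₀ i₁ i₂ U
  have h' := B.Al_nat α (d₀.comp c₀) (d₁.comp c₁) i₀ i₁ fun x y => t y x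
  simp only [ht] at h'
  have h₃ : ∀ {y}, (B.L .mor).R (d₁.comp c₁).one (fun y => B.seq ((B.L .mor).R d₀.one (fun x' =>
        B.Al α d₂ c₀ i₂ x' fun z x => U y x z) i₀) ((B.L .mor).R (d₀.comp c₀).one (t y) i₀)) y =
      B.seq ((B.L .mor).R (d₁.comp c₁).one (fun y => (B.L .mor).R d₀.one (fun x' =>
        B.Al α d₂ c₀ i₂ x' fun z x => U y x z) i₀) y)
        ((B.L .mor).R (d₁.comp c₁).one (fun y => (B.L .mor).R (d₀.comp c₀).one (t y) i₀) y) := by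
    intro y
    refine B.R_one_seq _ (fun y => ?_) _
    simp only [B.R_one_src, B.R_one_tgt, B.Al_tgt, LAlg.R_comp, ht]
  have h₄ : ∀ {x}, (B.L .mor).R (d₀.comp c₀).one (fun x => B.seq ((B.L .mor).R d₁.one (fun y' =>
        B.Al α d₂ c₁ i₂ y' fun z y => U y x z) i₁)
          ((B.L .mor).R (d₁.comp c₁).one (fun y => t y x) i₁)) x =
      B.seq ((B.L .mor).R (d₀.comp c₀).one (fun x => (B.L .mor).R d₁.one (fun y' =>
        B.Al α d₂ c₁ i₂ y' fun z y => U y x z) i₁) x)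
        ((B.L .mor).R (d₀.comp c₀).one (fun x => (B.L .mor).R (d₁.comp c₁).one
          (fun y => t y x) i₁) x) := by
    intro x
    refine B.R_one_seq _ (fun x => ?_) _
    simp only [B.R_one_src, B.R_one_tgt, B.Al_tgt, LAlg.R_comp, ht]
  simp only [B.Al_sm_left, dec_mk, h₃, h₄]
  rw [B.seq_assoc, B.seq_assoc, B.seq_assoc (f := (B.L .mor).R (d₀.comp c₀).one _ i₀), h']
  refine Eq.trans ?_ (B.seq_assoc₄ ?_ ?_ ?_).symm
  rw [h]
  · rw [B.seq_assoc, B.seq_assoc, B.seq_assoc]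
    all_goals
      simp only [B.src_seq, B.tgt_seq, B.R_one_src, B.R_one_tgt, B.Al_src, B.Al_tgt, LAlg.R_comp,
        ht]
  all_goals
    simp only [B.src_seq, B.tgt_seq, B.R_one_src, B.R_one_tgt, B.Al_src, B.Al_tgt, LAlg.R_comp,
      ht]

end PtAlg

namespace DPt

variable {P : Operad V} {T : V} {l : Lvl} (α : PseudoComm P)

section R_thetak

variable {k : ℕ} (B : PtAlg.{w} P T)

theorem R_thetak_src {m n p : Fin k → ℕ} {ψ : ∀ i, FMap (n i) (p i)}
    {φ : ∀ i, FMap (m i) (n i)} (d : ∀ i, DPt P .ob T (ψ i)) (c : ∀ i, DPt P .ob T (φ i))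
    (X : Fin (ark m) → (B.L .mor).car) (j : Fin (ark p)) :
    B.src ((B.L .mor).R (thetak α d c) X j) =
      (B.L .ob).R (smk d) ((B.L .ob).R (smk c) fun i => B.src (X i)) j := by
  rw [B.R_src, thetak_src, LAlg.R_cast, LAlg.R_comp]

theorem R_thetak_tgt {m n p : Fin k → ℕ} {ψ : ∀ i, FMap (n i) (p i)}
    {φ : ∀ i, FMap (m i) (n i)} (d : ∀ i, DPt P .ob T (ψ i)) (c : ∀ i, DPt P .ob T (φ i))
    (X : Fin (ark m) → (B.L .mor).car) (j : Fin (ark p)) :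
    B.tgt ((B.L .mor).R (thetak α d c) X j) =
      (B.L .ob).R (smk fun i => (d i).comp (c i)) (fun i => B.tgt (X i)) j := by
  rw [B.R_tgt, thetak_tgt]

theorem R_thetak_succ {m n p : Fin (k + 1) → ℕ} {ψ : ∀ i, FMap (n i) (p i)}
    {φ : ∀ i, FMap (m i) (n i)} (d : ∀ i, DPt P .ob T (ψ i)) (c : ∀ i, DPt P .ob T (φ i))
    (X : Fin (ark m) → (B.L .ob).car) (j : Fin (p 0 * ark fun i : Fin k => p i.succ)) :
    (B.L .mor).R (thetak α d c) (fun i => B.one (X i)) j =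
      B.seq ((B.L .mor).R (d 0).one (fun x' => B.Al α (smk fun i => d i.succ) (c 0) (dec j).2 x'
          fun y x => (B.L .ob).R (smk fun i => c i.succ) (fun z => X (finProdFinEquiv (x, z))) y)
            (dec j).1)
        ((B.L .mor).R ((d 0).comp (c 0)).one (fun x => (B.L .mor).R
          (thetak α (fun i => d i.succ) fun i => c i.succ)
            (fun z => B.one (X (finProdFinEquiv (x, z)))) (dec j).2) (dec j).1) := by
  have h := R_thetaSeq α (d 0) (smk fun i => d i.succ) (c 0) (smk fun i => c i.succ) rfl
    (smk_comp (fun i => ψ i.succ) fun i => φ i.succ).symm (t := ((d 0).comp (c 0)).one)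
    (t' := thetak α (fun i => d i.succ) fun i => c i.succ) (one_src _)
    (thetak_src α (fun i => d i.succ) fun i => c i.succ) B (fun i => B.one (X i)) j
  simp only [B.src_one] at h
  exact h

end R_thetak

section R_cell

variable (B : PtAlg.{w} P T) {k : ℕ} {f : Fin k → Fin k} (b : Braid k f)

theorem R_cell_interchange {m n : Fin k → ℕ} {φ : ∀ i, FMap (m i) (n i)}
    (c : ∀ i, DPt P .ob T (φ i)) (X : Fin (ark fun i => m (f i)) → (B.L .mor).car)
    (j : Fin (ark n)) :
    B.seq ((B.L .mor).R (smk c).one (fun i => X ((b.bij m).symm i)) j)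
        ((B.L .mor).R (cell α b c) (fun i => B.one (B.tgt (X i))) j) =
      B.seq ((B.L .mor).R (cell α b c) (fun i => B.one (B.src (X i))) j)
        ((B.L .mor).R (smk fun i => c (f i)).one X ((b.bij n).symm j)) := by
  have h := (B.R_eq_seq_src (cell α b c) X j).symm.trans (B.R_eq_seq_tgt (cell α b c) X j)
  rw [cell_src, cell_tgt] at h
  refine Eq.trans ?_ (h.trans ?_)
  · refine congrArg (B.seq · _) ?_
    rw [comp_one, LAlg.R_comp, iota_one]
    exact congrFun (congrArg _ (funext fun i => ((B.L .mor).R_iota_ofEquiv _ _ _ _).symm)) j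
  · refine congrArg (B.seq _) ?_
    rw [cast_one, LAlg.R_cast, comp_one, LAlg.R_comp, iota_one, LAlg.R_iota_ofEquiv]

/-- The reordering constraint at a list of operations is compatible with the interchange of the
first operation with the remaining ones. -/
theorem R_cell_Al {m n : Fin k → ℕ} {φ : ∀ i, FMap (m i) (n i)} (d : ∀ i, DPt P .ob T (φ i))
    {m' n' : ℕ} {χ : FMap m' n'} (c : DPt P .ob T χ)
    (W : Fin (ark fun i => m (f i)) → Fin m' → (B.L .ob).car) (j : Fin (ark n)) (x' : Fin n') :
    B.seq ((B.L .mor).R (cell α b d) (fun y => B.one ((B.L .ob).R c (W y) x')) j)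
        (B.Al α (smk fun i => d (f i)) c ((b.bij n).symm j) x' W) =
      B.seq (B.Al α (smk d) c j x' fun y => W ((b.bij m).symm y))
        ((B.L .mor).R c.one (fun x => (B.L .mor).R (cell α b d) (fun y => B.one (W y x)) j) x') := by
  have h := B.Al_nat_mor α (cell α b d) c.one j x' fun y x => B.one (W y x)
  simp only [cell_src, cell_tgt, one_src, one_tgt, B.Al_cast_left, B.Al_comp_iota_left,
    B.Al_iota_comp_left, B.R_one, B.src_one, B.tgt_one] at h
  exact h

end R_cell

theorem R_smk_one_succ {k : ℕ} {m n : Fin (k + 1) → ℕ} {φ : ∀ i, FMap (m i) (n i)}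
    (c : ∀ i, DPt P .ob T (φ i)) (A : LAlg.{w} P T .mor) (X : Fin (ark m) → A.car)
    (j : Fin (n 0 * (ark fun i : Fin k => n i.succ))) :
    A.R (smk c).one X j = A.R (c 0).one (fun x => A.R (smk fun i => c i.succ).one
      (fun z => X (finProdFinEquiv (x, z))) (dec j).2) (dec j).1 :=
  (congrFun (congrArg (A.R · X) (sm_one (c 0) (smk fun i => c i.succ))) j).trans (A.R_sm _ _ X j)

/-- Compatibility of the reordering constraints with the pseudofunctoriality constraints of the
smash product, evaluated on an array of objects. -/
theorem R_cell_theta : ∀ {k : ℕ} {f : Fin k → Fin k} (b : Braid k f) {m n p : Fin k → ℕ}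
    {ψ : ∀ i, FMap (n i) (p i)} {φ : ∀ i, FMap (m i) (n i)} (d : ∀ i, DPt P .ob T (ψ i))
    (c : ∀ i, DPt P .ob T (φ i)) (B : PtAlg.{w} P T)
    (X : Fin (ark fun i => m (f i)) → (B.L .ob).car) (j : Fin (ark p)),
    B.seq (B.seq ((B.L .mor).R (smk d).one
          (fun y => (B.L .mor).R (cell α b c) (fun i => B.one (X i)) y) j)
        ((B.L .mor).R (cell α b d) (fun y => B.one ((B.L .ob).R (smk fun i => c (f i)) X y)) j))
        ((B.L .mor).R (thetak α (fun i => d (f i)) fun i => c (f i)) (fun i => B.one (X i))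
          ((b.bij p).symm j)) =
      B.seq ((B.L .mor).R (thetak α d c) (fun i => B.one (X ((b.bij m).symm i))) j)
        ((B.L .mor).R (cell α b fun i => (d i).comp (c i)) (fun i => B.one (X i)) j)
  | k, _, .refl _, m, n, p, ψ, φ, d, c, B, X, j => by
    have h₁ : (B.L .mor).R (smk d).one
        (fun y => (B.L .mor).R (cell α (.refl k) c) (fun i => B.one (X i)) y) j =
        B.one ((B.L .ob).R (smk d) ((B.L .ob).R (smk c) X) j) := by
      simp only [R_cell_refl]
      exact B.R_one _ _ _
    have h₂ := R_cell_refl α B d ((B.L .ob).R (smk c) X) j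
    have h₃ := R_cell_refl α B (fun i => (d i).comp (c i)) X j
    refine (congrArg₂ B.seq (congrArg₂ B.seq h₁ h₂) rfl).trans
      (Eq.trans ?_ (congrArg (B.seq _) h₃).symm)
    rw [B.one_seq' (B.src_one _)]
    refine (B.one_seq' ?_).trans (B.seq_one' ?_).symm
    · refine (R_thetak_src α B d c _ j).trans ?_
      simp only [B.src_one]
    · refine (R_thetak_tgt α B d c _ j).trans ?_
      simp only [B.tgt_one]
  | _, _, .swap k, m, n, p, ψ, φ, d, c, B, X, j => by
    obtain ⟨⟨i₀, w⟩, rfl⟩ := finProdFinEquiv.surjective j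
    obtain ⟨⟨i₁, i₂⟩, rfl⟩ := finProdFinEquiv.surjective w
    let U : Fin (m 1) → Fin (m 0) → Fin (ark fun i : Fin k => n i.succ.succ) → (B.L .ob).car :=
      fun y x => (B.L .ob).R (smk fun i => c i.succ.succ)
        (fun z => X (finProdFinEquiv (y, finProdFinEquiv (x, z))))
    let t : Fin (m 1) → Fin (m 0) → (B.L .mor).car := fun y x => (B.L .mor).R
      (thetak α (fun i => d i.succ.succ) fun i => c i.succ.succ)
        (fun z => B.one (X (finProdFinEquiv (y, finProdFinEquiv (x, z))))) i₂
    have h := B.Al_swap_tail α (d 0) (d 1) (smk fun i => d i.succ.succ) (c 0) (c 1) i₀ i₁ i₂ U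
      rfl rfl (cast_self rfl _).symm (cast_self rfl _).symm t (fun y x => by
        refine (R_thetak_src α B _ _ _ i₂).trans ?_
        simp only [B.src_one]
        rfl)
    refine Eq.trans (congrArg₂ B.seq (congrArg₂ B.seq ?_ ?_) ?_) (h.trans (congrArg₂ B.seq ?_ ?_))
    · refine (R_smk_one_succ d _ _ _).trans ?_
      rw [dec_mk]
      refine congrArg (fun F => (B.L .mor).R (d 0).one F i₀) (funext fun x' => ?_)
      refine (R_smk_one_succ (fun i => d i.succ) _ _ _).trans ?_
      rw [dec_mk]
      refine congrArg (fun F => (B.L .mor).R (d 1).one F i₁) (funext fun y' => ?_)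
      refine congrArg (fun F => (B.L .mor).R _ F i₂) (funext fun z => ?_)
      refine (R_cell_swap α B c X (finProdFinEquiv (x', finProdFinEquiv (y', z)))).trans ?_
      simp only [dec_mk]
      rfl
    · refine (R_cell_swap α B d _ (finProdFinEquiv (i₀, finProdFinEquiv (i₁, i₂)))).trans ?_
      simp only [dec_mk]
      refine congrArg (B.Al α (d 0) (d 1) i₀ i₁) (funext fun x' => funext fun y' =>
        congrArg (fun F => (B.L .ob).R _ F i₂) (funext fun z => ?_))
      refine (R_smk_succ (fun i => c (swapF i)) (B.L .ob) X
        (finProdFinEquiv (y', finProdFinEquiv (x', z)))).trans ?_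
      rw [dec_mk]
      refine congrArg (fun F => (B.L .ob).R (c 1) F y') (funext fun y => ?_)
      refine (R_smk_succ (fun i => c (swapF i.succ)) (B.L .ob) _ (finProdFinEquiv (x', z))).trans ?_
      rw [dec_mk]
      rfl
    · refine (congrArg _ (swap3_symm_mk i₁ i₀ i₂)).trans ?_
      refine (R_thetak_succ α B (fun i => d (swapF i)) (fun i => c (swapF i)) X
        (finProdFinEquiv (i₁, finProdFinEquiv (i₀, i₂)))).trans ?_
      rw [dec_mk]
      refine congrArg₂ B.seq ?_ ?_
      · refine congrArg (fun F => (B.L .mor).R (d 1).one F i₁) (funext fun y' => ?_)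
        refine congrArg (B.Al α (smk fun i => d (swapF i.succ)) (c 1) _ y') (funext fun w =>
          funext fun y => ?_)
        exact R_smk_succ (fun i => c (swapF i.succ)) (B.L .ob) _ w
      · refine congrArg (fun F => (B.L .mor).R ((d 1).comp (c 1)).one F i₁) (funext fun y => ?_)
        refine (R_thetak_succ α B (fun i => d (swapF i.succ)) (fun i => c (swapF i.succ)) _
          (finProdFinEquiv (i₀, i₂))).trans ?_
        rw [dec_mk]
        rfl
    · refine Eq.symm ((R_thetak_succ α B d c _ (finProdFinEquiv (i₀, finProdFinEquiv (i₁, i₂)))).trans ?_)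
      rw [dec_mk]
      refine congrArg₂ B.seq ?_ ?_
      · refine congrArg (fun F => (B.L .mor).R (d 0).one F i₀) (funext fun x' => ?_)
        refine congrArg (B.Al α (smk fun i => d i.succ) (c 0) _ x') (funext fun w =>
          funext fun x => ?_)
        refine (R_smk_succ (fun i => c i.succ) (B.L .ob) _ w).trans ?_
        refine congrArg (fun F => (B.L .ob).R (c 1) F _) (funext fun y =>
          congrArg (fun F => (B.L .ob).R _ F _) (funext fun z => congrArg X ?_))
        exact swap3_symm_mk y x z
      · refine congrArg (fun F => (B.L .mor).R ((d 0).comp (c 0)).one F i₀) (funext fun x => ?_)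
        refine (R_thetak_succ α B (fun i => d i.succ) (fun i => c i.succ) _
          (finProdFinEquiv (i₁, i₂))).trans ?_
        rw [dec_mk]
        refine congrArg₂ B.seq ?_ ?_
        · refine congrArg (fun F => (B.L .mor).R (d 1).one F i₁) (funext fun y' => ?_)
          refine congrArg (B.Al α (smk fun i => d i.succ.succ) (c 1) i₂ y') (funext fun z' =>
            funext fun y => ?_)
          refine congrArg (fun F => (B.L .ob).R _ F z') (funext fun z => congrArg X ?_)
          exact swap3_symm_mk y x z
        · refine congrArg (fun F => (B.L .mor).R ((d 1).comp (c 1)).one F i₁) (funext fun y => ?_)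
          refine congrArg (fun F => (B.L .mor).R _ F i₂) (funext fun z =>
            congrArg (fun w => B.one (X w)) ?_)
          exact swap3_symm_mk y x z
    · refine Eq.symm ((R_cell_swap α B (fun i => (d i).comp (c i)) X
        (finProdFinEquiv (i₀, finProdFinEquiv (i₁, i₂)))).trans ?_)
      simp only [dec_mk]
      refine congrArg (B.Al α _ _ i₀ i₁) (funext fun x => funext fun y => ?_)
      refine Eq.trans ?_ (R_thetak_tgt α B _ _ _ i₂).symm
      simp only [B.tgt_one]
  | _, _, .cons (f := f) b, m, n, p, ψ, φ, d, c, B, X, j => by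
    obtain ⟨⟨i₀, j⟩, rfl⟩ := finProdFinEquiv.surjective j
    have ih := fun x => R_cell_theta b (fun i => d i.succ) (fun i => c i.succ) B
      (fun z => X (finProdFinEquiv (x, z))) j
    have h₀ : (b.cons.bij p).symm (finProdFinEquiv (i₀, j)) =
        finProdFinEquiv (i₀, (b.bij fun i => p i.succ).symm j) := prodE_symm_mk _ _ _ _
    have h₀' : ∀ x z, (b.cons.bij m).symm (finProdFinEquiv (x, z)) =
        finProdFinEquiv (x, (b.bij fun i => m i.succ).symm z) := fun _ _ => prodE_symm_mk _ _ _ _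
    have h₁ : (B.L .mor).R (smk d).one
        (fun y => (B.L .mor).R (cell α (.cons b) c) (fun i => B.one (X i)) y)
          (finProdFinEquiv (i₀, j)) =
        (B.L .mor).R (d 0).one (fun x' => (B.L .mor).R (smk fun i => d i.succ).one (fun y =>
          (B.L .mor).R (c 0).one (fun x => (B.L .mor).R (cell α b fun i => c i.succ)
            (fun z => B.one (X (finProdFinEquiv (x, z)))) y) x') j) i₀ := by
      refine (R_smk_one_succ d _ _ _).trans ?_
      rw [dec_mk]
      refine congrArg (fun F => (B.L .mor).R (d 0).one F i₀) (funext fun x' =>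
        congrArg (fun F => (B.L .mor).R _ F j) (funext fun y => ?_))
      refine (R_cell_cons α B b c (fun i => B.one (X i)) (finProdFinEquiv (x', y))).trans ?_
      rw [dec_mk]
    have h₂ : (B.L .mor).R (cell α (.cons b) d)
        (fun y => B.one ((B.L .ob).R (smk fun i => c (tailF _ i)) X y)) (finProdFinEquiv (i₀, j)) =
        (B.L .mor).R (d 0).one (fun x' => (B.L .mor).R (cell α b fun i => d i.succ) (fun y =>
          B.one ((B.L .ob).R (c 0) (fun x => (B.L .ob).R (smk fun i => c (tailF _ i.succ))
            (fun z => X (finProdFinEquiv (x, z))) y) x')) j) i₀ := by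
      refine (R_cell_cons α B b d _ _).trans ?_
      rw [dec_mk]
      refine congrArg (fun F => (B.L .mor).R (d 0).one F i₀) (funext fun x' =>
        congrArg (fun F => (B.L .mor).R _ F j) (funext fun y => congrArg B.one ?_))
      refine (R_smk_succ (fun i => c (tailF _ i)) (B.L .ob) X (finProdFinEquiv (x', y))).trans ?_
      rw [dec_mk]
      rfl
    have h₃ := R_thetak_succ α B (fun i => d (tailF _ i)) (fun i => c (tailF _ i)) X
      (finProdFinEquiv (i₀, (b.bij fun i => p i.succ).symm j))
    have h₄ := R_thetak_succ α B d c (fun i => X ((b.cons.bij m).symm i)) (finProdFinEquiv (i₀, j))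
    have h₅ := R_cell_cons α B b (fun i => (d i).comp (c i)) (fun i => B.one (X i))
      (finProdFinEquiv (i₀, j))
    rw [dec_mk] at h₃ h₄ h₅
    simp only [h₀'] at h₄
    refine (congrArg₂ B.seq (congrArg₂ B.seq h₁ h₂) ((congrArg _ h₀).trans h₃)).trans
      (Eq.trans ?_ (congrArg₂ B.seq h₄ h₅).symm)
    refine B.R_comp_paste (d 0) (c 0) (fun x' => ?_) ih ?_ ?_ ?_ ?_ ?_ ?_ ?_ i₀
    · have e₁ := R_cell_Al α B b (fun i => d i.succ) (c 0) (fun y x =>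
        (B.L .ob).R (smk fun i => c (tailF _ i.succ)) (fun z => X (finProdFinEquiv (x, z))) y) j x'
      have e₂ := B.Al_nat α (smk fun i => d i.succ) (c 0) j x' fun y x =>
        (B.L .mor).R (cell α b fun i => c i.succ) (fun z => B.one (X (finProdFinEquiv (x, z)))) y
      simp only [R_cell_src, R_cell_tgt, B.src_one, B.tgt_one] at e₂
      rw [B.seq_assoc]
      · refine (congrArg (B.seq _) e₁).trans ?_
        rw [← B.seq_assoc]
        · refine (congrArg (B.seq · _) e₂).trans ?_
          rw [B.seq_assoc]
          all_goals
            simp only [B.R_one_src, B.R_one_tgt, R_cell_src, R_cell_tgt, B.src_one, B.tgt_one,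
              B.Al_tgt]
          all_goals rfl
        all_goals
          simp only [B.R_one_src, B.R_one_tgt, R_cell_src, R_cell_tgt, B.src_one, B.tgt_one,
            B.Al_src, B.Al_tgt]
        all_goals rfl
      all_goals
        simp only [B.R_one_tgt, R_cell_src, R_cell_tgt, B.src_one, B.tgt_one]
      · rfl
      · exact (B.Al_src α (smk fun i => d (f i).succ) (c 0) _ _ _).symm
    all_goals
      intros
      simp only [B.R_one_src, B.R_one_tgt, R_cell_src, R_cell_tgt, R_thetak_src, R_thetak_tgt,
        B.src_one, B.tgt_one, B.Al_tgt]
    · rfl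
    · exact (B.Al_src α (smk fun i => d (f i).succ) (c 0) _ _ _).symm
    · exact B.Al_tgt α (smk fun i => d (f i).succ) (c 0) _ _ _
    · rfl
  | _, _, .trans (f := f) b b', m, n, p, ψ, φ, d, c, B, X, j => by
    have ih := R_cell_theta b d c B (fun i => X ((b'.bij fun i => m (f i)).symm i)) j
    have ih' := R_cell_theta b' (fun i => d (f i)) (fun i => c (f i)) B X ((b.bij p).symm j)
    have h₁ : ∀ y, (B.L .mor).R (cell α (b.trans b') c) (fun i => B.one (X i)) y =
        B.seq ((B.L .mor).R (cell α b c) (fun i => B.one (X ((b'.bij fun i => m (f i)).symm i))) y)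
          ((B.L .mor).R (cell α b' fun i => c (f i)) (fun i => B.one (X i)) ((b.bij n).symm y)) :=
      R_cell_trans α B b b' c X
    have h₂ := R_cell_trans α B b b' d ((B.L .ob).R (smk fun i => c (f _)) X) j
    have h₃ := R_cell_trans α B b b' (fun i => (d i).comp (c i)) X j
    have hi := R_cell_interchange α B b d
      ((B.L .mor).R (cell α b' fun i => c (f i)) (fun i => B.one (X i))) j
    simp only [R_cell_src, R_cell_tgt, B.src_one, B.tgt_one] at hi
    refine (congrArg₂ B.seq (congrArg₂ B.seq ((congrArg (fun F => (B.L .mor).R _ F j)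
      (funext h₁)).trans (B.R_one_seq (smk d) (fun y => ?_) j)) h₂) rfl).trans
      (Eq.trans (B.seq_paste hi ih ih' ?_ ?_ ?_ ?_ ?_ ?_ ?_ ?_ ?_ ?_)
        (congrArg (B.seq _) h₃).symm)
    all_goals
      simp only [B.R_one_src, B.R_one_tgt, R_cell_src, R_cell_tgt, R_thetak_src, R_thetak_tgt,
        B.src_one, B.tgt_one]
    rfl

end DPt

/-! ### Further properties of the reordering constraints -/

theorem Operad.inv_cmp (P : Operad V) {T : V} {n k : ℕ} {j : Fin k → ℕ} (e : Fin n ≃ Σ i, Fin (j i))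
    {d : T ⟶ (P.O k).car .mor} {c : ∀ i, T ⟶ (P.O (j i)).car .mor} (hd : (P.O k).Inv d)
    (hc : ∀ i, (P.O _).Inv (c i)) : (P.O n).Inv (P.cmp e d c) :=
  VFun.ap_inv _ (VFun.ap_inv _ (VCat.inv_pr hd (VCat.inv_tup hc)))

namespace DPt

variable {P : Operad V} {T : V} {l : Lvl} (α : PseudoComm P)

theorem R_cell_nat : ∀ {k : ℕ} {f : Fin k → Fin k} (b : Braid k f) {m n : Fin k → ℕ}
    {φ : ∀ i, FMap (m i) (n i)} (c : ∀ i, DPt P .mor T (φ i)) (B : PtAlg.{w} P T)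
    (X : Fin (ark fun i => m (f i)) → (B.L .ob).car) (j : Fin (ark n)),
    B.seq ((B.L .mor).R (smk c) (fun i => B.one (X ((b.bij m).symm i))) j)
        ((B.L .mor).R (cell α b fun i => (c i).tgt) (fun i => B.one (X i)) j) =
      B.seq ((B.L .mor).R (cell α b fun i => (c i).src) (fun i => B.one (X i)) j)
        ((B.L .mor).R (smk fun i => c (f i)) (fun i => B.one (X i)) ((b.bij n).symm j))
  | k, _, .refl _, m, n, φ, c, B, X, j => by
    refine (congrArg (B.seq _) (R_cell_refl α B (fun i => (c i).tgt) X j)).trans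
      (Eq.trans ?_ (congrArg (B.seq · _) (R_cell_refl α B (fun i => (c i).src) X j)).symm)
    refine (B.seq_one' ?_).trans (B.one_seq' ?_).symm
    · rw [B.R_tgt, smk_tgt]
      simp only [B.tgt_one]
      rfl
    · rw [B.R_src, smk_src]
      simp only [B.src_one]
      rfl
  | _, _, .swap k, m, n, φ, c, B, X, j => by
    obtain ⟨⟨i₀, w⟩, rfl⟩ := finProdFinEquiv.surjective j
    obtain ⟨⟨i₁, i₂⟩, rfl⟩ := finProdFinEquiv.surjective w
    have h := B.Al_nat_mor α (c 0) (c 1) i₀ i₁ fun x y =>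
      (B.L .mor).R (smk fun i => c i.succ.succ)
        (fun z => B.one (X (finProdFinEquiv (y, finProdFinEquiv (x, z))))) i₂
    simp only [B.R_src, B.R_tgt, smk_src, smk_tgt, B.src_one, B.tgt_one] at h
    refine Eq.trans (congrArg₂ B.seq ?_ ?_) (h.trans (congrArg₂ B.seq ?_ ?_))
    · refine (R_smk_succ c _ _ (finProdFinEquiv (i₀, finProdFinEquiv (i₁, i₂)))).trans ?_
      rw [dec_mk]
      refine congrArg (fun F => (B.L .mor).R (c 0) F i₀) (funext fun x => ?_)
      refine (R_smk_succ (fun i => c i.succ) _ _ (finProdFinEquiv (i₁, i₂))).trans ?_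
      rw [dec_mk]
      refine congrArg (fun F => (B.L .mor).R (c 1) F i₁) (funext fun y => ?_)
      refine congrArg (fun F => (B.L .mor).R _ F i₂) (funext fun z =>
        congrArg (fun w => B.one (X w)) (swap3_symm_mk y x z))
    · refine (R_cell_swap α B _ X (finProdFinEquiv (i₀, finProdFinEquiv (i₁, i₂)))).trans ?_
      simp only [dec_mk]
    · refine Eq.symm ((R_cell_swap α B _ X (finProdFinEquiv (i₀, finProdFinEquiv (i₁, i₂)))).trans ?_)
      simp only [dec_mk]
    · refine Eq.symm ((congrArg _ (swap3_symm_mk i₁ i₀ i₂)).trans ?_)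
      refine (R_smk_succ (fun i => c (swapF i)) _ _
        (finProdFinEquiv (i₁, finProdFinEquiv (i₀, i₂)))).trans ?_
      rw [dec_mk]
      refine congrArg (fun F => (B.L .mor).R (c 1) F i₁) (funext fun y => ?_)
      refine (R_smk_succ (fun i => c (swapF i.succ)) _ _ (finProdFinEquiv (i₀, i₂))).trans ?_
      rw [dec_mk]
      rfl
  | _, _, .cons (f := f) b, m, n, φ, c, B, X, j => by
    obtain ⟨⟨i₀, j⟩, rfl⟩ := finProdFinEquiv.surjective j
    have ih := fun x => R_cell_nat b (fun i => c i.succ) B (fun z => X (finProdFinEquiv (x, z))) j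
    have h₁ := R_cell_cons α B b (fun i => (c i).tgt) (fun i => B.one (X i)) (finProdFinEquiv (i₀, j))
    have h₂ := R_cell_cons α B b (fun i => (c i).src) (fun i => B.one (X i)) (finProdFinEquiv (i₀, j))
    rw [dec_mk] at h₁ h₂
    have h₃ : (B.L .mor).R (smk c) (fun i => B.one (X ((b.cons.bij m).symm i)))
        (finProdFinEquiv (i₀, j)) = (B.L .mor).R (c 0) (fun x => (B.L .mor).R (smk fun i => c i.succ)
          (fun z => B.one (X (finProdFinEquiv (x, (b.bij fun i => m i.succ).symm z)))) j) i₀ := by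
      refine (R_smk_succ c _ _ (finProdFinEquiv (i₀, j))).trans ?_
      rw [dec_mk]
      refine congrArg (fun F => (B.L .mor).R (c 0) F i₀) (funext fun x =>
        congrArg (fun F => (B.L .mor).R _ F j) (funext fun z => congrArg (fun w => B.one (X w)) ?_))
      exact prodE_symm_mk _ _ _ _
    have h₄ : (B.L .mor).R (smk fun i => c (tailF f i)) (fun i => B.one (X i))
        ((b.cons.bij n).symm (finProdFinEquiv (i₀, j))) =
        (B.L .mor).R (c 0) (fun x => (B.L .mor).R (smk fun i => c (f i).succ)
          (fun z => B.one (X (finProdFinEquiv (x, z)))) ((b.bij fun i => n i.succ).symm j)) i₀ := by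
      refine (congrArg _ (prodE_symm_mk _ _ _ _)).trans ?_
      refine (R_smk_succ (fun i => c (tailF f i)) _ _ (finProdFinEquiv
        (i₀, (b.bij fun i => n i.succ).symm j))).trans ?_
      rw [dec_mk]
      rfl
    refine (congrArg₂ B.seq h₃ h₁).trans (Eq.trans ?_ (congrArg₂ B.seq h₂ h₄).symm)
    have h₅ := B.R_seq (f := c 0) (g := (c 0).tgt.one) (one_src _).symm (X := fun x =>
      (B.L .mor).R (smk fun i => c i.succ)
          (fun z => B.one (X (finProdFinEquiv (x, (b.bij fun i => m i.succ).symm z)))) j)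
      (Y := fun x => (B.L .mor).R (cell α b fun i => (c i.succ).tgt)
        (fun z => B.one (X (finProdFinEquiv (x, z)))) j) (fun x => by
        rw [R_cell_src, B.R_tgt, smk_tgt]; simp only [B.tgt_one, B.src_one]) i₀
    rw [seq_one] at h₅
    refine h₅.symm.trans ?_
    refine (congrArg (fun F => (B.L .mor).R (c 0) F i₀) (funext ih)).trans
      (B.R_src_seq _ (fun x => ?_) _)
    refine (R_cell_tgt ..).trans (Eq.trans ?_ (B.R_src ..).symm)
    rw [smk_src]; simp only [B.tgt_one, B.src_one]
  | _, _, .trans (f := f) b b', m, n, φ, c, B, X, j => by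
    have ih := R_cell_nat b c B (fun i => X ((b'.bij fun i => m (f i)).symm i)) j
    have ih' := R_cell_nat b' (fun i => c (f i)) B X ((b.bij n).symm j)
    have h₁ := R_cell_trans α B b b' (fun i => (c i).src) X j
    have h₂ := R_cell_trans α B b b' (fun i => (c i).tgt) X j
    refine (congrArg (B.seq _) h₂).trans (Eq.trans ?_ (congrArg (B.seq · _) h₁).symm)
    refine (B.seq_assoc ?_ ?_).symm.trans ((congrArg (B.seq · _) ih).trans
      ((B.seq_assoc ?_ ?_).trans ((congrArg (B.seq _) ih').trans (B.seq_assoc ?_ ?_).symm)))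
    all_goals try simp only [R_cell_src, R_cell_tgt]
    all_goals try simp only [B.R_src, B.R_tgt, smk_src, smk_tgt, B.src_one, B.tgt_one]
    all_goals rfl

theorem cell_nat {k : ℕ} {f : Fin k → Fin k} (b : Braid k f) {m n : Fin k → ℕ}
    {φ : ∀ i, FMap (m i) (n i)} (c : ∀ i, DPt P .mor T (φ i)) :
    ((smk c).comp (iota (ofEquiv (b.bij m)) (isPi_ofEquiv _))).seq (cell α b fun i => (c i).tgt) =
      (cell α b fun i => (c i).src).seq
        (((iota (ofEquiv (b.bij n)) (isPi_ofEquiv _)).comp (smk fun i => c (f i))).cast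
          (b.nat φ).symm) := by
  refine ext_of_R_one fun B X => funext fun j => ?_
  rw [B.R_seq_one, B.R_seq_one, LAlg.R_cast, LAlg.R_comp, LAlg.R_comp, LAlg.R_iota_ofEquiv]
  · refine Eq.trans (congrArg (B.seq · _) ?_) (R_cell_nat α b c B X j)
    exact congrFun (congrArg _ (funext fun i => (B.L .mor).R_iota_ofEquiv _ _ _ _)) j
  · rw [cell_tgt, cast_src, comp_src, iota_src, smk_src]
  · rw [cell_src, comp_tgt, iota_tgt, smk_tgt]

theorem comp_cell_tgt {k : ℕ} {f : Fin k → Fin k} (b : Braid k f) {m n p : Fin k → ℕ}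
    {ψ : ∀ i, FMap (n i) (p i)} {φ : ∀ i, FMap (m i) (n i)} (d : ∀ i, DPt P .ob T (ψ i))
    (c : ∀ i, DPt P .ob T (φ i)) {χ : FMap (ark fun i => m (f i)) (ark p)}
    (h₁ : (FMap.smk ψ).comp ((FMap.smk φ).comp (ofEquiv (b.bij m))) = χ)
    (h₂ : ((FMap.smk ψ).comp (ofEquiv (b.bij n))).comp (FMap.smk fun i => φ (f i)) = χ) :
    (((smk d).one.comp (cell α b c)).cast h₁).tgt =
      (((cell α b d).comp (smk fun i => c (f i)).one).cast h₂).src := by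
  refine ext_of_R fun B X => ?_
  rw [cast_tgt, cast_src, comp_tgt, comp_src, one_tgt, one_src, cell_tgt, cell_src,
    B.R_cast, B.R_cast, B.R_comp, B.R_comp, B.R_cast, B.R_comp, B.R_comp]

theorem cell_comp_tgt {k : ℕ} {f : Fin k → Fin k} (b : Braid k f) {m n p : Fin k → ℕ}
    {ψ : ∀ i, FMap (n i) (p i)} {φ : ∀ i, FMap (m i) (n i)} (d : ∀ i, DPt P .ob T (ψ i))
    (c : ∀ i, DPt P .ob T (φ i)) {χ : FMap (ark fun i => m (f i)) (ark p)}
    (h₂ : ((FMap.smk ψ).comp (ofEquiv (b.bij n))).comp (FMap.smk fun i => φ (f i)) = χ)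
    (h₃ : (ofEquiv (b.bij p)).comp (FMap.smk fun i => (ψ (f i)).comp (φ (f i))) = χ) :
    (((cell α b d).comp (smk fun i => c (f i)).one).cast h₂).tgt =
      (((iota (ofEquiv (b.bij p)) (isPi_ofEquiv _)).comp
          (thetak α (fun i => d (f i)) fun i => c (f i))).cast h₃).src := by
  refine ext_of_R fun B X => ?_
  rw [cast_tgt, cast_src, comp_tgt, comp_src, one_tgt, cell_tgt, iota_src, thetak_src,
    B.R_cast, B.R_cast, B.R_comp, B.R_comp, B.R_cast, B.R_cast, B.R_comp, B.R_comp]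

theorem thetak_comp_tgt {k : ℕ} {f : Fin k → Fin k} (b : Braid k f) {m n p : Fin k → ℕ}
    {ψ : ∀ i, FMap (n i) (p i)} {φ : ∀ i, FMap (m i) (n i)} (d : ∀ i, DPt P .ob T (ψ i))
    (c : ∀ i, DPt P .ob T (φ i)) {χ : FMap (ark fun i => m (f i)) (ark p)}
    (h₄ : (FMap.smk fun i => (ψ i).comp (φ i)).comp (ofEquiv (b.bij m)) = χ) :
    (((thetak α d c).comp (iota (ofEquiv (b.bij m)) (isPi_ofEquiv _))).cast h₄).tgt =
      ((cell α b fun i => (d i).comp (c i)).cast h₄).src := by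
  rw [cast_tgt, cast_src, comp_tgt, thetak_tgt, cell_src, iota_tgt]

/-- Compatibility of the reordering constraints with the pseudofunctoriality constraints of the
smash product. -/
theorem cell_theta {k : ℕ} {f : Fin k → Fin k} (b : Braid k f) {m n p : Fin k → ℕ}
    {ψ : ∀ i, FMap (n i) (p i)} {φ : ∀ i, FMap (m i) (n i)} (d : ∀ i, DPt P .ob T (ψ i))
    (c : ∀ i, DPt P .ob T (φ i)) {χ : FMap (ark fun i => m (f i)) (ark p)}
    (h₁ : (FMap.smk ψ).comp ((FMap.smk φ).comp (ofEquiv (b.bij m))) = χ)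
    (h₂ : ((FMap.smk ψ).comp (ofEquiv (b.bij n))).comp (FMap.smk fun i => φ (f i)) = χ)
    (h₃ : (ofEquiv (b.bij p)).comp (FMap.smk fun i => (ψ (f i)).comp (φ (f i))) = χ)
    (h₄ : (FMap.smk fun i => (ψ i).comp (φ i)).comp (ofEquiv (b.bij m)) = χ) :
    (((((smk d).one.comp (cell α b c)).cast h₁).seq
        (((cell α b d).comp (smk fun i => c (f i)).one).cast h₂)).seq
        (((iota (ofEquiv (b.bij p)) (isPi_ofEquiv _)).comp
          (thetak α (fun i => d (f i)) fun i => c (f i))).cast h₃)) =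
      (((thetak α d c).comp (iota (ofEquiv (b.bij m)) (isPi_ofEquiv _))).cast h₄).seq
        ((cell α b fun i => (d i).comp (c i)).cast h₄) := by
  have e₁ := comp_cell_tgt α b d c h₁ h₂
  have e₂ := cell_comp_tgt α b d c h₂ h₃
  refine ext_of_R_one fun B X => funext fun j => ?_
  rw [B.R_seq_one, B.R_seq_one, B.R_seq_one, LAlg.R_cast, LAlg.R_cast, LAlg.R_cast, LAlg.R_cast,
    LAlg.R_cast, LAlg.R_comp, LAlg.R_comp, LAlg.R_comp, LAlg.R_comp, LAlg.R_iota_ofEquiv]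
  · refine Eq.trans ?_ ((R_cell_theta α b d c B X j).trans (congrArg (B.seq · _) ?_))
    · refine congrArg (fun F => B.seq (B.seq _ ((B.L .mor).R (cell α b d) F j)) _)
        (funext fun y => ?_)
      exact B.R_one ..
    · exact congrArg (fun F => (B.L .mor).R (thetak α d c) F j)
        (funext fun i =>
        ((B.L .mor).R_iota_ofEquiv (b.bij m) _ (fun i => B.one (X i)) i).symm)
  · exact thetak_comp_tgt α b d c h₄
  · exact e₁
  · rw [seq_tgt e₁, e₂]

theorem _root_.ORExt.FMap.Braid.injective : ∀ {k : ℕ} {f : Fin k → Fin k}, Braid k f → f.Injective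
  | _, _, .refl _ => fun _ _ h => h
  | _, _, .swap _ => Function.LeftInverse.injective (g := swapF)
      (Fin.cases rfl (Fin.cases rfl fun _ => rfl))
  | _, _, .cons b => fun i j => by
    refine Fin.cases (Fin.cases (fun _ => rfl) (fun j h => ?_) j) (fun i => Fin.cases (fun h => ?_)
      (fun j h => ?_) j) i
    · exact absurd h (Fin.succ_ne_zero _).symm
    · exact absurd h (Fin.succ_ne_zero _)
    · exact congrArg Fin.succ (b.injective (Fin.succ_injective _ h))
  | _, _, .trans b b' => b.injective.comp b'.injective

/-- The elements of `Π`. -/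
def IsIota {l : Lvl} {m n : ℕ} {φ : FMap m n} (c : DPt P l T φ) : Prop :=
  ∃ h : φ.IsPi, c = iota φ h

/-- A reordering constraint is an identity if at most one of its arguments is not in `Π`. -/
theorem R_cell_eq_one : ∀ {k : ℕ} {f : Fin k → Fin k} (b : Braid k f) {m n : Fin k → ℕ}
    {φ : ∀ i, FMap (m i) (n i)} (c : ∀ i, DPt P .ob T (φ i))
    (_ : ∀ i j, i ≠ j → IsIota (c i) ∨ IsIota (c j)) (B : PtAlg.{w} P T)
    (X : Fin (ark fun i => m (f i)) → (B.L .ob).car) (j : Fin (ark n)), ∃ x,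
    (B.L .mor).R (cell α b c) (fun i => B.one (X i)) j = B.one x
  | k, _, .refl _, m, n, φ, c, h, B, X, j => ⟨_, R_cell_refl α B c X j⟩
  | _, _, .swap k, m, n, φ, c, h, B, X, j => by
    rcases h 0 1 (Fin.succ_ne_zero 0).symm with ⟨h, e⟩ | ⟨h, e⟩
    · exact ⟨_, (R_cell_swap α B c X j).trans ((congrArg (fun a => B.Al α a (c 1) _ _ _) e).trans
        (B.Al_iota_left α h _ _ _ _))⟩
    · exact ⟨_, (R_cell_swap α B c X j).trans ((congrArg (fun a => B.Al α (c 0) a _ _ _) e).trans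
        (B.Al_iota_right α h _ _ _ _))⟩
  | _, _, .cons (f := f) b, m, n, φ, c, h, B, X, j => by
    have ih := fun x => R_cell_eq_one b (fun i => c i.succ)
      (fun i j hij => h _ _ ((Fin.succ_injective _).ne hij)) B
      (fun z => X (finProdFinEquiv (x, z))) (dec j).2
    choose x hx using ih
    refine ⟨(B.L .ob).R (c 0) x (dec j).1, (R_cell_cons α B b c (fun i => B.one (X i)) j).trans ?_⟩
    exact (congrArg (fun F => (B.L .mor).R (c 0).one F (dec j).1) (funext hx)).trans (B.R_one ..)
  | _, _, .trans (f := f) b b', m, n, φ, c, h, B, X, j => by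
    obtain ⟨x, hx⟩ := R_cell_eq_one b c h B (fun i => X ((b'.bij fun i => m (f i)).symm i)) j
    obtain ⟨y, hy⟩ := R_cell_eq_one b' (fun i => c (f i)) (fun i j hij => h _ _ (b.injective.ne hij))
      B X ((b.bij n).symm j)
    refine ⟨y, (R_cell_trans α B b b' c X j).trans ?_⟩
    rw [← hy]
    refine (congrArg (B.seq · _) hx).trans (B.one_seq' ?_)
    have := congrArg B.tgt hx
    rw [B.tgt_one] at this
    rw [← this, R_cell_tgt, R_cell_src]
    simp only [B.src_one, B.tgt_one]

/-- The reordering constraints are identities on `Π`. -/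
theorem cell_iota {k : ℕ} {f : Fin k → Fin k} (b : Braid k f) {m n : Fin k → ℕ}
    {φ : ∀ i, FMap (m i) (n i)} (h : ∀ i, (φ i).IsPi) :
    (cell α b fun i => (iota (φ i) (h i) : DPt P .ob T (φ i))) =
      ((smk fun i => iota (φ i) (h i)).comp (iota (ofEquiv (b.bij m)) (isPi_ofEquiv _))).one := by
  refine ext_of_R_one fun B X => funext fun j => ?_
  obtain ⟨x, hx⟩ := R_cell_eq_one α b (fun i => iota (φ i) (h i)) (fun i _ _ => .inl ⟨h i, rfl⟩) B X j
  rw [B.R_one, ← cell_src α, hx, ← B.src_one x, ← hx, B.R_src]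
  simp only [B.src_one]

theorem cell_res {S : V} (t : S ⟶ T) : ∀ {k : ℕ} {f : Fin k → Fin k} (b : Braid k f)
    {m n : Fin k → ℕ} {φ : ∀ i, FMap (m i) (n i)} (c : ∀ i, DPt P .ob T (φ i)),
    (cell α b c).res t = cell α b fun i => (c i).res t
  | k, _, .refl _, m, n, φ, c => by
    change (smk c).one.res t = (smk fun i => (c i).res t).one
    rw [res_one, res_smk]
  | _, _, .swap k, m, n, φ, c => by
    funext i
    have h : t ≫ (smk fun i => c i.succ.succ).one (dec (dec i).2).2 =
        (smk fun i => (c i.succ.succ).res t).one (dec (dec i).2).2 := by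
      rw [← res_smk, ← res_one]; rfl
    refine (VFun.comp_ap _ _ _).trans (congrArg _ ((P.comp_cmp _ _ _ _).trans ?_))
    exact congrArg₂ (P.cmp _) (PseudoComm.comp_ap ..) (funext fun _ => h)
  | _, _, .cons b, m, n, φ, c =>
    (res_cast ..).trans (congrArg (cast _) ((res_sm ..).trans
      (congrArg₂ sm (res_one ..) (cell_res t b fun i => c i.succ))))
  | _, _, .trans (f := f) b b', m, n, φ, c => by
    refine (res_seq t (transCell_comp _ _ _ (b.nat φ) _ (cell_tgt α b c)
      (cell_src α b' fun i => c (f i)))).trans (congrArg₂ seq ?_ ?_)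
    · refine (res_comp ..).trans ?_
      rw [res_iota, cell_res t b]
    · refine (res_cast ..).trans (congrArg (cast _) ((res_comp ..).trans ?_))
      rw [res_iota, cell_res t b']

theorem inv_cast {m n : ℕ} {φ φ' : FMap m n} (h : φ = φ') {c : DPt P .mor T φ}
    (hc : ∀ j, (P.O _).Inv (c j)) : ∀ j, (P.O _).Inv (c.cast h j) := by
  subst h; exact hc

theorem inv_iota {m n : ℕ} {φ : FMap m n} (h : φ.IsPi) (j : Fin n) :
    (P.O _).Inv ((iota φ h : DPt P .mor T φ) j) := VCat.inv_one ..

theorem inv_cell : ∀ {k : ℕ} {f : Fin k → Fin k} (b : Braid k f)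
    {m n : Fin k → ℕ} {φ : ∀ i, FMap (m i) (n i)} (c : ∀ i, DPt P .ob T (φ i)) (j : Fin (ark n)),
    (P.O _).Inv (cell α b c j)
  | k, _, .refl _, m, n, φ, c, j => VCat.inv_one ..
  | _, _, .swap k, m, n, φ, c, j =>
    VFun.ap_inv _ (P.inv_cmp _ (α.inv _ _) fun _ => VCat.inv_one ..)
  | _, _, .cons b, m, n, φ, c, j =>
    inv_cast _ (fun _ => VFun.ap_inv _ (P.inv_cmp _ (VCat.inv_one ..) fun _ => inv_cell b _ _)) j
  | _, _, .trans (f := f) b b', m, n, φ, c, j =>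
    VCat.inv_seq _ (congrFun (transCell_comp _ _ _ (b.nat φ) _ (cell_tgt α b c)
      (cell_src α b' fun i => c (f i))) j) (P.inv_cmp _ (inv_cell b c j) fun _ => inv_iota _ _)
      (inv_cast _ (fun j => P.inv_cmp _ (inv_iota _ j) fun _ => inv_cell b' _ _) j)

end DPt

/-! ### Generalized points of algebras over the category of operators -/

namespace DPt

variable {P : Operad V} {T : V} {l : Lvl} {m n : ℕ} {φ : FMap m n}

/-- The generalized point of a summand of the category of operators with given coordinates. -/
noncomputable def hom (c : DPt P l T φ) : T ⟶ (P.D φ).car l := tup fun j => c j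

theorem comp_hom {S : V} (t : S ⟶ T) (c : DPt P l T φ) : t ≫ c.hom = (c.res t).hom := comp_tup _ _

theorem hom_src (f : DPt P .mor T φ) : f.hom ≫ (P.D φ).src = f.src.hom := tup_src _

theorem hom_tgt (f : DPt P .mor T φ) : f.hom ≫ (P.D φ).tgt = f.tgt.hom := tup_tgt _

theorem one_hom (c : DPt P .ob T φ) : (P.D φ).one c.hom = c.one.hom := one_tup _

theorem seq_hom {f g : DPt P .mor T φ} (h : f.tgt = g.src) :
    (P.D φ).seq f.hom g.hom = (f.seq g).hom := seq_tup (congrFun h)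

end DPt

namespace DAlgData

variable {P : Operad V} (X : DAlgData P) {T : V} {l : Lvl} {m n p : ℕ} {φ : FMap m n}

theorem op_def (c : DPt P l T φ) (x : T ⟶ (X.X m).car l) :
    X.op φ c x = (X.θ φ).ap (pr c.hom x) := rfl

theorem comp_op {S : V} (t : S ⟶ T) (c : DPt P l T φ) (x : T ⟶ (X.X m).car l) :
    t ≫ X.op φ c x = X.op φ (c.res t) (t ≫ x) := by
  rw [op_def, VFun.comp_ap, comp_pr, DPt.comp_hom]; rfl

theorem op_src (f : DPt P .mor T φ) (x : T ⟶ (X.X m).car .mor) :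
    X.op φ f x ≫ (X.X n).src = X.op φ f.src (x ≫ (X.X m).src) := by
  rw [op_def, VFun.ap_src, pr_src, DPt.hom_src]; rfl

theorem op_tgt (f : DPt P .mor T φ) (x : T ⟶ (X.X m).car .mor) :
    X.op φ f x ≫ (X.X n).tgt = X.op φ f.tgt (x ≫ (X.X m).tgt) := by
  rw [op_def, VFun.ap_tgt, pr_tgt, DPt.hom_tgt]; rfl

theorem op_one (c : DPt P .ob T φ) (x : T ⟶ (X.X m).car .ob) :
    X.op φ c.one ((X.X m).one x) = (X.X n).one (X.op φ c x) := by
  rw [op_def, op_def, ← VFun.ap_one, one_pr, DPt.one_hom]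

theorem op_seq {f g : DPt P .mor T φ} {x y : T ⟶ (X.X m).car .mor} (h : f.tgt = g.src)
    (h' : x ≫ (X.X m).tgt = y ≫ (X.X m).src) :
    X.op φ (f.seq g) ((X.X m).seq x y) = (X.X n).seq (X.op φ f x) (X.op φ g y) := by
  have h₁ : f.hom ≫ (P.D φ).tgt = g.hom ≫ (P.D φ).src := by rw [DPt.hom_src, DPt.hom_tgt, h]
  rw [op_def, op_def, op_def, ← VFun.ap_seq _ (by rw [pr_src, pr_tgt, h₁, h']), seq_pr' h₁ h',
    DPt.seq_hom h]

theorem inv_op {f : DPt P .mor T φ} {x : T ⟶ (X.X m).car .mor} (hf : ∀ j, (P.O _).Inv (f j))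
    (hx : (X.X m).Inv x) : (X.X n).Inv (X.op φ f x) :=
  VFun.ap_inv _ (inv_pr (inv_tup hf) hx)

theorem op_cast {φ' : FMap m n} (h : φ = φ') (c : DPt P l T φ) (x : T ⟶ (X.X m).car l) :
    X.op φ' (c.cast h) x = X.op φ c x := by
  subst h; rfl

theorem rel_ap (e : Fin m ≃ Fin n) (x : T ⟶ (X.X m).car l) :
    (X.rel e).ap x = X.op (ofEquiv e) (DPt.iota _ (isPi_ofEquiv e)) x := by
  refine (VFun.comp_ap' _ _ _).trans (congrArg (X.θ (ofEquiv e)).ap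
    ((VFun.pair_ap _ _ _).trans (congrArg₂ pr ((VFun.tuple_ap _ _).trans ?_) (VFun.id_ap _ _))))
  exact congrArg (fun c => tup c) (funext fun j => VFun.const_ap _ _)

theorem one_zero : (X.X n).one (X.zero : T ⟶ _) = X.zero := rfl

end DAlgData

namespace DAlg

variable {P : Operad V} (X : DAlg P) {T : V} {l : Lvl} {m n p : ℕ}

theorem rel_refl (x : T ⟶ (X.X m).car l) : (X.rel (Equiv.refl _)).ap x = x :=
  (X.rel_ap _ x).trans (X.isAlgebra.id x)

theorem rel_zero (e : Fin m ≃ Fin n) : (X.rel e).ap (X.zero : T ⟶ (X.X m).car l) = X.zero := by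
  rw [X.rel_ap, X.isAlgebra.base_right]

theorem rel_op_eq {a b : DMor P l T} (h : a = b) (hm : a.m = b.m) (hn : a.n = b.n)
    (x : T ⟶ (X.X a.m).car l) : (X.rel (finCongr hn)).ap (X.op a.φ a.c x) =
      X.op b.φ b.c ((X.rel (finCongr hm)).ap x) := by
  subst h
  exact (X.rel_refl _).trans (congrArg _ (X.rel_refl _).symm)

theorem rel_pair_eq {a b : DPair P T} (h : a = b) (hm : a.m = b.m) (hp : a.p = b.p)
    (x : T ⟶ (X.X a.m).car .ob) :
    (X.rel (finCongr hp)).ap (X.op a.χ a.t ((X.X _).one x)) =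
      X.op b.χ b.t ((X.X _).one ((X.rel (finCongr hm)).ap x)) := by
  subst h
  exact (X.rel_refl _).trans (congrArg (fun x => X.op a.χ a.t ((X.X _).one x)) (X.rel_refl _).symm)

end DAlg

namespace PreD

variable {P : Operad V} {k : ℕ} {X : Fin k → DAlg P} {Y : DAlg P} {l : Lvl} {T : V}
  (F : PreD X Y) {m n : Fin k → ℕ}

theorem comp_f {S : V} (t : S ⟶ T) (x : ∀ i, T ⟶ ((X i).X (m i)).car l) :
    t ≫ F.f x = F.f fun i => t ≫ x i := by
  rw [f, VFun.comp_ap, comp_tup]; rfl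

theorem f_src (x : ∀ i, T ⟶ ((X i).X (m i)).car .mor) :
    F.f x ≫ (Y.X _).src = F.f fun i => x i ≫ ((X i).X (m i)).src := by
  rw [f, VFun.ap_src, tup_src]; rfl

theorem f_tgt (x : ∀ i, T ⟶ ((X i).X (m i)).car .mor) :
    F.f x ≫ (Y.X _).tgt = F.f fun i => x i ≫ ((X i).X (m i)).tgt := by
  rw [f, VFun.ap_tgt, tup_tgt]; rfl

theorem f_one (x : ∀ i, T ⟶ ((X i).X (m i)).car .ob) :
    (F.f fun i => ((X i).X (m i)).one (x i)) = (Y.X _).one (F.f x) := by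
  rw [f, f, ← VFun.ap_one, one_tup]

theorem f_seq {x y : ∀ i, T ⟶ ((X i).X (m i)).car .mor}
    (h : ∀ i, x i ≫ ((X i).X (m i)).tgt = y i ≫ ((X i).X (m i)).src) :
    (F.f fun i => ((X i).X (m i)).seq (x i) (y i)) = (Y.X _).seq (F.f x) (F.f y) := by
  rw [f, f, f, ← VFun.ap_seq, seq_tup h]
  rw [tup_src, tup_tgt]; simp only [h]

theorem inv_f {x : ∀ i, T ⟶ ((X i).X (m i)).car .mor} (h : ∀ i, ((X i).X (m i)).Inv (x i)) :
    (Y.X _).Inv (F.f x) :=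
  VFun.ap_inv _ (inv_tup h)

theorem d_def (φ : ∀ i, FMap (m i) (n i)) (c : ∀ i, DPt P .ob T (φ i))
    (x : ∀ i, T ⟶ ((X i).X (m i)).car .ob) :
    F.d φ c x = pr (A := VCat.pi fun i => P.D (φ i)) (tup fun i => (c i).hom) (tup x) ≫ F.δ φ := rfl

theorem comp_d {S : V} (t : S ⟶ T) (φ : ∀ i, FMap (m i) (n i)) (c : ∀ i, DPt P .ob T (φ i))
    (x : ∀ i, T ⟶ ((X i).X (m i)).car .ob) :
    t ≫ F.d φ c x = F.d φ (fun i => (c i).res t) fun i => t ≫ x i := by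
  rw [d_def, ← Category.assoc, comp_pr, comp_tup, comp_tup]
  simp only [DPt.comp_hom]; rfl

theorem d_cast {φ φ' : ∀ i, FMap (m i) (n i)} (h : ∀ i, φ i = φ' i) (c : ∀ i, DPt P .ob T (φ i))
    (x : ∀ i, T ⟶ ((X i).X (m i)).car .ob) : F.d φ' (fun i => (c i).cast (h i)) x = F.d φ c x := by
  obtain rfl : φ = φ' := funext h
  rfl

theorem mkδ_eval (φ : ∀ i, FMap (m i) (n i))
    (D : ∀ {T : V}, (∀ i, DPt P .ob T (φ i)) → (∀ i, T ⟶ ((X i).X (m i)).car .ob) →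
      (T ⟶ (Y.X (ark n)).car .mor))
    (hD : ∀ {S T : V} (t : S ⟶ T) c x, t ≫ D c x = D (fun i => (c i).res t) fun i => t ≫ x i)
    (c : ∀ i, DPt P .ob T (φ i)) (x : ∀ i, T ⟶ ((X i).X (m i)).car .ob) :
    pr (A := VCat.pi fun i => P.D (φ i)) (tup fun i => (c i).hom) (tup x) ≫ mkδ φ D = D c x := by
  refine (hD _ _ _).trans (congrArg₂ _ (funext fun i => funext fun j => ?_) (funext fun i => ?_))
  · refine (comp_co (B := fun j => P.O ((φ i).c j)) _ _ j).symm.trans ?_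
    refine (congrArg (co · j) ((comp_co (B := fun i => P.D (φ i)) _ _ i).symm.trans
      (congrArg (co · i) (pr_p₁ _ _)))).trans ?_
    exact (congrArg (co (A := fun j => P.O ((φ i).c j)) · j) (co_tup _ i)).trans (co_tup _ _)
  · exact (comp_co (B := fun i => (X i).X (m i)) _ _ i).symm.trans
      ((congrArg (co · i) (pr_p₂ _ _)).trans (co_tup _ _))

/-- Data of multimorphisms agree if their functors agree and their transformations agree at
generalized points. -/
theorem ext_d {F G : PreD X Y} (hF : ∀ m, F.F m = G.F m)
    (hd : ∀ {T : V} {m n : Fin k → ℕ} (φ : ∀ i, FMap (m i) (n i)) (c : ∀ i, DPt P .ob T (φ i))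
      (x : ∀ i, T ⟶ ((X i).X (m i)).car .ob), F.d φ c x = G.d φ c x) : F = G := by
  refine PreD.ext (funext hF) ?_
  funext m n φ
  have e : pr (A := VCat.pi fun i => P.D (φ i)) (B := VCat.pi fun i => (X i).X (m i))
      (tup fun i => DPt.hom (P := P) (φ := φ i) fun j => co (A := fun j => P.O ((φ i).c j))
        (co (A := fun i => P.D (φ i)) (p₁ _ _ .ob) i) j)
      (tup (co (A := fun i => (X i).X (m i)) (p₂ (VCat.pi fun i => P.D (φ i)) _ _))) = 𝟙 _ := by
    refine times_ext ?_ ?_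
    · rw [pr_p₁, Category.id_comp]
      refine co_ext fun i => (co_tup _ _).trans (tup_co _)
    · rw [pr_p₂, Category.id_comp, tup_co]
  exact (Category.id_comp _).symm.trans ((congrArg (· ≫ F.δ φ) e.symm).trans ((hd φ _ _).trans
    ((congrArg (· ≫ G.δ φ) e).trans (Category.id_comp _))))

end PreD

/-! ### Multimorphisms of algebras over the category of operators -/

namespace DMor

variable {P : Operad V} {l : Lvl} {T : V}

theorem single {m n : Fin 1 → ℕ} {φ : ∀ i, FMap (m i) (n i)} (c : ∀ i, DPt P l T (φ i)) :
    (⟨φ 0, c 0⟩ : DMor P l T) = ⟨smk φ, DPt.smk c⟩ := by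
  rw [← prod_ofFn, List.ofFn_succ, List.ofFn_zero, List.prod_singleton]

/-- An iterated smash product of morphisms is the smash product of the concatenated family. -/
theorem smk_sigma {k : ℕ} {j : Fin k → ℕ} {m n : Fin (∑ i, j i) → ℕ} {φ : ∀ p, FMap (m p) (n p)}
    (c : ∀ p, DPt P l T (φ p)) :
    (⟨smk fun i => smk fun r => φ (finSigmaFinEquiv ⟨i, r⟩),
      DPt.smk fun i => DPt.smk fun r => c (finSigmaFinEquiv ⟨i, r⟩)⟩ : DMor P l T) =
      ⟨smk φ, DPt.smk c⟩ := by
  rw [← prod_ofFn, ← prod_ofFn, ← prod_ofFn_sigma]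
  simp only [prod_ofFn]

end DMor

namespace DPair

variable {P : Operad V} {T : V} (α : PseudoComm P)

/-- The pair of the smash products of two composable families, with the pseudofunctoriality
constraint. -/
noncomputable def ofFamily {k : ℕ} {m n p : Fin k → ℕ} {ψ : ∀ i, FMap (n i) (p i)}
    {φ : ∀ i, FMap (m i) (n i)} (d : ∀ i, DPt P .ob T (ψ i)) (c : ∀ i, DPt P .ob T (φ i)) :
    DPair P T where
  ψ := FMap.smk ψ
  φ := FMap.smk φ
  χ := FMap.smk fun i => (ψ i).comp (φ i)
  h := (smk_comp ψ φ).symm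
  d := DPt.smk d
  c := DPt.smk c
  t := DPt.thetak α d c
  src := DPt.thetak_src α d c

theorem ofFamily_eq_prod {k : ℕ} {m n p : Fin k → ℕ} {ψ : ∀ i, FMap (n i) (p i)}
    {φ : ∀ i, FMap (m i) (n i)} (d : ∀ i, DPt P .ob T (ψ i)) (c : ∀ i, DPt P .ob T (φ i)) :
    let := monoid (T := T) α
    ofFamily α d c = (List.ofFn fun i =>
      (⟨ψ i, φ i, _, rfl, d i, c i, ((d i).comp (c i)).one, DPt.one_src _⟩ : DPair P T)).prod := by
  intro
  refine Eq.symm ((prod_ofFn α (fun _ => rfl) d c _ _).trans (mk_congr ?_))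
  rw [← DPt.smk_one, ← DPt.thetak_tgt α]
  exact DPt.seq_one _

theorem single {m n p : Fin 1 → ℕ} {ψ : ∀ i, FMap (n i) (p i)} {φ : ∀ i, FMap (m i) (n i)}
    (d : ∀ i, DPt P .ob T (ψ i)) (c : ∀ i, DPt P .ob T (φ i)) :
    (⟨ψ 0, φ 0, _, rfl, d 0, c 0, ((d 0).comp (c 0)).one, DPt.one_src _⟩ : DPair P T) =
      ofFamily α d c := by
  let := monoid (T := T) α
  rw [ofFamily_eq_prod, List.ofFn_succ, List.ofFn_zero, List.prod_singleton]

/-- The constraint of an iterated smash product of composable pairs. -/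
theorem smk_sigma {k : ℕ} {j : Fin k → ℕ} {m n p : Fin (∑ i, j i) → ℕ}
    {ψ : ∀ i, FMap (n i) (p i)} {φ : ∀ i, FMap (m i) (n i)}
    (d : ∀ i, DPt P .ob T (ψ i)) (c : ∀ i, DPt P .ob T (φ i)) :
    smk α (fun _ => (smk_comp _ _).symm)
      (fun i => DPt.smk fun r => d (finSigmaFinEquiv ⟨i, r⟩))
      (fun i => DPt.smk fun r => c (finSigmaFinEquiv ⟨i, r⟩))
      (fun i => DPt.thetak α (fun r => d (finSigmaFinEquiv ⟨i, r⟩))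
        fun r => c (finSigmaFinEquiv ⟨i, r⟩)) = ofFamily α d c := by
  let := monoid (T := T) α
  rw [ofFamily_eq_prod, ← prod_ofFn_sigma]
  refine (prod_ofFn α _ _ _ _ fun i => DPt.thetak_src α _ _).symm.trans ?_
  exact congrArg (fun f => (List.ofFn f).prod) (funext fun i => ofFamily_eq_prod α _ _)

end DPair

namespace DAlg

variable {P : Operad V} (X : DAlg P) {T : V} {l : Lvl} {m n : ℕ}

theorem op_none {φ : FMap m n} (h : φ = fun _ => none) (c : DPt P l T φ)
    (x : T ⟶ (X.X m).car l) : X.op φ c x = X.zero := by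
  subst h
  exact X.isAlgebra.base_left c x

end DAlg

namespace PreD

variable {P : Operad V} (α : PseudoComm P) {l : Lvl} {T : V}

section one

variable (X : DAlg P) {m n : Fin 1 → ℕ}

theorem one_f (x : ∀ i, T ⟶ (X.X (m i)).car l) :
    (one X).f x = (X.rel (finCongr (ark_one m))).ap (x 0) := by
  refine (VFun.comp_ap' _ _ _).trans (congrArg _ ?_)
  exact co_tup (B := fun i => X.X (m i)) x 0

theorem one_d (φ : ∀ i, FMap (m i) (n i)) (c : ∀ i, DPt P .ob T (φ i))
    (x : ∀ i, T ⟶ (X.X (m i)).car .ob) :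
    (one X).d φ c x =
      (X.X _).one ((X.rel (finCongr (ark_one n))).ap (X.op (φ 0) (c 0) (x 0))) :=
  mkδ_eval (X := fun _ : Fin 1 => X) φ (fun c x =>
      (X.X _).one ((X.rel (finCongr (ark_one n))).ap (X.op (φ 0) (c 0) (x 0)))) (fun t c x => by
    rw [VCat.comp_one, VFun.comp_ap, X.comp_op]) c x

theorem isHom_one : (one X).IsHom α where
  based x i h := by
    rw [Subsingleton.elim i 0] at h
    rw [one_f, h, X.rel_zero]
  src φ c x := by
    rw [one_d, VCat.one_src, one_f]
    exact X.rel_op_eq (DMor.single c) (ark_one _) (ark_one _) (x 0)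
  tgt φ c x := by
    rw [one_d, VCat.one_tgt, one_f]
  nat φ c x := by
    have h₀ := (congrArg (X.op (smk φ) (DPt.smk c)) (one_f X x)).trans
      (X.rel_op_eq (DMor.single c) (ark_one _) (ark_one _) (x 0)).symm
    have h₁ := (X.rel (finCongr (ark_one _))).ap_tgt (X.op (φ 0) (c 0) (x 0))
    have h₂ := (X.rel (finCongr (ark_one _))).ap_src (X.op (φ 0) (c 0) (x 0))
    rw [X.op_tgt] at h₁
    rw [X.op_src] at h₂
    refine (congrArg₂ (VCat.seq _) h₀ ((one_d X φ (fun i => (c i).tgt) _).trans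
      (congrArg _ h₁.symm))).trans ((VCat.seq_one _ _).trans ((VCat.one_seq _ _).symm.trans ?_))
    exact congrArg₂ (VCat.seq _) ((congrArg _ h₂).trans (one_d X φ (fun i => (c i).src)
      fun i => x i ≫ (X.X _).src).symm)
      (one_f X fun i => X.op (φ i) (c i) (x i)).symm
  inv φ c x := by
    rw [one_d]; exact inv_one _ _
  base_right φ c x i h := by
    rw [Subsingleton.elim i 0] at h
    rw [one_d, h, X.isAlgebra.base_right, X.rel_zero]
  base_left φ c x i h := by
    rw [Subsingleton.elim i 0] at h
    rw [one_d, X.op_none h, X.rel_zero]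
  strict φ h x := by
    rw [one_d, one_f]
  comp ψ φ d c x := by
    have h₁ := X.rel_op_eq (DMor.single c) (ark_one _) (ark_one _) (x 0)
    have h₂ := X.rel_op_eq (DMor.single d) (ark_one _) (ark_one _) (X.op (φ 0) (c 0) (x 0))
    have h₃ := X.rel_pair_eq (DPair.single α d c) (ark_one _) (ark_one _) (x 0)
    rw [one_d, one_d, one_d, one_f]
    refine (congrArg (VCat.seq _ · _) ((X.op_one _ _).trans (congrArg _ h₂.symm))).trans
      (Eq.trans ?_ (congrArg (VCat.seq _ · _) h₃))
    refine Eq.trans ?_ (congrArg (VCat.seq _ · _)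
      ((congrArg _ (X.op_one _ _)).trans (VFun.ap_one _ _)).symm)
    rw [X.isAlgebra.comp]
    rfl

end one

end PreD

/-! ### Composites of multimorphisms of algebras over the category of operators -/

namespace FMap

theorem sm_none_left {m n p q : ℕ} (ψ : FMap p q) :
    sm (fun _ : Fin m => (none : Option (Fin n))) ψ = fun _ => none := rfl

theorem sm_none_right {m n p q : ℕ} (φ : FMap m n) :
    sm φ (fun _ : Fin p => (none : Option (Fin q))) = fun _ => none := by
  funext i
  rcases h : φ (dec i).1 with _ | x <;> simp [sm, h]

/-- A smash product with a constant factor is constant. -/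
theorem smk_none : ∀ {k : ℕ} {m n : Fin k → ℕ} {φ : ∀ i, FMap (m i) (n i)} (i : Fin k),
    φ i = (fun _ => none) → smk φ = fun _ => none
  | 0, _, _, _, i, _ => i.elim0
  | _ + 1, _, _, φ, ⟨0, _⟩, h => (congrArg (sm · _) h).trans (sm_none_left _)
  | _ + 1, _, _, φ, ⟨i + 1, hi⟩, h =>
    (congrArg (sm (φ 0)) (smk_none (φ := fun i => φ i.succ) ⟨i, Nat.lt_of_succ_lt_succ hi⟩ h)).trans
      (sm_none_right _)

theorem isPi_sm {m n p q : ℕ} {φ : FMap m n} {ψ : FMap p q} (h : φ.IsPi) (h' : ψ.IsPi) :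
    (sm φ ψ).IsPi := fun j => by
  have := Fintype.card_congr (smE φ ψ j)
  rw [Fintype.card_fin, Fintype.card_fin] at this
  rw [this]
  exact Nat.mul_le_mul (h _) (h' _)

theorem isPi_smk : ∀ {k : ℕ} {m n : Fin k → ℕ} {φ : ∀ i, FMap (m i) (n i)},
    (∀ i, (φ i).IsPi) → (smk φ).IsPi
  | 0, _, _, _, _ => isPi_some
  | _ + 1, _, _, _, h => isPi_sm (h 0) (isPi_smk fun i => h i.succ)

end FMap

namespace DPt

variable {P : Operad V} {l : Lvl} {T : V}

theorem sm_iota {m n p q : ℕ} {φ : FMap m n} {ψ : FMap p q} (h : φ.IsPi) (h' : ψ.IsPi)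
    (h'' : (FMap.sm φ ψ).IsPi) :
    ((iota φ h : DPt P l T φ).sm (iota ψ h')) = iota _ h'' := by
  refine ext_of_R fun B X => funext fun j => ?_
  rw [B.R_sm]
  by_cases hi : ∃ i, φ i = some (dec j).1
  · obtain ⟨i, hi⟩ := hi
    rw [B.R_iota h _ hi]
    by_cases hi' : ∃ i', ψ i' = some (dec j).2
    · obtain ⟨i', hi'⟩ := hi'
      rw [B.R_iota h' _ hi', B.R_iota h'' _ (i := finProdFinEquiv (i, i'))]
      rw [FMap.sm_eq_some, dec_mk]
      exact ⟨hi, hi'⟩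
    · rw [B.R_iota_zero h' _ (fun i' h => hi' ⟨i', h⟩), B.R_iota_zero h'']
      exact fun i' h => hi' ⟨_, ((FMap.sm_eq_some _ _ _ _).1 h).2⟩
  · rw [B.R_iota_zero h _ (fun i' h => hi ⟨i', h⟩), B.R_iota_zero h'']
    exact fun i' h => hi ⟨_, ((FMap.sm_eq_some _ _ _ _).1 h).1⟩

theorem smk_cast {k : ℕ} {m n : Fin k → ℕ} {φ φ' : ∀ i, FMap (m i) (n i)} (h : ∀ i, φ i = φ' i)
    (c : ∀ i, DPt P l T (φ i)) :
    (smk fun i => (c i).cast (h i)) = (smk c).cast (congrArg FMap.smk (funext h)) := by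
  obtain rfl : φ = φ' := funext h
  rfl

theorem smk_iota : ∀ {k : ℕ} {m n : Fin k → ℕ} {φ : ∀ i, FMap (m i) (n i)}
    (h : ∀ i, (φ i).IsPi), (smk fun i => (iota (φ i) (h i) : DPt P l T (φ i))) =
      iota (FMap.smk φ) (isPi_smk h)
  | 0, _, _, _, _ => rfl
  | _ + 1, _, _, _, h => (congrArg (sm _) (smk_iota fun i => h i.succ)).trans (sm_iota _ _ _)

end DPt

namespace DAlgData

variable {P : Operad V} (X : DAlgData P) {T : V} {m n : ℕ} {φ : FMap m n}

theorem op_one_seq (c : DPt P .ob T φ) {x y : T ⟶ (X.X m).car .mor}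
    (h : x ≫ (X.X m).tgt = y ≫ (X.X m).src) :
    X.op φ c.one ((X.X m).seq x y) = (X.X n).seq (X.op φ c.one x) (X.op φ c.one y) := by
  have e : c.one.seq c.one = c.one := (congrArg c.one.seq (congrArg DPt.one (DPt.one_tgt c).symm)).trans
    (DPt.seq_one _)
  exact (congrArg (X.op φ · _) e.symm).trans (X.op_seq (by rw [DPt.one_src, DPt.one_tgt]) h)

theorem op_seq_one {f g : DPt P .mor T φ} (h : f.tgt = g.src) (x : T ⟶ (X.X m).car .ob) :
    X.op φ (f.seq g) ((X.X m).one x) =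
      (X.X n).seq (X.op φ f ((X.X m).one x)) (X.op φ g ((X.X m).one x)) := by
  have e : (X.X m).seq ((X.X m).one x) ((X.X m).one x) = (X.X m).one x :=
    (congrArg (VCat.seq _ _) (congrArg _ (VCat.one_tgt _ x).symm)).trans (VCat.seq_one _ _)
  exact (congrArg (X.op φ _) e.symm).trans (X.op_seq h (by rw [VCat.one_src, VCat.one_tgt]))

end DAlgData

/-- Pasting of four commutative squares. -/
theorem VCat.seq_paste (A : VCat V) {T : V} {a b c d a' g s t w h c' d' : T ⟶ A.car .mor}
    (e₁ : A.seq a a' = A.seq t w) (e₂ : A.seq b c = A.seq a' g) (e₃ : A.seq g d = A.seq h d')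
    (e₄ : A.seq s c' = A.seq w h) (h₁ : a ≫ A.tgt = b ≫ A.src) (h₂ : b ≫ A.tgt = c ≫ A.src)
    (h₃ : c ≫ A.tgt = d ≫ A.src) (h₄ : a' ≫ A.tgt = g ≫ A.src) (h₅ : t ≫ A.tgt = w ≫ A.src)
    (h₆ : w ≫ A.tgt = h ≫ A.src) (h₇ : s ≫ A.tgt = c' ≫ A.src) (h₈ : c' ≫ A.tgt = d' ≫ A.src) :
    A.seq (A.seq a b) (A.seq c d) = A.seq (A.seq t s) (A.seq c' d') := by
  have h₉ : a ≫ A.tgt = a' ≫ A.src := by rw [h₁, ← A.seq_src b c, e₂, A.seq_src]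
  have h₁₀ : g ≫ A.tgt = d ≫ A.src := by rw [← A.seq_tgt h₄, ← e₂, A.seq_tgt h₂, h₃]
  have h₁₁ : t ≫ A.tgt = s ≫ A.src := by rw [h₅, ← A.seq_src w h, ← e₄, A.seq_src]
  have h₁₂ : h ≫ A.tgt = d' ≫ A.src := by rw [← A.seq_tgt h₆, ← e₄, A.seq_tgt h₇, h₈]
  rw [A.seq_assoc h₁ (by rw [A.seq_src, h₂]), ← A.seq_assoc h₂ h₃, e₂, A.seq_assoc h₄ h₁₀, e₃,
    ← A.seq_assoc h₉ (by rw [← e₃, A.seq_src, h₄]), e₁, A.seq_assoc h₅ (by rw [A.seq_src, h₆]),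
    ← A.seq_assoc h₆ h₁₂, ← e₄, A.seq_assoc h₇ h₈,
    ← A.seq_assoc h₁₁ (by rw [A.seq_src, h₇])]

/-- Pasting of two commutative squares. -/
theorem VCat.seq_square (A : VCat V) {T : V} {a b c b' c' d g : T ⟶ A.car .mor}
    (e₁ : A.seq a b = A.seq b' g) (e₂ : A.seq g c = A.seq c' d) (h₁ : a ≫ A.tgt = b ≫ A.src)
    (h₂ : b ≫ A.tgt = c ≫ A.src) (h₃ : b' ≫ A.tgt = g ≫ A.src) (h₄ : c' ≫ A.tgt = d ≫ A.src) :
    A.seq a (A.seq b c) = A.seq (A.seq b' c') d := by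
  have h₅ : g ≫ A.tgt = c ≫ A.src := by rw [← A.seq_tgt h₃, ← e₁, A.seq_tgt h₁, h₂]
  have h₆ : b' ≫ A.tgt = c' ≫ A.src := by rw [h₃, ← A.seq_src g c, e₂, A.seq_src]
  rw [← A.seq_assoc h₁ h₂, e₁, A.seq_assoc h₃ h₅, e₂, A.seq_assoc h₆ h₄]

namespace PreD

/-- Naturality, with prescribed sources and targets. -/
theorem IsHom.nat' {P : Operad V} {α : PseudoComm P} {k : ℕ} {X : Fin k → DAlg P} {Y : DAlg P}
    {F : PreD X Y} (hF : F.IsHom α) {T : V} {m n : Fin k → ℕ} {φ : ∀ i, FMap (m i) (n i)}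
    {c : ∀ i, DPt P .mor T (φ i)} {a b : ∀ i, DPt P .ob T (φ i)} (ha : ∀ i, (c i).src = a i)
    (hb : ∀ i, (c i).tgt = b i) {x : ∀ i, T ⟶ ((X i).X (m i)).car .mor}
    {y z : ∀ i, T ⟶ ((X i).X (m i)).car .ob} (hy : ∀ i, x i ≫ ((X i).X (m i)).src = y i)
    (hz : ∀ i, x i ≫ ((X i).X (m i)).tgt = z i) :
    (Y.X _).seq (Y.op (FMap.smk φ) (DPt.smk c) (F.f x)) (F.d φ b z) =
      (Y.X _).seq (F.d φ a y) (F.f fun i => (X i).op (φ i) (c i) (x i)) := by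
  obtain rfl : (fun i => (c i).src) = a := funext ha
  obtain rfl : (fun i => (c i).tgt) = b := funext hb
  obtain rfl : (fun i => x i ≫ ((X i).X (m i)).src) = y := funext hy
  obtain rfl : (fun i => x i ≫ ((X i).X (m i)).tgt) = z := funext hz
  exact hF.nat φ c x

variable {P : Operad V} (α : PseudoComm P) {l : Lvl} {T : V}

section comp

variable {k : ℕ} {j : Fin k → ℕ} {X : Fin (∑ i, j i) → DAlg P} {Y : Fin k → DAlg P}
    {Z : DAlg P} (F : PreD Y Z) (E : ∀ i, PreD (fun r => X (finSigmaFinEquiv ⟨i, r⟩)) (Y i))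
    {m n p : Fin (∑ i, j i) → ℕ}

theorem f_comp (x : ∀ p, T ⟶ ((X p).X (m p)).car l) :
    (comp F E).f x = (Z.rel (finCongr (ark_sigma m))).ap
      (F.f fun i => (E i).f fun r => x (finSigmaFinEquiv ⟨i, r⟩)) := by
  refine (VFun.comp_ap' _ _ _).trans (congrArg _ ((VFun.comp_ap' _ _ _).trans (congrArg _
    ((VFun.tuple_ap _ _).trans (congrArg tup (funext fun i => (VFun.comp_ap' _ _ _).trans
      (congrArg _ ((VFun.tuple_ap _ _).trans (congrArg tup (funext fun r => ?_)))))))))) 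
  exact co_tup (B := fun p => (X p).X (m p)) x _

/-- The transformation of a composite at generalized points, before the relabelling. -/
noncomputable def compδ (φ : ∀ p, FMap (m p) (n p)) (c : ∀ p, DPt P .ob T (φ p))
    (x : ∀ p, T ⟶ ((X p).X (m p)).car .ob) :
    T ⟶ (Z.X (ark fun i => ark fun r => n (finSigmaFinEquiv ⟨i, r⟩))).car .mor :=
  (Z.X _).seq
      (F.d (fun i => FMap.smk fun r => φ (finSigmaFinEquiv ⟨i, r⟩))
        (fun i => DPt.smk fun r => c (finSigmaFinEquiv ⟨i, r⟩))
        fun i => (E i).f fun r => x (finSigmaFinEquiv ⟨i, r⟩))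
      (F.f fun i => (E i).d (fun r => φ (finSigmaFinEquiv ⟨i, r⟩))
        (fun r => c (finSigmaFinEquiv ⟨i, r⟩)) fun r => x (finSigmaFinEquiv ⟨i, r⟩))

variable {F E}

theorem compδ_comp (hF : F.IsHom α) (hE : ∀ i, (E i).IsHom α)
    (φ : ∀ p, FMap (m p) (n p)) (c : ∀ p, DPt P .ob T (φ p))
    (x : ∀ p, T ⟶ ((X p).X (m p)).car .ob) : 
      F.d (fun i => FMap.smk fun r => φ (finSigmaFinEquiv ⟨i, r⟩))
        (fun i => DPt.smk fun r => c (finSigmaFinEquiv ⟨i, r⟩))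
        (fun i => (E i).f fun r => x (finSigmaFinEquiv ⟨i, r⟩)) ≫ (Z.X _).tgt = 
      (F.f fun i => (E i).d (fun r => φ (finSigmaFinEquiv ⟨i, r⟩))
        (fun r => c (finSigmaFinEquiv ⟨i, r⟩)) fun r => x (finSigmaFinEquiv ⟨i, r⟩)) ≫ 
          (Z.X _).src := by
  rw [hF.tgt, F.f_src]
  simp only [(hE _).src]

theorem d_comp (hF : F.IsHom α) (hE : ∀ i, (E i).IsHom α)
    (φ : ∀ p, FMap (m p) (n p)) (c : ∀ p, DPt P .ob T (φ p))
    (x : ∀ p, T ⟶ ((X p).X (m p)).car .ob) :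
    (comp F E).d φ c x = (Z.rel (finCongr (ark_sigma n))).ap (compδ F E φ c x) :=
  mkδ_eval (Y := Z) φ (fun c x => (Z.rel (finCongr (ark_sigma n))).ap (compδ F E φ c x))
    (fun t c x => by
      rw [VFun.comp_ap, compδ, VCat.comp_seq _ _ (compδ_comp α hF hE φ c x), F.comp_d, F.comp_f]
      simp only [comp_f, comp_d, DPt.res_smk, compδ]) c x

theorem isHom_comp (hF : F.IsHom α) (hE : ∀ i, (E i).IsHom α) : (comp F E).IsHom α where
  based x p h := by
    obtain ⟨⟨i, r⟩, rfl⟩ := finSigmaFinEquiv.surjective p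
    rw [f_comp, hF.based _ i ((hE i).based _ r h), Z.rel_zero]
  src φ c x := by
    rw [d_comp α hF hE, VFun.ap_src, compδ, VCat.seq_src, hF.src, f_comp]
    exact Z.rel_op_eq (DMor.smk_sigma c) (ark_sigma _) (ark_sigma _) _
  tgt φ c x := by
    rw [d_comp α hF hE, VFun.ap_tgt, compδ, VCat.seq_tgt _ (compδ_comp α hF hE φ c x), F.f_tgt,
      f_comp]
    simp only [(hE _).tgt]
  nat {_ m n} φ c x := by
    have e₁ := Z.rel_op_eq (DMor.smk_sigma c) (ark_sigma m) (ark_sigma n)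
      (F.f fun i => (E i).f fun r => x (finSigmaFinEquiv ⟨i, r⟩))
    have e₂ := hF.nat' (φ := fun i => FMap.smk fun r => φ (finSigmaFinEquiv ⟨i, r⟩))
      (c := fun i => DPt.smk fun r => c (finSigmaFinEquiv ⟨i, r⟩))
      (x := fun i => (E i).f fun r => x (finSigmaFinEquiv ⟨i, r⟩))
      (fun i => DPt.smk_src _) (fun i => DPt.smk_tgt _) (fun i => f_src _ _) (fun i => f_tgt _ _)
    have e₃ := fun i => (hE i).nat' (c := fun r => c (finSigmaFinEquiv ⟨i, r⟩))
      (x := fun r => x (finSigmaFinEquiv ⟨i, r⟩)) (a := fun r => (c (finSigmaFinEquiv ⟨i, r⟩)).src)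
      (b := fun r => (c (finSigmaFinEquiv ⟨i, r⟩)).tgt) (fun _ => rfl) (fun _ => rfl)
      (fun _ => rfl) (fun _ => rfl)
    refine (congrArg₂ (VCat.seq _) ((congrArg _ (f_comp F E x)).trans e₁.symm)
      (d_comp α hF hE φ (fun p => (c p).tgt) _)).trans ?_
    refine Eq.trans ?_ (congrArg₂ (VCat.seq _) (d_comp α hF hE φ (fun p => (c p).src) _)
      (f_comp F E _)).symm
    have h₁ := compδ_comp α hF hE φ (fun p => (c p).tgt) fun p => x p ≫ ((X p).X (m p)).tgt
    have h₂ := compδ_comp α hF hE φ (fun p => (c p).src) fun p => x p ≫ ((X p).X (m p)).src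
    refine (VFun.ap_seq _ ?_).symm.trans (Eq.trans (congrArg _ ?_) (VFun.ap_seq _ ?_))
    · rw [Z.op_tgt, F.f_tgt, DPt.smk_tgt, compδ, VCat.seq_src, hF.src]
      simp only [f_tgt, DPt.smk_tgt]
    · refine VCat.seq_square _ e₂ (g := F.f fun i => (Y i).op _
        (DPt.smk fun r => c (finSigmaFinEquiv ⟨i, r⟩))
        ((E i).f fun r => x (finSigmaFinEquiv ⟨i, r⟩))) ?_ ?_ h₁ ?_ ?_
      · refine (F.f_seq ?_).symm.trans ((congrArg F.f (funext e₃)).trans (F.f_seq ?_))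
        · intro i
          rw [(Y i).op_tgt, (hE i).src, f_tgt, DPt.smk_tgt]
        · intro i
          rw [(hE i).tgt, f_src]
          simp only [DAlgData.op_src]
      · rw [Z.op_tgt, F.f_tgt, DPt.smk_tgt, hF.src]
        simp only [f_tgt, DPt.smk_tgt]
      · rw [hF.tgt, F.f_src]
        simp only [DAlgData.op_src, DPt.smk_src, f_src]
      · rw [F.f_src, F.f_tgt]
        simp only [(hE _).tgt, DAlgData.op_src, f_src]
    · rw [compδ, VCat.seq_tgt _ h₂, F.f_tgt, F.f_src]
      simp only [(hE _).tgt, f_src, DAlgData.op_src]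
  inv φ c x := by
    rw [d_comp α hF hE]
    exact VFun.ap_inv _ (inv_seq _ (compδ_comp α hF hE φ c x) (hF.inv ..)
      (F.inv_f fun i => (hE i).inv ..))
  base_right φ c x p h := by
    obtain ⟨⟨i, r⟩, rfl⟩ := finSigmaFinEquiv.surjective p
    rw [d_comp α hF hE, compδ, hF.base_right _ _ _ i ((hE i).based _ r h),
      hF.based _ i ((hE i).base_right _ _ _ r h), ← Z.one_zero]
    exact (congrArg _ ((congrArg _ (congrArg _ (VCat.one_tgt _ _).symm)).trans
      (VCat.seq_one _ _))).trans (Z.rel_zero _)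
  base_left φ c x p h := by
    obtain ⟨⟨i, r⟩, rfl⟩ := finSigmaFinEquiv.surjective p
    rw [d_comp α hF hE, compδ, hF.base_left _ _ _ i
      (smk_none (φ := fun r => φ (finSigmaFinEquiv ⟨i, r⟩)) r h),
      hF.based _ i ((hE i).base_left _ _ _ r h), ← Z.one_zero]
    exact (congrArg _ ((congrArg _ (congrArg _ (VCat.one_tgt _ _).symm)).trans
      (VCat.seq_one _ _))).trans (Z.rel_zero _)
  strict φ h x := by
    rw [d_comp α hF hE, f_comp, ← VFun.ap_one, compδ]
    refine congrArg _ ?_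
    have e₁ := hF.strict (fun i => FMap.smk fun r => φ (finSigmaFinEquiv ⟨i, r⟩))
      (fun i => isPi_smk fun r => h _) fun i => (E i).f fun r => x (finSigmaFinEquiv ⟨i, r⟩)
    have e₂ := fun i => (hE i).src (fun r => φ (finSigmaFinEquiv ⟨i, r⟩))
      (fun r => DPt.iota _ (h (finSigmaFinEquiv ⟨i, r⟩))) fun r => x (finSigmaFinEquiv ⟨i, r⟩)
    simp only [(hE _).strict, VCat.one_src, DPt.smk_iota] at e₂
    simp only [← e₂] at e₁
    simp only [DPt.smk_iota, (hE _).strict, F.f_one]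
    refine (congrArg (VCat.seq _ · _) e₁).trans ?_
    exact (congrArg (VCat.seq _ _) (congrArg _ (VCat.one_tgt _ _).symm)).trans (VCat.seq_one _ _)
  comp {_ m n p} ψ φ d c x := by
    rw [f_comp, d_comp α hF hE, d_comp α hF hE, d_comp α hF hE]
    have h₁ := compδ_comp α hF hE φ c x
    have h₂ := compδ_comp α hF hE ψ d fun p => (X p).op (φ p) (c p) (x p)
    have h₃ := compδ_comp α hF hE (fun p => (ψ p).comp (φ p)) (fun p => (d p).comp (c p)) x
    have r₁ := Z.rel_op_eq (DMor.smk_sigma fun p => (d p).one) (ark_sigma n) (ark_sigma p)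
      (compδ F E φ c x)
    rw [← DPt.smk_one] at r₁
    simp only [← DPt.smk_one] at r₁
    have r₂ := Z.rel_pair_eq (DPair.smk_sigma α d c) (ark_sigma m) (ark_sigma p)
      (F.f fun i => (E i).f fun r => x (finSigmaFinEquiv ⟨i, r⟩))
    have e₁ := hF.comp (fun i => FMap.smk fun r => ψ (finSigmaFinEquiv ⟨i, r⟩))
      (fun i => FMap.smk fun r => φ (finSigmaFinEquiv ⟨i, r⟩))
      (fun i => DPt.smk fun r => d (finSigmaFinEquiv ⟨i, r⟩))
      (fun i => DPt.smk fun r => c (finSigmaFinEquiv ⟨i, r⟩))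
      fun i => (E i).f fun r => x (finSigmaFinEquiv ⟨i, r⟩)
    have e₂ := hF.nat' (c := fun i => (DPt.smk fun r => d (finSigmaFinEquiv ⟨i, r⟩)).one)
      (x := fun i => (E i).d (fun r => φ (finSigmaFinEquiv ⟨i, r⟩))
        (fun r => c (finSigmaFinEquiv ⟨i, r⟩)) fun r => x (finSigmaFinEquiv ⟨i, r⟩))
      (fun i => DPt.one_src _) (fun i => DPt.one_tgt _) (fun i => (hE i).src _ _ _)
      (fun i => (hE i).tgt _ _ _)
    have e₃ := fun i => (hE i).comp (fun r => ψ (finSigmaFinEquiv ⟨i, r⟩))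
      (fun r => φ (finSigmaFinEquiv ⟨i, r⟩)) (fun r => d (finSigmaFinEquiv ⟨i, r⟩))
      (fun r => c (finSigmaFinEquiv ⟨i, r⟩)) fun r => x (finSigmaFinEquiv ⟨i, r⟩)
    have e₄ := hF.nat' (c := fun i => DPt.thetak α (fun r => d (finSigmaFinEquiv ⟨i, r⟩))
        fun r => c (finSigmaFinEquiv ⟨i, r⟩))
      (x := fun i => ((Y i).X _).one ((E i).f fun r => x (finSigmaFinEquiv ⟨i, r⟩)))
      (fun i => DPt.thetak_src α _ _) (fun i => DPt.thetak_tgt α _ _) (fun i => VCat.one_src _ _)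
      (fun i => VCat.one_tgt _ _)
    rw [F.d_cast, F.f_one] at e₄
    rw [← DPt.smk_one] at e₂
    have s₁ := Z.op_one_seq (DPt.smk fun i => DPt.smk fun r => d (finSigmaFinEquiv ⟨i, r⟩)) h₁
    have hc : ((DPt.thetak α (fun i => DPt.smk fun r => d (finSigmaFinEquiv ⟨i, r⟩))
        (fun i => DPt.smk fun r => c (finSigmaFinEquiv ⟨i, r⟩))).cast
        (by simp only [FMap.smk_comp])).tgt =
      (DPt.smk fun i => DPt.thetak α (fun r => d (finSigmaFinEquiv ⟨i, r⟩))
        fun r => c (finSigmaFinEquiv ⟨i, r⟩)).src := by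
      rw [DPt.cast_tgt, DPt.smk_src, DPt.thetak_tgt]
      simp only [DPt.thetak_src]
      exact (DPt.smk_cast (fun i => (FMap.smk_comp _ _).symm) _).symm
    have s₂ := Z.op_seq_one hc (F.f fun i => (E i).f fun r => x (finSigmaFinEquiv ⟨i, r⟩))
    rw [Z.op_cast] at s₂
    refine (congrArg (VCat.seq _ · _) (r₁.symm.trans (congrArg _ s₁))).trans (Eq.trans ?_
      (congrArg (VCat.seq _ · _) (r₂.symm.trans (congrArg _ s₂))).symm)
    refine (VFun.ap_seq _ ?_).symm.trans (Eq.trans (congrArg _ ?_) (VFun.ap_seq _ ?_))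
    · rw [VCat.seq_tgt, compδ, VCat.seq_src]
      · simp only [Z.op_tgt, F.f_tgt, hF.src, (hE _).tgt, DPt.one_tgt]
      · simp only [Z.op_tgt, Z.op_src, F.f_src, hF.tgt, DPt.one_src, DPt.one_tgt, (hE _).src]
    · refine VCat.seq_paste _ e₁ e₂ ((F.f_seq ?_).symm.trans ((congrArg F.f (funext e₃)).trans
        (F.f_seq ?_))) e₄ ?_ ?_ h₂ ?_ ?_ ?_ ?_ h₃
      all_goals try intro i
      all_goals simp only [Z.op_tgt, Z.op_src, F.f_src, F.f_tgt, hF.tgt, hF.src, DPt.one_src,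
        DPt.one_tgt, (hE _).src, (hE _).tgt, DAlgData.op_src, DAlgData.op_tgt, DPt.smk_tgt, DPt.thetak_src, DPt.thetak_tgt, VCat.one_src, VCat.one_tgt, DAlgData.op_cast,
        DAlg.isAlgebra _ |>.comp]
    · rw [VCat.seq_tgt, compδ, VCat.seq_src]
      · simp only [Z.op_tgt, VCat.one_tgt, hF.src, DPt.smk_tgt, DPt.thetak_tgt]
      · rw [Z.op_tgt, Z.op_src, ← hc, DPt.cast_tgt, Z.op_cast, VCat.one_src, VCat.one_tgt]

end comp

end PreD

/-! ### Permutations of multimorphisms of algebras over the category of operators -/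

/-- Pasting of three commutative diagrams. -/
theorem VCat.seq_paste' (A : VCat V) {T : V} {a b c d a' g t h c' d' : T ⟶ A.car .mor}
    (e₁ : A.seq (A.seq a a') h = A.seq t c') (e₂ : A.seq b c = A.seq a' g)
    (e₃ : A.seq g d = A.seq h d') (h₁ : a ≫ A.tgt = b ≫ A.src) (h₂ : b ≫ A.tgt = c ≫ A.src)
    (h₃ : c ≫ A.tgt = d ≫ A.src) (h₄ : a' ≫ A.tgt = g ≫ A.src) (h₅ : h ≫ A.tgt = d' ≫ A.src)
    (h₆ : t ≫ A.tgt = c' ≫ A.src) (h₇ : c' ≫ A.tgt = d' ≫ A.src) :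
    A.seq (A.seq a b) (A.seq c d) = A.seq t (A.seq c' d') := by
  have h₉ : a ≫ A.tgt = a' ≫ A.src := by rw [h₁, ← A.seq_src b c, e₂, A.seq_src]
  have h₁₀ : g ≫ A.tgt = d ≫ A.src := by rw [← A.seq_tgt h₄, ← e₂, A.seq_tgt h₂, h₃]
  have h₁₁ : a' ≫ A.tgt = h ≫ A.src := by rw [h₄, ← A.seq_src g d, e₃, A.seq_src]
  rw [A.seq_assoc h₁ (by rw [A.seq_src, h₂]), ← A.seq_assoc h₂ h₃, e₂, A.seq_assoc h₄ h₁₀, e₃,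
    ← A.seq_assoc h₉ (by rw [A.seq_src, h₁₁]), ← A.seq_assoc (by rw [A.seq_tgt h₉, h₁₁]) h₅, e₁,
    A.seq_assoc h₆ h₇]

theorem VCat.seq_one_one (A : VCat V) {T : V} (x : T ⟶ A.car .ob) :
    A.seq (A.one x) (A.one x) = A.one x :=
  (congrArg (A.seq _) (congrArg A.one (A.one_tgt x).symm)).trans (A.seq_one _)

theorem FMap.comp_assoc {m n p q : ℕ} (χ : FMap p q) (ψ : FMap n p) (φ : FMap m n) :
    (χ.comp ψ).comp φ = χ.comp (ψ.comp φ) := by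
  funext i
  exact (Option.bind_assoc _ _ _).symm

namespace DAlgData

variable {P : Operad V} (X : DAlgData P) {T : V} {m n : ℕ} {φ : FMap m n}

theorem op_seq_right {f g : DPt P .mor T φ} (h : f.tgt = g.src) (x : T ⟶ (X.X m).car .mor) :
    X.op φ (f.seq g) x =
      (X.X n).seq (X.op φ f x) (X.op φ g ((X.X m).one (x ≫ (X.X m).tgt))) := by
  rw [← X.op_seq h (VCat.one_src _ _).symm, VCat.seq_one]

theorem op_seq_left {f g : DPt P .mor T φ} (h : f.tgt = g.src) (x : T ⟶ (X.X m).car .mor) :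
    X.op φ (f.seq g) x =
      (X.X n).seq (X.op φ f ((X.X m).one (x ≫ (X.X m).src))) (X.op φ g x) := by
  rw [← X.op_seq h (VCat.one_tgt _ _), VCat.one_seq]

end DAlgData

namespace PreD

variable {P : Operad V} (α : PseudoComm P) {l : Lvl} {T : V} {k : ℕ} {X : Fin k → DAlg P}
  {Y : DAlg P} (F : PreD X Y) {f : Fin k → Fin k} (b : Braid k f) {m n p : Fin k → ℕ}

/-- The transformation of a permuted multimorphism, for a given presentation of the permutation. -/
noncomputable def brδ (φ : ∀ i, FMap (m i) (n i)) (c : ∀ i, DPt P .ob T (φ i))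
    (x : ∀ i, T ⟶ ((X i).X (m (f i))).car .ob) : T ⟶ (Y.X (ark n)).car .mor :=
  (Y.X _).seq
      (Y.op ((FMap.smk φ).comp (ofEquiv (b.bij m))) (DPt.cell α b c) ((Y.X _).one (F.f x)))
      ((Y.rel (b.bij n)).ap (F.d (fun i => φ (f i)) (fun i => c (f i)) x))

variable {F}

theorem brδ_comp (hF : F.IsHom α) (φ : ∀ i, FMap (m i) (n i)) (c : ∀ i, DPt P .ob T (φ i))
    (x : ∀ i, T ⟶ ((X i).X (m (f i))).car .ob) :
    Y.op ((FMap.smk φ).comp (ofEquiv (b.bij m))) (DPt.cell α b c) ((Y.X _).one (F.f x)) ≫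
        (Y.X _).tgt =
      (Y.rel (b.bij n)).ap (F.d (fun i => φ (f i)) (fun i => c (f i)) x) ≫ (Y.X _).src := by
  rw [Y.op_tgt, VFun.ap_src, hF.src, Y.rel_ap, ← Y.isAlgebra.comp, DPt.cell_tgt, Y.op_cast,
    VCat.one_tgt]

theorem comp_brδ (hF : F.IsHom α) {S : V} (t : S ⟶ T) (φ : ∀ i, FMap (m i) (n i))
    (c : ∀ i, DPt P .ob T (φ i)) (x : ∀ i, T ⟶ ((X i).X (m (f i))).car .ob) :
    t ≫ brδ α F b φ c x = brδ α F b φ (fun i => (c i).res t) fun i => t ≫ x i := by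
  rw [brδ, VCat.comp_seq _ _ (brδ_comp α b hF φ c x), Y.comp_op, VCat.comp_one, VFun.comp_ap,
    F.comp_d, F.comp_f, DPt.cell_res]
  rfl

theorem brδ_src (φ : ∀ i, FMap (m i) (n i)) (c : ∀ i, DPt P .ob T (φ i))
    (x : ∀ i, T ⟶ ((X i).X (m (f i))).car .ob) :
    brδ α F b φ c x ≫ (Y.X _).src = Y.op (FMap.smk φ) (DPt.smk c) ((Y.rel (b.bij m)).ap (F.f x)) := by
  rw [brδ, VCat.seq_src, Y.op_src, VCat.one_src, DPt.cell_src, Y.isAlgebra.comp, Y.rel_ap]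

theorem brδ_tgt (hF : F.IsHom α) (φ : ∀ i, FMap (m i) (n i)) (c : ∀ i, DPt P .ob T (φ i))
    (x : ∀ i, T ⟶ ((X i).X (m (f i))).car .ob) :
    brδ α F b φ c x ≫ (Y.X _).tgt =
      (Y.rel (b.bij n)).ap (F.f fun i => (X i).op (φ (f i)) (c (f i)) (x i)) := by
  rw [brδ, VCat.seq_tgt _ (brδ_comp α b hF φ c x), VFun.ap_tgt, hF.tgt]

theorem brδ_nat (hF : F.IsHom α) (φ : ∀ i, FMap (m i) (n i)) (c : ∀ i, DPt P .mor T (φ i))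
    (x : ∀ i, T ⟶ ((X i).X (m (f i))).car .mor) :
    (Y.X _).seq (Y.op (FMap.smk φ) (DPt.smk c) ((Y.rel (b.bij m)).ap (F.f x)))
        (brδ α F b φ (fun i => (c i).tgt) fun i => x i ≫ ((X i).X _).tgt) =
      (Y.X _).seq (brδ α F b φ (fun i => (c i).src) fun i => x i ≫ ((X i).X _).src)
        ((Y.rel (b.bij n)).ap (F.f fun i => (X i).op (φ (f i)) (c (f i)) (x i))) := by
  have h₁ : ((DPt.smk c).comp (DPt.iota (ofEquiv (b.bij m)) (isPi_ofEquiv _))).tgt =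
      (DPt.cell α b fun i => (c i).tgt).src := by
    rw [DPt.comp_tgt, DPt.cell_src, DPt.smk_tgt, DPt.iota_tgt]
  have h₂ : (DPt.cell α b fun i => (c i).src).tgt =
      (((DPt.iota (ofEquiv (b.bij n)) (isPi_ofEquiv _)).comp (DPt.smk fun i => c (f i))).cast
          (b.nat φ).symm).src := by
    rw [DPt.cell_tgt, DPt.cast_src, DPt.comp_src, DPt.smk_src, DPt.iota_src]
  have e₁ := congrArg (Y.op _ · (F.f x)) (DPt.cell_nat α b c)
  have e₂ := congrArg (Y.rel (b.bij n)).ap (hF.nat' (c := fun i => c (f i)) (x := x)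
    (a := fun i => (c (f i)).src) (b := fun i => (c (f i)).tgt) (fun _ => rfl) (fun _ => rfl)
    (fun _ => rfl) (fun _ => rfl))
  replace e₁ := (Y.op_seq_right h₁ _).symm.trans (e₁.trans (Y.op_seq_left h₂ _))
  rw [Y.op_cast, Y.isAlgebra.comp, Y.isAlgebra.comp, ← Y.rel_ap, ← Y.rel_ap, F.f_src, F.f_tgt] at e₁
  rw [VFun.ap_seq, VFun.ap_seq] at e₂
  · have h₃ := brδ_comp α b hF φ (fun i => (c i).tgt) fun i => x i ≫ ((X i).X (m (f i))).tgt
    refine VCat.seq_square _ e₁ e₂ ?_ h₃ ?_ ?_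
    · rw [Y.op_tgt, Y.op_src, VFun.ap_tgt, F.f_tgt, VCat.one_src, DPt.smk_tgt, DPt.cell_src,
        Y.isAlgebra.comp, Y.rel_ap]
    · rw [brδ_comp α b hF, VFun.ap_src, VFun.ap_src, hF.src, Y.op_src, F.f_src, DPt.smk_src]
    · rw [VFun.ap_tgt, VFun.ap_src, hF.tgt, F.f_src]
      simp only [DAlgData.op_src]
  · rw [hF.tgt, F.f_src]
    simp only [DAlgData.op_src]
  · rw [hF.src, Y.op_tgt, F.f_tgt, DPt.smk_tgt]

theorem brδ_base_right (hF : F.IsHom α) (φ : ∀ i, FMap (m i) (n i)) (c : ∀ i, DPt P .ob T (φ i))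
    (x : ∀ i, T ⟶ ((X i).X (m (f i))).car .ob) (i : Fin k) (h : x i = (X i).zero) :
    brδ α F b φ c x = (Y.X _).one Y.zero := by
  rw [brδ, hF.based x i h, hF.base_right _ _ x i h, VFun.ap_one, Y.rel_zero, Y.one_zero,
    Y.isAlgebra.base_right]
  exact VCat.seq_one_one _ _

theorem brδ_base_left (hF : F.IsHom α) (φ : ∀ i, FMap (m i) (n i)) (c : ∀ i, DPt P .ob T (φ i))
    (x : ∀ i, T ⟶ ((X i).X (m (f i))).car .ob) (i : Fin k) (h : φ (f i) = fun _ => none) :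
    brδ α F b φ c x = (Y.X _).one Y.zero := by
  have e : (FMap.smk φ).comp (ofEquiv (b.bij m)) = fun _ => none := by
    rw [smk_none _ h]; rfl
  rw [brδ, hF.base_left _ _ x i h, Y.op_none e, VFun.ap_one, Y.rel_zero]
  exact VCat.seq_one_one _ _

theorem brδ_strict (hF : F.IsHom α) (φ : ∀ i, FMap (m i) (n i)) (h : ∀ i, (φ i).IsPi)
    (x : ∀ i, T ⟶ ((X i).X (m (f i))).car .ob) :
    brδ α F b φ (fun i => DPt.iota (φ i) (h i)) x = (Y.X _).one ((Y.rel (b.bij n)).ap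
      (F.f fun i => (X i).op (φ (f i)) (DPt.iota _ (h (f i))) (x i))) := by
  have e := brδ_comp α b hF φ (fun i => DPt.iota (φ i) (h i)) x
  rw [hF.strict _ fun i => h (f i), VFun.ap_one, VCat.one_src, DPt.cell_iota, Y.op_one,
    VCat.one_tgt] at e
  rw [brδ, hF.strict _ fun i => h (f i), VFun.ap_one, DPt.cell_iota, Y.op_one, e]
  exact VCat.seq_one_one _ _

theorem brδ_paste (hF : F.IsHom α) (ψ : ∀ i, FMap (n i) (p i)) (φ : ∀ i, FMap (m i) (n i))
    (d : ∀ i, DPt P .ob T (ψ i)) (c : ∀ i, DPt P .ob T (φ i))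
    (x : ∀ i, T ⟶ ((X i).X (m (f i))).car .ob) :
    (Y.X _).seq (Y.op (FMap.smk ψ) (DPt.smk d).one (brδ α F b φ c x))
        (brδ α F b ψ d fun i => (X i).op (φ (f i)) (c (f i)) (x i)) =
      (Y.X _).seq
        (Y.op (FMap.smk fun i => (ψ i).comp (φ i)) (DPt.thetak α d c)
          ((Y.X _).one ((Y.rel (b.bij m)).ap (F.f x))))
        (brδ α F b (fun i => (ψ i).comp (φ i)) (fun i => (d i).comp (c i)) x) := by
  have h₁ : (FMap.smk ψ).comp ((FMap.smk φ).comp (ofEquiv (b.bij m))) =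
      (FMap.smk fun i => (ψ i).comp (φ i)).comp (ofEquiv (b.bij m)) := by
    rw [← FMap.comp_assoc, smk_comp]
  have h₂ : ((FMap.smk ψ).comp (ofEquiv (b.bij n))).comp (FMap.smk fun i => φ (f i)) =
      (FMap.smk fun i => (ψ i).comp (φ i)).comp (ofEquiv (b.bij m)) := by
    rw [FMap.comp_assoc, ← b.nat, h₁]
  have h₃ := (b.nat fun i => (ψ i).comp (φ i)).symm
  have t₁ := DPt.comp_cell_tgt α b d c h₁ h₂
  have t₂ := DPt.cell_comp_tgt α b d c h₂ h₃
  have t₃ := DPt.thetak_comp_tgt α b d c rfl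
  have e₁ := congrArg (Y.op _ · ((Y.X _).one (F.f x))) (DPt.cell_theta α b d c h₁ h₂ h₃ rfl)
  replace e₁ := ((congrArg (VCat.seq _ · _) (Y.op_seq_one t₁ _).symm).trans
    ((Y.op_seq_one ((DPt.seq_tgt t₁).trans t₂) _).symm)).trans (e₁.trans (Y.op_seq_one t₃ _))
  simp only [Y.op_cast, Y.isAlgebra.comp, Y.op_one, ← Y.rel_ap] at e₁
  have e₂ := ((Y.op_seq_right (DPt.one_tgt _)
    (F.d (fun i => φ (f i)) (fun i => c (f i)) x)).symm.trans (congrArg (Y.op _ · _)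
      ((DPt.one_seq (DPt.cell α b d)).trans (DPt.seq_one _).symm))).trans
      (Y.op_seq_left (DPt.one_src _).symm (F.d (fun i => φ (f i)) (fun i => c (f i)) x))
  rw [DPt.cell_src, DPt.cell_tgt, DPt.cast_one, DPt.comp_one, DPt.comp_one, DPt.iota_one,
    DPt.iota_one, Y.op_cast, Y.isAlgebra.comp, Y.isAlgebra.comp, ← Y.rel_ap, ← Y.rel_ap, hF.src,
    hF.tgt] at e₂
  have e₃ := congrArg (Y.rel (b.bij p)).ap (hF.comp (fun i => ψ (f i)) (fun i => φ (f i))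
    (fun i => d (f i)) (fun i => c (f i)) x)
  rw [VFun.ap_seq, VFun.ap_seq] at e₃
  · have h₄ := brδ_comp α b hF φ c x
    have h₅ := brδ_comp α b hF ψ d fun i => (X i).op (φ (f i)) (c (f i)) (x i)
    have h₆ := brδ_comp α b hF (fun i => (ψ i).comp (φ i)) (fun i => (d i).comp (c i)) x
    rw [brδ, Y.op_one_seq _ h₄]
    refine VCat.seq_paste' _ (e₁.trans ?_) e₂ e₃ ?_ ?_ h₅ ?_ ?_ ?_ h₆
    · rw [VFun.ap_one]
    · rw [Y.op_tgt, Y.op_src, h₄, DPt.one_src, DPt.one_tgt]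
    · rw [Y.op_tgt, Y.op_src, VFun.ap_tgt, hF.tgt, VCat.one_src, DPt.one_tgt, DPt.cell_src,
        Y.isAlgebra.comp, Y.rel_ap]
    · rw [Y.op_tgt, VFun.ap_src, Y.op_src, DPt.cell_tgt, Y.op_cast, Y.isAlgebra.comp, hF.src,
        VCat.one_tgt, DPt.one_src, Y.rel_ap]
    · rw [VFun.ap_tgt, VFun.ap_src, hF.src, Y.op_tgt, DPt.thetak_tgt, VCat.one_tgt]
    · rw [Y.op_tgt, Y.op_src, DPt.thetak_tgt, DPt.cell_src, VCat.one_tgt, VCat.one_src,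
        Y.isAlgebra.comp, Y.rel_ap]
  · rw [Y.op_tgt, hF.src, DPt.thetak_tgt, VCat.one_tgt]
  · rw [Y.op_tgt, hF.src, hF.tgt, DPt.one_tgt]

section act

/-- The family over all indices obtained from a family over the values of a permutation. -/
def reidx {ι : Type} {Z : ι → ι → Type*} (σ : Equiv.Perm ι) (x : ∀ r, Z (σ r) r) (i : ι) :
    Z i (σ.symm i) :=
  Eq.rec (motive := fun i' _ => Z i' (σ.symm i)) (x (σ.symm i)) (σ.apply_symm_apply i)

theorem reidx_map {ι : Type} {Z : ι → ι → Type*} {W : ι → ι → Type*} (σ : Equiv.Perm ι)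
    (g : ∀ i r, Z i r → W i r) (x : ∀ r, Z (σ r) r) (i : ι) :
    reidx (Z := W) σ (fun r => g (σ r) r (x r)) i = g i _ (reidx σ x i) := by
  unfold reidx
  generalize σ.apply_symm_apply i = h
  revert h
  generalize hs : σ.symm i = s
  intro h
  subst h
  rfl

theorem reidx_ind {ι : Type} {Z : ι → ι → Type*} (σ : Equiv.Perm ι) (x : ∀ r, Z (σ r) r)
    (Q : ∀ i r, Z i r → Prop) (r : ι) (h : Q (σ r) r (x r)) : Q (σ r) _ (reidx σ x (σ r)) := by
  unfold reidx
  generalize σ.apply_symm_apply (σ r) = e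
  revert e
  rw [σ.symm_apply_apply]
  intro e
  exact h

variable (X) in
/-- A family of generalized points of the `X (σ i)`, indexed by the arguments of `X`. -/
def permute (σ : Equiv.Perm (Fin k)) (x : ∀ i, T ⟶ ((X (σ i)).X (m i)).car l) (i : Fin k) :
    T ⟶ ((X i).X (m (σ.symm i))).car l :=
  reidx (Z := fun i r => T ⟶ ((X i).X (m r)).car l) σ x i

variable (σ : Equiv.Perm (Fin k))

theorem permute_op (φ : ∀ i, FMap (m i) (n i)) (c : ∀ i, DPt P l T (φ i))
    (x : ∀ i, T ⟶ ((X (σ i)).X (m i)).car l) :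
    permute X σ (fun i => (X (σ i)).op (φ i) (c i) (x i)) =
      fun i => (X i).op (φ (σ.symm i)) (c (σ.symm i)) (permute X σ x i) :=
  funext (reidx_map (Z := fun i r => T ⟶ ((X i).X (m r)).car l)
    (W := fun i r => T ⟶ ((X i).X (n r)).car l) σ (fun i r y => (X i).op (φ r) (c r) y) x)

theorem permute_src (x : ∀ i, T ⟶ ((X (σ i)).X (m i)).car .mor) :
    permute X σ (fun i => x i ≫ ((X (σ i)).X (m i)).src) =
      fun i => permute X σ x i ≫ ((X i).X _).src :=
  funext (reidx_map (Z := fun i r => T ⟶ ((X i).X (m r)).car .mor)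
    (W := fun i r => T ⟶ ((X i).X (m r)).car .ob) σ (fun i r y => y ≫ ((X i).X (m r)).src) x)

theorem permute_tgt (x : ∀ i, T ⟶ ((X (σ i)).X (m i)).car .mor) :
    permute X σ (fun i => x i ≫ ((X (σ i)).X (m i)).tgt) =
      fun i => permute X σ x i ≫ ((X i).X _).tgt :=
  funext (reidx_map (Z := fun i r => T ⟶ ((X i).X (m r)).car .mor)
    (W := fun i r => T ⟶ ((X i).X (m r)).car .ob) σ (fun i r y => y ≫ ((X i).X (m r)).tgt) x)

theorem comp_permute {S : V} (t : S ⟶ T) (x : ∀ i, T ⟶ ((X (σ i)).X (m i)).car l) :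
    permute X σ (fun i => t ≫ x i) = fun i => t ≫ permute X σ x i :=
  funext (reidx_map (Z := fun i r => T ⟶ ((X i).X (m r)).car l)
    (W := fun i r => S ⟶ ((X i).X (m r)).car l) σ (fun i r y => t ≫ y) x)

theorem permute_zero {x : ∀ i, T ⟶ ((X (σ i)).X (m i)).car l} {i : Fin k}
    (h : x i = (X (σ i)).zero) : permute X σ x (σ i) = (X (σ i)).zero :=
  reidx_ind (Z := fun i r => T ⟶ ((X i).X (m r)).car l) σ x (fun i _ y => y = (X i).zero) i h

variable (F)

theorem f_act (x : ∀ i, T ⟶ ((X (σ i)).X (m i)).car l) :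
    (act α σ F).f x = (Y.rel ((braid σ).bij m)).ap (F.f (permute X σ x)) := by
  refine (VFun.comp_ap' _ _ _).trans (congrArg _ ((VFun.comp_ap' _ _ _).trans (congrArg _
    ((VFun.tuple_ap _ _).trans (congrArg tup (funext fun i => ?_))))))
  have h : ∀ {i i' : Fin k} (h : i = i') {A : VCat V} (F : VFun A ((X i).X (m (σ.symm i')))) 
      (a : T ⟶ A.car l), (Eq.rec (motive := fun i _ => VFun A ((X i).X (m (σ.symm i')))) F h).ap a =
      Eq.rec (motive := fun i _ => T ⟶ ((X i).X (m (σ.symm i'))).car l) (F.ap a) h := by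
    intro i i' h A F a
    subst h
    rfl
  refine (h (σ.apply_symm_apply i) _ _).trans ?_
  unfold permute reidx
  congr 1
  exact co_tup (B := fun i => (X (σ i)).X (m i)) x _

variable {F}

theorem d_act (hF : F.IsHom α) (φ : ∀ i, FMap (m i) (n i)) (c : ∀ i, DPt P .ob T (φ i))
    (x : ∀ i, T ⟶ ((X (σ i)).X (m i)).car .ob) :
    (act α σ F).d φ c x = brδ α F (braid σ) φ c (permute X σ x) :=
  mkδ_eval (X := fun i => X (σ i)) (Y := Y) φ
    (fun {T} c x => brδ α F (braid σ) φ c (permute X σ x))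
    (fun t c x => (comp_brδ α _ hF t _ _ _).trans (congrArg (brδ α F _ _ _)
      (comp_permute σ t x).symm)) c x

theorem isHom_act (hF : F.IsHom α) : (act α σ F).IsHom α where
  based x i h := by
    rw [f_act, hF.based _ (σ i) (permute_zero σ h), Y.rel_zero]
  src φ c x := by
    rw [d_act α σ hF, f_act, brδ_src]
  tgt φ c x := by
    rw [d_act α σ hF, f_act, brδ_tgt α _ hF, permute_op]
  nat φ c x := by
    have h := brδ_nat α (braid σ) hF φ c (permute X σ x)
    rw [← permute_src, ← permute_tgt, ← f_act, ← d_act α σ hF, ← d_act α σ hF, ← permute_op,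
      ← f_act] at h
    exact h
  inv φ c x := by
    rw [d_act α σ hF]
    exact inv_seq _ (brδ_comp α _ hF ..) (Y.inv_op (DPt.inv_cell α _ c) (inv_one _ _))
      (VFun.ap_inv _ (hF.inv ..))
  base_right φ c x i h := by
    rw [d_act α σ hF, brδ_base_right α _ hF φ c _ (σ i) (permute_zero σ h)]
  base_left φ c x i h := by
    have e : ∀ r, r = i → φ r = fun _ => none := by rintro _ rfl; exact h
    rw [d_act α σ hF, brδ_base_left α _ hF φ c _ (σ i) (e _ (σ.symm_apply_apply i))]
  strict φ h x := by
    rw [d_act α σ hF, brδ_strict α _ hF, f_act, permute_op]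
  comp ψ φ d c x := by
    rw [d_act α σ hF, d_act α σ hF, d_act α σ hF, f_act, permute_op, brδ_paste α _ hF]

end act

end PreD

theorem MultD.isClosed (P : Operad V) (α : PseudoComm P) : (MultD P α).IsClosed where
  one := PreD.isHom_one α
  comp _ _ := PreD.isHom_comp α
  act σ _ _ _ := PreD.isHom_act α σ

open Function

/-! ### Multimorphisms of algebras over an operad -/

namespace OAlg

variable {P : Operad V} (A : OAlg P) {T : V} {l : Lvl} {n : ℕ}

theorem comp_op {S : V} (t : S ⟶ T) (c : T ⟶ (P.O n).car l) (y : Fin n → (T ⟶ A.C.car l)) :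
    t ≫ A.op c y = A.op (t ≫ c) fun i => t ≫ y i := by
  rw [op, VFun.comp_ap, comp_pr, comp_tup]; rfl

theorem op_src (c : T ⟶ (P.O n).car .mor) (y : Fin n → (T ⟶ A.C.car .mor)) :
    A.op c y ≫ A.C.src = A.op (c ≫ (P.O n).src) fun i => y i ≫ A.C.src := (A.pt T).op_src c y

theorem op_tgt (c : T ⟶ (P.O n).car .mor) (y : Fin n → (T ⟶ A.C.car .mor)) :
    A.op c y ≫ A.C.tgt = A.op (c ≫ (P.O n).tgt) fun i => y i ≫ A.C.tgt := (A.pt T).op_tgt c y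

theorem op_one (c : T ⟶ (P.O n).car .ob) (y : Fin n → (T ⟶ A.C.car .ob)) :
    A.op ((P.O n).one c) (fun i => A.C.one (y i)) = A.C.one (A.op c y) := (A.pt T).op_one c y

theorem op_seq {c d : T ⟶ (P.O n).car .mor} {y z : Fin n → (T ⟶ A.C.car .mor)}
    (h : c ≫ (P.O n).tgt = d ≫ (P.O n).src) (h' : ∀ i, y i ≫ A.C.tgt = z i ≫ A.C.src) :
    A.op ((P.O n).seq c d) (fun i => A.C.seq (y i) (z i)) = A.C.seq (A.op c y) (A.op d z) :=
  (A.pt T).op_seq h h'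

theorem op_one_seq (c : T ⟶ (P.O n).car .ob) {y z : Fin n → (T ⟶ A.C.car .mor)}
    (h' : ∀ i, y i ≫ A.C.tgt = z i ≫ A.C.src) :
    A.op ((P.O n).one c) (fun i => A.C.seq (y i) (z i)) =
      A.C.seq (A.op ((P.O n).one c) y) (A.op ((P.O n).one c) z) := by
  rw [← A.op_seq (by rw [VCat.one_src, VCat.one_tgt]) h', VCat.seq_one_one]

theorem op_star (c : T ⟶ (P.O 0).car l) (y : Fin 0 → (T ⟶ A.C.car l)) : A.op c y = A.zero := by
  rw [P.eq_star c, zero, Subsingleton.elim y Fin.elim0]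

theorem comp_zero {S : V} (t : S ⟶ T) : t ≫ (A.zero : T ⟶ A.C.car l) = A.zero := by
  rw [zero, comp_op, A.op_star]

theorem one_zero : A.C.one (A.zero : T ⟶ A.C.car .ob) = A.zero := by
  rw [zero, ← A.op_one, A.op_star]

end OAlg

namespace PreO

variable {P : Operad V} {k : ℕ} {A : Fin k → OAlg P} {B : OAlg P} {l : Lvl} {T : V} (F : PreO A B)

theorem comp_f {S : V} (t : S ⟶ T) (w : ∀ i, T ⟶ (A i).C.car l) :
    t ≫ F.f w = F.f fun i => t ≫ w i := by
  rw [f, VFun.comp_ap, comp_tup]; rfl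

theorem f_src (w : ∀ i, T ⟶ (A i).C.car .mor) : F.f w ≫ B.C.src = F.f fun i => w i ≫ (A i).C.src := by
  rw [f, VFun.ap_src, tup_src]; rfl

theorem f_tgt (w : ∀ i, T ⟶ (A i).C.car .mor) : F.f w ≫ B.C.tgt = F.f fun i => w i ≫ (A i).C.tgt := by
  rw [f, VFun.ap_tgt, tup_tgt]; rfl

theorem f_one (w : ∀ i, T ⟶ (A i).C.car .ob) :
    (F.f fun i => (A i).C.one (w i)) = B.C.one (F.f w) := by
  rw [f, f, ← VFun.ap_one, one_tup]

theorem f_seq {x y : ∀ i, T ⟶ (A i).C.car .mor} (h : ∀ i, x i ≫ (A i).C.tgt = y i ≫ (A i).C.src) :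
    (F.f fun i => (A i).C.seq (x i) (y i)) = B.C.seq (F.f x) (F.f y) := by
  rw [f, f, f, ← VFun.ap_seq, seq_tup h]
  rw [tup_src, tup_tgt]; simp only [h]

theorem inv_f {x : ∀ i, T ⟶ (A i).C.car .mor} (h : ∀ i, (A i).C.Inv (x i)) : B.C.Inv (F.f x) :=
  VFun.ap_inv _ (inv_tup h)

theorem comp_d {S : V} (t : S ⟶ T) (i : Fin k) {n : ℕ} (c : T ⟶ (P.O n).car .ob)
    (y : Fin n → (T ⟶ (A i).C.car .ob)) (w : ∀ i, T ⟶ (A i).C.car .ob) :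
    t ≫ F.d i c y w = F.d i (t ≫ c) (fun r => t ≫ y r) fun j => t ≫ w j := by
  rw [d, ← Category.assoc, comp_pr, comp_pr, comp_tup, comp_tup]; rfl

/-- The `i`th argument of `δ i` is a dummy. -/
theorem d_congr (i : Fin k) {n : ℕ} (c : T ⟶ (P.O n).car .ob) (y : Fin n → (T ⟶ (A i).C.car .ob))
    {w w' : ∀ i, T ⟶ (A i).C.car .ob} (h : ∀ j, j ≠ i → w j = w' j) : F.d i c y w = F.d i c y w' := by
  have : (fun j : {j // j ≠ i} => w j.1) = fun j : {j // j ≠ i} => w' j.1 := funext fun j => h j.1 j.2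
  rw [d, d, this]

theorem d_update (i : Fin k) {n : ℕ} (c : T ⟶ (P.O n).car .ob) (y : Fin n → (T ⟶ (A i).C.car .ob))
    (w : ∀ i, T ⟶ (A i).C.car .ob) (z) : F.d i c y (update w i z) = F.d i c y w :=
  F.d_congr i c y fun _ h => update_of_ne h _ _

theorem mkδ_eval (i : Fin k) (n : ℕ)
    (D : ∀ {T : V}, (T ⟶ (P.O n).car .ob) → (Fin n → (T ⟶ (A i).C.car .ob)) →
      (∀ i, T ⟶ (A i).C.car .ob) → (T ⟶ B.C.car .mor))
    (hD : ∀ {S T : V} (t : S ⟶ T) c y w, t ≫ D c y w = D (t ≫ c) (fun r => t ≫ y r) fun j => t ≫ w j)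
    (hw : ∀ {T : V} c y (w : ∀ i, T ⟶ (A i).C.car .ob) z, D c y (update w i z) = D c y w)
    (c : T ⟶ (P.O n).car .ob) (y : Fin n → (T ⟶ (A i).C.car .ob)) (w : ∀ i, T ⟶ (A i).C.car .ob) :
    pr c (pr (tup y) (tup fun j : {j // j ≠ i} => w j.1)) ≫ mkδ i n D = D c y w := by
  rw [← hw c y w (A i).zero, mkδ, hD]
  have e₁ : pr c (pr (tup y) (tup fun j : {j // j ≠ i} => w j.1)) ≫ p₁ _ _ _ = c := pr_p₁ _ _
  have e₂ : pr c (pr (tup y) (tup fun j : {j // j ≠ i} => w j.1)) ≫ p₂ _ _ _ =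
    pr (tup y) (tup fun j : {j // j ≠ i} => w j.1) := pr_p₂ _ _
  rw [e₁]
  congr 1
  · funext r
    rw [← comp_co, ← Category.assoc, e₂, pr_p₁, co_tup]
  · funext j
    by_cases h : j = i
    · subst h
      rw [dif_pos rfl, update_self, OAlg.comp_zero]
    · rw [dif_neg h, update_of_ne h, ← comp_co, ← Category.assoc, e₂, pr_p₂, co_tup]

/-- Naturality, with prescribed sources and targets. -/
theorem IsHom.nat' {α : PseudoComm P} {F : PreO A B} (hF : F.IsHom α) (i : Fin k) {n : ℕ}
    (c : T ⟶ (P.O n).car .mor) {a b : T ⟶ (P.O n).car .ob} (ha : c ≫ (P.O n).src = a)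
    (hb : c ≫ (P.O n).tgt = b) (y : Fin n → (T ⟶ (A i).C.car .mor))
    {z z' : Fin n → (T ⟶ (A i).C.car .ob)} (hz : ∀ r, y r ≫ (A i).C.src = z r)
    (hz' : ∀ r, y r ≫ (A i).C.tgt = z' r) (w : ∀ i, T ⟶ (A i).C.car .mor)
    {t t' : ∀ i, T ⟶ (A i).C.car .ob} (ht : ∀ j, j ≠ i → w j ≫ (A j).C.src = t j)
    (ht' : ∀ j, j ≠ i → w j ≫ (A j).C.tgt = t' j) :
    B.C.seq (B.op c fun r => F.f (update w i (y r))) (F.d i b z' t') =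
      B.C.seq (F.d i a z t) (F.f (update w i ((A i).op c y))) := by
  obtain rfl : (fun r => y r ≫ (A i).C.src) = z := funext hz
  obtain rfl : (fun r => y r ≫ (A i).C.tgt) = z' := funext hz'
  subst ha hb
  rw [← F.d_congr i _ _ ht, ← F.d_congr i _ _ ht']
  exact hF.nat i c y w

section one

variable (α : PseudoComm P) (A : OAlg P)

theorem one_f (w : Fin 1 → (T ⟶ A.C.car l)) : (one A).f w = w 0 := co_tup (B := fun _ => A.C) w 0

theorem one_d (i : Fin 1) {n : ℕ} (c : T ⟶ (P.O n).car .ob) (y : Fin n → (T ⟶ A.C.car .ob))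
    (w : Fin 1 → (T ⟶ A.C.car .ob)) : (one A).d i c y w = A.C.one (A.op c y) :=
  mkδ_eval (A := fun _ : Fin 1 => A) i n (fun c y _ => A.C.one (A.op c y))
    (fun t c y w => by rw [VCat.comp_one, A.comp_op]) (fun _ _ _ _ => rfl) c y w

theorem isHom_one : (one A).IsHom α where
  based w i h := by rw [one_f, ← h, Subsingleton.elim i 0]
  src i n c y w := by
    rw [one_d, VCat.one_src, Subsingleton.elim i 0]
    simp only [one_f, update_self]
  tgt i n c y w := by
    rw [one_d, VCat.one_tgt, Subsingleton.elim i 0]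
    simp only [one_f, update_self]
  nat i n c y w := by
    rw [one_d, one_d, Subsingleton.elim i 0]
    simp only [one_f, update_self]
    rw [← A.op_src, ← A.op_tgt, VCat.seq_one, VCat.one_seq]
  inv i n c y w := by rw [one_d]; exact inv_one _ _
  nullary i c y w := by rw [one_d, A.op_star]
  equivariant i m n e c y w := by
    rw [one_d, one_d]
    exact congrArg _ (((A.pt _).L .ob).op_act e c y)
  unit i w := by
    rw [one_d, one_f, Subsingleton.elim i 0]
    exact congrArg _ (((A.pt _).L .ob).op_unit _)
  cmp i n m j e c b y w := by
    simp only [one_d]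
    rw [A.op_one]
    refine (VCat.seq_one_one _ _).trans (congrArg _ ?_)
    exact (((A.pt _).L .ob).op_cmp e c b y).symm
  comm i j h := absurd (Subsingleton.elim i j) h

end one

end PreO

/-! ### Composites of multimorphisms of algebras over an operad -/

namespace PreO

variable {P : Operad V} {l : Lvl} {T : V}

section comm

variable {k : ℕ} {A : Fin k → OAlg P} {B : OAlg P} {F : PreO A B} {α : PseudoComm P}

theorem IsHom.comm_comp' (hF : F.IsHom α) (i j : Fin k) (h : i ≠ j) {m n : ℕ}
    (x : T ⟶ (P.O m).car .ob) (y : T ⟶ (P.O n).car .ob) (a : Fin m → (T ⟶ (A i).C.car .ob))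
    (b : Fin n → (T ⟶ (A j).C.car .ob)) (w : ∀ i, T ⟶ (A i).C.car .ob) :
    (B.op ((P.O n).one y) fun s => F.d i x a (update w j (b s))) ≫ B.C.tgt =
      F.d j y b (update w i ((A i).op x a)) ≫ B.C.src := by
  rw [OAlg.op_tgt, hF.src, VCat.one_tgt]
  simp only [hF.tgt, update_comm h]

theorem IsHom.comm_comp (hF : F.IsHom α) (i j : Fin k) (h : i ≠ j) {m n : ℕ}
    (x : T ⟶ (P.O m).car .ob) (y : T ⟶ (P.O n).car .ob) (a : Fin m → (T ⟶ (A i).C.car .ob))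
    (b : Fin n → (T ⟶ (A j).C.car .ob)) (w : ∀ i, T ⟶ (A i).C.car .ob) :
    (B.op (α.ap x y) fun q => B.C.one
          (F.f (update (update w i (a (dec q).2)) j (b (dec q).1)))) ≫ B.C.tgt =
      B.C.seq (B.op ((P.O n).one y) fun s => F.d i x a (update w j (b s)))
          (F.d j y b (update w i ((A i).op x a))) ≫ B.C.src := by
  rw [VCat.seq_src, OAlg.op_src, OAlg.op_tgt, VCat.one_src,
    α.ap_tgt]
  simp only [hF.src, VCat.one_tgt]
  refine (((B.pt T).L .ob).op_cmp (finProdFinEquiv.symm.trans (Equiv.sigmaEquivProd _ _).symm) y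
    (fun _ => x) _).trans ?_
  refine congrArg (B.op y) (funext fun s => congrArg (B.op x) (funext fun t => ?_))
  simp [dec, update_comm h]

end comm

section comp

variable {k : ℕ} {j : Fin k → ℕ} {X : Fin (∑ i, j i) → OAlg P} {Y : Fin k → OAlg P}
    {Z : OAlg P} (F : PreO Y Z) (E : ∀ i, PreO (fun r => X (finSigmaFinEquiv ⟨i, r⟩)) (Y i))

/-- The values of the functors `E i` on the blocks of a family. -/
noncomputable def blk (w : ∀ p, T ⟶ (X p).C.car l) (i : Fin k) : T ⟶ (Y i).C.car l :=
  (E i).f fun r => w (finSigmaFinEquiv ⟨i, r⟩)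

theorem update_block {Z : Fin (∑ i, j i) → Type*} (w : ∀ p, Z p) (q : Fin k) (r : Fin (j q))
    (y : Z (finSigmaFinEquiv ⟨q, r⟩)) :
    (fun r' => update w (finSigmaFinEquiv ⟨q, r⟩) y (finSigmaFinEquiv ⟨q, r'⟩)) =
      update (fun r' => w (finSigmaFinEquiv ⟨q, r'⟩)) r y := by
  funext r'
  by_cases h : r' = r
  · subst h; rw [update_self, update_self]
  · rw [update_of_ne h, update_of_ne]
    intro e
    exact h (by simpa using finSigmaFinEquiv.injective e)

theorem update_block_ne {Z : Fin (∑ i, j i) → Type*} (w : ∀ p, Z p) {q q' : Fin k} (h : q' ≠ q)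
    (r : Fin (j q)) (y : Z (finSigmaFinEquiv ⟨q, r⟩)) :
    (fun r' => update w (finSigmaFinEquiv ⟨q, r⟩) y (finSigmaFinEquiv ⟨q', r'⟩)) =
      fun r' => w (finSigmaFinEquiv ⟨q', r'⟩) := by
  funext r'
  rw [update_of_ne]
  intro e
  exact h (congrArg Sigma.fst (finSigmaFinEquiv.injective e))

theorem blk_update (w : ∀ p, T ⟶ (X p).C.car l) (q : Fin k) (r : Fin (j q))
    (y : T ⟶ (X (finSigmaFinEquiv ⟨q, r⟩)).C.car l) :
    blk E (update w (finSigmaFinEquiv ⟨q, r⟩) y) =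
      update (blk E w) q ((E q).f (update (fun r' => w (finSigmaFinEquiv ⟨q, r'⟩)) r y)) := by
  funext i
  by_cases h : i = q
  · subst h
    rw [update_self, blk, update_block]
  · rw [update_of_ne h, blk, update_block_ne w h, blk]

theorem f_comp (w : ∀ p, T ⟶ (X p).C.car l) : (comp F E).f w = F.f (blk E w) := by
  refine (VFun.comp_ap' _ _ _).trans (congrArg _ ((VFun.tuple_ap _ _).trans (congrArg tup
    (funext fun i => (VFun.comp_ap' _ _ _).trans (congrArg _ ((VFun.tuple_ap _ _).trans
      (congrArg tup (funext fun r => ?_))))))))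
  exact co_tup (B := fun p => (X p).C) w _

/-- The transformation of a composite at generalized points. -/
noncomputable def compδ (q : Fin k) (r : Fin (j q)) {n : ℕ} (c : T ⟶ (P.O n).car .ob)
    (y : Fin n → (T ⟶ (X (finSigmaFinEquiv ⟨q, r⟩)).C.car .ob))
    (w : ∀ p, T ⟶ (X p).C.car .ob) : T ⟶ Z.C.car .mor :=
  Z.C.seq
    (F.d q c (fun s => (E q).f (update (fun r' => w (finSigmaFinEquiv ⟨q, r'⟩)) r (y s)))
      (blk E w))
    (F.f (update (fun i => (Y i).C.one (blk E w i)) q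
      ((E q).d r c y fun r' => w (finSigmaFinEquiv ⟨q, r'⟩))))

variable {F E} {α : PseudoComm P}

theorem src_update {k : ℕ} {A : Fin k → OAlg P} (w : ∀ i, T ⟶ (A i).C.car .mor) (q : Fin k)
    (y : T ⟶ (A q).C.car .mor) : (fun i => update w q y i ≫ (A i).C.src) =
      update (fun i => w i ≫ (A i).C.src) q (y ≫ (A q).C.src) :=
  funext fun i => apply_update (fun i (y : T ⟶ (A i).C.car .mor) => y ≫ (A i).C.src) w q y i

theorem tgt_update {k : ℕ} {A : Fin k → OAlg P} (w : ∀ i, T ⟶ (A i).C.car .mor) (q : Fin k)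
    (y : T ⟶ (A q).C.car .mor) : (fun i => update w q y i ≫ (A i).C.tgt) =
      update (fun i => w i ≫ (A i).C.tgt) q (y ≫ (A q).C.tgt) :=
  funext fun i => apply_update (fun i (y : T ⟶ (A i).C.car .mor) => y ≫ (A i).C.tgt) w q y i

theorem comp_update {S : V} (t : S ⟶ T) {k : ℕ} {A : Fin k → OAlg P} (w : ∀ i, T ⟶ (A i).C.car l)
    (q : Fin k) (y : T ⟶ (A q).C.car l) : (fun i => t ≫ update w q y i) =
      update (fun i => t ≫ w i) q (t ≫ y) :=
  funext fun i => apply_update (fun i (y : T ⟶ (A i).C.car l) => t ≫ y) w q y i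

theorem one_update {k : ℕ} {A : Fin k → OAlg P} (w : ∀ i, T ⟶ (A i).C.car .ob) (q : Fin k)
    (y : T ⟶ (A q).C.car .ob) : (fun i => (A i).C.one (update w q y i)) =
      update (fun i => (A i).C.one (w i)) q ((A q).C.one y) :=
  funext fun i => apply_update (fun i (y : T ⟶ (A i).C.car .ob) => (A i).C.one y) w q y i

theorem compδ_comp (hF : F.IsHom α) (hE : ∀ i, (E i).IsHom α) (q : Fin k) (r : Fin (j q)) {n : ℕ}
    (c : T ⟶ (P.O n).car .ob) (y : Fin n → (T ⟶ (X (finSigmaFinEquiv ⟨q, r⟩)).C.car .ob))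
    (w : ∀ p, T ⟶ (X p).C.car .ob) :
    F.d q c (fun s => (E q).f (update (fun r' => w (finSigmaFinEquiv ⟨q, r'⟩)) r (y s)))
        (blk E w) ≫ Z.C.tgt =
      F.f (update (fun i => (Y i).C.one (blk E w i)) q
        ((E q).d r c y fun r' => w (finSigmaFinEquiv ⟨q, r'⟩))) ≫ Z.C.src := by
  rw [hF.tgt, F.f_src, src_update, (hE q).src]
  simp only [VCat.one_src]

theorem d_comp (hF : F.IsHom α) (hE : ∀ i, (E i).IsHom α) (q : Fin k) (r : Fin (j q)) {n : ℕ}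
    (c : T ⟶ (P.O n).car .ob) (y : Fin n → (T ⟶ (X (finSigmaFinEquiv ⟨q, r⟩)).C.car .ob))
    (w : ∀ p, T ⟶ (X p).C.car .ob) :
    (comp F E).d (finSigmaFinEquiv ⟨q, r⟩) c y w = compδ F E q r c y w := by
  have h₁ := mkδ_eval (A := X) (B := Z) (finSigmaFinEquiv ⟨q, r⟩) n
    (fun c y w => compδ F E q r c y w) (fun t c y w => by
      rw [compδ, VCat.comp_seq _ _ (compδ_comp hF hE q r c y w), F.comp_d, F.comp_f, comp_update,
        (E q).comp_d]
      simp only [comp_f, comp_update, VCat.comp_one, compδ, blk]; rfl) (fun c y w z => by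
      rw [compδ, compδ, blk_update, F.d_update, update_block, (E q).d_update]
      simp only [update_idem, one_update]) c y w
  refine Eq.trans ?_ h₁
  refine congrArg (pr c (pr (tup y) (tup fun p : {p // p ≠ finSigmaFinEquiv ⟨q, r⟩} => w p.1)) ≫ ·) ?_
  -- The transformation of a composite is defined at `finSigmaFinEquiv (finSigmaFinEquiv.symm p)`.
  let M (s : Σ i, Fin (j i)) := mkδ (A := X) (B := Z) (finSigmaFinEquiv s) n fun c y w =>
      Z.C.seq
        (F.d s.1 c (fun t => (E s.1).f fun r' =>
            Function.update w (finSigmaFinEquiv ⟨s.1, s.2⟩) (y t) (finSigmaFinEquiv ⟨s.1, r'⟩))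
          fun i => (E i).f fun r' => w (finSigmaFinEquiv ⟨i, r'⟩))
        (F.f (Function.update (fun i => (Y i).C.one ((E i).f fun r' => w (finSigmaFinEquiv ⟨i, r'⟩)))
          s.1 ((E s.1).d s.2 c y fun r' => w (finSigmaFinEquiv ⟨s.1, r'⟩))))
  have hM : ∀ {s s' : Σ i, Fin (j i)} (_ : s = s') (h : finSigmaFinEquiv s = finSigmaFinEquiv s'),
      (h ▸ M s : ((P.O n).times ((VCat.pi fun _ : Fin n => (X (finSigmaFinEquiv s')).C).times
      (VCat.pi fun j : {j // j ≠ finSigmaFinEquiv s'} => (X j.1).C))).car .ob ⟶ Z.C.car .mor) =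
        M s' := by
    rintro s _ rfl h
    rfl
  refine (hM (finSigmaFinEquiv.symm_apply_apply ⟨q, r⟩) _).trans ?_
  exact congrArg (fun f => Z.C.seq (F.d q _ f _) _) (funext fun s =>
    congrArg (E q).f (update_block _ q r _))

/-- Pasting of three commutative diagrams. -/
theorem _root_.ORExt.VCat.seq_concat (A : VCat V) {T : V} {a b c d a' g x y : T ⟶ A.car .mor}
    (e₁ : A.seq a a' = x) (e₂ : A.seq b c = A.seq a' g) (e₃ : A.seq g d = y)
    (h₁ : a ≫ A.tgt = b ≫ A.src) (h₂ : b ≫ A.tgt = c ≫ A.src) (h₃ : c ≫ A.tgt = d ≫ A.src)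
    (h₄ : a' ≫ A.tgt = g ≫ A.src) : A.seq (A.seq a b) (A.seq c d) = A.seq x y := by
  have h₉ : a ≫ A.tgt = a' ≫ A.src := by rw [h₁, ← A.seq_src b c, e₂, A.seq_src]
  have h₁₀ : g ≫ A.tgt = d ≫ A.src := by rw [← A.seq_tgt h₄, ← e₂, A.seq_tgt h₂, h₃]
  rw [A.seq_assoc h₁ (by rw [A.seq_src, h₂]), ← A.seq_assoc h₂ h₃, e₂, A.seq_assoc h₄ h₁₀, e₃,
    ← A.seq_assoc h₉ (by rw [← e₃, A.seq_src, h₄]), e₁]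

section update

variable {k : ℕ} {A : Fin k → OAlg P} {B : OAlg P} (F : PreO A B) {v : ∀ i, T ⟶ (A i).C.car .mor}
  {w : ∀ i, T ⟶ (A i).C.car .ob} (q : Fin k) {y z : T ⟶ (A q).C.car .mor}

theorem f_update_right (hv : ∀ i, i ≠ q → v i ≫ (A i).C.tgt = w i)
    (h : y ≫ (A q).C.tgt = z ≫ (A q).C.src) :
    B.C.seq (F.f (update v q y)) (F.f (update (fun i => (A i).C.one (w i)) q z)) =
      F.f (update v q ((A q).C.seq y z)) := by
  rw [← F.f_seq]
  · congr 1
    funext i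
    by_cases h : i = q
    · subst h; simp only [update_self]
    · simp only [update_of_ne h, ← hv i h, VCat.seq_one]
  · intro i
    by_cases h' : i = q
    · subst h'; simp only [update_self, h]
    · simp only [update_of_ne h', VCat.one_src, hv i h']

theorem f_update_left (hv : ∀ i, i ≠ q → v i ≫ (A i).C.src = w i)
    (h : y ≫ (A q).C.tgt = z ≫ (A q).C.src) :
    B.C.seq (F.f (update (fun i => (A i).C.one (w i)) q y)) (F.f (update v q z)) =
      F.f (update v q ((A q).C.seq y z)) := by
  rw [← F.f_seq]
  · congr 1
    funext i
    by_cases h : i = q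
    · subst h; simp only [update_self]
    · simp only [update_of_ne h, ← hv i h, VCat.one_seq]
  · intro i
    by_cases h' : i = q
    · subst h'; simp only [update_self, h]
    · simp only [update_of_ne h', VCat.one_tgt, hv i h']

end update

theorem compδ_nat (hF : F.IsHom α) (hE : ∀ i, (E i).IsHom α) (q : Fin k) (r : Fin (j q)) {n : ℕ}
    (c : T ⟶ (P.O n).car .mor) (y : Fin n → (T ⟶ (X (finSigmaFinEquiv ⟨q, r⟩)).C.car .mor))
    (w : ∀ p, T ⟶ (X p).C.car .mor) :
    Z.C.seq (Z.op c fun s => (comp F E).f (update w (finSigmaFinEquiv ⟨q, r⟩) (y s)))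
        (compδ F E q r (c ≫ (P.O n).tgt) (fun s => y s ≫ (X (finSigmaFinEquiv ⟨q, r⟩)).C.tgt) fun p => w p ≫ (X p).C.tgt) =
      Z.C.seq (compδ F E q r (c ≫ (P.O n).src) (fun s => y s ≫ (X (finSigmaFinEquiv ⟨q, r⟩)).C.src)
        fun p => w p ≫ (X p).C.src)
      ((comp F E).f (update w (finSigmaFinEquiv ⟨q, r⟩) ((X (finSigmaFinEquiv ⟨q, r⟩)).op c y))) := by
  simp only [f_comp, blk_update]
  have hs : ∀ i, blk E w i ≫ (Y i).C.src = blk E (fun p => w p ≫ (X p).C.src) i := fun i => f_src _ _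
  have ht : ∀ i, blk E w i ≫ (Y i).C.tgt = blk E (fun p => w p ≫ (X p).C.tgt) i := fun i => f_tgt _ _
  have e := (hE q).nat r c y fun r' => w (finSigmaFinEquiv ⟨q, r'⟩)
  have hc₁ : (Y q).op c (fun s => (E q).f (update (fun r' => w (finSigmaFinEquiv ⟨q, r'⟩)) r (y s))) ≫
      (Y q).C.tgt = (E q).d r (c ≫ (P.O n).tgt) (fun s => y s ≫ (X (finSigmaFinEquiv ⟨q, r⟩)).C.tgt)
        (fun r' => w (finSigmaFinEquiv ⟨q, r'⟩) ≫ (X (finSigmaFinEquiv ⟨q, r'⟩)).C.tgt) ≫ (Y q).C.src := by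
    rw [OAlg.op_tgt, (hE q).src]
    simp only [f_tgt, tgt_update]
  have hc₂ : (E q).d r (c ≫ (P.O n).src) (fun s => y s ≫ (X (finSigmaFinEquiv ⟨q, r⟩)).C.src)
        (fun r' => w (finSigmaFinEquiv ⟨q, r'⟩) ≫ (X (finSigmaFinEquiv ⟨q, r'⟩)).C.src) ≫ (Y q).C.tgt =
      (E q).f (update (fun r' => w (finSigmaFinEquiv ⟨q, r'⟩)) r ((X (finSigmaFinEquiv ⟨q, r⟩)).op c y)) ≫ (Y q).C.src := by
    rw [(hE q).tgt, f_src, src_update, OAlg.op_src]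
  have e₁ := hF.nat' q c rfl rfl
      (fun s => (E q).f (update (fun r' => w (finSigmaFinEquiv ⟨q, r'⟩)) r (y s)))
      (fun s => ((E q).f_src _).trans (congrArg (E q).f (src_update _ _ _)))
      (fun s => ((E q).f_tgt _).trans (congrArg (E q).f (tgt_update _ _ _)))
      (blk E w) (fun i _ => hs i) fun i _ => ht i
  have e₂ := F.f_update_right q (fun i _ => ht i) hc₁
  have e₃ := F.f_update_left q (fun i _ => hs i) hc₂
  have e₄ := congrArg (fun y => F.f (update (blk E w) q y)) e
  have e₂ := e₂.trans (e₄.trans e₃.symm)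
  have h := compδ_comp hF hE q r (c ≫ (P.O n).tgt)
    (fun s => y s ≫ (X (finSigmaFinEquiv ⟨q, r⟩)).C.tgt) fun p => w p ≫ (X p).C.tgt
  refine VCat.seq_square _ e₁ e₂ ?_ h ?_ ?_
  · rw [OAlg.op_tgt, hF.src]
    simp only [f_tgt, tgt_update, ht]
  · rw [hF.tgt, f_src, src_update, OAlg.op_src]
    simp only [f_src, src_update, hs]
  · rw [f_tgt, f_src, tgt_update, src_update, hc₂]
    simp only [VCat.one_tgt, hs]

theorem compδ_cmp (hF : F.IsHom α) (hE : ∀ i, (E i).IsHom α) (q : Fin k) (r : Fin (j q)) {n m : ℕ}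
    {i : Fin m → ℕ} (e : Fin n ≃ Σ r, Fin (i r))
    (c : T ⟶ (P.O m).car .ob) (b : ∀ r, T ⟶ (P.O (i r)).car .ob)
    (y : Fin n → (T ⟶ (X (finSigmaFinEquiv ⟨q, r⟩)).C.car .ob)) (w : ∀ p, T ⟶ (X p).C.car .ob) :
    Z.C.seq
        (Z.op ((P.O m).one c) fun s => compδ F E q r (b s) (fun t => y (e.symm ⟨s, t⟩)) w)
        (compδ F E q r c (fun s => (X (finSigmaFinEquiv ⟨q, r⟩)).op (b s) fun t => y (e.symm ⟨s, t⟩)) w) =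
      compδ F E q r (P.cmp e c b) y w := by
  have h₁ := fun s => compδ_comp hF hE q r (b s) (fun t => y (e.symm ⟨s, t⟩)) w
  have h₂ := compδ_comp hF hE q r c (fun s => (X (finSigmaFinEquiv ⟨q, r⟩)).op (b s) fun t => y (e.symm ⟨s, t⟩)) w
  refine (congrArg (Z.C.seq · _) (Z.op_one_seq c h₁)).trans ?_
  have e₁ := hF.cmp q e c b
    (fun t => (E q).f (update (fun r' => w (finSigmaFinEquiv ⟨q, r'⟩)) r (y t))) (blk E w)
  have e₂ := hF.nat' q ((P.O m).one c) (VCat.one_src _ _) (VCat.one_tgt _ _)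
    (fun s => (E q).d r (b s) (fun t => y (e.symm ⟨s, t⟩)) fun r' => w (finSigmaFinEquiv ⟨q, r'⟩))
    (fun s => (hE q).src _ _ _ _) (fun s => (hE q).tgt _ _ _ _) (fun i => (Y i).C.one (blk E w i))
    (fun i _ => VCat.one_src _ _) (fun i _ => VCat.one_tgt _ _)
  have e₃ := (hE q).cmp r e c b y fun r' => w (finSigmaFinEquiv ⟨q, r'⟩)
  refine VCat.seq_concat _ e₁ e₂ ((F.f_update_right q (fun i _ => VCat.one_tgt _ _) ?_).trans
    (congrArg (fun y => F.f (update (fun i => (Y i).C.one (blk E w i)) q y)) e₃)) ?_ ?_ h₂ ?_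
  · rw [OAlg.op_tgt, (hE q).src, VCat.one_tgt]
    simp only [(hE q).tgt]
  · rw [OAlg.op_tgt, OAlg.op_src, VCat.one_src, VCat.one_tgt]
    simp only [h₁]
  · rw [OAlg.op_tgt, hF.src, VCat.one_tgt]
    simp only [f_tgt, tgt_update, (hE q).tgt, VCat.one_tgt]
  · rw [hF.tgt, f_src, src_update, OAlg.op_src, VCat.one_src]
    simp only [(hE q).src, VCat.one_src]

theorem compδ_half_ne (hF : F.IsHom α) (hE : ∀ i, (E i).IsHom α) {q q' : Fin k} (h : q ≠ q')
    (r : Fin (j q)) (r' : Fin (j q')) {m n : ℕ} (x : T ⟶ (P.O m).car .ob) (y : T ⟶ (P.O n).car .ob)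
    (a : Fin m → (T ⟶ (X (finSigmaFinEquiv ⟨q, r⟩)).C.car .ob))
    (b : Fin n → (T ⟶ (X (finSigmaFinEquiv ⟨q', r'⟩)).C.car .ob))
    (w : ∀ p, T ⟶ (X p).C.car .ob) :
    Z.C.seq
        (Z.op ((P.O m).one x) fun s =>
          compδ F E q' r' y b (update w (finSigmaFinEquiv ⟨q, r⟩) (a s)))
        (compδ F E q r x a (update w (finSigmaFinEquiv ⟨q', r'⟩)
          ((X (finSigmaFinEquiv ⟨q', r'⟩)).op y b))) =
      Z.C.seq
        (Z.C.seq
          (Z.op ((P.O m).one x) fun s => F.d q' y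
            (fun t => (E q').f (update (fun p => w (finSigmaFinEquiv ⟨q', p⟩)) r' (b t)))
            (update (blk E w) q ((E q).f (update (fun p => w (finSigmaFinEquiv ⟨q, p⟩)) r (a s)))))
          (F.d q x (fun s => (E q).f (update (fun p => w (finSigmaFinEquiv ⟨q, p⟩)) r (a s)))
            (update (blk E w) q' ((Y q').op y fun t =>
              (E q').f (update (fun p => w (finSigmaFinEquiv ⟨q', p⟩)) r' (b t))))))
        (F.f (update (update (fun i => (Y i).C.one (blk E w i)) q
          ((E q).d r x a fun p => w (finSigmaFinEquiv ⟨q, p⟩))) q'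
            ((E q').d r' y b fun p => w (finSigmaFinEquiv ⟨q', p⟩)))) := by
  have h₁ := fun s => compδ_comp hF hE q' r' y b (update w (finSigmaFinEquiv ⟨q, r⟩) (a s))
  have h₂ := compδ_comp hF hE q r x a (update w (finSigmaFinEquiv ⟨q', r'⟩)
          ((X (finSigmaFinEquiv ⟨q', r'⟩)).op y b))
  refine (congrArg (Z.C.seq · _) (Z.op_one_seq x h₁)).trans ?_
  unfold compδ
  simp only [update_block_ne w h, update_block_ne w h.symm, blk_update] at h₁ h₂ ⊢
  have e₁ := hF.nat' q ((P.O m).one x) (VCat.one_src _ _) (VCat.one_tgt _ _)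
    (fun s => (Y q).C.one ((E q).f (update (fun p => w (finSigmaFinEquiv ⟨q, p⟩)) r (a s))))
    (fun s => VCat.one_src _ _) (fun s => VCat.one_tgt _ _)
    (update (fun i => (Y i).C.one (blk E w i)) q'
      ((E q').d r' y b fun p => w (finSigmaFinEquiv ⟨q', p⟩)))
    (t := update (blk E w) q' ((Y q').op y fun t =>
              (E q').f (update (fun p => w (finSigmaFinEquiv ⟨q', p⟩)) r' (b t))))
    (t' := update (blk E w) q' ((E q').f (update (fun p => w (finSigmaFinEquiv ⟨q', p⟩)) r'
        ((X (finSigmaFinEquiv ⟨q', r'⟩)).op y b))))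
    (fun i _ => by
      refine (congrFun (src_update _ _ _) i).trans ?_
      simp only [VCat.one_src, (hE q').src])
    (fun i _ => by
      refine (congrFun (tgt_update _ _ _) i).trans ?_
      simp only [VCat.one_tgt, (hE q').tgt])
  rw [OAlg.op_one] at e₁
  have e₂ := F.f_update_right q (v := update (fun i => (Y i).C.one (blk E w i)) q'
      ((E q').d r' y b fun p => w (finSigmaFinEquiv ⟨q', p⟩)))
      (w := update (blk E w) q' ((E q').f (update (fun p => w (finSigmaFinEquiv ⟨q', p⟩)) r'
        ((X (finSigmaFinEquiv ⟨q', r'⟩)).op y b))))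
      (y := (Y q).C.one ((Y q).op x fun s =>
        (E q).f (update (fun p => w (finSigmaFinEquiv ⟨q, p⟩)) r (a s))))
      (z := (E q).d r x a fun p => w (finSigmaFinEquiv ⟨q, p⟩)) (fun i _ => by
      refine (congrFun (tgt_update _ _ _) i).trans ?_
      simp only [VCat.one_tgt, (hE q').tgt]) (by rw [VCat.one_tgt, (hE q).src])
  rw [← (hE q).src, VCat.one_seq, (hE q).src] at e₂
  simp only [one_update, update_comm h] at e₁ e₂ h₁ h₂ ⊢
  refine VCat.seq_concat _ rfl e₁ e₂ ?_ ?_ h₂ ?_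
  · rw [OAlg.op_tgt, OAlg.op_src, VCat.one_src, VCat.one_tgt]
    simp only [h₁]
  · rw [OAlg.op_tgt, hF.src, VCat.one_tgt]
    simp only [f_tgt, tgt_update, VCat.one_tgt, (hE _).tgt]
  · rw [hF.tgt, f_src]
    simp only [src_update, VCat.one_src, (hE _).src]

theorem compδ_half_eq (hF : F.IsHom α) (hE : ∀ i, (E i).IsHom α) {q : Fin k} {r r' : Fin (j q)}
    {m n : ℕ} (x : T ⟶ (P.O m).car .ob) (y : T ⟶ (P.O n).car .ob)
    (a : Fin m → (T ⟶ (X (finSigmaFinEquiv ⟨q, r⟩)).C.car .ob))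
    (b : Fin n → (T ⟶ (X (finSigmaFinEquiv ⟨q, r'⟩)).C.car .ob)) (h : r ≠ r')
    (w : ∀ p, T ⟶ (X p).C.car .ob) :
    Z.C.seq
        (Z.op ((P.O m).one x) fun s =>
          compδ F E q r' y b (update w (finSigmaFinEquiv ⟨q, r⟩) (a s)))
        (compδ F E q r x a (update w (finSigmaFinEquiv ⟨q, r'⟩)
          ((X (finSigmaFinEquiv ⟨q, r'⟩)).op y b))) =
      Z.C.seq
        (F.d q (P.pair x y) (fun p => (E q).f (update (update
          (fun p => w (finSigmaFinEquiv ⟨q, p⟩)) r (a (dec p).1)) r' (b (dec p).2))) (blk E w))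
        (F.f (update (fun i => (Y i).C.one (blk E w i)) q ((Y q).C.seq
          ((Y q).op ((P.O m).one x) fun s =>
            (E q).d r' y b (update (fun p => w (finSigmaFinEquiv ⟨q, p⟩)) r (a s)))
          ((E q).d r x a (update (fun p => w (finSigmaFinEquiv ⟨q, p⟩)) r'
            ((X (finSigmaFinEquiv ⟨q, r'⟩)).op y b)))))) := by
  have h₁ := fun s => compδ_comp hF hE q r' y b (update w (finSigmaFinEquiv ⟨q, r⟩) (a s))
  have h₂ := compδ_comp hF hE q r x a (update w (finSigmaFinEquiv ⟨q, r'⟩)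
          ((X (finSigmaFinEquiv ⟨q, r'⟩)).op y b))
  refine (congrArg (Z.C.seq · _) (Z.op_one_seq x h₁)).trans ?_
  unfold compδ
  simp only [update_block, blk_update, d_update, one_update, update_idem] at h₁ h₂ ⊢
  have e₁ := hF.cmp q (finProdFinEquiv.symm.trans (Equiv.sigmaEquivProd _ _).symm) x (fun _ => y)
    (fun p => (E q).f (update (update (fun p => w (finSigmaFinEquiv ⟨q, p⟩)) r (a (dec p).1)) r'
      (b (dec p).2))) (blk E w)
  have e₂ := hF.nat' q ((P.O m).one x) (VCat.one_src _ _) (VCat.one_tgt _ _)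
    (fun s => (E q).d r' y b (update (fun p => w (finSigmaFinEquiv ⟨q, p⟩)) r (a s)))
    (fun s => (hE q).src _ _ _ _) (fun s => (hE q).tgt _ _ _ _) (fun i => (Y i).C.one (blk E w i))
    (fun i _ => VCat.one_src _ _) (fun i _ => VCat.one_tgt _ _)
  have e₃ := F.f_update_right q (v := fun i => (Y i).C.one (blk E w i)) (w := blk E w)
    (y := (Y q).op ((P.O m).one x) fun s =>
            (E q).d r' y b (update (fun p => w (finSigmaFinEquiv ⟨q, p⟩)) r (a s)))
    (z := (E q).d r x a (update (fun p => w (finSigmaFinEquiv ⟨q, p⟩)) r'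
            ((X (finSigmaFinEquiv ⟨q, r'⟩)).op y b))) (fun i _ => VCat.one_tgt _ _) (by
      rw [OAlg.op_tgt, (hE q).src, VCat.one_tgt]
      simp only [(hE q).tgt, update_comm h])
  refine VCat.seq_concat _ (Eq.trans ?_ e₁) (Eq.trans ?_ e₂) e₃ ?_ ?_ h₂ ?_
  · simp [dec]
  · simp only [update_comm h]
  · rw [OAlg.op_tgt, OAlg.op_src, VCat.one_src, VCat.one_tgt]
    simp only [h₁]
  · rw [OAlg.op_tgt, hF.src, VCat.one_tgt]
    simp only [f_tgt, tgt_update, VCat.one_tgt, (hE _).tgt, update_comm h]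
  · rw [hF.tgt, f_src]
    simp only [src_update, VCat.one_src, (hE _).src, OAlg.op_src]

theorem compδ_comm (hF : F.IsHom α) (hE : ∀ i, (E i).IsHom α) (q q' : Fin k)
    (r : Fin (j q)) (r' : Fin (j q')) (h : finSigmaFinEquiv ⟨q, r⟩ ≠ finSigmaFinEquiv ⟨q', r'⟩)
    {m n : ℕ} (x : T ⟶ (P.O m).car .ob) (y : T ⟶ (P.O n).car .ob)
    (a : Fin m → (T ⟶ (X (finSigmaFinEquiv ⟨q, r⟩)).C.car .ob))
    (b : Fin n → (T ⟶ (X (finSigmaFinEquiv ⟨q', r'⟩)).C.car .ob))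
    (w : ∀ p, T ⟶ (X p).C.car .ob) :
    Z.C.seq
        (Z.op ((P.O m).one x) fun s =>
          compδ F E q' r' y b (update w (finSigmaFinEquiv ⟨q, r⟩) (a s)))
        (compδ F E q r x a (update w (finSigmaFinEquiv ⟨q', r'⟩)
          ((X (finSigmaFinEquiv ⟨q', r'⟩)).op y b))) =
      Z.C.seq
        (Z.op (α.ap x y) fun p => Z.C.one (F.f (blk E (update (update w
          (finSigmaFinEquiv ⟨q, r⟩) (a (dec p).2)) (finSigmaFinEquiv ⟨q', r'⟩) (b (dec p).1)))))
        (Z.C.seq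
          (Z.op ((P.O n).one y) fun s =>
            compδ F E q r x a (update w (finSigmaFinEquiv ⟨q', r'⟩) (b s)))
          (compδ F E q' r' y b (update w (finSigmaFinEquiv ⟨q, r⟩)
            ((X (finSigmaFinEquiv ⟨q, r⟩)).op x a)))) := by
  by_cases hq : q = q'
  · subst hq
    have h' : r ≠ r' := fun e => h (by rw [e])
    rw [compδ_half_eq hF hE x y a b h', compδ_half_eq hF hE y x b a h'.symm]
    have e₁ := hF.nat' q (α.ap x y) (α.ap_src x y) (α.ap_tgt x y)
      (fun p => (Y q).C.one ((E q).f (update (update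
        (fun p => w (finSigmaFinEquiv ⟨q, p⟩)) r (a (dec p).2)) r' (b (dec p).1))))
      (fun _ => VCat.one_src _ _) (fun _ => VCat.one_tgt _ _) (fun i => (Y i).C.one (blk E w i))
      (fun i _ => VCat.one_src _ _) (fun i _ => VCat.one_tgt _ _)
    rw [hF.equivariant] at e₁
    have e₂ := (hE q).comm r r' h' x y a b fun p => w (finSigmaFinEquiv ⟨q, p⟩)
    have h₁ := (hE q).comm_comp r r' h' x y a b fun p => w (finSigmaFinEquiv ⟨q, p⟩)
    have e₃ := F.f_update_right q (v := fun i => (Y i).C.one (blk E w i)) (w := blk E w)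
      (fun i _ => VCat.one_tgt _ _) h₁
    have h₂ : F.d q (P.pair x y) (fun p => (E q).f (update (update
        (fun p => w (finSigmaFinEquiv ⟨q, p⟩)) r (a (dec p).1)) r' (b (dec p).2))) (blk E w) ≫
        Z.C.tgt = F.f (update (fun i => (Y i).C.one (blk E w i)) q
          ((Y q).op (α.ap x y) fun p => (Y q).C.one ((E q).f (update (update
            (fun p => w (finSigmaFinEquiv ⟨q, p⟩)) r (a (dec p).2)) r' (b (dec p).1))))) ≫
          Z.C.src := by
      rw [hF.tgt, f_src, src_update, OAlg.op_src, α.ap_src]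
      simp only [VCat.one_src]
      refine congrArg (fun y => F.f (update (blk E w) q y)) (Eq.trans ?_
        (((Y q).pt T).L .ob |>.op_act _ _ _).symm)
      refine congrArg ((Y q).op _) (funext fun p => ?_)
      simp [dec, flip]
    have h₃ := congrArg (fun y => F.f (update (blk E w) q y)) h₁
    rw [e₂, ← e₃, ← VCat.seq_assoc _ h₂]
    · simp only [blk_update, update_block, update_idem]
      refine (congrArg (Z.C.seq · _) (Eq.trans ?_ e₁.symm)).trans ((VCat.seq_assoc _ ?_ ?_).trans ?_)
      · simp [dec, flip]
      · rw [OAlg.op_tgt, hF.src, α.ap_tgt]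
        simp only [f_tgt, tgt_update, VCat.one_tgt]
      · rw [hF.tgt, f_src, src_update, ← h₁, OAlg.op_tgt, α.ap_tgt]
        simp only [VCat.one_src, VCat.one_tgt]
      · refine congrArg₂ Z.C.seq (congrArg (Z.op _) (funext fun p => ?_)) (congrArg (Z.C.seq · _)
          (congrArg (F.d q _ · _) (funext fun p => ?_)))
        · exact (congrArg F.f (one_update _ _ _).symm).trans (F.f_one _)
        · rw [update_comm h']
    · rw [f_tgt, f_src, tgt_update, src_update, h₁]
      simp only [VCat.one_src, VCat.one_tgt]
  · rw [compδ_half_ne hF hE hq r r' x y a b, compδ_half_ne hF hE (Ne.symm hq) r' r y x b a,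
      hF.comm q q' hq, update_comm hq]
    simp only [blk_update, update_block_ne _ (Ne.symm hq)]
    rw [VCat.seq_assoc]
    · exact hF.comm_comp q q' hq x y
        (fun s => (E q).f (update (fun p => w (finSigmaFinEquiv ⟨q, p⟩)) r (a s)))
        (fun s => (E q').f (update (fun p => w (finSigmaFinEquiv ⟨q', p⟩)) r' (b s))) (blk E w)
    rw [VCat.seq_tgt, hF.tgt, f_src]
    · simp only [src_update, VCat.one_src, (hE _).src, update_comm hq]
    · exact hF.comm_comp' q q' hq x y
        (fun s => (E q).f (update (fun p => w (finSigmaFinEquiv ⟨q, p⟩)) r (a s)))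
        (fun s => (E q').f (update (fun p => w (finSigmaFinEquiv ⟨q', p⟩)) r' (b s))) (blk E w)

end comp

end PreO

namespace PreO

variable {P : Operad V} {l : Lvl} {T : V} {α : PseudoComm P}

theorem isHom_comp {k : ℕ} {j : Fin k → ℕ} {X : Fin (∑ i, j i) → OAlg P} {Y : Fin k → OAlg P}
    {Z : OAlg P} (F : PreO Y Z) (E : ∀ i, PreO (fun r => X (finSigmaFinEquiv ⟨i, r⟩)) (Y i))
    (hF : F.IsHom α) (hE : ∀ i, (E i).IsHom α) : (comp F E).IsHom α where
  based w p h := by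
    obtain ⟨⟨q, r⟩, rfl⟩ := finSigmaFinEquiv.surjective p
    rw [f_comp]
    exact hF.based _ q ((hE q).based _ r h)
  src p n c y w := by
    obtain ⟨⟨q, r⟩, rfl⟩ := finSigmaFinEquiv.surjective p
    rw [d_comp hF hE, compδ, VCat.seq_src, hF.src]
    simp only [f_comp, blk_update]
  tgt p n c y w := by
    obtain ⟨⟨q, r⟩, rfl⟩ := finSigmaFinEquiv.surjective p
    rw [d_comp hF hE, compδ, VCat.seq_tgt _ (compδ_comp hF hE q r c y w), f_tgt, tgt_update,
      (hE q).tgt, f_comp, blk_update]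
    simp only [VCat.one_tgt]
  nat p n c y w := by
    obtain ⟨⟨q, r⟩, rfl⟩ := finSigmaFinEquiv.surjective p
    rw [d_comp hF hE, d_comp hF hE]
    exact compδ_nat hF hE q r c y w
  inv p n c y w := by
    obtain ⟨⟨q, r⟩, rfl⟩ := finSigmaFinEquiv.surjective p
    rw [d_comp hF hE]
    refine inv_seq _ (compδ_comp hF hE q r c y w) (hF.inv _ _ _ _) (inv_f _ fun i => ?_)
    by_cases h : i = q
    · subst h
      rw [update_self]
      exact (hE i).inv _ _ _ _
    · rw [update_of_ne h]
      exact inv_one _ _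
  nullary p c y w := by
    obtain ⟨⟨q, r⟩, rfl⟩ := finSigmaFinEquiv.surjective p
    rw [d_comp hF hE, compδ, hF.nullary, (hE q).nullary, hF.based _ q
      ((update_self _ _ _).trans (OAlg.one_zero _)), ← OAlg.one_zero, VCat.seq_one_one]
  equivariant p m n e c y w := by
    obtain ⟨⟨q, r⟩, rfl⟩ := finSigmaFinEquiv.surjective p
    rw [d_comp hF hE, d_comp hF hE, compδ, compδ, hF.equivariant, (hE q).equivariant]
  unit p w := by
    obtain ⟨⟨q, r⟩, rfl⟩ := finSigmaFinEquiv.surjective p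
    rw [d_comp hF hE, compδ, f_comp]
    have h₁ := (hE q).unit r fun r' => w (finSigmaFinEquiv ⟨q, r'⟩)
    have h₂ : F.d q P.unitP (fun _ => (E q).f fun r' => w (finSigmaFinEquiv ⟨q, r'⟩)) (blk E w) =
      _ := hF.unit q (blk E w)
    rw [h₁, update_eq_self, h₂]
    exact (congrArg _ ((congrArg F.f (update_eq_self _ _)).trans (F.f_one _))).trans
      (VCat.seq_one_one _ _)
  cmp p n m i e c b y w := by
    obtain ⟨⟨q, r⟩, rfl⟩ := finSigmaFinEquiv.surjective p
    simp only [d_comp hF hE]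
    exact compδ_cmp hF hE q r e c b y w
  comm p p' h m n x y a b w := by
    obtain ⟨⟨q, r⟩, rfl⟩ := finSigmaFinEquiv.surjective p
    obtain ⟨⟨q', r'⟩, rfl⟩ := finSigmaFinEquiv.surjective p'
    simp only [d_comp hF hE, f_comp]
    exact compδ_comm hF hE q q' r r' h x y a b w

section act

variable {k : ℕ} {A : Fin k → OAlg P} {B : OAlg P} (σ : Equiv.Perm (Fin k)) (F : PreO A B)

/-- A family indexed through a permutation, as a family. -/
def reind {Z : Fin k → Type*} (w : ∀ i, Z (σ i)) : ∀ i, Z i := Equiv.piCongrLeft Z σ w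

theorem reind_apply {Z : Fin k → Type*} (w : ∀ i, Z (σ i)) (i : Fin k) : reind σ w (σ i) = w i :=
  Equiv.piCongrLeft_apply_apply Z σ w i

theorem reind_map {Z Z' : Fin k → Type*} (g : ∀ i, Z i → Z' i) (w : ∀ i, Z (σ i)) :
    (fun i => g i (reind σ w i)) = reind σ fun i => g (σ i) (w i) := by
  funext i
  obtain ⟨i, rfl⟩ := σ.surjective i
  rw [reind_apply, reind_apply]

theorem reind_update {Z : Fin k → Type*} (w : ∀ i, Z (σ i)) (i : Fin k) (y : Z (σ i)) :
    reind σ (update w i y) = update (reind σ w) (σ i) y := by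
  funext j
  obtain ⟨j, rfl⟩ := σ.surjective j
  rw [reind_apply]
  by_cases h : j = i
  · subst h
    rw [update_self, update_self]
  · rw [update_of_ne h, update_of_ne (σ.injective.ne h), reind_apply]

theorem f_act (w : ∀ i, T ⟶ (A (σ i)).C.car l) : (act σ F).f w = F.f (reind σ w) := by
  refine (VFun.comp_ap' _ _ _).trans (congrArg _ ((VFun.tuple_ap _ _).trans (congrArg tup
    (funext fun i => ?_))))
  have h : ∀ (i j : Fin k) (e : σ j = i), (e ▸ VFun.proj (fun i => (A (σ i)).C) j :
      VFun (VCat.pi fun i => (A (σ i)).C) (A i).C).ap (tup w) =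
        reind (Z := fun i => T ⟶ (A i).C.car l) σ w i := by
    rintro _ j rfl
    rw [reind_apply]
    exact co_tup (B := fun i => (A (σ i)).C) w j
  exact h i _ _

theorem d_act (i : Fin k) {n : ℕ} (c : T ⟶ (P.O n).car .ob)
    (y : Fin n → (T ⟶ (A (σ i)).C.car .ob)) (w : ∀ i, T ⟶ (A (σ i)).C.car .ob) :
    (act σ F).d i c y w = F.d (σ i) c y (reind σ w) :=
  mkδ_eval (A := fun i => A (σ i)) i n (fun {T} c y w => F.d (σ i) c y (reind σ w))
    (fun t c y w => by
      rw [comp_d]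
      exact congrArg _ (reind_map σ (Z := fun i => _ ⟶ (A i).C.car .ob) (fun i y => t ≫ y) w))
    (fun c y w z => by rw [reind_update, d_update]) c y w

variable {F}

theorem isHom_act (hF : F.IsHom α) : (act σ F).IsHom α where
  based w i h := by
    rw [f_act]
    exact hF.based _ (σ i) (Eq.trans (reind_apply (Z := fun i => _ ⟶ (A i).C.car _) σ w i) h)
  src i n c y w := by rw [d_act, hF.src]; simp only [f_act, reind_update]
  tgt i n c y w := by rw [d_act, hF.tgt]; simp only [f_act, reind_update]
  nat {T} i n c y w := by
    simp only [d_act, f_act, reind_update]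
    have h := hF.nat (σ i) c y (reind σ w)
    rw [reind_map σ (fun i (y : T ⟶ (A i).C.car .mor) => y ≫ (A i).C.src),
      reind_map σ (fun i (y : T ⟶ (A i).C.car .mor) => y ≫ (A i).C.tgt)] at h
    exact h
  inv i n c y w := by rw [d_act]; exact hF.inv _ _ _ _
  nullary i c y w := by rw [d_act, hF.nullary]
  equivariant i m n e c y w := by rw [d_act, d_act, hF.equivariant]
  unit i w := by
    rw [d_act, f_act, ← hF.unit (σ i), reind_apply]
  cmp i n m j e c b y w := by
    simp only [d_act]
    exact hF.cmp (σ i) e c b y _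
  comm i j h m n x y a b w := by
    simp only [d_act, f_act, reind_update]
    exact hF.comm (σ i) (σ j) (σ.injective.ne h) x y a b _

end act

end PreO

theorem MultO.isClosed (P : Operad V) (α : PseudoComm P) : (MultO P α).IsClosed where
  one A := PreO.isHom_one α A
  comp F E hF hE := PreO.isHom_comp F E hF hE
  act σ _ _ _ hF := PreO.isHom_act σ hF

/-! ### Multimorphisms at a fixed stage -/

/-- The image of an object at either level: the object itself, or its identity arrow. -/
def PtAlg.deg {P : Operad V} {T : V} (B : PtAlg.{w} P T) : ∀ l, (B.L .ob).car → (B.L l).car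
  | .ob, x => x
  | .mor, x => B.one x

/-- Invertible arrows of the algebra of generalized points at `T`. -/
def PtAlg.Inv {P : Operad V} {T : V} (B : PtAlg.{w} P T) (f : (B.L .mor).car) : Prop :=
  ∃ g, B.src g = B.tgt f ∧ B.tgt g = B.src f ∧ B.seq f g = B.one (B.src f) ∧
    B.seq g f = B.one (B.tgt f)

/-- A `k`-ary morphism between the algebras of generalized points at a fixed stage `T`. Contrary to
a multimorphism of internal algebras, it can be evaluated in one of its variables, see
`PtMor.fix`. -/
structure PtMor {P : Operad V} (α : PseudoComm P) {T : V} {k : ℕ} (A : Fin k → PtAlg.{w} P T)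
    (B : PtAlg.{w} P T) where
  f : ∀ l, (∀ i, ((A i).L l).car) → (B.L l).car
  d : ∀ (i : Fin k) {n : ℕ}, (T ⟶ (P.O n).car .ob) → (Fin n → ((A i).L .ob).car) →
    (∀ i, ((A i).L .ob).car) → (B.L .mor).car
  f_src : ∀ w, B.src (f .mor w) = f .ob fun i => (A i).src (w i)
  f_tgt : ∀ w, B.tgt (f .mor w) = f .ob fun i => (A i).tgt (w i)
  f_one : ∀ w, (f .mor fun i => (A i).one (w i)) = B.one (f .ob w)
  f_seq : ∀ {w z : ∀ i, ((A i).L .mor).car}, (∀ i, (A i).tgt (w i) = (A i).src (z i)) →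
    (f .mor fun i => (A i).seq (w i) (z i)) = B.seq (f .mor w) (f .mor z)
  based : ∀ w i, w i = ((A i).L .ob).zero → f .ob w = (B.L .ob).zero
  d_update : ∀ i {n : ℕ} (c : T ⟶ (P.O n).car .ob) y w z, d i c y (update w i z) = d i c y w
  src : ∀ i {n : ℕ} (c : T ⟶ (P.O n).car .ob) y w,
    B.src (d i c y w) = (B.L .ob).op c fun r => f .ob (update w i (y r))
  tgt : ∀ i {n : ℕ} (c : T ⟶ (P.O n).car .ob) y w,
    B.tgt (d i c y w) = f .ob (update w i (((A i).L .ob).op c y))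
  nat : ∀ i {n : ℕ} (c : T ⟶ (P.O n).car .mor) (y : Fin n → ((A i).L .mor).car)
    (w : ∀ i, ((A i).L .mor).car),
    B.seq ((B.L .mor).op c fun r => f .mor (update w i (y r)))
        (d i (c ≫ (P.O n).tgt) (fun r => (A i).tgt (y r)) fun j => (A j).tgt (w j)) =
      B.seq (d i (c ≫ (P.O n).src) (fun r => (A i).src (y r)) fun j => (A j).src (w j))
        (f .mor (update w i (((A i).L .mor).op c y)))
  inv : ∀ i {n : ℕ} (c : T ⟶ (P.O n).car .ob) y w, B.Inv (d i c y w)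
  nullary : ∀ i (c : T ⟶ (P.O 0).car .ob) y w, d i c y w = B.one (B.L .ob).zero
  equivariant : ∀ i {m n : ℕ} (e : Fin m ≃ Fin n) (c : T ⟶ (P.O n).car .ob) y w,
    d i ((P.act e).ap c) y w = d i c (fun r => y (e.symm r)) w
  unit : ∀ i w, d i P.unitP (fun _ => w i) w = B.one (f .ob w)
  cmp : ∀ i {n m : ℕ} {j : Fin m → ℕ} (e : Fin n ≃ Σ r, Fin (j r)) (c : T ⟶ (P.O m).car .ob)
    (b : ∀ r, T ⟶ (P.O (j r)).car .ob) (y : Fin n → ((A i).L .ob).car) w,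
    B.seq
        ((B.L .mor).op ((P.O m).one c) fun r => d i (b r) (fun t => y (e.symm ⟨r, t⟩)) w)
        (d i c (fun r => ((A i).L .ob).op (b r) fun t => y (e.symm ⟨r, t⟩)) w) =
      d i (P.cmp e c b) y w
  comm : ∀ i j, i ≠ j → ∀ {m n : ℕ} (x : T ⟶ (P.O m).car .ob) (y : T ⟶ (P.O n).car .ob)
    (a : Fin m → ((A i).L .ob).car) (b : Fin n → ((A j).L .ob).car) w,
    B.seq ((B.L .mor).op ((P.O m).one x) fun r => d j y b (update w i (a r)))
        (d i x a (update w j (((A j).L .ob).op y b))) =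
      B.seq (B.al α x y fun r s => f .ob (update (update w i (a r)) j (b s)))
        (B.seq ((B.L .mor).op ((P.O n).one y) fun s => d i x a (update w j (b s)))
          (d j y b (update w i (((A i).L .ob).op x a))))

/-- The values of a multimorphism at a stage `T`. -/
noncomputable def PreO.pt {P : Operad V} {α : PseudoComm P} {k : ℕ} {A : Fin k → OAlg P}
    {B : OAlg P} {F : PreO A B} (hF : F.IsHom α) (T : V) :
    PtMor α (fun i => (A i).pt T) (B.pt T) where
  f _ w := F.f w
  d i _ c y w := F.d i c y w
  f_src := F.f_src
  f_tgt := F.f_tgt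
  f_one := F.f_one
  f_seq := F.f_seq
  based := hF.based
  d_update i _ := F.d_update i
  src i _ := hF.src i
  tgt i _ := hF.tgt i
  nat i _ := hF.nat i
  inv i _ := hF.inv i
  nullary i := hF.nullary i
  equivariant i _ _ := hF.equivariant i
  unit i := hF.unit i
  cmp i _ _ _ := hF.cmp i
  comm i j h _ _ := hF.comm i j h

namespace PtMor

variable {P : Operad V} {α : PseudoComm P} {T : V} {k : ℕ}

section cons

variable {A : Fin (k + 1) → PtAlg.{w} P T} {l : Lvl}

/-- A family of elements of algebras, given by its first member and the others. -/
def cons (a : ((A 0).L l).car) (w : ∀ i : Fin k, ((A i.succ).L l).car) : ∀ i, ((A i).L l).car :=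
  Fin.cons (α := fun i => ((A i).L l).car) a w

theorem cons_update (a : ((A 0).L l).car) (w : ∀ i : Fin k, ((A i.succ).L l).car) (i : Fin k) (z) :
    cons a (update w i z) = update (cons a w) i.succ z :=
  Fin.cons_update (α := fun i => ((A i).L l).car) a w i z

theorem update_cons (a z : ((A 0).L l).car) (w : ∀ i : Fin k, ((A i.succ).L l).car) :
    update (cons a w) 0 z = cons z w :=
  Fin.update_cons_zero (α := fun i => ((A i).L l).car) a w z

theorem cons_tail (w : ∀ i, ((A i).L l).car) : cons (w 0) (fun i => w i.succ) = w :=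
  Fin.cons_self_tail (α := fun i => ((A i).L l).car) w

theorem update_tail (w : ∀ i, ((A i).L l).car) (z : ((A 0).L l).car) :
    update w 0 z = cons z fun i => w i.succ := by
  rw [← update_cons (w 0), cons_tail]

theorem map_cons {l' : Lvl} (g : ∀ i, ((A i).L l).car → ((A i).L l').car) (a : ((A 0).L l).car)
    (w : ∀ i : Fin k, ((A i.succ).L l).car) :
    (fun i => g i (cons a w i)) = cons (g 0 a) fun i => g i.succ (w i) :=
  funext (Fin.cases rfl fun _ => rfl)

end cons

variable {A : Fin k → PtAlg.{w} P T} {B : PtAlg.{w} P T}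

/-- The multimorphism obtained from `F` by fixing its first variable. -/
def fix {A : Fin (k + 1) → PtAlg.{w} P T} (F : PtMor α A B) (a : ((A 0).L .ob).car) :
    PtMor α (fun i : Fin k => A i.succ) B where
  f l w := F.f l (cons ((A 0).deg l a) w)
  d i _ c y w := F.d i.succ c y (cons a w)
  f_src w := by rw [F.f_src, map_cons fun i => (A i).src]; simp only [PtAlg.deg, PtAlg.src_one]
  f_tgt w := by rw [F.f_tgt, map_cons fun i => (A i).tgt]; simp only [PtAlg.deg, PtAlg.tgt_one]
  f_one w := by
    refine Eq.trans ?_ (F.f_one _)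
    rw [map_cons fun i => (A i).one]; rfl
  f_seq {w z} h := by
    refine Eq.trans ?_ (F.f_seq (Fin.cases ?_ h))
    · refine congrArg _ (funext (Fin.cases ?_ fun _ => rfl))
      exact ((A 0).seq_one' (by exact (A 0).tgt_one a)).symm
    · exact ((A 0).tgt_one a).trans ((A 0).src_one a).symm
  based w i h := F.based _ i.succ h
  d_update i _ c y w z := by rw [cons_update, F.d_update]
  src i _ c y w := by rw [F.src]; simp only [cons_update]; rfl
  tgt i _ c y w := by rw [F.tgt, cons_update]; rfl
  nat i _ c y w := by
    have h := F.nat i.succ c y (cons ((A 0).one a) w)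
    rw [map_cons fun i => (A i).tgt, map_cons fun i => (A i).src] at h
    simp only [← cons_update, PtAlg.src_one, PtAlg.tgt_one] at h
    exact h
  inv i _ c y w := F.inv _ _ _ _
  nullary i c y w := F.nullary _ _ _ _
  equivariant i _ _ e c y w := F.equivariant _ _ _ _ _
  unit i w := F.unit i.succ (cons a w)
  cmp i _ _ _ e c b y w := F.cmp i.succ e c b y (cons a w)
  comm i j h _ _ x y b c w := by
    have := F.comm i.succ j.succ ((Fin.succ_injective _).ne h) x y b c (cons a w)
    simp only [← cons_update] at this
    exact this

theorem d_low (F : PtMor α A B) (i : Fin k) {n : ℕ} (h : n ≤ 1) (y : Fin n → ((A i).L .ob).car)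
    (w : ∀ i, ((A i).L .ob).car) :
    F.d i (terminal.from T ≫ P.low n h) y w = B.one (F.f .ob (update w i
      (((A i).L .ob).op (terminal.from T ≫ P.low n h) y))) := by
  match n, h with
  | 0, _ =>
    rw [F.nullary, F.based _ i]
    rw [update_self, LAlg.op_zero _ rfl]
  | 1, _ =>
    obtain ⟨z, rfl⟩ : ∃ z, y = fun _ => z := ⟨y 0, funext fun i => congrArg y (Subsingleton.elim _ _)⟩
    have h := F.unit i (update w i z)
    rw [F.d_update, update_self] at h
    exact h.trans (congrArg (fun z => B.one (F.f .ob (update w i z)))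
      (((A i).L .ob).op_unit fun _ => z).symm)

theorem d_const_zero (F : PtMor α A B) (i : Fin k) {n : ℕ} (c : T ⟶ (P.O n).car .ob)
    (w : ∀ i, ((A i).L .ob).car) :
    F.d i c (fun _ => ((A i).L .ob).zero) w = (B.L .mor).zero := by
  have e : Fin 0 ≃ Σ _ : Fin n, Fin 0 := ⟨Fin.elim0, fun x => x.2, fun x => x.elim0, fun x => x.2.elim0⟩
  have h := F.cmp i e c (fun _ => P.star) Fin.elim0 w
  rw [F.nullary, B.one_zero] at h
  simp only [F.nullary, B.one_zero, LAlg.op_const_zero] at h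
  rw [← h, ← B.one_zero]
  refine Eq.trans ?_ (congrArg (B.seq _) (congrArg (F.d i c · w) (funext fun r =>
    (LAlg.op_zero _ rfl _ _).symm)))
  rw [B.one_seq']
  rw [F.src]
  exact (congrArg _ (funext fun r => F.based _ i (update_self ..))).trans (LAlg.op_const_zero _ _)

theorem d_zero (F : PtMor α A B) {i j : Fin k} (hij : i ≠ j) {n : ℕ} (c : T ⟶ (P.O n).car .ob)
    (y : Fin n → ((A i).L .ob).car) {w : ∀ i, ((A i).L .ob).car} (h : w j = ((A j).L .ob).zero) :
    F.d i c y w = (B.L .mor).zero := by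
  have e := F.comm i j hij c P.star y Fin.elim0 w
  have h₁ : update w j (((A j).L .ob).op P.star Fin.elim0) = w := by
    rw [LAlg.op_zero _ rfl, ← h, update_eq_self]
  simp only [F.nullary, B.one_zero, LAlg.op_const_zero, h₁] at e
  rw [LAlg.op_zero _ rfl, PtAlg.al, LAlg.op_zero _ (Nat.zero_mul _), ← B.one_zero, B.one_seq'] at e
  · rw [e, B.one_seq', B.one_seq', B.one_zero]
    all_goals simp only [B.src_one, B.src_seq]
  · rw [F.src]
    refine (congrArg _ (funext fun r => F.based _ j ?_)).trans (LAlg.op_const_zero _ _)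
    rw [update_of_ne hij.symm, h]

end PtMor

/-! ### Powers of multimorphisms -/

theorem FMap.crd_mk_zero {k : ℕ} {m : Fin (k + 1) → ℕ} (x : Fin (m 0))
    (z : Fin (ark fun i : Fin k => m i.succ)) : crd (m := m) (finProdFinEquiv (x, z)) 0 = x :=
  congrArg Prod.fst (dec_mk (x, z))

theorem FMap.crd_mk_succ {k : ℕ} {m : Fin (k + 1) → ℕ} (x : Fin (m 0))
    (z : Fin (ark fun i : Fin k => m i.succ)) (i : Fin k) :
    crd (m := m) (finProdFinEquiv (x, z)) i.succ = crd z i :=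
  congrArg (fun p : Fin _ × Fin _ => crd (m := fun i : Fin k => m i.succ) p.2 i) (dec_mk (x, z))

theorem PtAlg.inv_one {P : Operad V} {T : V} (B : PtAlg.{w} P T) (x : (B.L .ob).car) :
    B.Inv (B.one x) :=
  ⟨B.one x, by rw [B.src_one, B.tgt_one], by rw [B.src_one, B.tgt_one],
    by rw [B.one_seq' (B.src_one x), B.src_one], by rw [B.one_seq' (B.src_one x), B.tgt_one]⟩

theorem PtAlg.inv_seq {P : Operad V} {T : V} (B : PtAlg.{w} P T) {f g : (B.L .mor).car}
    (h : B.tgt f = B.src g) (hf : B.Inv f) (hg : B.Inv g) : B.Inv (B.seq f g) := by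
  obtain ⟨f', a₁, a₂, a₃, a₄⟩ := hf
  obtain ⟨g', b₁, b₂, b₃, b₄⟩ := hg
  have h' : B.tgt g' = B.src f' := by rw [b₂, a₁, h]
  refine ⟨B.seq g' f', ?_, ?_, ?_, ?_⟩
  · rw [B.src_seq, B.tgt_seq h, b₁]
  · rw [B.src_seq, B.tgt_seq h', a₂]
  · rw [B.seq_assoc h (by rw [B.src_seq, b₁]), ← B.seq_assoc b₁.symm h', b₃,
      B.one_seq' (by rw [a₁, h]), a₃, B.src_seq]
  · rw [B.seq_assoc h' (by rw [B.src_seq, a₂]), ← B.seq_assoc a₂ h, a₄,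
      B.one_seq' h.symm, b₄, B.tgt_seq h]

theorem PtAlg.inv_R {P : Operad V} {T : V} (B : PtAlg.{w} P T) {m n : ℕ} {φ : FMap m n}
    (c : DPt P .ob T φ) {X : Fin m → (B.L .mor).car} (h : ∀ i, B.Inv (X i)) (j : Fin n) :
    B.Inv ((B.L .mor).R c.one X j) := by
  choose Y h₁ h₂ h₃ h₄ using h
  refine ⟨(B.L .mor).R c.one Y j, ?_, ?_, ?_, ?_⟩
  · rw [B.R_one_src, B.R_one_tgt]; simp only [h₁]
  · rw [B.R_one_src, B.R_one_tgt]; simp only [h₂]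
  · rw [← B.R_one_seq c (fun i => (h₁ i).symm), B.R_one_src, ← B.R_one]; simp only [h₃]
  · rw [← B.R_one_seq c h₂, B.R_one_tgt, ← B.R_one]; simp only [h₄]

namespace PtMor

variable {P : Operad V} {α : PseudoComm P} {T : V}

/-- The power of a multimorphism, whose components are indexed by `m₁ ⋯ m_k` in lexicographic
order. -/
def pow {k : ℕ} {A : Fin k → PtAlg.{w} P T} {B : PtAlg.{w} P T} (F : PtMor α A B) (l : Lvl)
    {m : Fin k → ℕ} (X : ∀ i, Fin (m i) → ((A i).L l).car) (z : Fin (ark m)) : (B.L l).car :=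
  F.f l fun i => X i (crd z i)

/-- The family of the values of the `c i` on lists `X i`, at the coordinates of `J`. -/
def val {k : ℕ} {A : Fin k → PtAlg.{w} P T} {l : Lvl} {m n : Fin k → ℕ} {φ : ∀ i, FMap (m i) (n i)}
    (c : ∀ i, DPt P l T (φ i)) (X : ∀ i, Fin (m i) → ((A i).L l).car) (J : Fin (ark n)) (i : Fin k) :
    ((A i).L l).car :=
  ((A i).L l).R (c i) (X i) (crd J i)

/-- The pseudonaturality constraint of the powers of a multimorphism: the operations `c i` are
moved past `F` one variable after the other, the last variable first. -/
noncomputable def Δ : ∀ {k : ℕ} {A : Fin k → PtAlg.{w} P T} {B : PtAlg.{w} P T} (_ : PtMor α A B)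
    {m n : Fin k → ℕ} {φ : ∀ i, FMap (m i) (n i)} (_ : ∀ i, DPt P .ob T (φ i))
    (_ : ∀ i, Fin (m i) → ((A i).L .ob).car) (_ : Fin (ark n)), (B.L .mor).car
  | 0, _, B, F, _, _, _, _, _, _ => B.one (F.f .ob fun i => i.elim0)
  | _ + 1, _, B, F, _, _, _, c, X, J =>
    B.seq
      ((B.L .mor).R (c 0).one
        (fun x => Δ (F.fix (X 0 x)) (fun i => c i.succ) (fun i => X i.succ) (dec J).2) (dec J).1)
      (F.d 0 (c 0 (dec J).1) (fun r => X 0 ((fib _ (dec J).1 r).1)) (val c X J))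

section succ

variable {k : ℕ} {A : Fin (k + 1) → PtAlg.{w} P T} {B : PtAlg.{w} P T} (F : PtMor α A B) {l : Lvl}
  {m n : Fin (k + 1) → ℕ} {φ : ∀ i, FMap (m i) (n i)}

theorem pow_mk (X : ∀ i, Fin (m i) → ((A i).L l).car) (x : Fin (m 0))
    (z : Fin (ark fun i : Fin k => m i.succ)) :
    F.pow l X (finProdFinEquiv (x, z)) = F.f l (cons (X 0 x) fun i => X i.succ (crd z i)) :=
  congrArg (F.f l) (funext (Fin.cases (congrArg (X 0) (crd_mk_zero (m := m) x z)) fun i =>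
    congrArg (X i.succ) (crd_mk_succ (m := m) x z i)))

theorem val_eq_cons (c : ∀ i, DPt P l T (φ i)) (X : ∀ i, Fin (m i) → ((A i).L l).car)
    (J : Fin (ark n)) :
    (val c X J : ∀ i, ((A i).L l).car) =
      cons (((A 0).L l).R (c 0) (X 0) (dec J).1) (val (A := fun i : Fin k => A i.succ)
        (fun i => c i.succ) (fun i => X i.succ) (dec J).2) :=
  funext (Fin.cases rfl fun _ => rfl)

theorem R_smk_pow (c : ∀ i, DPt P l T (φ i)) (X : ∀ i, Fin (m i) → ((A i).L l).car)
    (J : Fin (ark n)) :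
    (B.L l).R (DPt.smk c) (F.pow l X) J = (B.L l).R (c 0) (fun x => (B.L l).R
      (DPt.smk fun i => c i.succ) (fun z => F.f l (cons (X 0 x) fun i => X i.succ (crd z i)))
        (dec J).2) (dec J).1 := by
  refine ((B.L l).R_sm (c 0) (DPt.smk fun i => c i.succ) (F.pow l X) J).trans ?_
  simp only [pow_mk]

theorem R_smk_pow_ob (c : ∀ i, DPt P .ob T (φ i)) (X : ∀ i, Fin (m i) → ((A i).L .ob).car)
    (J : Fin (ark n)) :
    (B.L .ob).R (DPt.smk c) (F.pow .ob X) J = (B.L .ob).R (c 0) (fun x => (B.L .ob).R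
      (DPt.smk fun i => c i.succ) ((F.fix (X 0 x)).pow .ob fun i => X i.succ) (dec J).2) (dec J).1 :=
  F.R_smk_pow c X J

theorem Δ_succ (c : ∀ i, DPt P .ob T (φ i)) (X : ∀ i, Fin (m i) → ((A i).L .ob).car)
    (J : Fin (ark n)) : F.Δ c X J = B.seq
      ((B.L .mor).R (c 0).one
        (fun x => Δ (F.fix (X 0 x)) (fun i => c i.succ) (fun i => X i.succ) (dec J).2) (dec J).1)
      (F.d 0 (c 0 (dec J).1) (fun r => X 0 ((fib _ (dec J).1 r).1)) (val c X J)) := rfl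

theorem d_val_src (c : ∀ i, DPt P .ob T (φ i)) (X : ∀ i, Fin (m i) → ((A i).L .ob).car)
    (J : Fin (ark n)) :
    B.src (F.d 0 (c 0 (dec J).1) (fun r => X 0 ((fib _ (dec J).1 r).1)) (val c X J)) =
      (B.L .ob).R (c 0) (fun x => (F.fix (X 0 x)).f .ob (val (A := fun i : Fin k => A i.succ)
        (fun i => c i.succ) (fun i => X i.succ) (dec J).2)) (dec J).1 := by
  rw [F.src]
  simp only [val_eq_cons, update_cons]
  rfl

theorem d_val_tgt (c : ∀ i, DPt P .ob T (φ i)) (X : ∀ i, Fin (m i) → ((A i).L .ob).car)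
    (J : Fin (ark n)) :
    B.tgt (F.d 0 (c 0 (dec J).1) (fun r => X 0 ((fib _ (dec J).1 r).1)) (val c X J)) =
      F.f .ob (val c X J) := by
  rw [F.tgt]
  simp only [val_eq_cons, update_cons]
  rfl

end succ

variable {B : PtAlg.{w} P T}

theorem Δ_tgt : ∀ {k : ℕ} {A : Fin k → PtAlg.{w} P T} (F : PtMor α A B) {m n : Fin k → ℕ}
    {φ : ∀ i, FMap (m i) (n i)} (c : ∀ i, DPt P .ob T (φ i))
    (X : ∀ i, Fin (m i) → ((A i).L .ob).car) (J : Fin (ark n)),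
    B.tgt (F.Δ c X J) = F.f .ob (val c X J)
  | 0, _, F, _, _, _, c, X, J => (B.tgt_one _).trans (congrArg _ (funext fun i => i.elim0))
  | _ + 1, _, F, _, _, _, c, X, J => by
    rw [Δ_succ, B.tgt_seq, d_val_tgt]
    rw [B.R_one_tgt, d_val_src]
    simp only [Δ_tgt]

theorem Δ_succ_comp {k : ℕ} {A : Fin (k + 1) → PtAlg.{w} P T} (F : PtMor α A B)
    {m n : Fin (k + 1) → ℕ} {φ : ∀ i, FMap (m i) (n i)} (c : ∀ i, DPt P .ob T (φ i))
    (X : ∀ i, Fin (m i) → ((A i).L .ob).car) (J : Fin (ark n)) :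
    B.tgt ((B.L .mor).R (c 0).one
        (fun x => Δ (F.fix (X 0 x)) (fun i => c i.succ) (fun i => X i.succ) (dec J).2) (dec J).1) =
      B.src (F.d 0 (c 0 (dec J).1) (fun r => X 0 ((fib _ (dec J).1 r).1)) (val c X J)) := by
  rw [B.R_one_tgt, d_val_src]
  simp only [Δ_tgt]

theorem Δ_src : ∀ {k : ℕ} {A : Fin k → PtAlg.{w} P T} (F : PtMor α A B) {m n : Fin k → ℕ}
    {φ : ∀ i, FMap (m i) (n i)} (c : ∀ i, DPt P .ob T (φ i))
    (X : ∀ i, Fin (m i) → ((A i).L .ob).car) (J : Fin (ark n)),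
    B.src (F.Δ c X J) = (B.L .ob).R (DPt.smk c) (F.pow .ob X) J
  | 0, _, F, _, _, _, c, X, J => (B.src_one _).trans (Eq.trans
      (congrArg _ (funext fun i => i.elim0))
      (congrFun ((B.L .ob).R_iota_some isPi_some (F.pow .ob X)) J).symm)
  | _ + 1, _, F, _, _, _, c, X, J => by
    rw [Δ_succ, B.src_seq, B.R_one_src, R_smk_pow_ob]
    simp only [Δ_src]

theorem Δ_inv : ∀ {k : ℕ} {A : Fin k → PtAlg.{w} P T} (F : PtMor α A B) {m n : Fin k → ℕ}
    {φ : ∀ i, FMap (m i) (n i)} (c : ∀ i, DPt P .ob T (φ i))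
    (X : ∀ i, Fin (m i) → ((A i).L .ob).car) (J : Fin (ark n)), B.Inv (F.Δ c X J)
  | 0, _, F, _, _, _, c, X, J => B.inv_one _
  | _ + 1, _, F, _, _, _, c, X, J =>
    B.inv_seq (F.Δ_succ_comp c X J) (B.inv_R _ (fun _ => Δ_inv _ _ _ _) _) (F.inv _ _ _ _)

theorem Δ_eq_zero_of_forall : ∀ {k : ℕ} {A : Fin k → PtAlg.{w} P T} (F : PtMor α A B)
    {m n : Fin k → ℕ} {φ : ∀ i, FMap (m i) (n i)} (c : ∀ i, DPt P .ob T (φ i))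
    (X : ∀ i, Fin (m i) → ((A i).L .ob).car) (J : Fin (ark n))
    (_ : ∀ w, F.f .ob w = (B.L .ob).zero) (_ : ∀ i {n : ℕ} (c : T ⟶ (P.O n).car .ob) y w,
      F.d i c y w = (B.L .mor).zero), F.Δ c X J = (B.L .mor).zero
  | 0, _, F, _, _, _, c, X, J, h, _ => (congrArg _ (h _)).trans B.one_zero
  | _ + 1, _, F, _, _, _, c, X, J, h, h' => by
    rw [Δ_succ, h', ← B.one_zero, B.seq_one']
    · refine (congrArg (fun X => (B.L .mor).R (c 0).one X (dec J).1) (funext fun x =>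
        Δ_eq_zero_of_forall (F.fix (X 0 x)) _ _ _ (fun w => h _) fun i _ c y w => h' _ _ _ _)).trans
          ?_
      rw [(B.L .mor).R_zero, B.one_zero]
    · rw [Δ_succ_comp, h', ← B.one_zero, B.src_one]

theorem Δ_zero : ∀ {k : ℕ} {A : Fin k → PtAlg.{w} P T} (F : PtMor α A B)
    {m n : Fin k → ℕ} {φ : ∀ i, FMap (m i) (n i)} (c : ∀ i, DPt P .ob T (φ i))
    (X : ∀ i, Fin (m i) → ((A i).L .ob).car) (J : Fin (ark n)) (i : Fin k)
    (_ : ∀ r, X i ((fib (φ i) (crd J i) r).1) = ((A i).L .ob).zero), F.Δ c X J = (B.L .mor).zero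
  | 0, _, F, _, _, _, c, X, J, i, _ => i.elim0
  | k + 1, A, F, _, _, _, c, X, J, i, h => by
    revert h
    refine Fin.cases (fun h => ?_) (fun i h => ?_) i
    · have h' : (fun r => X 0 ((fib _ (dec J).1 r).1)) = fun _ => ((A 0).L .ob).zero := funext h
      rw [Δ_succ, h', d_const_zero, ← B.one_zero, B.seq_one']
      · refine Eq.trans (congrArg ((B.L .mor).op ((c 0).one (dec J).1)) (funext fun r =>
          Δ_eq_zero_of_forall _ _ _ _ ?_ ?_)) ((LAlg.op_const_zero _ _).trans B.one_zero.symm)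
        · exact fun w => F.based _ 0 (h r)
        · exact fun i _ c y w => F.d_zero (Fin.succ_ne_zero i) _ _ (j := 0) (h r)
      · rw [Δ_succ_comp, h', d_const_zero, ← B.one_zero, B.src_one]
    · have h' : F.d 0 (c 0 (dec J).1) (fun r => X 0 ((fib _ (dec J).1 r).1)) (val c X J) =
          (B.L .mor).zero := by
        refine F.d_zero (Fin.succ_ne_zero i).symm _ _ (j := i.succ) ?_
        exact (congrArg (((A i.succ).L .ob).op (c i.succ (crd J i.succ))) (funext h)).trans
          (LAlg.op_const_zero _ _)
      rw [Δ_succ, h', ← B.one_zero, B.seq_one']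
      · refine (congrArg (fun X => (B.L .mor).R (c 0).one X (dec J).1) (funext fun x =>
          Δ_zero (F.fix (X 0 x)) _ _ _ i h)).trans ?_
        rw [(B.L .mor).R_zero, B.one_zero]
      · rw [Δ_succ_comp, h', ← B.one_zero, B.src_one]

theorem Δ_iota : ∀ {k : ℕ} {A : Fin k → PtAlg.{w} P T} (F : PtMor α A B)
    {m n : Fin k → ℕ} {φ : ∀ i, FMap (m i) (n i)} (h : ∀ i, (φ i).IsPi)
    (X : ∀ i, Fin (m i) → ((A i).L .ob).car) (J : Fin (ark n)),
    F.Δ (fun i => DPt.iota (φ i) (h i)) X J = B.one (F.f .ob (val (fun i => DPt.iota (φ i) (h i)) X J))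
  | 0, _, F, _, _, _, c, X, J => congrArg (fun w => B.one (F.f .ob w)) (funext fun i => i.elim0)
  | k + 1, A, F, _, _, φ, h, X, J => by
    have e' : F.d 0 (DPt.iota (φ 0) (h 0) (dec J).1) (fun r => X 0 ((fib _ (dec J).1 r).1))
        (val (fun i => DPt.iota (φ i) (h i)) X J) =
        B.one (F.f .ob (val (fun i => DPt.iota (φ i) (h i)) X J)) :=
      (F.d_low 0 (h 0 _) _ _).trans (congrArg (fun w => B.one (F.f .ob w)) (update_eq_self 0 _))
    rw [Δ_succ, e', B.seq_one']
    · refine (congrArg (fun X => (B.L .mor).R _ X (dec J).1) (funext fun x =>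
        Δ_iota (F.fix (X 0 x)) (fun i => h i.succ) (fun i => X i.succ) (dec J).2)).trans ?_
      exact (B.R_one _ _ _).trans (congrArg B.one ((F.d_val_src
        (fun i => DPt.iota (φ i) (h i)) X J).symm.trans
        ((congrArg B.src e').trans (B.src_one _))))
    · exact (F.Δ_succ_comp (fun i => DPt.iota (φ i) (h i)) X J).trans ((congrArg B.src e').trans (B.src_one _))

end PtMor

theorem PtAlg.seq_comm_paste {P : Operad V} {T : V} (B : PtAlg.{w} P T)
    {a b e h p q ω p' b' : (B.L .mor).car} (e₁ : B.seq e h = B.seq p (B.seq q ω))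
    (e₂ : B.seq b p = B.seq p' b') (h₁ : B.tgt a = B.src b) (h₂ : B.tgt b = B.src e)
    (h₃ : B.tgt e = B.src h) (h₄ : B.tgt p = B.src q) (h₅ : B.tgt q = B.src ω)
    (h₆ : B.tgt p' = B.src b') :
    B.seq (B.seq a (B.seq b e)) h = B.seq (B.seq a p') (B.seq (B.seq b' q) ω) := by
  have h₇ : B.tgt b = B.src p := by rw [h₂, ← B.src_seq e h, e₁, B.src_seq]
  have h₈ : B.tgt a = B.src p' := by rw [h₁, ← B.src_seq b p, e₂, B.src_seq]
  have h₉ : B.tgt b' = B.src q := by rw [← B.tgt_seq h₆, ← e₂, B.tgt_seq h₇, h₄]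
  rw [B.seq_assoc (by rw [h₁, B.src_seq]) (by rw [B.tgt_seq h₂, h₃]), B.seq_assoc h₂ h₃, e₁,
    ← B.seq_assoc h₇ (by rw [B.src_seq, h₄]), e₂, B.seq_assoc h₉ h₅,
    B.seq_assoc h₈ (by rw [B.src_seq, h₆]), B.seq_assoc h₆ (by rw [B.src_seq, h₉])]

namespace PtMor

variable {P : Operad V} {α : PseudoComm P} {T : V} {B : PtAlg.{w} P T}

theorem R_smk_ob_succ {k : ℕ} {l : Lvl} {m n : Fin (k + 1) → ℕ} {φ : ∀ i, FMap (m i) (n i)}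
    (c : ∀ i, DPt P l T (φ i)) (A : LAlg.{w} P T l) {γ : Fin (k + 1) → Type*}
    (X : ∀ i, Fin (m i) → γ i) (Z : (∀ i, γ i) → A.car) (J : Fin (ark n)) :
    A.R (DPt.smk c) (fun z => Z fun i => X i (crd z i)) J =
      A.R (c 0) (fun x => A.R (DPt.smk fun i => c i.succ) (fun z =>
        Z (Fin.cons (X 0 x) fun i => X i.succ (crd z i))) (dec J).2) (dec J).1 := by
  refine (A.R_sm (c 0) (DPt.smk fun i => c i.succ) _ J).trans ?_
  refine congrArg (A.R (c 0) · (dec J).1) (funext fun x => congrArg (A.R _ · (dec J).2)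
    (funext fun z => congrArg Z (funext (Fin.cases ?_ fun i => ?_))))
  · exact congrArg (X 0) (crd_mk_zero (m := m) x z)
  · exact congrArg (X i.succ) (crd_mk_succ (m := m) x z i)

/-- The constraint `Δ` commutes with a modification `ω`, from the value of an operation on the
multimorphisms `G x` to the multimorphism `H`, up to interchange of the operations. -/
theorem Δ_comm : ∀ {k : ℕ} {A : Fin k → PtAlg.{w} P T} (H : PtMor α A B) {m₀ n₀ : ℕ}
    {φ₀ : FMap m₀ n₀} (c : DPt P .ob T φ₀) (K : Fin n₀) (G : Fin m₀ → PtMor α A B)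
    (ω : (∀ i, ((A i).L .ob).car) → (B.L .mor).car)
    (_ : ∀ w, B.src (ω w) = (B.L .ob).R c (fun x => (G x).f .ob w) K)
    (_ : ∀ w, B.tgt (ω w) = H.f .ob w)
    (_ : ∀ (i : Fin k) {n : ℕ} (b : T ⟶ (P.O n).car .ob) (y : Fin n → ((A i).L .ob).car) w,
      B.seq ((B.L .mor).op ((P.O n).one b) fun s => ω (update w i (y s))) (H.d i b y w) =
        B.seq (B.al α b (c K) fun s x => (G (fib _ K x).1).f .ob (update w i (y s)))
          (B.seq ((B.L .mor).R c.one (fun x => (G x).d i b y w) K)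
            (ω (update w i (((A i).L .ob).op b y)))))
    {m n : Fin k → ℕ} {φ : ∀ i, FMap (m i) (n i)} (d : ∀ i, DPt P .ob T (φ i))
    (X : ∀ i, Fin (m i) → ((A i).L .ob).car) (J : Fin (ark n)),
    B.seq ((B.L .mor).R (DPt.smk d).one (fun z => ω fun i => X i (crd z i)) J) (H.Δ d X J) =
      B.seq (B.Al α (DPt.smk d) c J K fun z x => (G x).pow .ob X z)
        (B.seq ((B.L .mor).R c.one (fun x => (G x).Δ d X J) K) (ω (val d X J)))
  | 0, A, H, _, _, _, c, K, G, ω, hs, ht, hω, m, n, _, d, X, J => by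
    have hw : ∀ w w' : ∀ i, ((A i).L .ob).car, w = w' := fun w w' => funext fun i => i.elim0
    have h₁ : (B.L .mor).R (DPt.smk d).one (fun z => ω fun i => X i (crd z i)) J = ω (val d X J) :=
      (congrFun ((B.L .mor).R_iota_some isPi_some _) J).trans (congrArg ω (hw _ _))
    have h₂ : (B.L .mor).R c.one (fun x => (G x).Δ d X J) K = B.one (B.src (ω (val d X J))) := by
      rw [hs, ← B.R_one]
      exact congrArg (fun w => (B.L .mor).R c.one (fun x => B.one ((G x).f .ob w)) K) (hw _ _)
    have h₃ : H.Δ d X J = B.one (B.tgt (ω (val d X J))) := by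
      rw [ht]
      exact congrArg (fun w => B.one (H.f .ob w)) (hw _ _)
    have h₄ : B.Al α (DPt.smk d) c J K (fun z x => (G x).pow .ob X z) =
        B.one (B.src (ω (val d X J))) := by
      refine (B.Al_iota_left α isPi_some c J K _).trans (congrArg B.one ?_)
      rw [LAlg.R_iota_some, hs]
      exact congrArg (fun w => (B.L .ob).R c (fun x => (G x).f .ob w) K) (hw _ _)
    rw [h₁, h₂, h₃, h₄, B.seq_one, B.one_seq, B.one_seq]
  | k + 1, A, H, _, _, _, c, K, G, ω, hs, ht, hω, m, n, φ, d, X, J => by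
    let v := val (A := fun i : Fin k => A i.succ) (fun i => d i.succ) (fun i => X i.succ) (dec J).2
    have ih := fun s => Δ_comm (H.fix (X 0 s)) c K (fun x => (G x).fix (X 0 s))
      (fun w => ω (cons (X 0 s) w)) (fun w => hs _) (fun w => ht _) (fun i n b y w => by
        have := hω i.succ b y (cons (X 0 s) w)
        simp only [← cons_update] at this
        exact this) (fun i => d i.succ) (fun i => X i.succ) (dec J).2
    have e₁ : (B.L .mor).R (DPt.smk d).one (fun z => ω fun i => X i (crd z i)) J =
        (B.L .mor).R (d 0).one (fun s => (B.L .mor).R (DPt.smk fun i => d i.succ).one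
          (fun z => ω (cons (X 0 s) fun i => X i.succ (crd z i))) (dec J).2) (dec J).1 := by
      rw [DPt.smk_one]
      refine (R_smk_ob_succ (fun i => (d i).one) (B.L .mor) X ω J).trans ?_
      rw [← DPt.smk_one]
      rfl
    have e₂ := hω 0 (d 0 (dec J).1) (fun r => X 0 (fib _ (dec J).1 r).1) (val d X J)
    simp only [val_eq_cons d X J, update_cons] at e₂
    have e₃ := B.Al_nat α (d 0) c (dec J).1 K fun s x =>
      ((G x).fix (X 0 s)).Δ (fun i => d i.succ) (fun i => X i.succ) (dec J).2
    simp only [Δ_src, Δ_tgt] at e₃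
    have e₄ : ∀ x, (G x).Δ d X J = _ := fun x => Δ_succ (G x) d X J
    have e₅ : B.Al α (DPt.smk d) c J K (fun z x => (G x).pow .ob X z) = _ :=
      B.Al_sm_left α (d 0) (DPt.smk fun i => d i.succ) c J K _
    simp only [pow_mk] at e₅
    have h₁ : ∀ s, B.tgt ((B.L .mor).R (DPt.smk fun i => d i.succ).one
          (fun z => ω (cons (X 0 s) fun i => X i.succ (crd z i))) (dec J).2) =
        B.src ((H.fix (X 0 s)).Δ (fun i => d i.succ) (fun i => X i.succ) (dec J).2) := fun s => by
      rw [B.R_one_tgt, Δ_src]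
      simp only [ht]
      rfl
    have h₂ : ∀ s, B.tgt ((B.L .mor).R c.one (fun x => ((G x).fix (X 0 s)).Δ
          (fun i => d i.succ) (fun i => X i.succ) (dec J).2) K) = B.src (ω (cons (X 0 s) v)) :=
      fun s => by
        rw [B.R_one_tgt, hs]
        simp only [Δ_tgt]
        rfl
    have h₃ : ∀ s, B.tgt (B.Al α (DPt.smk fun i => d i.succ) c (dec J).2 K fun z x =>
          ((G x).fix (X 0 s)).pow .ob (fun i => X i.succ) z) =
        B.src (B.seq ((B.L .mor).R c.one (fun x => ((G x).fix (X 0 s)).Δ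
          (fun i => d i.succ) (fun i => X i.succ) (dec J).2) K) (ω (cons (X 0 s) v))) := fun s => by
      rw [B.Al_tgt, B.src_seq, B.R_one_src]
      simp only [Δ_src]
    rw [e₁, Δ_succ, e₅, ← B.seq_assoc, ← B.R_one_seq _ h₁]
    · refine (congrArg (fun Y => B.seq ((B.L .mor).R (d 0).one Y (dec J).1) _) (funext ih)).trans ?_
      rw [B.R_one_seq _ h₃, B.R_one_seq _ h₂]
      simp only [e₄]
      have h₅ := fun x => (G x).Δ_succ_comp d X J
      rw [B.R_one_seq _ h₅]
      simp only [val_eq_cons d X J] at h₅ ⊢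
      refine B.seq_comm_paste e₂ e₃ ?_ ?_ ?_ ?_ ?_ ?_
      · rw [B.R_one_tgt, B.R_one_src]
        simp only [h₃, B.src_seq]
      · rw [B.R_one_tgt, B.R_one_src]
        simp only [h₂]
      · rw [B.R_one_tgt, H.src]
        simp only [ht, update_cons]
        rfl
      · rw [B.al_tgt, B.R_one_src]
        simp only [(G _).src, update_cons]
        rfl
      · rw [B.R_one_tgt, hs]
        simp only [(G _).tgt, update_cons]
        rfl
      · rw [B.Al_tgt, B.R_one_src]
        simp only [B.R_one_src, Δ_src]
        rfl
    · rw [B.R_one_tgt, B.R_one_src]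
      simp only [h₁]
    · exact H.Δ_succ_comp d X J

theorem fix_f_seq {k : ℕ} {A : Fin (k + 1) → PtAlg.{w} P T} (F : PtMor α A B)
    {g g' : ((A 0).L .mor).car} {w w' : ∀ i : Fin k, ((A i.succ).L .mor).car}
    (h : (A 0).tgt g = (A 0).src g') (h' : ∀ i, (A i.succ).tgt (w i) = (A i.succ).src (w' i)) :
    B.seq (F.f .mor (cons g w)) (F.f .mor (cons g' w')) =
      F.f .mor (cons ((A 0).seq g g') fun i => (A i.succ).seq (w i) (w' i)) :=
  (F.f_seq (Fin.cases h h')).symm.trans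
    (congrArg _ (funext (Fin.cases rfl fun _ => rfl)))

/-- The constraint `Δ` is natural with respect to an arrow in the variable which is fixed. -/
theorem Δ_fix_nat {k : ℕ} {A : Fin (k + 1) → PtAlg.{w} P T} (F : PtMor α A B)
    (g : ((A 0).L .mor).car) {m n : Fin k → ℕ} {φ : ∀ i, FMap (m i) (n i)}
    (d : ∀ i, DPt P .ob T (φ i)) (X : ∀ i, Fin (m i) → ((A i.succ).L .ob).car) (J : Fin (ark n)) :
    B.seq ((B.L .mor).R (DPt.smk d).one (fun z => F.f .mor (cons g fun i =>
        (A i.succ).one (X i (crd z i)))) J) ((F.fix ((A 0).tgt g)).Δ d X J) =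
      B.seq ((F.fix ((A 0).src g)).Δ d X J) (F.f .mor (cons g fun i =>
        (A i.succ).one (val (A := fun i : Fin k => A i.succ) d X J i))) := by
  have hs : ∀ w : ∀ i : Fin k, ((A i.succ).L .ob).car,
      B.src (F.f .mor (cons g fun i => (A i.succ).one (w i))) =
        (F.fix ((A 0).src g)).f .ob w := fun w => by
    rw [F.f_src, map_cons fun i => (A i).src]
    simp only [PtAlg.src_one]
    rfl
  have ht : ∀ w : ∀ i : Fin k, ((A i.succ).L .ob).car,
      B.tgt (F.f .mor (cons g fun i => (A i.succ).one (w i))) =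
        (F.fix ((A 0).tgt g)).f .ob w := fun w => by
    rw [F.f_tgt, map_cons fun i => (A i).tgt]
    simp only [PtAlg.tgt_one]
    rfl
  -- An arrow in the fixed variable is a modification from the value of the operadic unit.
  have h := Δ_comm (F.fix ((A 0).tgt g)) (DPt.iota (some : FMap 1 1) isPi_some) 0
    (fun _ => F.fix ((A 0).src g)) (fun w => F.f .mor (cons g fun i => (A i.succ).one (w i)))
    (fun w => by rw [LAlg.R_iota_some, hs]) ht (fun i n b y w => by
      have e₁ : ∀ W, B.al α b (DPt.iota (some : FMap 1 1) isPi_some 0) W = B.one _ :=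
        fun W => B.al_low_right α (isPi_some 0) b W
      have e₂ : ∀ w z, (fun j => (A j.succ).one (update w i z j)) =
          update (fun j => (A j.succ).one (w j)) i ((A i.succ).one z) := fun w z =>
        funext fun j => apply_update (fun j => (A (Fin.succ j)).one) w i z j
      have e₃ := F.nat i.succ ((P.O n).one b) (fun s => (A i.succ).one (y s))
        (cons g fun j => (A j.succ).one (w j))
      rw [map_cons fun i => (A i).tgt, map_cons fun i => (A i).src, (A i.succ).op_one] at e₃
      simp only [← cons_update, ← e₂, PtAlg.src_one, PtAlg.tgt_one, VCat.one_src,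
        VCat.one_tgt] at e₃
      rw [e₁, DPt.iota_one, B.one_seq']
      · refine e₃.trans (congrArg (B.seq · _) ?_)
        exact (congrFun ((B.L .mor).R_iota_some isPi_some
          (fun _ => (F.fix ((A 0).src g)).d i b y w)) (0 : Fin 1)).symm
      · rw [B.src_seq, B.R_src, DPt.iota_src, LAlg.R_iota_some, (PtMor.src _)]
        exact ((B.L .ob).op_low (isPi_some 0) (c_pos (i := 0) rfl)
          fun _ => (B.L .ob).op b fun r => (F.fix ((A 0).src g)).f .ob (update w i (y r))).symm) d X J
  rw [B.Al_iota_right, DPt.iota_one, B.one_seq'] at h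
  · exact h.trans (congrArg (B.seq · _) (congrFun ((B.L .mor).R_iota_some isPi_some _) (0 : Fin 1)))
  · rw [B.src_seq, B.R_src, DPt.iota_src]
    simp only [Δ_src]

/-- Naturality in the operations and in the arguments. -/
theorem Δ_nat : ∀ {k : ℕ} {A : Fin k → PtAlg.{w} P T} (F : PtMor α A B) {m n : Fin k → ℕ}
    {φ : ∀ i, FMap (m i) (n i)} (c : ∀ i, DPt P .mor T (φ i))
    (X : ∀ i, Fin (m i) → ((A i).L .mor).car) (J : Fin (ark n)),
    B.seq ((B.L .mor).R (DPt.smk c) (F.pow .mor X) J)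
        (F.Δ (fun i => (c i).tgt) (fun i z => (A i).tgt (X i z)) J) =
      B.seq (F.Δ (fun i => (c i).src) (fun i z => (A i).src (X i z)) J) (F.f .mor (val c X J))
  | 0, A, F, m, n, φ, c, X, J => by
    have hw : ∀ w w' : ∀ i, ((A i).L .mor).car, w = w' := fun w w' => funext fun i => i.elim0
    have h₁ : (B.L .mor).R (DPt.smk c) (F.pow .mor X) J = F.f .mor (val c X J) :=
      (congrFun ((B.L .mor).R_iota_some isPi_some _) J).trans (congrArg _ (hw _ _))
    refine (congrArg (B.seq · _) h₁).trans ((B.seq_one' ?_).trans (B.one_seq' ?_).symm)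
    · rw [F.f_tgt]
      exact congrArg _ (funext fun i => i.elim0)
    · rw [F.f_src]
      exact congrArg _ (funext fun i => i.elim0)
  | k + 1, A, F, m, n, φ, c, X, J => by
    have e₁ : ∀ x, B.seq ((B.L .mor).R (DPt.smk fun i => c i.succ) (fun z => F.f .mor
          (cons (X 0 x) fun i => X i.succ (crd z i))) (dec J).2)
        ((F.fix ((A 0).tgt (X 0 x))).Δ (fun i => (c i.succ).tgt)
          (fun i z => (A i.succ).tgt (X i.succ z)) (dec J).2) =
        B.seq ((F.fix ((A 0).src (X 0 x))).Δ (fun i => (c i.succ).src)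
          (fun i z => (A i.succ).src (X i.succ z)) (dec J).2) (F.f .mor (cons (X 0 x)
            (val (A := fun i : Fin k => A i.succ) (fun i => c i.succ) (fun i => X i.succ)
              (dec J).2))) := fun x => by
      have h₁ : ∀ z : Fin (ark fun i : Fin k => m i.succ),
          F.f .mor (cons (X 0 x) fun i => X i.succ (crd z i)) =
            B.seq ((F.fix ((A 0).src (X 0 x))).pow .mor (fun i => X i.succ) z) (F.f .mor
              (cons (X 0 x) fun i => (A i.succ).one ((A i.succ).tgt (X i.succ (crd z i))))) := by
        intro z
        refine Eq.trans ?_ (F.fix_f_seq ?_ ?_).symm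
        · simp only [PtAlg.deg, PtAlg.seq_one, PtAlg.one_seq]
        · exact (A 0).tgt_one _
        · exact fun i => ((A i.succ).src_one _).symm
      have h₂ : DPt.seq (DPt.smk fun i => c i.succ) (DPt.smk fun i => (c i.succ).tgt).one =
          DPt.smk fun i => c i.succ := by
        rw [← DPt.smk_tgt, DPt.seq_one]
      have h₃ : ∀ z : Fin (ark fun i : Fin k => m i.succ),
          B.tgt ((F.fix ((A 0).src (X 0 x))).pow .mor (fun i => X i.succ) z) = B.src (F.f .mor
            (cons (X 0 x) fun i => (A i.succ).one ((A i.succ).tgt (X i.succ (crd z i))))) := by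
        intro z
        rw [pow, PtMor.f_tgt, F.f_src, map_cons fun i => (A i).src]
        simp only [PtAlg.src_one]
        rfl
      have h₄ := F.Δ_fix_nat (X 0 x) (fun i => (c i.succ).tgt)
        (fun i z => (A i.succ).tgt (X i.succ z)) (dec J).2
      have ih := Δ_nat (F.fix ((A 0).src (X 0 x))) (fun i => c i.succ) (fun i => X i.succ) (dec J).2
      simp only [h₁]
      rw [← h₂, B.R_seq (by rw [DPt.smk_tgt, DPt.one_src]) h₃, B.seq_assoc, h₄, ← B.seq_assoc, ih,
        B.seq_assoc]
      · refine congrArg _ ((F.fix_f_seq ?_ ?_).trans ?_)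
        · exact (A 0).tgt_one _
        · exact fun i => ((A i.succ).R_tgt _ _ _).trans ((A i.succ).src_one _).symm
        · refine congrArg₂ (fun a w => F.f .mor (cons a w)) ((A 0).one_seq _) (funext fun i => ?_)
          exact (A i.succ).seq_one' ((A i.succ).R_tgt _ _ _)
      · rw [Δ_tgt, PtMor.f_src]
        exact congrArg _ (funext fun i => ((A i.succ).R_src _ _ _).symm)
      · rw [PtMor.f_tgt, F.f_src, map_cons fun i => (A i).src]
        simp only [PtAlg.src_one]
        exact congrArg _ (funext fun i => (A i.succ).R_tgt _ _ _)
      · rw [B.R_tgt, DPt.smk_tgt, Δ_src]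
        simp only [pow, PtMor.f_tgt]
        rfl
      · rw [Δ_tgt, F.f_src, map_cons fun i => (A i).src]
        simp only [PtAlg.src_one]
        rfl
      · rw [B.R_tgt, B.R_one_src, DPt.smk_tgt]
        simp only [h₃]
      · rw [B.R_one_tgt, Δ_src]
        simp only [F.f_tgt, map_cons fun i => (A i).tgt, PtAlg.tgt_one]
        rfl
    have e₅ : (fun i => (A i).tgt (val c X J i)) =
        val (fun i => (c i).tgt) (fun i z => (A i).tgt (X i z)) J :=
      funext fun i => (A i).R_tgt (c i) (X i) (crd J i)
    have e₆ : (fun i => (A i).src (val c X J i)) =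
        val (fun i => (c i).src) (fun i z => (A i).src (X i z)) J :=
      funext fun i => (A i).R_src (c i) (X i) (crd J i)
    have e₂ := F.nat 0 (c 0 (dec J).1) (fun r => X 0 (fib _ (dec J).1 r).1) (val c X J)
    rw [e₅, e₆] at e₂
    have e₇ : ∀ z, update (val c X J) 0 z = cons z _ := update_tail (val c X J)
    simp only [e₇] at e₂
    have h₁ : ∀ x, B.tgt ((B.L .mor).R (DPt.smk fun i => c i.succ) (fun z => F.f .mor
          (cons (X 0 x) fun i => X i.succ (crd z i))) (dec J).2) =
        B.src ((F.fix ((A 0).tgt (X 0 x))).Δ (fun i => (c i.succ).tgt)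
          (fun i z => (A i.succ).tgt (X i.succ z)) (dec J).2) := fun x => by
      rw [B.R_tgt, DPt.smk_tgt, Δ_src]
      simp only [F.f_tgt, map_cons fun i => (A i).tgt]
      rfl
    have h₂ : ∀ x, B.tgt (((F.fix ((A 0).src (X 0 x))).Δ (fun i => (c i.succ).src)
          (fun i z => (A i.succ).src (X i.succ z)) (dec J).2)) = B.src (F.f .mor (cons (X 0 x)
            (val (A := fun i : Fin k => A i.succ) (fun i => c i.succ) (fun i => X i.succ)
              (dec J).2))) := fun x => by
      rw [Δ_tgt, F.f_src, map_cons fun i => (A i).src]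
      exact congrArg (fun w => F.f .ob (cons _ w)) (funext fun i => ((A i.succ).R_src _ _ _).symm)
    have e₃ := B.R_seq (by rw [DPt.one_src]) h₁ (f := c 0) (g := (c 0).tgt.one) (dec J).1
    have e₄ := B.R_seq (by rw [DPt.one_tgt]) h₂ (f := (c 0).src.one) (g := c 0) (dec J).1
    rw [DPt.seq_one] at e₃
    rw [DPt.one_seq] at e₄
    have h₃ := F.Δ_succ_comp (fun i => (c i).tgt) (fun i z => (A i).tgt (X i z)) J
    have h₄ := F.Δ_succ_comp (fun i => (c i).src) (fun i z => (A i).src (X i z)) J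
    rw [R_smk_pow, Δ_succ, Δ_succ, ← B.seq_assoc, ← e₃, funext e₁, e₄, B.seq_assoc, B.seq_assoc]
    · exact congrArg _ (e₂.trans (congrArg (fun w => B.seq _ (F.f .mor w)) (cons_tail (val c X J))))
    · exact h₄
    · rw [F.f_src, F.tgt, e₆]
      exact congrArg _ (update_eq_self 0 _)
    · rw [B.R_one_tgt, B.R_src]
      simp only [h₂]
    · rw [B.R_tgt, ← h₃, B.R_one_tgt]
      refine congrArg (fun Y => (B.L .ob).R (c 0).tgt Y (dec J).1) (funext fun x => ?_)
      rw [Δ_tgt, F.f_tgt, map_cons fun i => (A i).tgt]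
      exact congrArg (fun w => F.f .ob (cons _ w)) (funext fun i => (A i.succ).R_tgt _ _ _)
    · rw [B.R_tgt, B.R_one_src]
      simp only [h₁]
    · exact h₃

end PtMor

theorem PtAlg.seq_comm_paste' {P : Operad V} {T : V} (B : PtAlg.{w} P T)
    {b e h p q ω p' b' t u : (B.L .mor).car} (e₁ : B.seq e h = B.seq p (B.seq q ω))
    (e₂ : B.seq b p = B.seq p' b') (e₃ : B.seq b' q = B.seq t u) (h₂ : B.tgt b = B.src e)
    (h₃ : B.tgt e = B.src h) (h₄ : B.tgt p = B.src q) (h₅ : B.tgt q = B.src ω)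
    (h₆ : B.tgt p' = B.src b') (h₇ : B.tgt t = B.src u) :
    B.seq (B.seq b e) h = B.seq p' (B.seq t (B.seq u ω)) := by
  have h₈ : B.tgt b = B.src p := by rw [h₂, ← B.src_seq e h, e₁, B.src_seq]
  have h₉ : B.tgt b' = B.src q := by rw [← B.tgt_seq h₆, ← e₂, B.tgt_seq h₈, h₄]
  rw [B.seq_assoc h₂ h₃, e₁, ← B.seq_assoc h₈ (by rw [B.src_seq, h₄]), e₂,
    B.seq_assoc h₆ (by rw [B.src_seq, h₉]), ← B.seq_assoc h₉ h₅, e₃, B.seq_assoc h₇]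
  rw [← B.tgt_seq h₇, ← e₃, B.tgt_seq h₉, h₅]

theorem PtAlg.seq_assoc₅ {P : Operad V} {T : V} (B : PtAlg.{w} P T) {p t u o h : (B.L .mor).car}
    (h₁ : B.tgt p = B.src t) (h₂ : B.tgt t = B.src u) (h₃ : B.tgt u = B.src o)
    (h₄ : B.tgt o = B.src h) :
    B.seq (B.seq p (B.seq t (B.seq u o))) h = B.seq (B.seq p t) (B.seq u (B.seq o h)) := by
  have h₅ : B.tgt (B.seq u o) = B.src h := by rw [B.tgt_seq h₃, h₄]
  have h₆ : B.tgt t = B.src (B.seq u o) := by rw [B.src_seq, h₂]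
  rw [B.seq_assoc (by rw [B.src_seq, h₁]) (by rw [B.tgt_seq h₆, h₅]), B.seq_assoc h₆ h₅,
    B.seq_assoc h₃ h₄, B.seq_assoc h₁ (by rw [B.src_seq, h₂])]

namespace PtMor

variable {P : Operad V} {α : PseudoComm P} {T : V} {B : PtAlg.{w} P T}

/-- The constraint for the first operations, followed by the one for the second operations, when
both have been moved past all variables but the first one, and the first operation `c 0` has been
moved past the first variable. -/
theorem Δ_comp_tail {k : ℕ} {A : Fin (k + 1) → PtAlg.{w} P T} (F : PtMor α A B)
    {m n p : Fin (k + 1) → ℕ} {ψ : ∀ i, FMap (n i) (p i)} {φ : ∀ i, FMap (m i) (n i)}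
    (d : ∀ i, DPt P .ob T (ψ i)) (c : ∀ i, DPt P .ob T (φ i))
    (X : ∀ i, Fin (m i) → ((A i).L .ob).car) (J : Fin (ark fun i : Fin k => p i.succ))
    (ih : ∀ x, B.seq ((B.L .mor).R (DPt.smk fun i => d i.succ).one ((F.fix (X 0 x)).Δ
          (fun i => c i.succ) fun i => X i.succ) J)
        ((F.fix (X 0 x)).Δ (fun i => d i.succ)
          (fun i => ((A i.succ).L .ob).R (c i.succ) (X i.succ)) J) =
      B.seq ((B.L .mor).R (DPt.thetak α (fun i => d i.succ) fun i => c i.succ)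
          (fun z => B.one ((F.fix (X 0 x)).pow .ob (fun i => X i.succ) z)) J)
        ((F.fix (X 0 x)).Δ (fun i => (d i.succ).comp (c i.succ)) (fun i => X i.succ) J))
    (y : Fin (n 0)) :
    B.seq ((B.L .mor).R (DPt.smk fun i => d i.succ).one
        (fun z => F.Δ c X (finProdFinEquiv (y, z))) J)
      ((F.fix (((A 0).L .ob).R (c 0) (X 0) y)).Δ (fun i => d i.succ)
        (fun i => ((A i.succ).L .ob).R (c i.succ) (X i.succ)) J) =
    B.seq (B.Al α (DPt.smk fun i => d i.succ) (c 0) J y fun z x => (B.L .ob).R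
        (DPt.smk fun i => c i.succ) ((F.fix (X 0 x)).pow .ob fun i => X i.succ) z)
      (B.seq ((B.L .mor).R (c 0).one (fun x => (B.L .mor).R (DPt.thetak α (fun i => d i.succ)
          fun i => c i.succ) (fun z => B.one ((F.fix (X 0 x)).pow .ob (fun i => X i.succ) z)) J) y)
        (B.seq ((B.L .mor).R (c 0).one (fun x => (F.fix (X 0 x)).Δ
            (fun i => (d i.succ).comp (c i.succ)) (fun i => X i.succ) J) y)
          (F.d 0 (c 0 y) (fun r => X 0 (fib _ y r).1) (cons (((A 0).L .ob).R (c 0) (X 0) y)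
            (val (A := fun i : Fin k => A i.succ) (fun i => d i.succ)
              (fun i => ((A i.succ).L .ob).R (c i.succ) (X i.succ)) J))))) := by
  let ω : (∀ i : Fin k, ((A i.succ).L .ob).car) → (B.L .mor).car := fun w =>
    F.d 0 (c 0 y) (fun r => X 0 (fib _ y r).1) (cons (((A 0).L .ob).R (c 0) (X 0) y) w)
  have hs : ∀ w, B.src (ω w) = (B.L .ob).R (c 0) (fun x => (F.fix (X 0 x)).f .ob w) y := fun w => by
    rw [F.src]
    simp only [update_cons]
    rfl
  have ht : ∀ w, B.tgt (ω w) = (F.fix (((A 0).L .ob).R (c 0) (X 0) y)).f .ob w := fun w => by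
    rw [F.tgt]
    simp only [update_cons]
    rfl
  have e₁ := Δ_comm (F.fix (((A 0).L .ob).R (c 0) (X 0) y)) (c 0) y (fun x => F.fix (X 0 x)) ω hs ht
    (fun i n b z w => by
      have h := F.comm i.succ 0 (Fin.succ_ne_zero i) b (c 0 y) z (fun r => X 0 (fib _ y r).1)
        (cons (((A 0).L .ob).R (c 0) (X 0) y) w)
      simp only [← cons_update, update_cons] at h
      exact h) (fun i => d i.succ) (fun i => ((A i.succ).L .ob).R (c i.succ) (X i.succ)) J
  have e₂ := B.Al_nat α (DPt.smk fun i => d i.succ) (c 0) J y fun z x =>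
    (F.fix (X 0 x)).Δ (fun i => c i.succ) (fun i => X i.succ) z
  simp only [Δ_src, Δ_tgt] at e₂
  have h₁ : ∀ z, F.Δ c X (finProdFinEquiv (y, z)) = B.seq ((B.L .mor).R (c 0).one
      (fun x => (F.fix (X 0 x)).Δ (fun i => c i.succ) (fun i => X i.succ) z) y)
      (ω (val (A := fun i : Fin k => A i.succ) (fun i => c i.succ) (fun i => X i.succ) z)) := by
    intro z
    refine (F.Δ_succ c X _).trans ((congrArg (fun w => B.seq _ (F.d 0 _ _ w))
      (val_eq_cons c X _)).trans ?_)
    exact congrArg (fun q : Fin (n 0) × Fin (ark fun i : Fin k => n i.succ) => B.seq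
      ((B.L .mor).R (c 0).one (fun x => (F.fix (X 0 x)).Δ (fun i => c i.succ)
        (fun i => X i.succ) q.2) q.1)
      (F.d 0 (c 0 q.1) (fun r => X 0 (fib _ q.1 r).1) (cons (((A 0).L .ob).R (c 0) (X 0) q.1)
        (val (A := fun i : Fin k => A i.succ) (fun i => c i.succ) (fun i => X i.succ) q.2))))
      (dec_mk (y, z))
  have h₂ : ∀ z, B.tgt ((B.L .mor).R (c 0).one (fun x => (F.fix (X 0 x)).Δ
      (fun i => c i.succ) (fun i => X i.succ) z) y) = B.src (ω (val (A := fun i : Fin k => A i.succ)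
        (fun i => c i.succ) (fun i => X i.succ) z)) := fun z => by
    rw [B.R_one_tgt, hs]
    simp only [Δ_tgt]
  have h₃ : ∀ x, B.tgt ((B.L .mor).R (DPt.smk fun i => d i.succ).one ((F.fix (X 0 x)).Δ
          (fun i => c i.succ) fun i => X i.succ) J) = B.src ((F.fix (X 0 x)).Δ (fun i => d i.succ)
          (fun i => ((A i.succ).L .ob).R (c i.succ) (X i.succ)) J) := fun x => by
    rw [B.R_one_tgt, Δ_src]
    simp only [Δ_tgt]
    rfl
  have h₄ : ∀ x, B.tgt ((B.L .mor).R (DPt.thetak α (fun i => d i.succ) fun i => c i.succ)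
      (fun z => B.one ((F.fix (X 0 x)).pow .ob (fun i => X i.succ) z)) J) =
      B.src ((F.fix (X 0 x)).Δ (fun i => (d i.succ).comp (c i.succ)) (fun i => X i.succ) J) := by
    intro x
    rw [B.R_tgt, DPt.thetak_tgt, Δ_src]
    simp only [PtAlg.tgt_one]
  have e₃ := (B.R_one_seq (c 0) h₃ y).symm.trans ((congrArg (fun Y => (B.L .mor).R (c 0).one Y y)
    (funext ih)).trans (B.R_one_seq (c 0) h₄ y))
  simp only [h₁]
  rw [B.R_one_seq _ h₂]
  refine B.seq_comm_paste' e₁ e₂ e₃ ?_ ?_ ?_ ?_ ?_ ?_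
  · rw [B.R_one_tgt, B.R_one_src]
    simp only [h₂]
  · rw [B.R_one_tgt, Δ_src]
    simp only [ht]
    rfl
  · rw [B.Al_tgt, B.R_one_src]
    simp only [Δ_src]
  · rw [B.R_one_tgt, hs]
    simp only [Δ_tgt]
  · rw [B.Al_tgt, B.R_one_src]
    simp only [B.R_one_src, Δ_src]
  · rw [B.R_one_tgt, B.R_one_src]
    simp only [h₄]

/-- The constraint for `c` followed by the one for `d` is the one for the composites `d i ∘ c i`,
preceded by the pseudofunctoriality constraint of the smash product. -/
theorem Δ_comp : ∀ {k : ℕ} {A : Fin k → PtAlg.{w} P T} (F : PtMor α A B)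
    {m n p : Fin k → ℕ} {ψ : ∀ i, FMap (n i) (p i)} {φ : ∀ i, FMap (m i) (n i)}
    (d : ∀ i, DPt P .ob T (ψ i)) (c : ∀ i, DPt P .ob T (φ i))
    (X : ∀ i, Fin (m i) → ((A i).L .ob).car) (J : Fin (ark p)),
    B.seq ((B.L .mor).R (DPt.smk d).one (F.Δ c X) J)
        (F.Δ d (fun i => ((A i).L .ob).R (c i) (X i)) J) =
      B.seq ((B.L .mor).R (DPt.thetak α d c) (fun z => B.one (F.pow .ob X z)) J)
        (F.Δ (fun i => (d i).comp (c i)) X J)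
  | 0, A, F, m, n, p, _, _, d, c, X, J => by
    have hw : ∀ w w' : ∀ i, ((A i).L .ob).car, w = w' := fun w w' => funext fun i => i.elim0
    refine congrArg₂ B.seq ?_ rfl
    refine (congrFun ((B.L .mor).R_iota_some isPi_some _) J).trans (Eq.symm ?_)
    exact (congrFun ((B.L .mor).R_iota_some isPi_some _) J).trans
      (congrArg (fun w => B.one (F.f .ob w)) (hw _ _))
  | k + 1, A, F, m, n, p, ψ, φ, d, c, X, J => by
    have e₁ := fun y => F.Δ_comp_tail d c X (dec J).2 (fun x => Δ_comp (F.fix (X 0 x))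
      (fun i => d i.succ) (fun i => c i.succ) (fun i => X i.succ) (dec J).2) y
    have e₂ := DPt.R_smk_one_succ d (B.L .mor) (F.Δ c X) J
    have e₃ := F.Δ_succ d (fun i => ((A i).L .ob).R (c i) (X i)) J
    have e₄ := F.Δ_succ (fun i => (d i).comp (c i)) X J
    have e₅ := DPt.R_thetak_succ α B d c (F.pow .ob X) J
    simp only [pow_mk] at e₅
    refine (congrArg₂ B.seq e₂ e₃).trans (Eq.trans ?_ (congrArg₂ B.seq e₅ e₄).symm)
    have e₆ : ∀ Z, (B.L .mor).R ((d 0).comp (c 0)).one Z = (B.L .mor).R (d 0).one _ :=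
      fun Z => (congrArg (fun f => (B.L .mor).R f Z) (DPt.comp_one (d 0) (c 0))).trans
        ((B.L .mor).R_comp _ _ Z)
    rw [e₆, e₆]
    have e₇ := F.cmp 0 (compE (ψ 0) (φ 0) (dec J).1) (d 0 (dec J).1)
      (fun r => c 0 ((ψ 0).fib (dec J).1 r).1)
      (fun r => X 0 (fib ((ψ 0).comp (φ 0)) (dec J).1 r).1) (val (fun i => (d i).comp (c i)) X J)
    have hw : (val (fun i => (d i).comp (c i)) X J : ∀ i, ((A i).L .ob).car) =
        val d (fun i => ((A i).L .ob).R (c i) (X i)) J :=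
      funext fun i => congrFun (((A i).L .ob).R_comp (d i) (c i) (X i)) _
    simp only [compE_symm, hw] at e₇
    have e₈ : ∀ a {n : ℕ} (b : T ⟶ (P.O n).car .ob) z,
        F.d 0 b z (val d (fun i => ((A i).L .ob).R (c i) (X i)) J) = F.d 0 b z (cons a
          (val (A := fun i : Fin k => A i.succ) (fun i => d i.succ)
            (fun i => ((A i.succ).L .ob).R (c i.succ) (X i.succ)) (dec J).2)) := fun a _ b z => by
      rw [← F.d_update 0 b z _ a]
      exact congrArg _ (update_tail _ a)
    have h₀ : ∀ y, B.tgt ((B.L .mor).R (DPt.smk fun i => d i.succ).one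
          (fun z => F.Δ c X (finProdFinEquiv (y, z))) (dec J).2) =
        B.src ((F.fix (((A 0).L .ob).R (c 0) (X 0) y)).Δ (fun i => d i.succ)
          (fun i => ((A i.succ).L .ob).R (c i.succ) (X i.succ)) (dec J).2) := fun y => by
      rw [B.R_one_tgt, Δ_src]
      refine congrArg (fun Y => (B.L .ob).R _ Y (dec J).2) (funext fun z => ?_)
      refine (F.Δ_tgt c X _).trans (congrArg (F.f .ob) ((val_eq_cons c X _).trans ?_))
      exact congrArg (fun q : Fin (n 0) × Fin (ark fun i : Fin k => n i.succ) => (cons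
        (((A 0).L .ob).R (c 0) (X 0) q.1) (val (A := fun i : Fin k => A i.succ)
          (fun i => c i.succ) (fun i => X i.succ) q.2) : ∀ i, ((A i).L .ob).car)) (dec_mk (y, z))
    have h₁ : ∀ x, B.tgt ((B.L .mor).R (DPt.thetak α (fun i => d i.succ) fun i => c i.succ)
        (fun z => B.one ((F.fix (X 0 x)).pow .ob (fun i => X i.succ) z)) (dec J).2) =
        B.src ((F.fix (X 0 x)).Δ (fun i => (d i.succ).comp (c i.succ)) (fun i => X i.succ)
          (dec J).2) := fun x => by
      rw [B.R_tgt, DPt.thetak_tgt, Δ_src]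
      simp only [PtAlg.tgt_one]
    have h₃ : ∀ y, B.tgt (B.Al α (DPt.smk fun i => d i.succ) (c 0) (dec J).2 y fun z x =>
          (B.L .ob).R (DPt.smk fun i => c i.succ)
            ((F.fix (X 0 x)).pow .ob fun i => X i.succ) z) =
        B.src ((B.L .mor).R (c 0).one (fun x => (B.L .mor).R (DPt.thetak α (fun i => d i.succ)
          fun i => c i.succ) (fun z => B.one ((F.fix (X 0 x)).pow .ob (fun i => X i.succ) z))
            (dec J).2) y) := fun y => by
      rw [B.Al_tgt, B.R_one_src]
      refine congrArg (fun Y => (B.L .ob).R (c 0) Y y) (funext fun x => ?_)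
      rw [B.R_src, DPt.thetak_src, LAlg.R_cast, LAlg.R_comp]
      simp only [PtAlg.src_one]
    have h₄ : ∀ y, B.tgt ((B.L .mor).R (c 0).one (fun x => (B.L .mor).R (DPt.thetak α
          (fun i => d i.succ) fun i => c i.succ)
            (fun z => B.one ((F.fix (X 0 x)).pow .ob (fun i => X i.succ) z)) (dec J).2) y) =
        B.src ((B.L .mor).R (c 0).one (fun x => (F.fix (X 0 x)).Δ
          (fun i => (d i.succ).comp (c i.succ)) (fun i => X i.succ) (dec J).2) y) := fun y => by
      rw [B.R_one_tgt, B.R_one_src]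
      simp only [h₁]
    have h₅ : ∀ y, B.tgt ((B.L .mor).R (c 0).one (fun x => (F.fix (X 0 x)).Δ
          (fun i => (d i.succ).comp (c i.succ)) (fun i => X i.succ) (dec J).2) y) =
        B.src (F.d 0 (c 0 y) (fun r => X 0 (fib _ y r).1) (cons (((A 0).L .ob).R (c 0) (X 0) y)
          (val (A := fun i : Fin k => A i.succ) (fun i => d i.succ)
            (fun i => ((A i.succ).L .ob).R (c i.succ) (X i.succ)) (dec J).2))) := fun y => by
      rw [B.R_one_tgt, F.src]
      simp only [Δ_tgt, update_cons]
      exact congrArg (fun w => (B.L .ob).R (c 0) (fun x => F.f .ob (cons (X 0 x) w)) y)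
        (funext fun i => congrFun (((A i.succ).L .ob).R_comp (d i.succ) (c i.succ) _) _)
    have h₂ := B.R_one_seq (d 0) h₀ (dec J).1
    rw [funext e₁, B.R_one_seq, B.R_one_seq, B.R_one_seq] at h₂
    · rw [← B.seq_assoc]
      · refine (congrArg (B.seq · _) h₂.symm).trans (Eq.trans ?_ (congrArg (B.seq (B.seq _ _))
          (congrArg (B.seq _) (e₇.trans (congrArg (F.d 0 _ _) hw.symm)))))
        refine (B.seq_assoc₅ ?_ ?_ ?_ ?_).trans (congrArg (B.seq (B.seq _ _)) (congrArg (B.seq _)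
          (congrArg (B.seq · _) (congrArg ((B.L .mor).op _) (funext fun r => (e₈ _ _ _).symm)))))
        · rw [B.R_one_tgt, B.R_one_src]
          simp only [h₃]
        · rw [B.R_one_tgt, B.R_one_src]
          simp only [h₄]
        · rw [B.R_one_tgt, B.R_one_src]
          simp only [h₅]
        · rw [B.R_one_tgt]
          refine Eq.trans ?_ (F.d_val_src d (fun i => ((A i).L .ob).R (c i) (X i)) J).symm
          simp only [F.tgt, update_cons]
          rfl
      · rw [B.R_one_tgt, B.R_one_src]
        simp only [h₀]
      · exact F.Δ_succ_comp d (fun i => ((A i).L .ob).R (c i) (X i)) J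
    · exact h₅
    · simpa only [B.src_seq] using h₄
    · simpa only [B.src_seq] using h₃

end PtMor

/-! ### The powers of an algebra as an algebra over the category of operators -/

namespace RData

variable {P : Operad V} {A : OAlg P} {T : V} {l : Lvl} {m n p : ℕ}

/-- The coordinates of a generalized object or arrow of a power of `A`. -/
noncomputable def cr (x : T ⟶ ((RData A).X m).car l) : Fin m → ((A.pt T).L l).car :=
  co (A := fun _ : Fin m => A.C) x

theorem ext_cr {x y : T ⟶ ((RData A).X m).car l} (h : ∀ i, cr x i = cr y i) : x = y :=
  VCat.co_ext h

/-- The generalized object or arrow of a power of `A` with given coordinates. -/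
noncomputable def mkr (x : Fin m → ((A.pt T).L l).car) : T ⟶ ((RData A).X m).car l :=
  tup (A := fun _ : Fin m => A.C) x

theorem cr_mkr (x : Fin m → ((A.pt T).L l).car) : cr (mkr x) = x :=
  funext fun i => co_tup (B := fun _ : Fin m => A.C) x i

theorem cr_op (φ : FMap m n) (c : DPt P l T φ) (x : T ⟶ ((RData A).X m).car l) :
    cr ((RData A).op φ c x) = ((A.pt T).L l).R c (cr x) := by
  refine (congrArg cr (VFun.tuple_ap _ _)).trans ((cr_mkr _).trans (funext fun j => ?_))
  refine (VFun.comp_ap' _ _ _).trans (congrArg (A.θ _).ap ((VFun.pair_ap _ _ _).trans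
    (congrArg₂ pr ?_ ((VFun.tuple_ap _ _).trans (congrArg tup (funext fun r => ?_))))))
  · refine (VFun.comp_ap' _ _ _).trans ((congrArg _ (VFun.fst_ap _ _ _ _)).trans ?_)
    exact (VFun.proj_ap (fun j => P.O (φ.c j)) j _).trans (co_tup _ j)
  · refine (VFun.comp_ap' _ _ _).trans ((congrArg _ (VFun.snd_ap _ _ _ _)).trans ?_)
    exact VFun.proj_ap (fun _ : Fin m => A.C) _ _

theorem cr_zero : cr ((RData A).zero : T ⟶ ((RData A).X m).car l) =
    fun _ => ((A.pt T).L l).zero := funext fun i => by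
  refine (co_deg (B := fun _ : Fin m => A.C) _ i).trans ?_
  have h : co (A := fun _ : Fin m => A.C) (terminal.from T ≫ (RData A).base m) i = A.zero :=
    (comp_co (B := fun _ : Fin m => A.C) _ _ i).trans
      ((congrArg (terminal.from T ≫ ·) (co_tup (B := fun _ : Fin m => A.C) _ i)).trans
        (A.comp_zero _))
  refine (congrArg (A.C.deg l) h).trans ?_
  cases l
  · rfl
  · exact A.one_zero

theorem cr_src (x : T ⟶ ((RData A).X m).car .mor) (i : Fin m) :
    cr (x ≫ ((RData A).X m).src) i = (A.pt T).src (cr x i) :=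
  co_src (B := fun _ : Fin m => A.C) x i

theorem cr_src' (x : T ⟶ ((RData A).X m).car .mor) :
    cr (x ≫ ((RData A).X m).src) = fun i => (A.pt T).src (cr x i) :=
  funext (cr_src x)

theorem cr_tgt (x : T ⟶ ((RData A).X m).car .mor) (i : Fin m) :
    cr (x ≫ ((RData A).X m).tgt) i = (A.pt T).tgt (cr x i) :=
  co_tgt (B := fun _ : Fin m => A.C) x i

theorem cr_tgt' (x : T ⟶ ((RData A).X m).car .mor) :
    cr (x ≫ ((RData A).X m).tgt) = fun i => (A.pt T).tgt (cr x i) :=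
  funext (cr_tgt x)

theorem cr_one (x : T ⟶ ((RData A).X m).car .ob) (i : Fin m) :
    cr (((RData A).X m).one x) i = (A.pt T).one (cr x i) :=
  co_one (B := fun _ : Fin m => A.C) x i

theorem cr_one' (x : T ⟶ ((RData A).X m).car .ob) :
    cr (((RData A).X m).one x) = fun i => (A.pt T).one (cr x i) :=
  funext (cr_one x)

theorem cr_seq {f g : T ⟶ ((RData A).X m).car .mor}
    (h : f ≫ ((RData A).X m).tgt = g ≫ ((RData A).X m).src) (i : Fin m) :
    cr (((RData A).X m).seq f g) i = (A.pt T).seq (cr f i) (cr g i) :=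
  co_seq (B := fun _ : Fin m => A.C) h i

theorem comp_cr {S : V} (t : S ⟶ T) (x : T ⟶ ((RData A).X m).car l) (i : Fin m) :
    cr (t ≫ x) i = t ≫ cr x i :=
  comp_co (B := fun _ : Fin m => A.C) t x i

theorem isAlgebra (A : OAlg P) : (RData A).IsAlgebra where
  base_right φ c := ext_cr fun j => by rw [cr_op, cr_zero, cr_zero, LAlg.R_zero]
  base_left c x := ext_cr fun j => by
    rw [cr_op, cr_zero]
    exact LAlg.op_zero _ (c_eq_zero fun _ => Option.some_ne_none _ ∘ Eq.symm) _ _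
  id x := ext_cr fun j => by rw [cr_op, LAlg.R_iota_some]
  comp ψ φ d c x := ext_cr fun j => by rw [cr_op, cr_op, cr_op, LAlg.R_comp]

end RData

/-- The algebra over the category of operators given by the powers of `A`. -/
noncomputable abbrev RAlg {P : Operad V} (A : OAlg P) : DAlg P := ⟨RData A, RData.isAlgebra A⟩

namespace PtMor

variable {P : Operad V} {α : PseudoComm P} {S T : V} {B : OAlg P}

theorem comp_R {A : OAlg P} {l : Lvl} {m n : ℕ} {φ : FMap m n} (t : S ⟶ T) (c : DPt P l T φ)
    (X : Fin m → ((A.pt T).L l).car) (j : Fin n) :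
    t ≫ ((A.pt T).L l).R c X j = ((A.pt S).L l).R (c.res t) (fun i => t ≫ X i) j :=
  A.comp_op t _ _

theorem comp_Δ (t : S ⟶ T) : ∀ {k : ℕ} {A : Fin k → OAlg P}
    (F : PtMor α (fun i => (A i).pt T) (B.pt T)) (G : PtMor α (fun i => (A i).pt S) (B.pt S))
    (_ : ∀ w, t ≫ F.f .ob w = G.f .ob fun i => t ≫ w i)
    (_ : ∀ i {n : ℕ} (c : T ⟶ (P.O n).car .ob) y w,
      t ≫ F.d i c y w = G.d i (t ≫ c) (fun r => t ≫ y r) fun j => t ≫ w j)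
    {m n : Fin k → ℕ} {φ : ∀ i, FMap (m i) (n i)} (c : ∀ i, DPt P .ob T (φ i))
    (X : ∀ i, Fin (m i) → (T ⟶ (A i).C.car .ob)) (J : Fin (ark n)),
    t ≫ F.Δ c X J = G.Δ (fun i => (c i).res t) (fun i r => t ≫ X i r) J
  | 0, _, F, G, hf, hd, _, _, _, c, X, J =>
    (VCat.comp_one _ _ _).trans (congrArg B.C.one ((hf _).trans
      (congrArg _ (funext fun i => i.elim0))))
  | k + 1, A, F, G, hf, hd, _, _, _, c, X, J => by
    have e : ∀ a w, (fun i => t ≫ (cons (A := fun i => (A i).pt T) (l := .ob) a w) i) =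
        cons (A := fun i => (A i).pt S) (l := .ob) (t ≫ a) fun i => t ≫ w i := fun a w =>
      funext (Fin.cases rfl fun _ => rfl)
    refine (VCat.comp_seq B.C t (F.Δ_succ_comp c X J)).trans (congrArg₂ B.C.seq ?_ ?_)
    · refine (comp_R t (c 0).one _ _).trans ?_
      rw [DPt.res_one]
      refine congrArg (fun Y => ((B.pt S).L .mor).R ((c 0).res t).one Y (dec J).1)
        (funext fun x => ?_)
      refine comp_Δ t (F.fix (X 0 x)) (G.fix (t ≫ X 0 x)) (fun w => (hf _).trans ?_)
        (fun i n b y w => (hd _ _ _ _).trans ?_) (fun i => c i.succ) (fun i => X i.succ) (dec J).2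
      · exact congrArg (G.f .ob) (e _ w)
      · exact congrArg (G.d i.succ _ _) (e _ w)
    · refine (hd _ _ _ _).trans (congrArg (G.d 0 _ _) (funext fun i => ?_))
      exact comp_R t (c i) (X i) _

end PtMor

namespace PreO

open RData

variable {P : Operad V} {α : PseudoComm P} {k : ℕ} {A : Fin k → OAlg P} {B : OAlg P}
  {F : PreO A B}

/-- The image of a multimorphism: the powers of its functor, with the constraint `PtMor.Δ`. -/
noncomputable def toD (hF : F.IsHom α) : PreD (fun i => RAlg (A i)) (RAlg B) where
  F m := VFun.tuple fun J => (VFun.tuple fun i =>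
    (VFun.proj (fun i => (RData (A i)).X (m i)) i).comp
      (VFun.proj (fun _ : Fin (m i) => (A i).C) (crd J i))).comp F.F
  δ φ := PreD.mkδ (X := fun i => RAlg (A i)) (Y := RAlg B) φ fun {T} c x =>
    mkr (A := B) fun J => (pt hF T).Δ c (fun i => cr (x i)) J

variable (hF : F.IsHom α) {T : V} {m n : Fin k → ℕ}

theorem cr_f {l : Lvl} (x : ∀ i, T ⟶ ((RData (A i)).X (m i)).car l) :
    cr ((toD hF).f x) = (pt hF T).pow l fun i => cr (x i) := by
  refine (congrArg cr (VFun.tuple_ap _ _)).trans ((cr_mkr _).trans (funext fun J => ?_))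
  refine (VFun.comp_ap' _ _ _).trans (congrArg F.F.ap ((VFun.tuple_ap _ _).trans
    (congrArg tup (funext fun i => ?_))))
  refine (VFun.comp_ap' _ _ _).trans ((VFun.proj_ap (fun _ : Fin (m i) => (A i).C) _ _).trans ?_)
  exact congrArg (co · _) ((VFun.proj_ap (fun i => (RData (A i)).X (m i)) i _).trans (co_tup _ i))

theorem cr_d (φ : ∀ i, FMap (m i) (n i)) (c : ∀ i, DPt P .ob T (φ i))
    (x : ∀ i, T ⟶ ((RData (A i)).X (m i)).car .ob) :
    cr ((toD hF).d φ c x) = (pt hF T).Δ c fun i => cr (x i) := by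
  refine (congrArg cr (PreD.mkδ_eval (X := fun i => RAlg (A i)) (Y := RAlg B) φ
    (fun {T} c x => mkr (A := B) fun J =>
      (pt hF T).Δ c (fun i => cr (x i)) J) (fun t c x => ?_) c x)).trans (cr_mkr _)
  refine ext_cr fun J => (comp_cr t _ J).trans ((congrArg (t ≫ ·) (congrFun (cr_mkr _) J)).trans
    (Eq.trans ?_ (congrFun (cr_mkr _) J).symm))
  refine (PtMor.comp_Δ t (pt hF _) (pt hF _) (fun w => F.comp_f t w)
    (fun i _ c y w => F.comp_d t i c y w) c _ J).trans ?_
  exact congrArg ((pt hF _).Δ _ · J) (funext fun i => funext fun r => (comp_cr t (x i) r).symm)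

/-- The image of a multimorphism is a multimorphism. -/
theorem isHom_toD : (toD hF).IsHom α where
  based x i h := ext_cr fun J => by
    rw [cr_f, cr_zero]
    exact hF.based _ i ((congrArg (fun y => cr y (crd J i)) h).trans (congrFun cr_zero _))
  src φ c x := ext_cr fun J => by rw [cr_src, cr_d, PtMor.Δ_src, cr_op, cr_f]
  tgt φ c x := ext_cr fun J => by
    rw [cr_tgt, cr_d, PtMor.Δ_tgt, cr_f]
    simp only [cr_op]
    rfl
  nat φ c x := ext_cr fun J => by
    have h₁ : (RData B).op (smk φ) (DPt.smk c) ((toD hF).f x) ≫ ((RData B).X _).tgt =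
        (toD hF).d φ (fun i => (c i).tgt) (fun i => x i ≫ ((RData (A i)).X _).tgt) ≫
          ((RData B).X _).src := ext_cr fun J => by
      rw [cr_src, cr_tgt, cr_op, cr_f, cr_d, PtMor.Δ_src, PtAlg.R_tgt, DPt.smk_tgt]
      simp only [PtMor.pow, PtMor.f_tgt, cr_tgt']
      rfl
    have h₂ : (toD hF).d φ (fun i => (c i).src) (fun i => x i ≫ ((RData (A i)).X _).src) ≫
        ((RData B).X _).tgt = ((toD hF).f fun i => (RData (A i)).op (φ i) (c i) (x i)) ≫
          ((RData B).X _).src := ext_cr fun J => by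
      rw [cr_src, cr_tgt, cr_f, cr_d, PtMor.Δ_tgt, PtMor.pow, PtMor.f_src]
      simp only [cr_op, cr_src']
      exact congrArg _ (funext fun i => (((A i).pt _).R_src _ _ _).symm)
    refine (cr_seq h₁ J).trans (Eq.trans ?_ (cr_seq h₂ J).symm)
    rw [cr_op, cr_f, cr_d, cr_d, cr_f]
    refine Eq.trans ?_ (((pt hF _).Δ_nat c (fun i => cr (x i)) J).trans ?_)
    · simp only [cr_tgt']
    · simp only [cr_src', cr_op]
      rfl
  inv φ c x := by
    choose g h₁ h₂ h₃ h₄ using (pt hF _).Δ_inv c fun i => cr (x i)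
    have e₁ : mkr g ≫ ((RData B).X _).src = (toD hF).d φ c x ≫ ((RData B).X _).tgt :=
      ext_cr fun J => by rw [cr_src, cr_tgt, cr_mkr, cr_d, h₁]
    have e₂ : mkr g ≫ ((RData B).X _).tgt = (toD hF).d φ c x ≫ ((RData B).X _).src :=
      ext_cr fun J => by rw [cr_src, cr_tgt, cr_mkr, cr_d, h₂]
    refine ⟨mkr g, e₁, e₂, ext_cr fun J => ?_, ext_cr fun J => ?_⟩
    · rw [cr_seq e₁.symm, cr_one, cr_src, cr_mkr, cr_d, h₃]
    · rw [cr_seq e₂, cr_one, cr_tgt, cr_mkr, cr_d, h₄]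
  base_right φ c x i h := ext_cr fun J => by
    rw [cr_d, cr_one, cr_zero]
    refine ((pt hF _).Δ_zero c _ J i fun r => ?_).trans (B.one_zero).symm
    rw [h, cr_zero]
  base_left φ c x i h := ext_cr fun J => by
    rw [cr_d, cr_one, cr_zero]
    refine ((pt hF _).Δ_zero c _ J i fun r => ?_).trans (B.one_zero).symm
    exact nomatch ((φ i).fib_spec _ r).symm.trans (congrFun h _)
  strict φ h x := ext_cr fun J => by
    rw [cr_d, cr_one, cr_f, PtMor.Δ_iota]
    simp only [cr_op]
    rfl
  comp ψ φ d c x := ext_cr fun J => by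
    refine (cr_seq ?_ J).trans (Eq.trans ?_ (cr_seq ?_ J).symm)
    · refine ext_cr fun J => ?_
      rw [cr_src, cr_tgt, cr_op, cr_d, cr_d, PtMor.Δ_src, PtAlg.R_one_tgt]
      simp only [PtMor.Δ_tgt, cr_op]
      rfl
    · rw [cr_op, cr_op, cr_d, cr_d, cr_d]
      refine Eq.trans ?_ (((pt hF _).Δ_comp d c (fun i => cr (x i)) J).trans ?_)
      · simp only [cr_op]
      · rw [cr_one', cr_f]
    · refine ext_cr fun J => ?_
      rw [cr_src, cr_tgt, cr_op, cr_d, PtMor.Δ_src, PtAlg.R_tgt, DPt.thetak_tgt]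
      simp only [cr_one', PtAlg.tgt_one, cr_f]

end PreO

/-! ### Multimorphisms are determined by operations in a single variable -/

theorem VCat.Inv.cancel {A : VCat V} {T : V} {e f g : T ⟶ A.car .mor} (he : A.Inv e)
    (hf : e ≫ A.tgt = f ≫ A.src) (hg : e ≫ A.tgt = g ≫ A.src) (h : A.seq e f = A.seq e g) :
    f = g := by
  obtain ⟨e', h₁, h₂, -, h₄⟩ := he
  have key : ∀ f, e ≫ A.tgt = f ≫ A.src → f = A.seq e' (A.seq e f) := fun f hf => by
    rw [← A.seq_assoc h₂ hf, h₄, hf, A.one_seq]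
  rw [key f hf, h, ← key g hg]

namespace DPt

variable {P : Operad V} {T : V} {l : Lvl}

theorem inv_thetak (α : PseudoComm P) : ∀ {k : ℕ} {m n p : Fin k → ℕ} {ψ : ∀ i, FMap (n i) (p i)}
    {φ : ∀ i, FMap (m i) (n i)} (d : ∀ i, DPt P .ob T (ψ i)) (c : ∀ i, DPt P .ob T (φ i))
    (j : Fin (ark p)), (P.O _).Inv (thetak α d c j)
  | 0, _, _, _, _, _, _, _, _ => inv_iota _ _
  | _ + 1, _, _, _, _, _, d, c, j => VCat.inv_seq _
    (congrFun (thetaSeq_comp α (d 0) (smk fun i => d i.succ) (c 0) (smk fun i => c i.succ) rfl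
      (FMap.smk_comp _ _).symm (one_src _) (thetak_src α _ _)) j)
    (inv_cast _ (fun _ => P.inv_cmp _ (VCat.inv_one ..) fun _ => P.inv_cmp _ (α.inv _ _)
      fun _ => VCat.inv_one ..) j)
    (VFun.ap_inv _ (P.inv_cmp _ (VCat.inv_one ..) fun _ => inv_thetak α _ _ _))

/-- The elements of `Π` which act by selecting coordinates: no fibre is empty. -/
def IsSel {m n : ℕ} {φ : FMap m n} (c : DPt P l T φ) : Prop :=
  IsIota c ∧ ∀ j, ∃ i, φ i = some j

theorem isSel_iota_some {m : ℕ} : IsSel (iota some isPi_some : DPt P l T (some : FMap m m)) :=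
  ⟨⟨_, rfl⟩, fun j => ⟨j, rfl⟩⟩

theorem isSel_smk : ∀ {k : ℕ} {m n : Fin k → ℕ} {φ : ∀ i, FMap (m i) (n i)}
    {c : ∀ i, DPt P l T (φ i)} (_ : ∀ i, IsSel (c i)), IsSel (smk c)
  | 0, _, _, _, _, _ => isSel_iota_some
  | k + 1, _, _, φ, c, h => by
    have h' := isSel_smk fun i => h i.succ
    constructor
    · choose g hg using fun i => (h i).1
      exact ⟨isPi_smk g, (congrArg smk (funext hg)).trans (smk_iota g)⟩
    · intro j
      obtain ⟨x, hx⟩ := (h 0).2 (dec j).1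
      obtain ⟨y, hy⟩ := h'.2 (dec j).2
      exact ⟨finProdFinEquiv (x, y), (sm_eq_some (φ 0) _ _ _).2 (by rw [dec_mk]; exact ⟨hx, hy⟩)⟩

theorem IsSel.R_eq {m n : ℕ} {φ : FMap m n} {c : DPt P l T φ} (h : IsSel c) (B : LAlg.{w} P T l)
    (X : Fin m → B.car) {i : Fin m} {j : Fin n} (hij : φ i = some j) : B.R c X j = X i := by
  obtain ⟨⟨g, rfl⟩, -⟩ := h
  exact B.R_iota g X hij

theorem IsSel.one {m n : ℕ} {φ : FMap m n} {c : DPt P .ob T φ} (h : IsSel c) : IsSel c.one := by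
  obtain ⟨⟨g, rfl⟩, h⟩ := h
  exact ⟨⟨g, iota_one g⟩, h⟩

end DPt

namespace PreD

open DPt

variable {P : Operad V} {α : PseudoComm P} {k : ℕ} {X : Fin k → DAlg P} {Y : DAlg P}

/-- Every family of operations is composed of families in which all operations but one select
coordinates, and the constraint of a composite is determined by the constraints of its factors,
since the pseudofunctoriality constraint of the smash product is invertible. -/
theorem eq_of_single {G H : PreD X Y} (hG : G.IsHom α) (hH : H.IsHom α) (hF : ∀ m, G.F m = H.F m)
    (hd : ∀ (t : Fin k) {T : V} {m n : Fin k → ℕ} (φ : ∀ i, FMap (m i) (n i))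
      (c : ∀ i, DPt P .ob T (φ i)) (x : ∀ i, T ⟶ ((X i).X (m i)).car .ob),
      (∀ i, i ≠ t → IsSel (c i)) → G.d φ c x = H.d φ c x) : G = H := by
  have hf : ∀ {T : V} {m : Fin k → ℕ} (x : ∀ i, T ⟶ ((X i).X (m i)).car .ob), G.f x = H.f x :=
    fun x => congrArg (fun F => VFun.ap F (tup x)) (hF _)
  have key : ∀ (s : ℕ) {T : V} {m n : Fin k → ℕ} (φ : ∀ i, FMap (m i) (n i))
      (c : ∀ i, DPt P .ob T (φ i)) (x : ∀ i, T ⟶ ((X i).X (m i)).car .ob),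
      (∀ i : Fin k, s ≤ i → IsIota (c i)) → G.d φ c x = H.d φ c x := by
    intro s
    induction s with
    | zero =>
      intro T m n φ c x hc
      choose g hg using fun i => hc i (Nat.zero_le _)
      obtain rfl : c = fun i => iota (φ i) (g i) := funext hg
      rw [hG.strict, hH.strict, hf]
    | succ s ih =>
      intro T m n φ c x hc
      by_cases hs : s < k
      swap
      · exact ih φ c x fun i hi => absurd (hi.trans_lt i.2) hs
      have key : ∀ i, ∃ (p : ℕ) (ψ : FMap p (n i)) (μ : FMap (m i) p) (h : ψ.comp μ = φ i)
          (d : DPt P .ob T ψ) (b : DPt P .ob T μ), (d.comp b).cast h = c i ∧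
            (i ≠ ⟨s, hs⟩ → IsSel d) ∧ (s ≤ i → IsIota b) := by
        intro i
        -- The operation with index `s` goes into the outer family `d`, the others into the inner
        -- family `b`; the complementary factors are identities.
        by_cases hi : i = ⟨s, hs⟩
        · have e : (φ i).comp some = φ i := rfl
          refine ⟨_, φ i, some, e, c i, iota some isPi_some, ?_, absurd hi, fun _ => ⟨_, rfl⟩⟩
          exact ext_of_R fun B X => by rw [B.R_cast, B.R_comp, B.R_iota_some]
        · refine ⟨_, some, φ i, funext fun z => Option.bind_fun_some _, iota some isPi_some, c i, ?_,
            fun _ => isSel_iota_some, fun h => hc i (Nat.lt_of_le_of_ne h fun e => hi (Fin.ext e.symm))⟩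
          exact ext_of_R fun B X => by rw [B.R_cast, B.R_comp, B.R_iota_some]
      choose p ψ μ h d b hc' hd' hb using key
      obtain rfl : φ = fun i => (ψ i).comp (μ i) := (funext h).symm
      obtain rfl : c = fun i => (d i).comp (b i) := funext fun i => (hc' i).symm
      have h₁ := hG.comp ψ μ d b x
      have h₂ := hH.comp ψ μ d b x
      rw [ih μ b x hb, hd ⟨s, hs⟩ ψ d _ hd'] at h₁
      rw [← hf] at h₂
      have e : ∀ {K : PreD X Y}, K.IsHom α → G.f x = K.f x →
          Y.op _ (thetak α d b) ((Y.X _).one (G.f x)) ≫ (Y.X _).tgt =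
            K.d (fun i => (ψ i).comp (μ i)) (fun i => (d i).comp (b i)) x ≫ (Y.X _).src :=
        fun hK e => by rw [hK.src, Y.op_tgt, thetak_tgt, VCat.one_tgt, e]
      exact VCat.Inv.cancel (Y.inv_op (inv_thetak α d b) (VCat.inv_one _ _)) (e hG rfl) (e hH (hf x))
        (h₁.symm.trans h₂)
  exact ext_d hF fun φ c x => key k φ c x fun i hi => absurd i.2 hi.not_gt

end PreD

namespace PtMor

open DPt

variable {P : Operad V} {α : PseudoComm P} {T : V} {B : PtAlg.{w} P T}

theorem Δ_isIota {k : ℕ} {A : Fin k → PtAlg.{w} P T} (F : PtMor α A B)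
    {m n : Fin k → ℕ} {φ : ∀ i, FMap (m i) (n i)} {c : ∀ i, DPt P .ob T (φ i)}
    (h : ∀ i, IsIota (c i)) (X : ∀ i, Fin (m i) → ((A i).L .ob).car) (J : Fin (ark n)) :
    F.Δ c X J = B.one (F.f .ob (val c X J)) := by
  choose g hg using h
  obtain rfl : c = fun i => iota (φ i) (g i) := funext hg
  exact F.Δ_iota g X J

/-- If all operations but one select coordinates, only one step of the constraint is not an
identity. -/
theorem Δ_single : ∀ {k : ℕ} {A : Fin k → PtAlg.{w} P T} (F : PtMor α A B)
    {m n : Fin k → ℕ} {φ : ∀ i, FMap (m i) (n i)} (c : ∀ i, DPt P .ob T (φ i))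
    (X : ∀ i, Fin (m i) → ((A i).L .ob).car) (J : Fin (ark n)) (t : Fin k)
    (_ : ∀ i, i ≠ t → IsSel (c i)), F.Δ c X J =
      F.d t (c t (crd J t)) (fun r => X t (fib (φ t) (crd J t) r).1) (val c X J)
  | 0, _, _, _, _, _, _, _, _, t, _ => t.elim0
  | k + 1, A, F, m, n, φ, c, X, J, t, h => by
    revert h
    refine Fin.cases (fun h => ?_) (fun t h => ?_) t
    · have e : (fun x => Δ (F.fix (X 0 x)) (fun i => c i.succ) (fun i => X i.succ) (dec J).2) =
          fun x => B.one ((F.fix (X 0 x)).f .ob (val (A := fun i : Fin k => A i.succ)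
            (fun i => c i.succ) (fun i => X i.succ) (dec J).2)) :=
        funext fun x => Δ_isIota _ (fun i => (h i.succ (Fin.succ_ne_zero i)).1) _ _
      refine (F.Δ_succ c X J).trans ((congrArg (fun W => B.seq ((B.L .mor).R (c 0).one W (dec J).1)
        _) e).trans ?_)
      rw [B.R_one]
      exact B.one_seq' (F.d_val_src c X J)
    · have h₀ := h 0 (Fin.succ_ne_zero t).symm
      obtain ⟨x, hx⟩ := h₀.2 (dec J).1
      have e₁ := h₀.one.R_eq (B.L .mor) (fun x => Δ (F.fix (X 0 x)) (fun i => c i.succ)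
        (fun i => X i.succ) (dec J).2) hx
      have e₂ : F.d 0 (c 0 (dec J).1) (fun r => X 0 ((fib _ (dec J).1 r).1)) (val c X J) =
          B.one (F.f .ob (val c X J)) := by
        obtain ⟨⟨g, hg⟩, -⟩ := h₀
        refine (congrArg (fun a => F.d 0 (a (dec J).1) _ (val c X J)) hg).trans
          ((F.d_low 0 (g _) _ _).trans (congrArg (fun w => B.one (F.f .ob w)) ?_))
        refine Eq.trans (congrArg (update _ 0) ?_) (update_eq_self 0 _)
        exact congrArg (fun a : DPt P .ob T (φ 0) => ((A 0).L .ob).R a (X 0) (dec J).1) hg.symm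
      have e₃ := F.Δ_succ_comp c X J
      rw [F.Δ_succ, e₂, B.seq_one', e₁]
      · refine (Δ_single (F.fix (X 0 x)) _ _ _ t fun i hi => h i.succ
          ((Fin.succ_injective _).ne hi)).trans ?_
        refine congrArg (F.d t.succ _ _) (Eq.trans ?_ (val_eq_cons c X J).symm)
        exact congrArg (cons · _) (h₀.R_eq ((A 0).L .ob) (X 0) hx).symm
      · rw [e₃, e₂, B.src_one]

end PtMor

/-! ### Coordinates of iterated smash products -/

theorem FMap.smk_eq_some : ∀ {k : ℕ} {m n : Fin k → ℕ} (φ : ∀ i, FMap (m i) (n i))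
    (z : Fin (ark m)) (z' : Fin (ark n)),
    smk φ z = some z' ↔ ∀ i, φ i (crd z i) = some (crd z' i)
  | 0, _, _, _, z, z' => ⟨fun _ i => i.elim0, fun _ =>
      congrArg some (Subsingleton.elim (α := Fin 1) z z')⟩
  | _ + 1, _, _, φ, z, z' => (sm_eq_some (φ 0) _ z z').trans
      ((and_congr_right fun _ => smk_eq_some (fun i => φ i.succ) _ _).trans
        (Fin.forall_fin_succ (P := fun i => φ i (crd z i) = some (crd z' i))).symm)

/-- The coordinates of an element are recovered from the value at it of the smash product of maps
which are only defined at these coordinates; and the smash product is compatible with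
concatenation. -/
theorem DMor.crd_crd (P : Operad V) {k : ℕ} {j : Fin k → ℕ} (m : Fin (∑ i, j i) → ℕ)
    (J : Fin (ark m)) (i : Fin k) (r : Fin (j i)) :
    crd (crd ((finCongr (ark_sigma m)).symm J) i) r = crd J (finSigmaFinEquiv ⟨i, r⟩) := by
  let φ : ∀ p, FMap (m p) (m p) := fun p i => if i = crd J p then some i else none
  have hφ : ∀ {p i i'}, φ p i = some i' → i = i' ∧ i = crd J p := fun {p i i'} h => by
    by_cases e : i = crd J p
    · exact ⟨Option.some.inj ((if_pos e).symm.trans h), e⟩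
    · exact nomatch (if_neg e).symm.trans h
  have h := DMor.smk_sigma (P := P) (l := .ob) (T := ⊤_ V) fun p =>
    DPt.iota (φ p) (isPi_of fun _ _ _ h h' => (hφ h).2.trans (hφ h').2.symm)
  have key : ∀ {a b : DMor P .ob (⊤_ V)} (_ : a = b) (hm : a.m = b.m) (hn : a.n = b.n) z z',
      b.φ (Fin.cast hm z) = some (Fin.cast hn z') → a.φ z = some z' := by
    rintro a _ rfl _ _ z z' h
    exact h
  have e := key h (ark_sigma m) (ark_sigma m) ((finCongr (ark_sigma m)).symm J)
    ((finCongr (ark_sigma m)).symm J) ((smk_eq_some φ J J).2 fun _ => if_pos rfl)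
  exact (hφ ((smk_eq_some _ _ _).1 ((smk_eq_some _ _ _).1 e i) r)).2

namespace PtMor

open DPt

variable {P : Operad V} {α : PseudoComm P} {T : V}

/-- A smash product of operations which select coordinates selects the coordinates of an array. -/
theorem R_smk_sel : ∀ {k : ℕ} {l : Lvl} {A : Fin k → LAlg.{w} P T l} (K : LAlg.{w} P T l)
    {m n : Fin k → ℕ} {φ : ∀ i, FMap (m i) (n i)} (c : ∀ i, DPt P l T (φ i))
    (X : ∀ i, Fin (m i) → (A i).car) (Z : (∀ i, (A i).car) → K.car) (J : Fin (ark n))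
    (_ : ∀ i, IsSel (c i)), K.R (smk c) (fun z => Z fun i => X i (crd z i)) J =
      Z fun i => (A i).R (c i) (X i) (crd J i)
  | 0, _, _, K, _, _, _, c, X, Z, J, _ => (congrFun (K.R_iota_some isPi_some _) J).trans
      (congrArg Z (funext fun i => i.elim0))
  | k + 1, _, A, K, _, _, _, c, X, Z, J, h => by
    obtain ⟨x, hx⟩ := (h 0).2 (dec J).1
    refine (R_smk_ob_succ c K X Z J).trans (((h 0).R_eq K _ hx).trans
      ((R_smk_sel (A := fun i => A i.succ) K (fun i => c i.succ) (fun i => X i.succ)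
        (fun w => Z (Fin.cons (X 0 x) w)) (dec J).2 fun i => h i.succ).trans
        (congrArg Z (funext (Fin.cases ?_ fun _ => rfl)))))
    exact ((h 0).R_eq (A 0) (X 0) hx).symm

/-- If all operations but one select coordinates, their smash product acts by this one operation
in its own variable. -/
theorem R_smk_single : ∀ {k : ℕ} {l : Lvl} {A : Fin k → LAlg.{w} P T l} (K : LAlg.{w} P T l)
    {m n : Fin k → ℕ} {φ : ∀ i, FMap (m i) (n i)} (c : ∀ i, DPt P l T (φ i))
    (X : ∀ i, Fin (m i) → (A i).car) (Z : (∀ i, (A i).car) → K.car) (J : Fin (ark n)) (t : Fin k)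
    (_ : ∀ i, i ≠ t → IsSel (c i)), K.R (smk c) (fun z => Z fun i => X i (crd z i)) J =
      K.R (c t) (fun x => Z (update (fun i => (A i).R (c i) (X i) (crd J i)) t (X t x))) (crd J t)
  | 0, _, _, _, _, _, _, _, _, _, _, t, _ => t.elim0
  | k + 1, _, A, K, m, _, _, c, X, Z, J, t, h => by
    revert h
    refine Fin.cases (fun h => ?_) (fun t h => ?_) t
    · refine (R_smk_ob_succ c K X Z J).trans (congrArg (K.R (c 0) · (dec J).1) (funext fun x =>
        (R_smk_sel (A := fun i => A i.succ) K (fun i => c i.succ) (fun i => X i.succ)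
          (fun w => Z (Fin.cons (X 0 x) w)) (dec J).2 fun i => h i.succ (Fin.succ_ne_zero i)).trans
        (congrArg Z (funext (Fin.cases ?_ fun i => ?_)))))
      · exact (update_self (β := fun i => (A i).car) 0 (X 0 x) _).symm
      · exact (update_of_ne (β := fun i => (A i).car) (Fin.succ_ne_zero i) (X 0 x) _).symm
    · have h₀ := h 0 (Fin.succ_ne_zero t).symm
      obtain ⟨x, hx⟩ := h₀.2 (dec J).1
      refine (R_smk_ob_succ c K X Z J).trans ((h₀.R_eq K _ hx).trans
        ((R_smk_single (A := fun i => A i.succ) K (fun i => c i.succ) (fun i => X i.succ)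
          (fun w => Z (Fin.cons (X 0 x) w)) (dec J).2 t fun i hi => h i.succ
            ((Fin.succ_injective _).ne hi)).trans
        (congrArg (K.R (c t.succ) · (crd (dec J).2 t)) (funext fun y =>
          congrArg Z ((Fin.cons_update (α := fun i => (A i).car) (X 0 x) _ t (X t.succ y)).trans
            (congrArg (update (β := fun i => (A i).car) · t.succ (X t.succ y))
              (funext (Fin.cases ?_ fun _ => rfl))))))))
      exact (h₀.R_eq (A 0) (X 0) hx).symm

variable {k : ℕ} {A : Fin k → PtAlg.{w} P T} {B : PtAlg.{w} P T}

/-- The objects of `A q` with an arrow of `B` to the value of `F` at this object in the `q`th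
variable. -/
def comma (F : PtMor α A B) (q : Fin k) (w : ∀ i, ((A i).L .ob).car) : LAlg.{w} P T .ob where
  car := {p : ((A q).L .ob).car × (B.L .mor).car // B.tgt p.2 = F.f .ob (update w q p.1)}
  op {n} c p := ⟨(((A q).L .ob).op c fun r => (p r).1.1,
    B.seq ((B.L .mor).op ((P.O n).one c) fun r => (p r).1.2) (F.d q c (fun r => (p r).1.1) w)), by
      rw [B.tgt_seq, F.tgt]
      rw [B.op_one_tgt, F.src]
      exact congrArg _ (funext fun r => (p r).2)⟩
  op_act e c y := Subtype.ext (Prod.ext (LAlg.op_act _ _ _ _) (by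
    dsimp only
    rw [← VFun.ap_one, LAlg.op_act, F.equivariant]))
  op_unit y := Subtype.ext (Prod.ext (LAlg.op_unit _ _) (by
    have h := F.unit q (update w q (y 0).1.1)
    rw [F.d_update, update_self] at h
    have e : (fun r => (y r).1.1) = fun _ => (y 0).1.1 :=
      funext fun r => by rw [Subsingleton.elim r 0]
    dsimp only
    rw [← P.unitP_mor, LAlg.op_unit, e, h, B.seq_one' (y 0).2]))
  op_cmp e d c y := Subtype.ext (Prod.ext (LAlg.op_cmp _ _ _ _ _) (by
    have h : ∀ i, B.tgt ((B.L .mor).op ((P.O _).one (c i)) fun t => (y (e.symm ⟨i, t⟩)).1.2) =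
        B.src (F.d q (c i) (fun t => (y (e.symm ⟨i, t⟩)).1.1) w) := fun i => by
      rw [B.op_one_tgt, F.src]
      exact congrArg _ (funext fun r => (y _).2)
    dsimp only
    rw [P.one_cmp, LAlg.op_cmp, ← F.cmp, B.op_one_seq _ h, B.seq_assoc]
    · rw [B.op_one_tgt, B.op_one_src]
      simp only [h]
    · rw [B.op_one_tgt, F.src]
      simp only [F.tgt]))

/-- The constraint of `F` in one variable only depends on the formal combination of objects which
the operation and its arguments represent. -/
theorem d_congr (F : PtMor α A B) (q : Fin k) (w : ∀ i, ((A i).L .ob).car) {n n' : ℕ}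
    (a : T ⟶ (P.O n).car .ob) (b : T ⟶ (P.O n').car .ob) (y : Fin n → ((A q).L .ob).car)
    (y' : Fin n' → ((A q).L .ob).car) (h : ∀ (K : LAlg.{w} P T .ob) (Z : ((A q).L .ob).car → K.car),
      K.op a (fun r => Z (y r)) = K.op b fun r => Z (y' r)) : F.d q a y w = F.d q b y' w := by
  have e : ∀ {n : ℕ} (a : T ⟶ (P.O n).car .ob) (y : Fin n → ((A q).L .ob).car),
      ((F.comma q w).op a fun r => ⟨(y r, B.one (F.f .ob (update w q (y r)))), B.tgt_one _⟩).1.2 =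
        F.d q a y w := fun a y => by
    refine (congrArg (B.seq · _) (B.op_one _ _)).trans (B.one_seq' ?_)
    exact F.src ..
  rw [← e a, ← e b]
  exact congrArg (fun p => p.1.2) (h (F.comma q w)
    fun y => ⟨(y, B.one (F.f .ob (update w q y))), B.tgt_one _⟩)

end PtMor

/-! ### Compatibility with identities, composition and permutations -/

theorem FMap.Braid.crd_bij : ∀ {k : ℕ} {f : Fin k → Fin k} (b : Braid k f) (m : Fin k → ℕ)
    (z : Fin (ark fun i => m (f i))) (i : Fin k), crd (b.bij m z) (f i) = crd z i
  | _, _, .refl _, _, _, _ => rfl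
  | _, _, .swap k, m, z, i => by
    have h : (Braid.swap k).bij m z = finProdFinEquiv ((dec (dec z).2).1,
      (finProdFinEquiv ((dec z).1, (dec (dec z).2).2) :
        Fin (m 1 * ark fun i : Fin k => m i.succ.succ))) := rfl
    rw [h]
    refine Fin.cases ?_ (Fin.cases ?_ fun i => ?_) i
    · exact (crd_mk_succ (m := m) _ _ 0).trans (crd_mk_zero (m := fun i : Fin (k + 1) => m i.succ) _ _)
    · exact crd_mk_zero (m := m) _ _
    · exact (crd_mk_succ (m := m) _ _ i.succ).trans
        (crd_mk_succ (m := fun i : Fin (k + 1) => m i.succ) _ _ i)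
  | _, _, .cons b, m, z, i => by
    refine Fin.cases ?_ (fun i => ?_) i
    · exact crd_mk_zero (m := m) _ _
    · exact (crd_mk_succ (m := m) _ _ _).trans (b.crd_bij (fun i => m i.succ) _ i)
  | _, _, .trans (f := f) (g := g) b b', m, z, i =>
    (b.crd_bij m _ (g i)).trans (b'.crd_bij (fun i => m (f i)) z i)

theorem PreD.F_eq {P : Operad V} {k : ℕ} {X : Fin k → DAlg P} {Y : DAlg P} {G H : PreD X Y}
    {m : Fin k → ℕ} (h : ∀ {l : Lvl} {T : V} (x : ∀ i, T ⟶ ((X i).X (m i)).car l), G.f x = H.f x) :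
    G.F m = H.F m :=
  VFun.ext_ap fun l T x => by
    rw [← tup_co x]
    exact h _

theorem RData.cr_rel {P : Operad V} {A : OAlg P} {l : Lvl} {T : V} {m n : ℕ} (e : Fin m ≃ Fin n)
    (x : T ⟶ ((RData A).X m).car l) (j : Fin n) : cr (((RData A).rel e).ap x) j = cr x (e.symm j) := by
  rw [DAlgData.rel_ap, cr_op, LAlg.R_iota_ofEquiv]

namespace PreO

open RData DPt

variable {P : Operad V} {α : PseudoComm P}

theorem toD_one {A : OAlg P} (h : (one A).IsHom α) : toD h = PreD.one (RAlg A) := by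
  have hJ : ∀ {m : Fin 1 → ℕ} (J : Fin (ark m)),
      crd J 0 = (finCongr (ark_one m)).symm J := fun {m} J => by
    obtain ⟨⟨y, z⟩, rfl⟩ := finProdFinEquiv.surjective J
    exact (crd_mk_zero (m := m) y z).trans (fin_mul_one (Nat.mul_one _) y z).symm
  refine PreD.ext_d (fun m => PreD.F_eq fun x => ext_cr fun J => ?_) fun φ c x => ext_cr fun J => ?_
  · rw [cr_f, PreD.one_f]
    refine (one_f A _).trans (Eq.trans ?_ (cr_rel _ _ _).symm)
    rw [← hJ]
  · rw [cr_d, PreD.one_d, cr_one]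
    refine (PtMor.Δ_single _ c _ J 0 fun i hi => absurd (Subsingleton.elim i 0) hi).trans
      ((one_d A _ _ _ _).trans (congrArg A.C.one (Eq.trans ?_ (cr_rel _ _ _).symm)))
    rw [cr_op, ← hJ]
    rfl

section comp

variable {k : ℕ} {j : Fin k → ℕ} {X : Fin (∑ i, j i) → OAlg P} {Y : Fin k → OAlg P} {Z : OAlg P}
  {F : PreO Y Z} {E : ∀ i, PreO (fun r => X (finSigmaFinEquiv ⟨i, r⟩)) (Y i)}

/-- By `PreD.eq_of_single` it suffices to compare the constraints at families with one operation,
in the variable `r` of `E q`; both are then the constraint of `F` in the variable `q` followed by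
the value of `F` at the constraint of `E q` in the variable `r`. -/
theorem toD_comp (hF : F.IsHom α) (hE : ∀ i, (E i).IsHom α) (h : (comp F E).IsHom α) :
    toD h = PreD.comp (X := fun p => RAlg (X p)) (toD hF) fun i => toD (hE i) := by
  refine PreD.eq_of_single (α := α) (isHom_toD h) (PreD.isHom_comp α (isHom_toD hF)
    fun i => isHom_toD (hE i)) (fun m => PreD.F_eq fun x => ext_cr fun J => ?_) fun t T m n φ c x hc =>
      ext_cr fun J => ?_
  · refine Eq.trans ?_ ((congrArg (cr · J) (PreD.f_comp (X := fun p => RAlg (X p)) (toD hF)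
      (fun i => toD (hE i)) x)).trans (cr_rel _ _ _)).symm
    rw [cr_f, cr_f]
    refine (f_comp F E _).trans (congrArg F.f (funext fun i => ?_))
    refine Eq.trans ?_ (congrFun (cr_f (hE i) _) _).symm
    exact congrArg (E i).f (funext fun r => congrArg (cr (x _)) (DMor.crd_crd P m J i r).symm)
  · obtain ⟨⟨q, r⟩, rfl⟩ := finSigmaFinEquiv.surjective t
    refine Eq.trans ?_ ((congrArg (cr · J) (PreD.d_comp (X := fun p => RAlg (X p)) α (isHom_toD hF)
      (fun i => isHom_toD (hE i)) φ c x)).trans ((cr_rel _ _ _).trans (cr_seq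
        (PreD.compδ_comp (X := fun p => RAlg (X p)) α (isHom_toD hF) (fun i => isHom_toD (hE i))
          φ c x) _))).symm
    rw [cr_d, cr_d, cr_f]
    set J' := (finCongr (ark_sigma n)).symm J with hJ'
    have hJ := DMor.crd_crd P n J
    rw [← hJ'] at hJ
    have hc' : ∀ r', r' ≠ r → IsSel (c (finSigmaFinEquiv ⟨q, r'⟩)) := fun r' hr => hc _
      (finSigmaFinEquiv.injective.ne fun e => hr (eq_of_heq (Sigma.mk.inj e).2))
    have hi : ∀ i, i ≠ q → ∀ r', IsSel (c (finSigmaFinEquiv ⟨i, r'⟩)) := fun i hi r' => hc _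
      (finSigmaFinEquiv.injective.ne fun e => hi (Sigma.mk.inj e).1)
    have hv : ∀ i, PtMor.val (A := fun r => (X (finSigmaFinEquiv ⟨i, r⟩)).pt T)
        (fun r => c (finSigmaFinEquiv ⟨i, r⟩)) (fun r => cr (x (finSigmaFinEquiv ⟨i, r⟩)))
        (crd J' i) = fun r => PtMor.val (A := fun p => (X p).pt T) c (fun p => cr (x p)) J
          (finSigmaFinEquiv ⟨i, r⟩) := fun i => funext fun r => congrArg
      (((X _).pt T).L .ob |>.R (c (finSigmaFinEquiv ⟨i, r⟩)) (cr (x _))) (hJ i r)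
    refine ((pt h T).Δ_single c _ J _ hc).trans ((d_comp hF hE q r _ _ _).trans
      (congrArg₂ Z.C.seq ?_ (congrArg F.f (funext fun i => ?_))))
    -- In `toD F` the operation is the whole block `q`, on the inputs of this block; it has the same
    -- value in every algebra as `c` at `(q, r)` on the inputs of this single variable.
    · refine Eq.trans ?_ ((pt hF T).Δ_single _ _ J' q fun i h => isSel_smk (hi i h)).symm
      refine ((pt hF T).d_congr q _ _ (DPt.smk (fun r => c (finSigmaFinEquiv ⟨q, r⟩)) (crd J' q)) _
        (fun s => cr ((toD (hE q)).f fun r => x (finSigmaFinEquiv ⟨q, r⟩)) (fib _ (crd J' q) s).1)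
        fun K W => ?_).trans ?_
      · refine Eq.trans ?_ ((PtMor.R_smk_single (A := fun r => ((X (finSigmaFinEquiv ⟨q, r⟩)).pt T).L
          .ob) K (fun r => c (finSigmaFinEquiv ⟨q, r⟩)) (fun r => cr (x (finSigmaFinEquiv ⟨q, r⟩)))
          (fun v => W ((E q).f v)) (crd J' q) r hc').symm.trans ?_)
        · refine Eq.trans ?_ (congrArg (fun w => K.R (c _) (fun y => W ((E q).f (update w r
            (cr (x (finSigmaFinEquiv ⟨q, r⟩)) y)))) (crd (crd J' q) r)) (hv q).symm)
          exact congrArg (fun z => K.R (c (finSigmaFinEquiv ⟨q, r⟩)) (fun y => W ((E q).f (update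
            (fun r => PtMor.val (A := fun p => (X p).pt T) c (fun p => cr (x p)) J
              (finSigmaFinEquiv ⟨q, r⟩)) r (cr (x (finSigmaFinEquiv ⟨q, r⟩)) y)))) z) (hJ q r).symm
        · exact congrArg (fun Y => K.R (DPt.smk fun r => c (finSigmaFinEquiv ⟨q, r⟩))
            (fun z => W (Y z)) (crd J' q)) (cr_f (hE q) _).symm
      · refine Eq.trans (congrArg (F.d q _ _) ?_) ((pt hF T).d_update q _ _ _
          (blk E (PtMor.val (A := fun p => (X p).pt T) c (fun p => cr (x p)) J) q))
        funext i
        by_cases e : i = q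
        · subst e
          exact (update_self (β := fun i => (((Y i).pt T).L .ob).car) i _ _).symm
        · refine Eq.trans ?_ (update_of_ne (β := fun i => (((Y i).pt T).L .ob).car) e _ _).symm
          refine Eq.symm ((congrArg (fun y => (((Y i).pt T).L .ob).R (DPt.smk fun r =>
            c (finSigmaFinEquiv ⟨i, r⟩)) y (crd J' i)) (cr_f (hE i) _)).trans
            ((PtMor.R_smk_sel (A := fun r => ((X (finSigmaFinEquiv ⟨i, r⟩)).pt T).L .ob)
              (((Y i).pt T).L .ob) (fun r => c (finSigmaFinEquiv ⟨i, r⟩)) (fun r => cr (x (finSigmaFinEquiv ⟨i, r⟩))) (fun v => (pt (hE i) T).f .ob v) (crd J' i)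
              (hi i e)).trans ?_))
          exact congrArg (E i).f (hv i)
    · refine Eq.trans ?_ (congrFun (cr_d (hE i) _ _ _) (crd J' i)).symm
      by_cases e : i = q
      · subst e
        refine (update_self i _ _).trans (Eq.trans ?_ ((pt (hE i) T).Δ_single _ _ _ r hc').symm)
        refine Eq.trans ?_ (congrArg ((E i).d r _ _) (hv i).symm)
        exact congrArg (fun z => (E i).d r (c _ z) (fun s => cr (x _) (fib _ z s).1) _)
          (hJ i r).symm
      · refine (update_of_ne e _ _).trans (Eq.trans ?_ ((pt (hE i) T).Δ_isIota
          (fun r => (hi i e r).1) _ _).symm)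
        exact congrArg (fun w => (Y i).C.one ((E i).f w)) (hv i).symm

end comp

section act

variable {k : ℕ} {A : Fin k → OAlg P} {B : OAlg P} {F : PreO A B} {σ : Equiv.Perm (Fin k)}

/-- At families with one operation the reordering constraint in the permuted multimorphism is an
identity, and both constraints are the one of `F` in the permuted variable. -/
theorem toD_act (hF : F.IsHom α) (h : (act σ F).IsHom α) :
    toD h = PreD.act (X := fun i => RAlg (A i)) α σ (toD hF) := by
  have hJ : ∀ {n : Fin k → ℕ} (J : Fin (ark n)) (i : Fin k),
      crd (((PreD.braid σ).bij n).symm J) i = crd J (σ.symm i) := fun {n} J i => by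
    have := (PreD.braid σ).crd_bij n (((PreD.braid σ).bij n).symm J) i
    rw [Equiv.apply_symm_apply] at this
    exact this.symm
  refine PreD.eq_of_single (α := α) (isHom_toD h) (PreD.isHom_act (X := fun i => RAlg (A i)) α σ
    (isHom_toD hF)) (fun m => PreD.F_eq fun {l T} x => ext_cr fun J => ?_) fun t T m n φ c x hc =>
      ext_cr fun J => ?_
  · refine Eq.trans ?_ ((congrArg (cr · J) (PreD.f_act (X := fun i => RAlg (A i)) α (toD hF) σ
      x)).trans (cr_rel _ _ _)).symm
    rw [cr_f, cr_f]
    refine (f_act σ F _).trans (congrArg F.f (funext fun i => ?_))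
    rw [hJ]
    exact PreD.reidx_map (Z := fun i r => T ⟶ ((RData (A i)).X (m r)).car l)
      (W := fun i _ => T ⟶ (A i).C.car l) σ (fun i r y => cr y (crd J r)) x i
  · have hf := PreD.brδ_comp (X := fun i => RAlg (A i)) α (PreD.braid σ) (isHom_toD hF) φ c
      (PreD.permute (fun i => RAlg (A i)) σ x)
    obtain ⟨y, hy⟩ := R_cell_eq_one α (PreD.braid σ) c (fun i j hij => (em (i = t)).elim
      (fun e => .inr (hc j fun e' => hij (e.trans e'.symm)).1) fun e => .inl (hc i e).1) (B.pt T)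
      (cr ((toD hF).f (PreD.permute (fun i => RAlg (A i)) σ x))) J
    have hy := (congrArg (fun Y => ((B.pt T).L .mor).R (cell α (PreD.braid σ) c) Y J)
      (cr_one' _)).trans hy
    have hy := (congrFun (cr_op _ (cell α (PreD.braid σ) c) _) J).trans hy
    have hs := (cr_tgt _ J).symm.trans ((congrArg (cr · J) hf).trans (cr_src _ J))
    refine Eq.trans ?_ ((congrArg (cr · J) (PreD.d_act (X := fun i => RAlg (A i)) α σ (isHom_toD hF)
      φ c x)).trans ((cr_seq hf J).trans ((congrArg (B.C.seq · _) hy).trans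
        (((B.pt T).one_seq' (hs.symm.trans ((congrArg (B.pt T).tgt hy).trans ((B.pt T).tgt_one y)))).trans
          (cr_rel _ _ _))))).symm
    rw [cr_d, cr_d]
    refine ((pt h T).Δ_single c _ J t hc).trans ((d_act σ F t _ _ _).trans (Eq.trans ?_
      ((pt hF T).Δ_single (fun i => c (σ.symm i)) _ _ (σ t) fun i hi => hc _ fun e =>
        hi (by rw [← e, σ.apply_symm_apply])).symm))
    have hv : reind σ (PtMor.val (A := fun i => (A (σ i)).pt T) c (fun i => cr (x i)) J) =
        PtMor.val (A := fun i => (A i).pt T) (fun i => c (σ.symm i))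
          (fun i => cr (PreD.permute (fun i => RAlg (A i)) σ x i))
          (((PreD.braid σ).bij n).symm J) := funext fun i => by
      refine (PreD.reidx_map (Z := fun i r => T ⟶ ((RData (A i)).X (m r)).car .ob)
        (W := fun i _ => T ⟶ (A i).C.car .ob) σ
        (fun i r y => (((A i).pt T).L .ob).R (c r) (cr y) (crd J r)) x i).trans ?_
      exact congrArg _ (hJ J i).symm
    refine (congrArg (F.d (σ t) _ _) hv).trans ?_
    refine (PreD.reidx_ind (Z := fun i r => T ⟶ ((RData (A i)).X (m r)).car .ob) σ x
      (fun i r y => ∀ w, F.d (σ t) (c t (crd J t)) (fun s => cr (x t) (fib _ (crd J t) s).1) w =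
        F.d i (c r (crd J r)) (fun s => cr y (fib _ (crd J r) s).1) w) t fun w => rfl) _ |>.trans ?_
    exact congrArg (fun z => F.d (σ t) (c _ z) (fun s => cr (PreD.permute (fun i => RAlg (A i)) σ x
      (σ t)) (fib _ z s).1) _) (hJ J (σ t)).symm

end act

end PreO

/-! ### Unary multimorphisms and their transformations -/

theorem RData.cr_tup_comp {P : Operad V} {A B : OAlg P} {T : V} {m : Fin 1 → ℕ}
    (ω : (VCat.pi fun _ : Fin 1 => A.C).car .ob ⟶ B.C.car .mor)
    (x : ∀ i, T ⟶ ((RData A).X (m i)).car .ob) (J : Fin (ark m)) :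
    cr (A := B) (tup x ≫ tup (A := fun _ : Fin (ark m) => B.C) (l := .mor) fun j =>
      tup (A := fun _ : Fin 1 => A.C) (l := .ob) (fun i => co (A := fun _ : Fin (m i) => A.C)
        (pk (fun i => VCat.pi fun _ : Fin (m i) => A.C) i .ob) (crd j i)) ≫ ω) J =
      tup (fun i => cr (x i) (crd J i)) ≫ ω := by
  refine (comp_cr (A := B) (tup x) _ J).trans ((congrArg (tup x ≫ ·) (congrFun
    (cr_mkr (A := B) (l := .mor) _) J)).trans ((Category.assoc ..).symm.trans (congrArg (· ≫ ω)
      ((comp_tup _ _).trans (congrArg tup (funext fun i =>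
        (comp_cr (A := A) (l := .ob) (tup x) _ _).symm.trans ?_))))))
  exact congrArg (cr · (crd J i)) (co_tup x i)

namespace PreO

open RData DPt

variable {P : Operad V} {α : PseudoComm P} {A B : OAlg P} {F G : PreO (fun _ : Fin 1 => A) B}
  {T : V}

theorem cr_d_single (hF : F.IsHom α) {m n : Fin 1 → ℕ} (φ : ∀ i, FMap (m i) (n i))
    (c : ∀ i, DPt P .ob T (φ i)) (x : ∀ i, T ⟶ ((RData A).X (m i)).car .ob) (J : Fin (ark n))
    (w : Fin 1 → (T ⟶ A.C.car .ob)) :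
    cr ((toD hF).d φ c x) J =
      F.d 0 (c 0 (crd J 0)) (fun r => cr (x 0) (fib (φ 0) (crd J 0) r).1) w := by
  rw [cr_d]
  refine ((pt hF T).Δ_single c _ J 0 fun i hi => absurd (Subsingleton.elim i 0) hi).trans
    (Eq.trans (congrArg (F.d 0 _ _) (funext fun i => ?_)) ((pt hF T).d_update 0 _ _ w (PtMor.val
      (A := fun _ : Fin 1 => A.pt T) c (fun i => cr (x i)) J 0)))
  obtain rfl := Subsingleton.elim 0 i
  exact (update_self (β := fun _ => T ⟶ A.C.car .ob) _ _ _).symm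

variable {ω : (VCat.pi fun _ : Fin 1 => A.C).car .ob ⟶ B.C.car .mor}

/-- Compatibility with the nullary operation. -/
theorem trans_zero (hF : F.IsHom α) (hG : G.IsHom α) (h : IsOTrans F G ω)
    {w : Fin 1 → (T ⟶ A.C.car .ob)} (hw : w 0 = A.zero) : tup w ≫ ω = B.C.one B.zero := by
  have e := h.compat 0 (P.star : T ⟶ _) Fin.elim0 w
  have e' : update w 0 (A.op P.star Fin.elim0) = w := by
    rw [← show w 0 = A.op P.star Fin.elim0 from
      hw.trans (((A.pt T).L .ob).op_zero rfl P.star Fin.elim0).symm, update_eq_self]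
  rw [hF.nullary, hG.nullary, e'] at e
  have hs : (tup w ≫ ω) ≫ B.C.src = B.zero := (h.src w).trans (hF.based w 0 hw)
  refine ((B.pt T).one_seq' hs).symm.trans (e.trans ?_)
  refine (congrArg (B.C.seq · _) ((((B.pt T).L .mor).op_zero rfl _ _).trans
    (B.pt T).one_zero.symm)).trans ((B.pt T).one_seq' ((B.pt T).src_one _))

/-- The powers of a transformation of pseudomorphisms are a transformation of their images; the
components of the latter are determined by `hΩ`. -/
theorem isDTrans (hF : F.IsHom α) (hG : G.IsHom α) (h : IsOTrans F G ω)
    (Ω : ∀ m : Fin 1 → ℕ, (VCat.pi fun i => (RData A).X (m i)).car .ob ⟶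
      ((RData B).X (ark m)).car .mor)
    (hΩ : ∀ {T : V} {m : Fin 1 → ℕ} (x : ∀ i, T ⟶ ((RData A).X (m i)).car .ob) (J : Fin (ark m)),
      cr (tup x ≫ Ω m) J = tup (fun i => cr (x i) (crd J i)) ≫ ω) :
    IsDTrans (toD hF) (toD hG) Ω := by
  have hs : ∀ {T : V} {m : Fin 1 → ℕ} (x : ∀ i, T ⟶ ((RData A).X (m i)).car .ob),
      (tup x ≫ Ω m) ≫ ((RData B).X _).src = (toD hF).f x := fun x => ext_cr fun J => by
    rw [cr_src, hΩ, cr_f]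
    exact h.src _
  have ht : ∀ {T : V} {m : Fin 1 → ℕ} (x : ∀ i, T ⟶ ((RData A).X (m i)).car .ob),
      (tup x ≫ Ω m) ≫ ((RData B).X _).tgt = (toD hG).f x := fun x => ext_cr fun J => by
    rw [cr_tgt, hΩ, cr_f]
    exact h.tgt _
  refine ⟨hs, ht, fun x => ext_cr fun J => ?_, fun x i hi => ext_cr fun J => ?_,
    fun {T m n} φ c x => ext_cr fun J => ?_⟩
  · refine (cr_seq ?_ J).trans (Eq.trans ?_ (cr_seq ?_ J).symm)
    · exact (PreD.f_tgt _ x).trans (hs _).symm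
    · rw [hΩ, hΩ, cr_f, cr_f]
      refine Eq.trans ?_ ((h.nat fun i => cr (x i) (crd J i)).trans ?_)
      · simp only [cr_tgt]
        rfl
      · simp only [cr_src]
        rfl
    · exact (ht _).trans (PreD.f_src _ x).symm
  · rw [hΩ, cr_one, cr_zero]
    obtain rfl := Subsingleton.elim 0 i
    exact trans_zero hF hG h ((congrArg (cr · _) hi).trans (congrFun cr_zero _))
  · let w := PtMor.val (A := fun _ : Fin 1 => A.pt T) c (fun i => cr (x i)) J
    have e : (RData B).op (smk φ) (DPt.smk c).one (tup x ≫ Ω _) ≫ ((RData B).X _).tgt =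
        (toD hG).d φ c x ≫ ((RData B).X _).src :=
      ((RData B).op_tgt _ _).trans (Eq.trans (by rw [DPt.one_tgt, ht]) ((isHom_toD hG).src φ c x).symm)
    refine (cr_seq (((isHom_toD hF).tgt φ c x).trans (hs _).symm) J).trans
      (Eq.trans ?_ (cr_seq e J).symm)
    rw [hΩ, cr_op, cr_d_single hF φ c x J w, cr_d_single hG φ c x J w]
    refine Eq.trans ?_ ((h.compat 0 (c 0 (crd J 0)) (fun r => cr (x 0) (fib (φ 0) (crd J 0) r).1)
      w).trans (congrArg (B.C.seq · _) (Eq.trans ?_ (R_smk_one_succ c ((B.pt T).L .mor) _ J).symm)))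
    · refine congrArg (B.C.seq _) (congrArg (fun v : Fin 1 → (T ⟶ A.C.car .ob) => tup v ≫ ω)
        (funext fun i => ?_))
      obtain rfl := Subsingleton.elim 0 i
      exact (congrFun (cr_op _ _ _) _).trans
        (update_self (β := fun _ => T ⟶ A.C.car .ob) _ _ _).symm
    · refine congrArg (B.op _) (funext fun r => Eq.symm
        ((congrFun (((B.pt T).L .mor).R_iota_some isPi_some _) _).trans ((hΩ x _).trans
          (congrArg (fun v => tup v ≫ ω) (funext fun i => ?_)))))
      obtain rfl := Subsingleton.elim 0 i
      exact (congrArg (cr (x 0)) (crd_mk_zero (m := m) _ _)).trans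
        (update_self (β := fun _ => T ⟶ A.C.car .ob) _ _ _).symm

end PreO

end ORExt

theorem mainTheorem5 {V : Type u} [Category.{v} V] [HasLimits V] [HasColimits V]
    [CartesianMonoidalCategory V] [MonoidalClosed V] [HasColimits (ORExt.VCat V)]
    (P : ORExt.Operad V) (α : ORExt.PseudoComm P) :
    ∃ (hO : (ORExt.MultO P α).IsClosed) (hD : (ORExt.MultD P α).IsClosed)
      (hR : ∀ A : ORExt.OAlg P, (ORExt.RData A).IsAlgebra)
      (R : ORExt.SymmMultifunctor (ORExt.MultO P α) (ORExt.MultD P α) hO hD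
        fun A : ORExt.OAlg P => (⟨ORExt.RData A, hR A⟩ : ORExt.DAlg P)),
      ORExt.ExtendsR R := by
  refine ⟨ORExt.MultO.isClosed P α, ORExt.MultD.isClosed P α, ORExt.RData.isAlgebra,
    { map := fun F => ⟨ORExt.PreO.toD F.2, ORExt.PreO.isHom_toD F.2⟩
      map_one := fun A => Subtype.ext (ORExt.PreO.toD_one _)
      map_comp := fun F E => Subtype.ext (ORExt.PreO.toD_comp F.2 (fun i => (E i).2) _)
      map_act := fun σ _ _ F => Subtype.ext (ORExt.PreO.toD_act F.2 _) }, ?_⟩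
  constructor
  · intro k A B F hF l T m x j
    exact congrFun (ORExt.PreO.cr_f hF x) j
  · intro A B F hF T m n φ c x j
    exact ORExt.PreO.cr_d_single hF φ c x j _
  · intro A B F G hF hG ω h
    exact ORExt.PreO.isDTrans hF hG h _ fun x J => ORExt.RData.cr_tup_comp ω x J
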